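/- **Setting.** Let $(M,\omega)$ be a $4$-dimensional compact symplectic manifold, possibly with smooth boundary, with a fixed Riemannian metric. For $2\le s\le\infty$ let $C^s(M,\mathbb R)$ be the set of $C^s$ functions $H\colon M\to\mathbb R$ that are constant on each connected component of $\partial M$; $X_H$ is the Hamiltonian vector field ($\omega(X_H,\cdot)=dH$) and $\varphi_H^t$ its flow. Fix a finite Darboux atlas $h_i\colon U_i\to\mathbb R^4$ (with values in a half-space of $\mathbb R^4$ near $\partial M$), compact sets $C_i\subset U_i$ covering $M$, and for each $x\in M$ a chart $h_{j(x)}$ of the atlas around $x$. The $C^2$-norm of a function is the maximum over $i$ of the suprema over $C_i$ of the absolute values of the partial derivatives of order $\le 2$ of its expression in the chart $h_i$. At a point $x$ with $dH(x)\ne0$ let $N_x=(\mathbb R X_H(x))^{\perp}$ and $\mathcal N_x=N_x\cap\ker dH(x)$. The transversal linear Poincaré flow is $\Phi_H^t(x)=\Pi_{\varphi_H^t(x)}\,D\varphi_H^t(x)|_{\mathcal N_x}\colon \mathcal N_x\to\mathcal N_{\varphi_H^t(x)}$, where $\Pi_y\colon T_yM\to N_y$ is the orthogonal projection. The normal section $\mathfrak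 N_x\subset U_{j(x)}$ is the set of the points that the chart $h=h_{j(x)}$ maps into the affine hyperplane $h(x)+Dh(x)N_x$. For $r>0$, $B(x,r)\subset\mathfrak N_x$ is the set of the $y$ with $h(y)=h(x)+Dh(x)(n+w)$, $n\in\mathcal N_x$, $w\in N_x\cap\mathcal N_x^{\perp}$, $\|n\|<r$, $\|w\|<r$. The measure $\overline\mu$ on $\mathfrak N_x$ is the one induced by the $3$-form $\iota_{X_H}\omega^2$. The Poincaré map $\mathcal P_H^T(x)$ maps $y\in B(x,r)$, $r$ small, to $\varphi_H^{\tau(y)}(y)\in\mathfrak N_{\varphi_H^T(x)}$, where $\tau$ is continuous and $\tau(x)=T$; the flowbox over $U\subset B(x,r)$ is $\mathcal F_H^T(x,U)=\{\varphi_H^t(y): y\in U,\ 0\le t\le\tau(y)\}$. **Definition.** Let $H\in C^{s+1}(M,\mathbb R)$, $T,\epsilon>0$, $0<\kappa<1$, and let $x\in M$ be non-periodic or of period larger than $T$ (in particular $\varphi_H^t(x)\neq x$ for $0<t\le T$, so $x$ is not critical). A family of linear maps $L^t\colon\mathcal N_x\to\mathcal N_{\varphi_H^t(x)}$, $0\le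 t\le T$, that preserve the restrictions of $\omega$ is *$(\epsilon,\kappa)$-realizable of length $T$ at $x$* if for every $\gamma>0$ there is $r>0$ (with $\mathcal P^T_H(x)$ defined on $B(x,r)$) such that for every relatively open $U\subset B(x,r)$ there are a Borel set $K\subset U$ with $\overline\mu(U\setminus K)\le\kappa\,\overline\mu(U)$ and $\widetilde H\in C^s(M,\mathbb R)$ with $\|\widetilde H-H\|_{C^2}<\epsilon$ such that 1. $\widetilde H=H$ outside $\mathcal F_H^T(x,U)$; 2. $DX_{\widetilde H}(y)=DX_H(y)$, as maps $T_yM\to TTM$, for $y\in U\cup\mathcal P_H^T(x)U$; 3. $\|\Phi_{\widetilde H}^T(y)-L^T(x)\|<\gamma$ for all $y\in K$. Here both maps are composed with the orthogonal projections onto $\mathcal N_y$ (for $\widetilde H$) and $\mathcal N_x$ (for $H$), then written as endomorphisms of $\mathbb R^4$ with the chart $h_{j(x)}$ at the initial points and $h_{j(\varphi_H^T(x))}$ at the final points (it is understood that $\varphi^T_{\widetilde H}(y)$ lies in the domain of the latter), and compared in the operator norm. **Lemma.** Let $H\in C^{s+1}(M,\mathbb R)$, with $s\ge2$ an integer or $s=\infty$,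 and let $x\in M$ be non-periodic, i.e. $\varphi_H^t(x)\ne x$ for all $t\neq0$. If $L_1$ is $(\epsilon,\kappa_1)$-realizable of length $T_1$ at $x$ and $L_2$ is $(\epsilon,\kappa_2)$-realizable of length $T_2$ at $\varphi_H^{T_1}(x)$, with $\kappa_1+\kappa_2<1$, then the concatenated linear flow $$L^t=\begin{cases}L_1^t, & 0\le t\le T_1,\\ L_2^{t-T_1}\,L_1^{T_1}, & T_1<t\le T_1+T_2,\end{cases}$$ is $(\epsilon,\kappa_1+\kappa_2)$-realizable of length $T_1+T_2$ at $x$. -/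

import Mathlib

open Set Filter Topology Manifold ContDiff MeasureTheory Bundle

noncomputable section

namespace HamRealizable

/-- The Euclidean space `ℝ⁴`. -/
abbrev E4 : Type := EuclideanSpace ℝ (Fin 4)

/-- The canonical symplectic form `dy₁ ∧ dy₃ + dy₂ ∧ dy₄` of `ℝ⁴` (coordinates are numbered from `0`
in the code). -/
def stdForm (u v : E4) : ℝ :=
  (u 0 * v 2 - u 2 * v 0) + (u 1 * v 3 - u 3 * v 1)

section Defs

variable {B : Type*} [TopologicalSpace B] (I : ModelWithCorners ℝ E4 B)
  (M : Type*) [TopologicalSpace M] [ChartedSpace B M]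

/-- A symplectic form on `M`: a smooth, alternating, nondegenerate, closed 2-form. -/
structure SymplecticForm [IsManifold I ∞ M] where
  /-- the bilinear form on each tangent space -/
  form : ∀ x : M, TangentSpace I x →L[ℝ] TangentSpace I x →L[ℝ] ℝ
  smooth : ContMDiff I (I.prod 𝓘(ℝ, E4 →L[ℝ] E4 →L[ℝ] ℝ)) ∞
    (fun x ↦ TotalSpace.mk' (E4 →L[ℝ] E4 →L[ℝ] ℝ)
      (E := fun x : M ↦ TangentSpace I x →L[ℝ] TangentSpace I x →L[ℝ] ℝ) x (form x))
  alternating : ∀ (x : M) (v : TangentSpace I x), form x v v = 0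
  nondegenerate : ∀ (x : M) (v : TangentSpace I x), (∀ w, form x v w = 0) → v = 0
  /-- `dΩ = 0`, written out in the preferred chart at each point `x`: with
  `F z a b = Ω (Dφ⁻¹ a, Dφ⁻¹ b)` the expression of `Ω` in the chart `φ`, the cyclic sum
  `∂_a F(b, c) + ∂_b F(c, a) + ∂_c F(a, b)` vanishes at `φ x`. -/
  closed : ∀ (x : M) (a b c : E4),
    let F : E4 → E4 → E4 → ℝ := fun z a b ↦
      form ((extChartAt I x).symm z)
        ((mfderiv I 𝓘(ℝ, E4) (extChartAt I x) ((extChartAt I x).symm z)).inverse a)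
        ((mfderiv I 𝓘(ℝ, E4) (extChartAt I x) ((extChartAt I x).symm z)).inverse b)
    fderivWithin ℝ (fun z ↦ F z b c) (range I) (extChartAt I x x) a
      + fderivWithin ℝ (fun z ↦ F z c a) (range I) (extChartAt I x x) b
      + fderivWithin ℝ (fun z ↦ F z a b) (range I) (extChartAt I x x) c = 0

variable {I M}

/-- `H` belongs to `C^s(M, ℝ)`, the space of `C^s` Hamiltonians: it is `C^s` on `M` and constant on
each connected component of the boundary of `M`. -/
def IsHamiltonian (I : ModelWithCorners ℝ E4 B) [IsManifold I ∞ M] (s : ℕ∞) (H : M → ℝ) : Prop :=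
  ContMDiff I 𝓘(ℝ, ℝ) (s : WithTop ℕ∞) H ∧
    ∀ x ∈ I.boundary M, ∀ y ∈ connectedComponentIn (I.boundary M) x, H y = H x

variable [IsManifold I ∞ M]

/-- The differential of `H` at `x`. -/
def dHam (I : ModelWithCorners ℝ E4 B) (H : M → ℝ) (x : M) : TangentSpace I x →L[ℝ] ℝ :=
  mfderiv I 𝓘(ℝ, ℝ) H x

namespace SymplecticForm

variable (Ω : SymplecticForm I M)

/-- The 4-form `Ω² = Ω ∧ Ω`. -/
def sq (x : M) (a b c d : TangentSpace I x) : ℝ :=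
  2 * (Ω.form x a b * Ω.form x c d - Ω.form x a c * Ω.form x b d + Ω.form x a d * Ω.form x b c)

/-- The Hamiltonian vector field `X_H`, i.e. the solution of `Ω(X_H, ·) = dH`. -/
def hamField (H : M → ℝ) (x : M) : TangentSpace I x :=
  (Ω.form x).inverse (dHam I H x)

open Classical in
/-- The Hamiltonian flow `φ_H^t(x)`: the value at time `t` of the integral curve of `X_H` that
starts at `x`. -/
def flow (H : M → ℝ) (t : ℝ) (x : M) : M :=
  if h : ∃ γ : ℝ → M, γ 0 = x ∧ IsMIntegralCurve (I := I) γ (Ω.hamField H) then h.choose t else x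

/-- The tangent flow `Dφ_H^t(x)`. -/
def tangentFlow (H : M → ℝ) (t : ℝ) (x : M) :
    TangentSpace I x →L[ℝ] TangentSpace I (Ω.flow H t x) :=
  mfderiv I I (Ω.flow H t) x

/-- A finite Darboux atlas of `M`. The atlas comes with compact sets `core i ⊆ U_i` that cover `M`
(on which `C²`-norms are computed) and with a choice, for each point `x`, of a chart around `x`. -/
structure DarbouxAtlas where
  /-- the number of charts -/
  num : ℕ
  /-- the charts, as local homeomorphisms to the model space (`ℝ⁴` or a half-space) -/
  chart : Fin num → OpenPartialHomeomorph M B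
  mem_maximalAtlas : ∀ i, chart i ∈ IsManifold.maximalAtlas I ∞ M
  symplectic : ∀ i, ∀ x ∈ (chart i).source, ∀ u v : TangentSpace I x,
    stdForm (mfderiv I 𝓘(ℝ, E4) ((chart i).extend I) x u)
      (mfderiv I 𝓘(ℝ, E4) ((chart i).extend I) x v) = Ω.form x u v
  /-- compact subsets of the chart domains -/
  core : Fin num → Set M
  isCompact_core : ∀ i, IsCompact (core i)
  core_subset : ∀ i, core i ⊆ (chart i).source
  iUnion_core : ⋃ i, core i = univ
  /-- the chosen chart around `x` -/
  idx : M → Fin num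
  mem_idx : ∀ x, x ∈ (chart (idx x)).source

end SymplecticForm

open SymplecticForm

namespace SymplecticForm.DarbouxAtlas

variable {Ω : SymplecticForm I M} (A : Ω.DarbouxAtlas)

/-- The chart `h_i`, with values in `ℝ⁴`. -/
def h (i : Fin A.num) (x : M) : E4 := (A.chart i).extend I x

/-- The inverse of the chart `h_i`. -/
def hinv (i : Fin A.num) (z : E4) : M := ((A.chart i).extend I).symm z

/-- The differential `Dh_i(x)`. -/
def dh (i : Fin A.num) (x : M) : TangentSpace I x →L[ℝ] E4 :=
  mfderiv I 𝓘(ℝ, E4) ((A.chart i).extend I) x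

/-- The expression of a vector field in the chart `h_i`. -/
def localField (i : Fin A.num) (X : ∀ x : M, TangentSpace I x) (z : E4) : E4 :=
  A.dh i (A.hinv i z) (X (A.hinv i z))

/-- `‖H' - H‖_{C²} < ε`, the `C²`-norm being the maximum over the charts of the atlas of the
suprema (over the compact cores) of the absolute values of the partial derivatives of order `≤ 2`
of the expression of the function in the chart. -/
def C2Close (ε : ℝ) (H' H : M → ℝ) : Prop :=
  ∀ i, ∀ x ∈ A.core i, ∀ k : ℕ, k ≤ 2 → ∀ a : Fin k → Fin 4,
    |iteratedFDerivWithin ℝ k (fun z ↦ H' (A.hinv i z) - H (A.hinv i z)) (range I) (A.h i x)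
      (fun m ↦ EuclideanSpace.single (a m) (1 : ℝ))| < ε

/-- `DX_{H'}(x) = DX_H(x)` as maps `T_xM → TTM` (so that also `X_{H'}(x) = X_H(x)`). -/
def SameDerivAt (H' H : M → ℝ) (x : M) : Prop :=
  ∀ i, x ∈ (A.chart i).source →
    A.localField i (Ω.hamField H') (A.h i x) = A.localField i (Ω.hamField H) (A.h i x) ∧
    fderivWithin ℝ (A.localField i (Ω.hamField H')) (range I) (A.h i x)
      = fderivWithin ℝ (A.localField i (Ω.hamField H)) (range I) (A.h i x)

/-- The distance between two linear maps `S : T_pM → T_qM` and `S' : T_{p'}M → T_{q'}M` at different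
base points, measured with the chart `h_i` around `p, p'` and the chart `h_j` around `q, q'`. -/
def mapDist (i j : Fin A.num) {p q p' q' : M} (S : TangentSpace I p →L[ℝ] TangentSpace I q)
    (S' : TangentSpace I p' →L[ℝ] TangentSpace I q') : ℝ :=
  ‖(A.dh j q ∘L S ∘L (A.dh i p).inverse) - (A.dh j q' ∘L S' ∘L (A.dh i p').inverse)‖

end SymplecticForm.DarbouxAtlas

section Riemannian

variable [RiemannianBundle (fun x : M ↦ TangentSpace I x)]

instance finiteDimensional_tangentSpace (x : M) : FiniteDimensional ℝ (TangentSpace I x) :=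
  inferInstanceAs (FiniteDimensional ℝ E4)

instance hasOrthogonalProjection_tangentSpace (x : M) (K : Submodule ℝ (TangentSpace I x)) :
    K.HasOrthogonalProjection :=
  haveI : CompleteSpace K := FiniteDimensional.complete ℝ K
  inferInstance

variable (Ω : SymplecticForm I M)

/-- The normal fiber `N_x = (ℝ X_H(x))^⊥`. -/
def normalSpace (H : M → ℝ) (x : M) : Submodule ℝ (TangentSpace I x) :=
  (Submodule.span ℝ {Ω.hamField H x})ᗮ

/-- The fiber `𝒩_x = N_x ∩ ker dH(x)`. -/
def transSpace (H : M → ℝ) (x : M) : Submodule ℝ (TangentSpace I x) :=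
  normalSpace Ω H x ⊓ (dHam I H x).ker

/-- The transversal linear Poincaré flow `Φ_H^t(x) v = Π_{φ_H^t(x)} Dφ_H^t(x) v`, `v ∈ 𝒩_x`, as a map
on `T_xM` after composition with the orthogonal projection `T_xM → 𝒩_x`. -/
def transFlow (H : M → ℝ) (t : ℝ) (x : M) :
    TangentSpace I x →L[ℝ] TangentSpace I (Ω.flow H t x) :=
  (normalSpace Ω H (Ω.flow H t x)).starProjection ∘L Ω.tangentFlow H t x
    ∘L (transSpace Ω H x).starProjection

/-- A family of linear maps `L^t : 𝒩_x → 𝒩_{φ_H^t(x)}`; only `0 ≤ t ≤ T` matters for a family of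
length `T`. -/
abbrev LinearFlow (H : M → ℝ) (x : M) : Type _ :=
  ∀ t : ℝ, transSpace Ω H x →L[ℝ] transSpace Ω H (Ω.flow H t x)

variable {Ω}

namespace LinearFlow

/-- The maps `L^t`, `0 ≤ t ≤ T`, preserve the symplectic form induced by `Ω` on the fibers. -/
def IsSymplectic {H : M → ℝ} {x : M} (L : LinearFlow Ω H x) (T : ℝ) : Prop :=
  ∀ t ∈ Icc 0 T, ∀ v w : transSpace Ω H x,
    Ω.form (Ω.flow H t x) (L t v) (L t w) = Ω.form x v w

/-- `L^t` as a map `T_xM → T_{φ_H^t(x)}M`, after composition with the orthogonal projection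
`T_xM → 𝒩_x`. -/
def ext {H : M → ℝ} {x : M} (L : LinearFlow Ω H x) (t : ℝ) :
    TangentSpace I x →L[ℝ] TangentSpace I (Ω.flow H t x) :=
  (transSpace Ω H (Ω.flow H t x)).subtypeL ∘L L t ∘L (transSpace Ω H x).orthogonalProjectionOnto

open Classical in
/-- The concatenated linear flow: `L₁^t` for `t ≤ T₁`, and `L₂^{t - T₁} L₁^{T₁}` for `t > T₁`. The
case distinction on `e` only serves to identify the fibers over the points `φ_H^{t-T₁}(φ_H^{T₁}(x))`
and `φ_H^t(x)`, which coincide by the group property of the flow. -/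
def concat {H : M → ℝ} {x : M} (T₁ : ℝ) (L₁ : LinearFlow Ω H x)
    (L₂ : LinearFlow Ω H (Ω.flow H T₁ x)) : LinearFlow Ω H x := fun t ↦
  if t ≤ T₁ then L₁ t
  else if e : Ω.flow H (t - T₁) (Ω.flow H T₁ x) = Ω.flow H t x then
    e ▸ (L₂ (t - T₁) ∘L L₁ T₁)
  else 0

end LinearFlow

namespace SymplecticForm.DarbouxAtlas

variable (A : Ω.DarbouxAtlas)

/-- The vector `v ∈ T_xM` such that `y` has coordinates `h(x) + Dh(x) v` in the chosen chart `h`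
around `x`. -/
def displacement (x y : M) : TangentSpace I x :=
  (A.dh (A.idx x) x).inverse (A.h (A.idx x) y - A.h (A.idx x) x)

/-- The normal section `𝔑_x` at `x`: in the chosen chart `h` around `x` it is the affine hyperplane
through `h(x)` with direction `Dh(x) N_x`. -/
def normalSection (H : M → ℝ) (x : M) : Set M :=
  {y ∈ (A.chart (A.idx x)).source | A.displacement x y ∈ normalSpace Ω H x}

/-- The ball `B(x, r) = {(u, v, w) : √(u² + v²) < r, |w| < r}` in `𝔑_x`, where `(u, v)` are
orthonormal coordinates of `𝒩_x` and `w` is the coordinate of its orthogonal complement in `N_x`. -/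
def ball (H : M → ℝ) (x : M) (r : ℝ) : Set M :=
  {y ∈ A.normalSection H x |
    ‖(transSpace Ω H x).starProjection (A.displacement x y)‖ < r ∧
    ‖A.displacement x y - (transSpace Ω H x).starProjection (A.displacement x y)‖ < r}

open Classical in
/-- Three vectors forming a basis of `N_x` (when this space is three-dimensional, that is, when `x`
is a regular point). -/
def normalFrame (Ω : SymplecticForm I M) (H : M → ℝ) (x : M) (k : Fin 3) : TangentSpace I x :=
  if e : Module.finrank ℝ (normalSpace Ω H x) = 3 then
    (Module.finBasisOfFinrankEq ℝ (normalSpace Ω H x) e k : TangentSpace I x)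
  else 0

/-- The parametrization of the section `𝔑_x` by `c ∈ ℝ³`, in the chart `h`:
`c ↦ h(x) + Dh(x) (∑ₖ cₖ eₖ)` with `e` the basis `normalFrame` of `N_x`. -/
def sectionCoord (H : M → ℝ) (x : M) (c : Fin 3 → ℝ) : E4 :=
  A.h (A.idx x) x + A.dh (A.idx x) x (∑ k, c k • normalFrame Ω H x k)

/-- The density of the 3-form `ι_{X_H} Ω²` in the parametrization `sectionCoord` of `𝔑_x`. -/
def fluxDensity (H : M → ℝ) (x : M) (c : Fin 3 → ℝ) : ℝ :=
  let y : M := A.hinv (A.idx x) (A.sectionCoord H x c)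
  let e : Fin 3 → TangentSpace I y := fun k ↦
    (A.dh (A.idx x) y).inverse (A.dh (A.idx x) x (normalFrame Ω H x k))
  |Ω.sq y (Ω.hamField H y) (e 0) (e 1) (e 2)|

/-- The measure on `𝔑_x` induced by the 3-form `ι_{X_H} Ω²`. -/
def sectionMeasure (H : M → ℝ) (x : M) (S : Set M) : ENNReal :=
  ∫⁻ c in {c : Fin 3 → ℝ | ∃ y ∈ S ∩ A.normalSection H x,
      A.h (A.idx x) y = A.sectionCoord H x c},
    ENNReal.ofReal (A.fluxDensity H x c)

/-- `τ` is the arrival time on `B(x, r)` of the Poincaré map `𝒫_H^T(x) : B(x, r) → 𝔑_{φ_H^T(x)}`: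
a continuous function with `τ(x) = T` and `φ_H^{τ(y)}(y) ∈ 𝔑_{φ_H^T(x)}`. The Poincaré map is then
`y ↦ φ_H^{τ(y)}(y)`. -/
def IsPoincareTime (H : M → ℝ) (x : M) (T r : ℝ) (τ : M → ℝ) : Prop :=
  ContinuousOn τ (A.ball H x r) ∧ τ x = T ∧
    ∀ y ∈ A.ball H x r, Ω.flow H (τ y) y ∈ A.normalSection H (Ω.flow H T x)

end SymplecticForm.DarbouxAtlas

/-- The flowbox over `U`: the union of the orbit segments from the points `y ∈ U` to their images
`φ_H^{τ(y)}(y)` under the Poincaré map with arrival time `τ`. -/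
def flowbox (Ω : SymplecticForm I M) (H : M → ℝ) (U : Set M) (τ : M → ℝ) : Set M :=
  {z | ∃ y ∈ U, ∃ t ∈ Icc 0 (τ y), z = Ω.flow H t y}

/-- The family `L` is an `(ε, κ)`-realizable linear flow of length `T` at `x`, for the Hamiltonian
`H` of class `C^{s+1}`. -/
def IsRealizable (A : Ω.DarbouxAtlas) (s : ℕ∞) (H : M → ℝ) (ε κ T : ℝ) (x : M)
    (L : LinearFlow Ω H x) : Prop :=
  0 < T ∧ 0 < ε ∧ 0 < κ ∧ κ < 1 ∧
  -- `x` is not periodic, or its period is larger than `T`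
  (∀ t ∈ Ioc 0 T, Ω.flow H t x ≠ x) ∧
  L.IsSymplectic T ∧
  ∀ γ > 0, ∃ r > 0, ∃ τ : M → ℝ, A.IsPoincareTime H x T r τ ∧
    ∀ U ⊆ A.ball H x r, (∃ V, IsOpen V ∧ U = V ∩ A.normalSection H x) →
      ∃ K ⊆ U, MeasurableSet[borel M] K ∧
        A.sectionMeasure H x (U \ K) ≤ ENNReal.ofReal κ * A.sectionMeasure H x U ∧
        ∃ H' : M → ℝ, IsHamiltonian I s H' ∧ A.C2Close ε H' H ∧
          (∀ z ∉ flowbox Ω H U τ, H' z = H z) ∧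
          (∀ y ∈ U, A.SameDerivAt H' H y ∧ A.SameDerivAt H' H (Ω.flow H (τ y) y)) ∧
          ∀ y ∈ K,
            Ω.flow H' T y ∈ (A.chart (A.idx (Ω.flow H T x))).source ∧
            A.mapDist (A.idx x) (A.idx (Ω.flow H T x)) (transFlow Ω H' T y) (L.ext T) < γ

end Riemannian

end Defs

end HamRealizable

end

namespace HamRealizable

/-! ### Ordinary differential equations in a Banach space or a half-space: existence and dependence
on the initial point -/

section ODE

open Metric NNReal

variable {E : Type*} [NormedAddCommGroup E] [NormedSpace ℝ E]

/-! Let p be the Poincaré map of H from the normal section at x to the one at φ_H^{T₁}(x). Over a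
small open subset U of the first section, realizability of L₁ gives a perturbation H₁ of H in the
flowbox over U and a set K₁; realizability of L₂, applied to p(U), gives H₂ and K₂. The
concatenation is realized by H₁ + H₂ - H, with the set of those y ∈ K₁ that the Poincaré map p₁ of
H₁ sends into K₂. Four points need an argument.

Size of the perturbation. The two flowboxes meet only on the middle section. Hence every point is in
the closure of an open set on which H₁ or H₂ equals H. There the pasted Hamiltonian is the other
perturbation, so by continuity its 2-jet at the point is that of a single ε-close function, and the
bound ε is not doubled (`mem_closure_compl`, `C2Close.of_closure`).

Perturbed orbits. H₁ and H₂ are ε-close to H in C² with ε fixed, which alone says nothing about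
their orbits. However, their supports shrink to a compact orbit segment, and this segment has dense
complement because H is constant along it and not critical there. The difference vanishes near
points arbitrarily close to any given point and has bounded second derivatives, so it is C¹-small
(`c1Conv_thinFilter`). The flows therefore converge to that of H (`C1Conv.tendsto_flow`), and the
crossing and non-return properties of the non-periodic orbit persist (`exists_sectionPair`). The
flow is constructed on a compact manifold with boundary: X_H is tangent to the boundary since H is
constant on its components.

Measure. Poincaré maps of a Hamiltonian preserve the flux of its own form ι_X ω²
(`lintegral_transition`), and X_{H₁} = X_H on U and p(U). So the points that p₁ sends to p(U) \ K₂
cost at most κ₂ times the measure of U. Moreover p₁ sends almost every point of U into p(U)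
(`volume_hit_notMem`): H₁ = H on the H-orbits that start outside U, and a function that vanishes on
a measurable set has zero derivative at almost every point of it. Hence almost all of these orbits
are also H₁-orbits, and injectivity of p₁ excludes that a point of U arrives at their ends.

Linear part. The second derivatives of the perturbations are only bounded, so their tangent flows
need not converge to that of H; for short times, however, they are uniformly close to the identity.
The linear Poincaré flow of the pasted Hamiltonian factors into that of H₁ over time T₁, that of H₂
over time T₂, and four short pieces that are close to projections onto normal spaces
(`transFlow_eq_comp`, `exists_transFlow_paste_close`). The long factors are close to L₁ and L₂ by
assumption, and the projections fix the ranges of these maps. -/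

theorem _root_.IsPicardLindelof.exists_solution_mem_closedBall [CompleteSpace E]
    {f : ℝ → E → E} {tmin tmax : ℝ} {t₀ : Icc tmin tmax} {x₀ x : E} {a r L K : ℝ≥0}
    (hf : IsPicardLindelof f t₀ x₀ a r L K) (hx : x ∈ closedBall x₀ r) :
    ∃ α : ℝ → E, α t₀ = x ∧
      ∀ t ∈ Icc tmin tmax, HasDerivWithinAt α (f t (α t)) (Icc tmin tmax) t ∧
        α t ∈ closedBall x₀ a := by
  obtain ⟨α, hα⟩ := ODE.FunSpace.exists_isFixedPt_next hf hx
  refine ⟨α.compProj, by rw [ODE.FunSpace.compProj_val, ← hα, ODE.FunSpace.next_apply₀],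
    fun t ht ↦ ⟨?_, α.compProj_mem_closedBall hf.mul_max_le⟩⟩
  apply ODE.hasDerivWithinAt_picard_Icc t₀.2 hf.continuousOn_uncurry
    α.continuous_compProj.continuousOn (fun _ ht' ↦ α.compProj_mem_closedBall hf.mul_max_le)
    x ht |>.congr_of_mem _ ht
  intro t' ht'
  nth_rw 1 [← hα]
  rw [ODE.FunSpace.compProj_of_mem ht', ODE.FunSpace.next_apply]

/-- At speed at most `M`, a curve that starts in the ball of radius `ρ / 2` cannot leave the ball of
radius `ρ` before time `δ`. The confinement matters later, since the field is only controlled in a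
box of a chart. -/
theorem exists_solution_of_lipschitzOnWith [CompleteSpace E] {v : E → E} {z₀ z : E} {ρ M δ : ℝ}
    {K : ℝ≥0} (hρ : 0 ≤ ρ) (hM0 : 0 ≤ M) (hv : LipschitzOnWith K v (closedBall z₀ ρ))
    (hM : ∀ z ∈ closedBall z₀ ρ, ‖v z‖ ≤ M) (hδ : 0 ≤ δ) (hδM : M * δ ≤ ρ / 2)
    (hz : z ∈ closedBall z₀ (ρ / 2)) :
    ∃ α : ℝ → E, α 0 = z ∧
      ∀ t ∈ Ioo (-δ) δ, HasDerivAt α (v (α t)) t ∧ α t ∈ closedBall z₀ ρ := by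
  lift ρ to ℝ≥0 using hρ
  lift M to ℝ≥0 using hM0
  have hpl : IsPicardLindelof (fun _ ↦ v) (tmin := -δ) (tmax := δ) ⟨0, by simpa using hδ⟩
      z₀ ρ (ρ / 2) M K := by
    refine .of_time_independent hM hv ?_
    simp only [sub_zero, zero_sub, neg_neg, max_self]
    push_cast
    linarith
  obtain ⟨α, h0, h⟩ := hpl.exists_solution_mem_closedBall (x := z) (by simpa using hz)
  refine ⟨α, h0, fun t ht ↦ ⟨?_, (h t (Ioo_subset_Icc_self ht)).2⟩⟩
  exact (h t (Ioo_subset_Icc_self ht)).1.hasDerivAt (Icc_mem_nhds ht.1 ht.2)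

/-- The squared negative part is differentiable everywhere. It serves as a test function to show
that a coordinate stays nonnegative along a curve. -/
theorem hasDerivAt_min_zero_sq (x : ℝ) :
    HasDerivAt (fun x : ℝ ↦ (min x 0) ^ 2) (2 * min x 0) x := by
  rcases lt_trichotomy x 0 with h | rfl | h
  · have : (fun x : ℝ ↦ (min x 0) ^ 2) =ᶠ[𝓝 x] fun x ↦ x ^ 2 := by
      filter_upwards [eventually_lt_nhds h] with y hy
      rw [min_eq_left hy.le]
    rw [min_eq_left h.le]
    simpa using (hasDerivAt_pow 2 x).congr_of_eventuallyEq this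
  · have : (fun x : ℝ ↦ x ^ 2) =o[𝓝 0] fun x : ℝ ↦ x := by
      simpa using Asymptotics.isLittleO_pow_pow (𝕜 := ℝ) (m := 1) (n := 2) (by norm_num)
    rw [hasDerivAt_iff_isLittleO]
    simp only [min_self, mul_zero, smul_zero, sub_zero, ne_eq, OfNat.ofNat_ne_zero,
      not_false_eq_true, zero_pow]
    refine (Asymptotics.IsBigO.of_bound 1 ?_).trans_isLittleO this
    filter_upwards with y
    rw [one_mul, norm_pow, norm_pow]
    gcongr
    rcases le_total y 0 with h | h <;> simp [h]
  · have : (fun x : ℝ ↦ (min x 0) ^ 2) =ᶠ[𝓝 x] fun _ ↦ 0 := by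
      filter_upwards [eventually_gt_nhds h] with y hy
      rw [min_eq_right hy.le]; simp
    rw [min_eq_right h.le]
    simpa using (hasDerivAt_const x (0 : ℝ)).congr_of_eventuallyEq this

/-- The nearest-point projection of `ℝ⁴` onto the half-space `{y | 0 ≤ y 0}`. -/
def halfProj (y : E4) : E4 := WithLp.toLp 2 fun i ↦ if i = 0 then max (y 0) 0 else y i

theorem halfProj_zero (y : E4) : halfProj y 0 = max (y 0) 0 := by simp [halfProj]

theorem halfProj_of_nonneg {y : E4} (hy : 0 ≤ y 0) : halfProj y = y := by
  ext i
  by_cases h : i = 0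
  · subst h; simp [halfProj, hy]
  · simp [halfProj, h]

theorem lipschitzWith_halfProj : LipschitzWith 1 halfProj := by
  refine LipschitzWith.mk_one fun x y ↦ ?_
  rw [EuclideanSpace.dist_eq, EuclideanSpace.dist_eq]
  refine Real.sqrt_le_sqrt (Finset.sum_le_sum fun i _ ↦ ?_)
  by_cases h : i = 0
  · subst h
    simp only [halfProj, if_true]
    rw [Real.dist_eq, Real.dist_eq]
    exact pow_le_pow_left₀ (abs_nonneg _) (abs_max_sub_max_le_abs _ _ _) 2
  · simp [halfProj, h]

/-- In the half-space case the field is extended by composition with the nearest-point projection,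
which is 1-Lipschitz and preserves the ball because `z₀` is in the half-space. Tangency on the
boundary hyperplane then prevents the solution of the extended equation from leaving the half-space,
so it solves the original one. -/
theorem exists_solution_range {S : Set E4} (hS : S = univ ∨ S = {y : E4 | 0 ≤ y 0})
    {v : E4 → E4} {z₀ z : E4} {ρ M δ : ℝ} {K : ℝ≥0} (hz₀ : z₀ ∈ S) (hρ : 0 ≤ ρ) (hM0 : 0 ≤ M)
    (hv : LipschitzOnWith K v (closedBall z₀ ρ ∩ S))
    (hM : ∀ z ∈ closedBall z₀ ρ ∩ S, ‖v z‖ ≤ M)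
    (htan : S = univ ∨ ∀ z ∈ closedBall z₀ ρ ∩ S, z 0 = 0 → v z 0 = 0)
    (hδ : 0 ≤ δ) (hδM : M * δ ≤ ρ / 2) (hz : z ∈ closedBall z₀ (ρ / 2) ∩ S) :
    ∃ α : ℝ → E4, α 0 = z ∧
      ∀ t ∈ Ioo (-δ) δ, HasDerivAt α (v (α t)) t ∧ α t ∈ closedBall z₀ ρ ∩ S := by
  by_cases hSu : S = univ
  · subst hSu
    simp only [inter_univ] at *
    exact exists_solution_of_lipschitzOnWith hρ hM0 hv hM hδ hδM hz
  have hS' : S = {y : E4 | 0 ≤ y 0} := hS.resolve_left hSu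
  replace htan := htan.resolve_left hSu
  have hmaps : ∀ y ∈ closedBall z₀ ρ, halfProj y ∈ closedBall z₀ ρ ∩ S := by
    intro y hy
    refine ⟨?_, ?_⟩
    · rw [mem_closedBall]
      have h1 := lipschitzWith_halfProj.dist_le_mul y z₀
      rw [halfProj_of_nonneg (y := z₀) (by rw [hS'] at hz₀; exact hz₀)] at h1
      simp only [NNReal.coe_one, one_mul] at h1
      exact h1.trans hy
    · rw [hS', mem_ofPred, halfProj_zero]; exact le_max_right _ _
  obtain ⟨α, h0, h⟩ := exists_solution_of_lipschitzOnWith (v := v ∘ halfProj) (K := K) (z := z)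
    hρ hM0 ((hv.comp (lipschitzWith_halfProj.lipschitzOnWith (s := closedBall z₀ ρ)) hmaps).weaken
      (by simp)) (fun y hy ↦ hM _ (hmaps y hy)) hδ hδM hz.1
  have hder : ∀ t ∈ Ioo (-δ) δ, HasDerivAt (fun t ↦ (min (α t 0) 0) ^ 2) 0 t := by
    intro t ht
    have h1 : HasDerivAt (fun t ↦ α t 0) ((v (halfProj (α t))) 0) t :=
      ((EuclideanSpace.proj (𝕜 := ℝ) (0 : Fin 4)).hasFDerivAt.comp_hasDerivAt t (h t ht).1)
    have h2 := (hasDerivAt_min_zero_sq (α t 0)).comp t h1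
    convert! h2 using 1
    -- If the coordinate is nonpositive, the projected point lies on the hyperplane and tangency
    -- kills the first component of the field; otherwise the factor `min (α t 0) 0` vanishes.
    rcases le_total (α t 0) 0 with hle | hle
    · rw [htan _ (hmaps _ (h t ht).2) (by rw [halfProj_zero]; exact max_eq_right hle)]; simp
    · simp [hle]
  have hnonneg : ∀ t ∈ Ioo (-δ) δ, 0 ≤ α t 0 := by
    intro t ht
    have h0' : (0 : ℝ) ∈ Ioo (-δ) δ := by
      constructor <;> linarith [ht.1, ht.2]
    have := isOpen_Ioo.is_const_of_deriv_eq_zero (isPreconnected_Ioo)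
      (fun t ht ↦ (hder t ht).differentiableAt.differentiableWithinAt)
      (fun t ht ↦ (hder t ht).deriv) ht h0'
    have hz0 : 0 ≤ z 0 := by have := hz.2; rw [hS'] at this; exact this
    simp only [h0, min_eq_right hz0] at this
    by_contra! hneg
    rw [min_eq_left hneg.le] at this
    nlinarith
  refine ⟨α, h0, fun t ht ↦ ?_⟩
  have hp := halfProj_of_nonneg (hnonneg t ht)
  refine ⟨?_, ?_⟩
  · have := (h t ht).1
    simpa [Function.comp, hp] using this
  · have := hmaps _ (h t ht).2
    rwa [hp] at this

/-- Picard iteration in the unit ball around the identity: there ‖A‖ ≤ 2, so the right-hand side is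
bounded by `2 * K`, and `2 * K * δ ≤ 1` keeps the solution in the ball. -/
theorem exists_solution_variational [CompleteSpace E] {B : ℝ → E →L[ℝ] E} {K δ : ℝ} (hδ : 0 ≤ δ)
    (hK0 : 0 ≤ K) (hB : ContinuousOn B (Icc 0 δ)) (hK : ∀ t ∈ Icc 0 δ, ‖B t‖ ≤ K)
    (hKδ : 2 * K * δ ≤ 1) :
    ∃ A : ℝ → E →L[ℝ] E, A 0 = .id ℝ E ∧
      (∀ t ∈ Icc 0 δ, HasDerivWithinAt A (B t ∘L A t) (Icc 0 δ) t) ∧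
      ∀ t ∈ Icc 0 δ, ‖A t - .id ℝ E‖ ≤ 2 * K * t := by
  lift K to ℝ≥0 using hK0
  have hball : ∀ A ∈ closedBall (ContinuousLinearMap.id ℝ E) 1, ‖A‖ ≤ 2 := by
    intro A hA
    rw [mem_closedBall, dist_eq_norm] at hA
    have := norm_le_norm_add_norm_sub (ContinuousLinearMap.id ℝ E) A
    have h2 := ContinuousLinearMap.norm_id_le (𝕜 := ℝ) (E := E)
    rw [norm_sub_rev] at this
    linarith [norm_sub_rev (ContinuousLinearMap.id ℝ E) A]
  have hpl : IsPicardLindelof (fun t (A : E →L[ℝ] E) ↦ B t ∘L A) (tmin := 0) (tmax := δ)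
      ⟨0, left_mem_Icc.2 hδ⟩ (.id ℝ E) 1 0 (2 * K) K := by
    refine ⟨fun t ht ↦ ?_, fun A _ ↦ ?_, fun t ht A hA ↦ ?_, ?_⟩
    · refine LipschitzOnWith.of_dist_le_mul fun A _ A' _ ↦ ?_
      rw [dist_eq_norm, dist_eq_norm, ← ContinuousLinearMap.comp_sub]
      exact (ContinuousLinearMap.opNorm_comp_le _ _).trans
        (mul_le_mul_of_nonneg_right (hK t ht) (norm_nonneg _))
    · exact hB.clm_comp continuousOn_const
    · refine (ContinuousLinearMap.opNorm_comp_le _ _).trans ?_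
      have h1 := hball A (by simpa using hA)
      have h2 := hK t ht
      push_cast
      rw [mul_comm (2 : ℝ)]
      exact mul_le_mul h2 h1 (norm_nonneg _) (by positivity)
    · push_cast
      simp only [sub_zero, sub_self]
      rw [max_eq_left hδ]
      exact hKδ
  obtain ⟨A, h0, h⟩ := hpl.exists_solution_mem_closedBall
    (x := ContinuousLinearMap.id ℝ E) (by simp)
  refine ⟨A, h0, fun t ht ↦ (h t ht).1, fun t ht ↦ ?_⟩
  have := (convex_Icc (0 : ℝ) δ).norm_image_sub_le_of_norm_hasDerivWithin_le (C := 2 * K)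
    (fun s hs ↦ (h s hs).1) (fun s hs ↦ ?_) (left_mem_Icc.2 hδ) ht
  · simp only at h0
    rw [h0, sub_zero, Real.norm_of_nonneg ht.1] at this
    exact this
  · refine (ContinuousLinearMap.opNorm_comp_le _ _).trans ?_
    have h1 := hball _ (by simpa using (h s hs).2)
    rw [mul_comm (2 : ℝ)]
    exact mul_le_mul (hK s hs) h1 (norm_nonneg _) (by positivity)

/-- Grönwall is used twice. First, nearby solutions stay within a constant times ‖z' - z‖. Then the
remainder u(z') - u(z) - A(z' - z) satisfies a linear inequality whose source term is small by
uniform continuity of `v'` on the compact convex set `D`. Working within `D₀` admits initial points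
on the boundary of a half-space. -/
theorem hasFDerivWithinAt_solution [CompleteSpace E] {D D₀ : Set E} (hDc : Convex ℝ D)
    (hDk : IsCompact D) {v : E → E} {v' : E → E →L[ℝ] E}
    (hv : ∀ z ∈ D, HasFDerivWithinAt v (v' z) D z) (hv'c : ContinuousOn v' D) {K δ : ℝ}
    (hK0 : 0 ≤ K) (hK : ∀ z ∈ D, ‖v' z‖ ≤ K) {u : ℝ → E → E}
    (hu0 : ∀ z ∈ D₀, u 0 z = z)
    (hu : ∀ z ∈ D₀, ∀ t ∈ Icc 0 δ, HasDerivAt (fun s ↦ u s z) (v (u t z)) t ∧ u t z ∈ D)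
    {z : E} (hz : z ∈ D₀) {A : ℝ → E →L[ℝ] E} (hA0 : A 0 = .id ℝ E)
    (hA : ∀ t ∈ Icc 0 δ, HasDerivWithinAt A (v' (u t z) ∘L A t) (Icc 0 δ) t)
    {t : ℝ} (ht : t ∈ Icc 0 δ) : HasFDerivWithinAt (u t) (A t) D₀ z := by
  have hlip : LipschitzOnWith K.toNNReal v D :=
    hDc.lipschitzOnWith_of_nnnorm_hasFDerivWithin_le hv fun z hz ↦ by
      rw [← NNReal.coe_le_coe, coe_nnnorm, Real.coe_toNNReal _ hK0]; exact hK z hz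
  set C := Real.exp (K * δ) with hC
  have hC0 : 0 < C := Real.exp_pos _
  have hdist : ∀ z' ∈ D₀, ∀ s ∈ Icc 0 δ, ‖u s z' - u s z‖ ≤ C * ‖z' - z‖ := by
    intro z' hz' s hs
    have := dist_le_of_trajectories_ODE_of_mem (v := fun _ ↦ v) (s := fun _ ↦ D)
      (f := fun s ↦ u s z') (g := fun s ↦ u s z) (a := 0) (b := δ) (δ := ‖z' - z‖)
      (fun _ _ ↦ hlip) (fun s hs ↦ (hu z' hz' s hs).1.continuousAt.continuousWithinAt)
      (fun s hs ↦ (hu z' hz' s (Ico_subset_Icc_self hs)).1.hasDerivWithinAt)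
      (fun s hs ↦ (hu z' hz' s (Ico_subset_Icc_self hs)).2)
      (fun s hs ↦ (hu z hz s hs).1.continuousAt.continuousWithinAt)
      (fun s hs ↦ (hu z hz s (Ico_subset_Icc_self hs)).1.hasDerivWithinAt)
      (fun s hs ↦ (hu z hz s (Ico_subset_Icc_self hs)).2)
      (by rw [hu0 z' hz', hu0 z hz, dist_eq_norm]) s hs
    rw [dist_eq_norm, Real.coe_toNNReal _ hK0, sub_zero, mul_comm] at this
    refine this.trans (mul_le_mul_of_nonneg_right ?_ (norm_nonneg _))
    rw [hC]
    gcongr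
    exact hs.2
  -- The constant `K + 1` instead of `K` excludes the degenerate case of the Grönwall bound, in
  -- which it would be zero.
  set C' := (Real.exp ((K + 1) * t) - 1) / (K + 1) with hC'
  have hC'0 : 0 ≤ C' := by
    refine div_nonneg ?_ (by linarith)
    have : 0 ≤ (K + 1) * t := mul_nonneg (by linarith) ht.1
    linarith [Real.one_le_exp this]
  rw [hasFDerivWithinAt_iff_isLittleO, Asymptotics.isLittleO_iff]
  intro c hc
  -- Chosen so that the final bound `η * (C * C')` is at most `c`.
  set η := c / (C * C' + 1) with hη
  have hη0 : 0 < η := by positivity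
  obtain ⟨ξ, hξ0, hξ⟩ := Metric.uniformContinuousOn_iff.1
    (hDk.uniformContinuousOn_of_continuous hv'c) η hη0
  have hmem : {z' | ‖z' - z‖ < ξ / C} ∈ 𝓝[D₀] z := by
    refine mem_nhdsWithin_of_mem_nhds ?_
    have : Metric.ball z (ξ / C) ∈ 𝓝 z := Metric.ball_mem_nhds _ (by positivity)
    simpa [Metric.ball, dist_eq_norm] using this
  filter_upwards [hmem, self_mem_nhdsWithin] with z' hz' hz'D
  have hrem : ∀ s ∈ Icc 0 δ,
      ‖v (u s z') - v (u s z) - v' (u s z) (u s z' - u s z)‖ ≤ η * (C * ‖z' - z‖) := by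
    intro s hs
    have h1 : ‖u s z' - u s z‖ < ξ := by
      refine (hdist z' hz'D s hs).trans_lt ?_
      have := mul_lt_mul_of_pos_left hz' hC0
      rwa [mul_div_cancel₀ _ hC0.ne'] at this
    have h2 := (hDc.inter (convex_ball (u s z) ξ)).norm_image_sub_le_of_norm_hasFDerivWithin_le'
      (f := v) (f' := v') (φ := v' (u s z)) (C := η)
      (fun w hw ↦ (hv w hw.1).mono inter_subset_left)
      (fun w hw ↦ by
        rw [← dist_eq_norm]
        exact (hξ w hw.1 _ (hu z hz s hs).2 hw.2).le)
      ⟨(hu z hz s hs).2, mem_ball_self hξ0⟩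
      ⟨(hu z' hz'D s hs).2, by rw [mem_ball, dist_eq_norm]; exact h1⟩
    exact h2.trans (mul_le_mul_of_nonneg_left (hdist z' hz'D s hs) hη0.le)
  have hgr := norm_le_gronwallBound_of_norm_deriv_right_le
    (f := fun s ↦ u s z' - u s z - A s (z' - z))
    (f' := fun s ↦ v (u s z') - v (u s z) - (v' (u s z) ∘L A s) (z' - z))
    (δ := 0) (K := K + 1) (ε := η * (C * ‖z' - z‖)) (a := 0) (b := δ) ?_ ?_ ?_ ?_ t ht
  · rw [gronwallBound_of_K_ne_0 (by linarith)] at hgr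
    simp only [zero_mul, sub_zero, zero_add] at hgr
    calc _ ≤ _ := hgr
      _ = η * (C * C') * ‖z' - z‖ := by rw [hC']; ring
      _ ≤ c * ‖z' - z‖ := by
        refine mul_le_mul_of_nonneg_right ?_ (norm_nonneg _)
        rw [hη, div_mul_eq_mul_div, div_le_iff₀ (by positivity)]
        nlinarith
  · refine ContinuousOn.sub (ContinuousOn.sub ?_ ?_) ?_
    · exact fun s hs ↦ (hu z' hz'D s hs).1.continuousAt.continuousWithinAt
    · exact fun s hs ↦ (hu z hz s hs).1.continuousAt.continuousWithinAt
    · exact ContinuousOn.clm_apply (fun s hs ↦ (hA s hs).continuousWithinAt) continuousOn_const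
  · intro s hs
    have hs' := Ico_subset_Icc_self hs
    refine ((hu z' hz'D s hs').1.hasDerivWithinAt.sub (hu z hz s hs').1.hasDerivWithinAt).sub ?_
    have h1 : HasDerivWithinAt A (v' (u s z) ∘L A s) (Ici s) s :=
      (hA s hs').mono_of_mem_nhdsWithin (mem_nhdsGE_iff_exists_Icc_subset.2
        ⟨δ, hs.2, Icc_subset_Icc_left hs.1⟩)
    exact h1.clm_apply (hasDerivWithinAt_const _ _ _) |>.congr_deriv (by simp)
  · simp [hu0 z hz, hu0 z' hz'D, hA0]
  · intro s hs
    have hs' := Ico_subset_Icc_self hs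
    have h1 : v (u s z') - v (u s z) - (v' (u s z) ∘L A s) (z' - z)
        = (v (u s z') - v (u s z) - v' (u s z) (u s z' - u s z))
          + v' (u s z) (u s z' - u s z - A s (z' - z)) := by
      simp only [ContinuousLinearMap.comp_apply, map_sub]; abel
    rw [h1]
    refine (norm_add_le _ _).trans ?_
    rw [add_comm]
    refine add_le_add ?_ (hrem s hs')
    refine ((v' (u s z)).le_opNorm _).trans (mul_le_mul_of_nonneg_right ?_ (norm_nonneg _))
    linarith [hK _ (hu z hz s hs').2]

/-- The derivative of β(A a, A b) is β(B A a, A b) + β(A a, B A b), which vanishes by infinitesimal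
invariance. This makes tangent flows symplectic. -/
theorem bilinear_apply_variational {A B : ℝ → E →L[ℝ] E} {δ : ℝ} (hA0 : A 0 = .id ℝ E)
    (hA : ∀ t ∈ Icc 0 δ, HasDerivWithinAt A (B t ∘L A t) (Icc 0 δ) t)
    (β : E →L[ℝ] E →L[ℝ] ℝ) (hβ : ∀ t ∈ Icc 0 δ, ∀ a b, β (B t a) b + β a (B t b) = 0)
    {t : ℝ} (ht : t ∈ Icc 0 δ) (a b : E) : β (A t a) (A t b) = β a b := by
  have hd : ∀ s ∈ Icc 0 δ, HasDerivWithinAt (fun s ↦ β (A s a) (A s b)) 0 (Icc 0 δ) s := by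
    intro s hs
    have h1 : HasDerivWithinAt (fun s ↦ A s a) ((B s ∘L A s) a) (Icc 0 δ) s :=
      ((hA s hs).clm_apply (hasDerivWithinAt_const _ _ _)).congr_deriv (by simp)
    have h2 : HasDerivWithinAt (fun s ↦ A s b) ((B s ∘L A s) b) (Icc 0 δ) s :=
      ((hA s hs).clm_apply (hasDerivWithinAt_const _ _ _)).congr_deriv (by simp)
    have h3 := (β.hasFDerivAt.comp_hasDerivWithinAt s h1).clm_apply h2
    refine h3.congr_deriv ?_
    simpa using hβ s hs (A s a) (A s b)
  have := (convex_Icc (0 : ℝ) δ).norm_image_sub_le_of_norm_hasDerivWithin_le (C := 0)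
    hd (fun s hs ↦ by simp) (left_mem_Icc.2 (ht.1.trans ht.2)) ht
  rw [zero_mul] at this
  have h2 := sub_eq_zero.1 (norm_le_zero_iff.1 this)
  simpa [hA0] using h2

end ODE

end HamRealizable

namespace HamRealizable

noncomputable section

/-! ### The standard symplectic form -/

/-- The standard basis of `ℝ⁴`. -/
abbrev e4 (i : Fin 4) : E4 := EuclideanSpace.single i 1

/-- The standard symplectic form as a continuous bilinear map. -/
def stdFormL : E4 →L[ℝ] E4 →L[ℝ] ℝ :=
  let p (i : Fin 4) : E4 →L[ℝ] ℝ := EuclideanSpace.proj i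
  (p 0).smulRight (p 2) + (p 2).smulRight (-p 0) + ((p 1).smulRight (p 3) + (p 3).smulRight (-p 1))

theorem stdFormL_apply (u v : E4) : stdFormL u v = stdForm u v := by
  simp [stdFormL, stdForm]
  ring

/-- The linear map sending a linear form `ℓ` to the vector `v` with `stdForm v · = ℓ`. -/
def stdDual : (E4 →L[ℝ] ℝ) →L[ℝ] E4 :=
  let a (i : Fin 4) : (E4 →L[ℝ] ℝ) →L[ℝ] ℝ := ContinuousLinearMap.apply ℝ ℝ (e4 i)
  (a 2).smulRight (e4 0) + (a 3).smulRight (e4 1) + (a 0).smulRight (-e4 2) + (a 1).smulRight (-e4 3)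

theorem E4_eq_sum (b : E4) : b = b 0 • e4 0 + b 1 • e4 1 + b 2 • e4 2 + b 3 • e4 3 := by
  ext i; fin_cases i <;> simp

theorem stdForm_stdDual (ℓ : E4 →L[ℝ] ℝ) (b : E4) : stdForm (stdDual ℓ) b = ℓ b := by
  conv_rhs => rw [E4_eq_sum b]
  simp only [stdForm, stdDual, map_add, map_smul]
  simp
  ring

theorem stdForm_self (v : E4) : stdForm v v = 0 := by simp [stdForm]; ring

theorem stdForm_swap (v w : E4) : stdForm v w = - stdForm w v := by simp [stdForm]; ring

theorem eq_of_stdForm_eq {v w : E4} (h : ∀ b, stdForm v b = stdForm w b) : v = w := by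
  have h0 := h (e4 0)
  have h1 := h (e4 1)
  have h2 := h (e4 2)
  have h3 := h (e4 3)
  simp [stdForm] at h0 h1 h2 h3
  ext i; fin_cases i <;> simp [*]

theorem stdDual_zero_coord (ℓ : E4 →L[ℝ] ℝ) : stdDual ℓ 0 = ℓ (e4 2) := by
  simp [stdDual]

/-! ### Hamiltonian vector fields in Darboux charts -/

section

variable {B : Type*} [TopologicalSpace B] {I : ModelWithCorners ℝ E4 B}
  {M : Type*} [TopologicalSpace M] [ChartedSpace B M] [IsManifold I ∞ M]

namespace SymplecticForm

variable (Ω : SymplecticForm I M)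

theorem isInvertible_form (x : M) : (Ω.form x).IsInvertible := by
  have key : ∀ f : E4 →L[ℝ] E4 →L[ℝ] ℝ, (∀ v, (∀ w, f v w = 0) → v = 0) → f.IsInvertible := by
    intro f hf
    have hinj : Function.Injective (f : E4 →ₗ[ℝ] (E4 →L[ℝ] ℝ)) := by
      rw [← LinearMap.ker_eq_bot, LinearMap.ker_eq_bot']
      intro v hv
      refine hf v fun w ↦ ?_
      have : f v = 0 := hv
      rw [this]; rfl
    have hfr : Module.finrank ℝ E4 = Module.finrank ℝ (E4 →L[ℝ] ℝ) := by
      rw [(InnerProductSpace.toDual ℝ E4).toLinearEquiv.finrank_eq]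
    have : FiniteDimensional ℝ (E4 →L[ℝ] ℝ) :=
      (InnerProductSpace.toDual ℝ E4).toLinearEquiv.finiteDimensional
    let e := (LinearEquiv.ofInjectiveOfFinrankEq _ hinj hfr).toContinuousLinearEquiv
    exact ⟨e, by ext v w; rfl⟩
  exact key (Ω.form x) (Ω.nondegenerate x)

theorem form_hamField (H : M → ℝ) (x : M) (w : TangentSpace I x) :
    Ω.form x (Ω.hamField H x) w = dHam I H x w := by
  have h := (Ω.isInvertible_form x).self_comp_inverse
  have h2 := congrArg (fun f ↦ f (dHam I H x)) h
  have h3 : Ω.form x ((Ω.form x).inverse (dHam I H x)) = dHam I H x := h2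
  rw [hamField, h3]

theorem dHam_hamField (H : M → ℝ) (x : M) : dHam I H x (Ω.hamField H x) = 0 := by
  rw [← Ω.form_hamField, Ω.alternating]

theorem hamField_eq_iff (H H' : M → ℝ) (x : M) :
    Ω.hamField H x = Ω.hamField H' x ↔ dHam I H x = dHam I H' x := by
  refine ⟨fun h ↦ ?_, fun h ↦ by rw [hamField, h, hamField]⟩
  ext w
  rw [← Ω.form_hamField, ← Ω.form_hamField, h]

namespace DarbouxAtlas

variable {Ω} (A : Ω.DarbouxAtlas) {i : Fin A.num} {p : M} {z : E4}

/-- The domain of the `i`-th chart. -/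
abbrev src (i : Fin A.num) : Set M := (A.chart i).source

/-- The image of the `i`-th chart in `ℝ⁴`. -/
abbrev tgt (i : Fin A.num) : Set E4 := ((A.chart i).extend I).target

theorem isOpen_src (i : Fin A.num) : IsOpen (A.src i) := (A.chart i).open_source

theorem h_mem_tgt (hp : p ∈ A.src i) : A.h i p ∈ A.tgt i :=
  ((A.chart i).extend I).map_source (by rwa [OpenPartialHomeomorph.extend_source])

theorem hinv_mem_src (hz : z ∈ A.tgt i) : A.hinv i z ∈ A.src i := by
  have := ((A.chart i).extend I).map_target hz
  rwa [OpenPartialHomeomorph.extend_source] at this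

theorem hinv_h (hp : p ∈ A.src i) : A.hinv i (A.h i p) = p := (A.chart i).extend_left_inv hp

theorem h_hinv (hz : z ∈ A.tgt i) : A.h i (A.hinv i z) = z :=
  ((A.chart i).extend I).right_inv hz

theorem tgt_subset_range (i : Fin A.num) : A.tgt i ⊆ range I :=
  (A.chart i).extend_target_subset_range

theorem h_mem_range (i : Fin A.num) (p : M) : A.h i p ∈ range I := mem_range_self _

theorem h_injOn (i : Fin A.num) : InjOn (A.h i) (A.src i) := fun p hp q hq h ↦ by
  rw [← A.hinv_h hp, h, A.hinv_h hq]

theorem tgt_mem_nhdsWithin (hp : p ∈ A.src i) : A.tgt i ∈ 𝓝[range I] (A.h i p) :=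
  (A.chart i).extend_target_mem_nhdsWithin hp

theorem tgt_mem_nhdsWithin' (hz : z ∈ A.tgt i) : A.tgt i ∈ 𝓝[range I] z := by
  simpa [A.h_hinv hz] using A.tgt_mem_nhdsWithin (A.hinv_mem_src hz)

theorem continuousAt_h (hp : p ∈ A.src i) : ContinuousAt (A.h i) p :=
  (A.chart i).continuousAt_extend hp

theorem continuousOn_h (i : Fin A.num) : ContinuousOn (A.h i) (A.src i) :=
  fun _ hp ↦ (A.continuousAt_h hp).continuousWithinAt

theorem continuousOn_hinv (i : Fin A.num) : ContinuousOn (A.hinv i) (A.tgt i) :=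
  (A.chart i).continuousOn_extend_symm

theorem continuousWithinAt_hinv (hz : z ∈ A.tgt i) : ContinuousWithinAt (A.hinv i) (range I) z :=
  ((A.continuousOn_hinv i) z hz).mono_of_mem_nhdsWithin (A.tgt_mem_nhdsWithin' hz)

theorem tendsto_h_nhdsWithin (hp : p ∈ A.src i) :
    Tendsto (A.h i) (𝓝 p) (𝓝[range I] (A.h i p)) :=
  tendsto_nhdsWithin_iff.2 ⟨A.continuousAt_h hp, Eventually.of_forall fun q ↦ A.h_mem_range i q⟩

theorem tendsto_hinv_nhds (hp : p ∈ A.src i) :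
    Tendsto (A.hinv i) (𝓝[range I] (A.h i p)) (𝓝 p) := by
  have := A.continuousWithinAt_hinv (A.h_mem_tgt hp)
  rwa [ContinuousWithinAt, A.hinv_h hp] at this

theorem contMDiffAt_h (hp : p ∈ A.src i) : ContMDiffAt I 𝓘(ℝ, E4) ∞ (A.h i) p :=
  OpenPartialHomeomorph.contMDiffAt_extend (A.mem_maximalAtlas i) hp

theorem contMDiffOn_hinv (i : Fin A.num) : ContMDiffOn 𝓘(ℝ, E4) I ∞ (A.hinv i) (A.tgt i) := by
  have := contMDiffOn_extend_symm (I := I) (A.mem_maximalAtlas i)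
  rwa [← OpenPartialHomeomorph.extend_target'] at this

theorem contMDiffWithinAt_hinv (hz : z ∈ A.tgt i) :
    ContMDiffWithinAt 𝓘(ℝ, E4) I ∞ (A.hinv i) (range I) z :=
  (A.contMDiffOn_hinv i z hz).mono_of_mem_nhdsWithin (A.tgt_mem_nhdsWithin' hz)

theorem hasMFDerivAt_h (hp : p ∈ A.src i) : HasMFDerivAt I 𝓘(ℝ, E4) (A.h i) p (A.dh i p) :=
  ((A.contMDiffAt_h hp).mdifferentiableAt (by simp)).hasMFDerivAt

/-- A linear map that pulls a form back to a nondegenerate one is injective, and the dimensions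
agree. The argument is the same at boundary points. -/
theorem isInvertible_dh (hp : p ∈ A.src i) : (A.dh i p).IsInvertible := by
  have key : ∀ f : E4 →L[ℝ] E4, Function.Injective f → f.IsInvertible := by
    intro f hf
    let e := (LinearEquiv.ofInjectiveOfFinrankEq (f : E4 →ₗ[ℝ] E4) hf rfl).toContinuousLinearEquiv
    exact ⟨e, by ext v; rfl⟩
  have h0 : ∀ v : TangentSpace I p, A.dh i p v = 0 → v = 0 := by
    intro v hv
    refine Ω.nondegenerate p v fun u ↦ ?_
    rw [← A.symplectic i p hp]
    change stdForm (A.dh i p v) _ = 0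
    rw [hv]
    simp [stdForm]
  exact key (A.dh i p) ((injective_iff_map_eq_zero (A.dh i p)).2 h0)

theorem dh_inverse_dh (hp : p ∈ A.src i) (v : TangentSpace I p) :
    (A.dh i p).inverse (A.dh i p v) = v := by
  have h := (A.isInvertible_dh hp).inverse_comp_self
  exact congrArg (fun f ↦ f v) h

theorem dh_dh_inverse (hp : p ∈ A.src i) (a : E4) : A.dh i p ((A.dh i p).inverse a) = a := by
  have h := (A.isInvertible_dh hp).self_comp_inverse
  exact congrArg (fun f ↦ f a) h

theorem stdForm_dh (hp : p ∈ A.src i) (u v : TangentSpace I p) :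
    stdForm (A.dh i p u) (A.dh i p v) = Ω.form p u v := A.symplectic i p hp u v

theorem uniqueMDiffWithinAt_range (hz : z ∈ range I) :
    UniqueMDiffWithinAt 𝓘(ℝ, E4) (range I) z :=
  uniqueMDiffWithinAt_iff_uniqueDiffWithinAt.2 (I.uniqueDiffOn z hz)

/-- Derivatives in coordinates are taken within `range I` throughout, as the chart image need not be
a neighborhood of its boundary points. Uniqueness of derivatives there identifies the derivative of
the inverse chart. -/
theorem hasMFDerivWithinAt_hinv (hz : z ∈ A.tgt i) :
    HasMFDerivWithinAt 𝓘(ℝ, E4) I (A.hinv i) (range I) z (A.dh i (A.hinv i z)).inverse := by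
  have h1 := ((A.contMDiffWithinAt_hinv hz).mdifferentiableWithinAt (by simp)).hasMFDerivWithinAt
  have hp := A.hinv_mem_src hz
  set L := mfderivWithin 𝓘(ℝ, E4) I (A.hinv i) (range I) z with hL
  have h2 := (A.hasMFDerivAt_h hp).comp_hasMFDerivWithinAt z h1
  have h3 : HasMFDerivWithinAt 𝓘(ℝ, E4) 𝓘(ℝ, E4) (A.h i ∘ A.hinv i) (range I) z
      (ContinuousLinearMap.id ℝ E4) := by
    refine (hasMFDerivWithinAt_id _ z).congr_of_eventuallyEq ?_ (A.h_hinv hz)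
    filter_upwards [A.tgt_mem_nhdsWithin' hz] with w hw using A.h_hinv hw
  have h4 := (uniqueMDiffWithinAt_range (I := I) (A.tgt_subset_range i hz)).eq h2 h3
  have h5 : L = (A.dh i (A.hinv i z)).inverse := by
    ext1 a
    have h6 : A.dh i (A.hinv i z) (L a) = a := congrArg (fun f ↦ f a) h4
    rw [← A.dh_inverse_dh hp (L a), h6]
    rfl
  rwa [h5] at h1

/-- The expression of a function in the `i`-th chart. -/
def loc (i : Fin A.num) (H : M → ℝ) (z : E4) : ℝ := H (A.hinv i z)

theorem contDiffOn_loc {n : ℕ∞} {H : M → ℝ} (hH : ContMDiff I 𝓘(ℝ, ℝ) n H) (i : Fin A.num) :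
    ContDiffOn ℝ n (A.loc i H) (A.tgt i) := by
  rw [← contMDiffOn_iff_contDiffOn]
  exact hH.comp_contMDiffOn ((A.contMDiffOn_hinv i).of_le (by exact_mod_cast le_top))

theorem contDiffWithinAt_loc {n : ℕ∞} {H : M → ℝ} (hH : ContMDiff I 𝓘(ℝ, ℝ) n H)
    (hz : z ∈ A.tgt i) : ContDiffWithinAt ℝ n (A.loc i H) (range I) z :=
  (A.contDiffOn_loc hH i z hz).mono_of_mem_nhdsWithin (A.tgt_mem_nhdsWithin' hz)

theorem fderivWithin_loc {H : M → ℝ} (hz : z ∈ A.tgt i)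
    (hH : MDifferentiableAt I 𝓘(ℝ, ℝ) H (A.hinv i z)) :
    fderivWithin ℝ (A.loc i H) (range I) z
      = dHam I H (A.hinv i z) ∘L (A.dh i (A.hinv i z)).inverse := by
  have h1 := hH.hasMFDerivAt.comp_hasMFDerivWithinAt z (A.hasMFDerivWithinAt_hinv hz)
  have h2 : HasFDerivWithinAt (A.loc i H)
      (dHam I H (A.hinv i z) ∘L (A.dh i (A.hinv i z)).inverse : E4 →L[ℝ] ℝ) (range I) z :=
    HasMFDerivWithinAt.hasFDerivWithinAt h1
  exact h2.fderivWithin (I.uniqueDiffOn z (A.tgt_subset_range i hz))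

theorem dHam_eq_fderivWithin {H : M → ℝ} (hp : p ∈ A.src i)
    (hH : MDifferentiableAt I 𝓘(ℝ, ℝ) H p) (v : TangentSpace I p) :
    dHam I H p v = fderivWithin ℝ (A.loc i H) (range I) (A.h i p) (A.dh i p v) := by
  have hz := A.h_mem_tgt hp
  have key : ∀ q, A.hinv i (A.h i p) = q → q = p →
      fderivWithin ℝ (A.loc i H) (range I) (A.h i p) = dHam I H q ∘L (A.dh i q).inverse := by
    rintro q rfl hq
    exact A.fderivWithin_loc hz (by rw [hq]; exact hH)
  rw [key p (A.hinv_h hp) rfl, ContinuousLinearMap.comp_apply, A.dh_inverse_dh hp]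

theorem dh_hamField {H : M → ℝ} (hp : p ∈ A.src i) (hH : MDifferentiableAt I 𝓘(ℝ, ℝ) H p) :
    A.dh i p (Ω.hamField H p) = stdDual (fderivWithin ℝ (A.loc i H) (range I) (A.h i p)) := by
  refine eq_of_stdForm_eq fun b ↦ ?_
  rw [stdForm_stdDual]
  conv_lhs => rw [← A.dh_dh_inverse hp b]
  rw [A.stdForm_dh hp, Ω.form_hamField, A.dHam_eq_fderivWithin hp hH, A.dh_dh_inverse hp]

/-- The Hamiltonian vector field of `H` in the `i`-th chart. -/
abbrev vf (i : Fin A.num) (H : M → ℝ) : E4 → E4 := A.localField i (Ω.hamField H)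

theorem localField_h (X : ∀ x : M, TangentSpace I x) (hp : p ∈ A.src i) :
    A.localField i X (A.h i p) = A.dh i p (X p) := by
  rw [localField, A.hinv_h hp]

theorem vf_eq {H : M → ℝ} (hH : MDifferentiable I 𝓘(ℝ, ℝ) H) (hz : z ∈ A.tgt i) :
    A.vf i H z = stdDual (fderivWithin ℝ (A.loc i H) (range I) z) := by
  have := A.dh_hamField (H := H) (A.hinv_mem_src hz) (hH _)
  rw [A.h_hinv hz] at this
  rw [vf, localField, this]

/-- The derivative of `vf`, in terms of the second derivative of `H`. -/
def dvf (i : Fin A.num) (H : M → ℝ) (z : E4) : E4 →L[ℝ] E4 :=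
  stdDual ∘L fderivWithin ℝ (fderivWithin ℝ (A.loc i H) (range I)) (range I) z

variable {H : M → ℝ}

theorem contDiffWithinAt_fderivWithin_loc (hH : ContMDiff I 𝓘(ℝ, ℝ) 2 H) (hz : z ∈ A.tgt i) :
    ContDiffWithinAt ℝ 1 (fderivWithin ℝ (A.loc i H) (range I)) (range I) z := by
  have h := A.contDiffWithinAt_loc (n := 2) hH hz
  exact h.fderivWithin_right I.uniqueDiffOn (by norm_num) (A.tgt_subset_range i hz)

theorem hasFDerivWithinAt_vf (hH : ContMDiff I 𝓘(ℝ, ℝ) 2 H) (hz : z ∈ A.tgt i) :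
    HasFDerivWithinAt (A.vf i H) (A.dvf i H z) (range I) z := by
  have h := (A.contDiffWithinAt_fderivWithin_loc hH hz).differentiableWithinAt
    (by norm_num) |>.hasFDerivWithinAt
  have h2 := stdDual.hasFDerivAt.comp_hasFDerivWithinAt z h
  refine h2.congr_of_eventuallyEq ?_ (A.vf_eq (hH.mdifferentiable (by norm_num)) hz)
  filter_upwards [A.tgt_mem_nhdsWithin' hz] with w hw
  exact A.vf_eq (hH.mdifferentiable (by norm_num)) hw

theorem continuousWithinAt_dvf (hH : ContMDiff I 𝓘(ℝ, ℝ) 2 H) (hz : z ∈ A.tgt i) :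
    ContinuousWithinAt (A.dvf i H) (range I) z := by
  have h := (A.contDiffWithinAt_fderivWithin_loc hH hz).fderivWithin_right (m := 0)
    I.uniqueDiffOn (by norm_num) (A.tgt_subset_range i hz)
  exact continuousWithinAt_const.clm_comp h.continuousWithinAt

theorem continuousWithinAt_vf (hH : ContMDiff I 𝓘(ℝ, ℝ) 2 H) (hz : z ∈ A.tgt i) :
    ContinuousWithinAt (A.vf i H) (range I) z :=
  (A.hasFDerivWithinAt_vf hH hz).continuousWithinAt

/-- The symmetry of second derivatives, which holds at boundary points too because they are limits
of interior points of the range. It is the infinitesimal form of the invariance of ω under the flow.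
-/
theorem stdForm_dvf (hH : ContMDiff I 𝓘(ℝ, ℝ) 2 H) (hz : z ∈ A.tgt i) (a b : E4) :
    stdForm (A.dvf i H z a) b + stdForm a (A.dvf i H z b) = 0 := by
  have h := A.contDiffWithinAt_loc (n := 2) hH hz
  have hs := h.isSymmSndFDerivWithinAt (by simp) I.uniqueDiffOn
    (I.range_subset_closure_interior (A.tgt_subset_range i hz)) (A.tgt_subset_range i hz)
  rw [stdForm_swap a]
  simp only [dvf, ContinuousLinearMap.comp_apply]
  rw [stdForm_stdDual, stdForm_stdDual, hs a b]
  ring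

/-! ### Tangency to the boundary -/

omit [IsManifold I ∞ M] in
-- The differential of a chart of the maximal atlas is surjective, and a map with surjective
-- differential at an interior point sends it to an interior point. So any such chart detects the
-- boundary, not only the preferred one.
theorem _root_.HamRealizable.mem_boundary_of_chart {e : OpenPartialHomeomorph M B}
    (he : e ∈ IsManifold.maximalAtlas I ∞ M) (hp : p ∈ e.source)
    (hb : I (e p) ∉ interior (range I)) : p ∈ I.boundary M := by
  rw [← ModelWithCorners.compl_interior]
  intro hint
  have he1 : e ∈ IsManifold.maximalAtlas I 1 M := IsManifold.maximalAtlas_subset_of_le (by simp) he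
  have hd : e.MDifferentiable I I :=
    ⟨fun q hq ↦ (mdifferentiableAt_of_mem_maximalAtlas he1 hq).mdifferentiableWithinAt,
     fun q hq ↦ (mdifferentiableAt_symm_of_mem_maximalAtlas he1 hq).mdifferentiableWithinAt⟩
  have h := (hd.mdifferentiableAt hp).isInteriorPoint_of_surjective_mfderiv
    (hd.mfderiv_surjective hp) hint
  change extChartAt I (e p) (e p) ∈ interior (range I) at h
  apply hb
  simpa [extChartAt, chartAt_self_eq] using h

/-- Coordinate 2 is conjugate to coordinate 0, so the 0-component of X_H is the derivative of H
along `e4 2`. That direction is tangent to the boundary hyperplane, and a short segment in it is a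
connected subset of the boundary, where H is constant. -/
theorem vf_zero_coord (hI : range I = univ ∨ range I = {y : E4 | 0 ≤ y 0})
    (hH : IsHamiltonian I 2 H) (hz : z ∈ A.tgt i) :
    range I = univ ∨ (z 0 = 0 → A.vf i H z 0 = 0) := by
  refine hI.imp_right fun hr hz0 ↦ ?_
  have hC2 : ContMDiff I 𝓘(ℝ, ℝ) 2 H := hH.1
  rw [A.vf_eq (hC2.mdifferentiable (by norm_num)) hz, stdDual_zero_coord]
  set c : ℝ → E4 := fun s ↦ z + s • e4 2 with hc
  have hc0 : ∀ s, c s 0 = 0 := fun s ↦ by simp [hc, hz0]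
  have hcr : ∀ s, c s ∈ range I := fun s ↦ by rw [hr]; exact (hc0 s).ge
  have hcc : Continuous c := by fun_prop
  have hct : ∀ᶠ s in 𝓝 (0 : ℝ), c s ∈ A.tgt i := by
    have h1 : Tendsto c (𝓝 0) (𝓝[range I] z) :=
      tendsto_nhdsWithin_iff.2 ⟨by simpa [hc] using hcc.tendsto 0, Eventually.of_forall hcr⟩
    exact h1 (A.tgt_mem_nhdsWithin' hz)
  obtain ⟨r, hr0, hball⟩ := Metric.eventually_nhds_iff_ball.1 hct
  have hbd : ∀ s ∈ Metric.ball (0 : ℝ) r, A.hinv i (c s) ∈ I.boundary M := by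
    intro s hs
    refine mem_boundary_of_chart (A.mem_maximalAtlas i) (A.hinv_mem_src (hball s hs)) ?_
    have h1 : I (A.chart i (A.hinv i (c s))) = c s := A.h_hinv (hball s hs)
    rw [h1, hr, interior_halfSpace]
    simp [hc0 s]
  have hconst : ∀ s ∈ Metric.ball (0 : ℝ) r, A.loc i H (c s) = A.loc i H z := by
    intro s hs
    have h0 : (0 : ℝ) ∈ Metric.ball (0 : ℝ) r := Metric.mem_ball_self hr0
    have hcz : c 0 = z := by simp [hc]
    refine hH.2 _ (by simpa [hcz] using hbd 0 h0) _ ?_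
    have hpre : IsPreconnected ((fun s ↦ A.hinv i (c s)) '' Metric.ball (0 : ℝ) r) :=
      (convex_ball (0 : ℝ) r).isPreconnected.image _
        ((A.continuousOn_hinv i).comp hcc.continuousOn fun s hs ↦ hball s hs)
    refine hpre.subset_connectedComponentIn ⟨0, h0, by simp only [hcz]⟩ ?_ ⟨s, hs, rfl⟩
    rintro _ ⟨s, hs, rfl⟩
    exact hbd s hs
  have h1 := (A.contDiffWithinAt_loc (n := 2) hC2 hz).differentiableWithinAt
    (by norm_num) |>.hasFDerivWithinAt
  have h2 : HasDerivAt c (e4 2) 0 := by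
    simpa [hc] using ((hasDerivAt_id (0 : ℝ)).smul_const (e4 2)).const_add z
  have hcz : c 0 = z := by simp [hc]
  have h3 : HasDerivAt (A.loc i H ∘ c)
      (fderivWithin ℝ (A.loc i H) (range I) z (e4 2)) 0 := by
    rw [← hasDerivWithinAt_univ]
    exact HasFDerivWithinAt.comp_hasDerivWithinAt (t := range I) 0 (by rw [hcz]; exact h1)
      h2.hasDerivWithinAt (fun s _ ↦ hcr s)
  have h4 : HasDerivAt (A.loc i H ∘ c) 0 0 := by
    refine (hasDerivAt_const (0 : ℝ) (A.loc i H z)).congr_of_eventuallyEq ?_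
    filter_upwards [Metric.ball_mem_nhds (0 : ℝ) hr0] with s hs using hconst s hs
  exact h3.unique h4

/-! ### Curves in charts -/

theorem hasDerivAt_h_comp {X : ∀ x : M, TangentSpace I x} {c : ℝ → M} {t : ℝ}
    (hp : c t ∈ A.src i)
    (hc : HasMFDerivAt 𝓘(ℝ, ℝ) I c t ((1 : ℝ →L[ℝ] ℝ).smulRight (X (c t)))) :
    HasDerivAt (fun s ↦ A.h i (c s)) (A.localField i X (A.h i (c t))) t := by
  have h1 := (A.hasMFDerivAt_h hp).comp t hc
  have h2 : HasFDerivAt (A.h i ∘ c)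
      (A.dh i (c t) ∘L ((1 : ℝ →L[ℝ] ℝ).smulRight (X (c t))) : ℝ →L[ℝ] E4) t :=
    HasMFDerivAt.hasFDerivAt h1
  have h3 := h2.hasDerivAt
  rw [A.localField_h X hp]
  convert! h3 using 1
  simp

theorem hasMFDerivAt_hinv_comp {X : ∀ x : M, TangentSpace I x} {α : ℝ → E4} {t : ℝ}
    (hp : α t ∈ A.tgt i) (hr : ∀ᶠ s in 𝓝 t, α s ∈ range I)
    (hc : HasDerivAt α (A.localField i X (α t)) t) :
    HasMFDerivAt 𝓘(ℝ, ℝ) I (fun s ↦ A.hinv i (α s)) t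
      ((1 : ℝ →L[ℝ] ℝ).smulRight (X (A.hinv i (α t)))) := by
  have h1 : HasMFDerivWithinAt 𝓘(ℝ, ℝ) 𝓘(ℝ, E4) α (α ⁻¹' range I) t
      ((1 : ℝ →L[ℝ] ℝ).smulRight (A.localField i X (α t))) :=
    hc.hasFDerivAt.hasMFDerivAt.hasMFDerivWithinAt
  have h2 := (A.hasMFDerivWithinAt_hinv hp).comp t h1 Subset.rfl
  have h3 := h2.hasMFDerivAt hr
  refine HasMFDerivAt.congr_mfderiv h3 ?_
  ext
  change (A.dh i (A.hinv i (α t))).inverse ((1 : ℝ) • A.localField i X (α t))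
    = (1 : ℝ) • X (A.hinv i (α t))
  rw [one_smul, one_smul, localField, A.dh_inverse_dh (A.hinv_mem_src hp)]

end DarbouxAtlas

end SymplecticForm

end

end

end HamRealizable

namespace HamRealizable

/-! ### Global integral curves from a uniform local existence time, with uniqueness as a hypothesis
-/

section UniformTime

open Function

variable {E : Type*} [NormedAddCommGroup E] [NormedSpace ℝ E]
  {H : Type*} [TopologicalSpace H] {I : ModelWithCorners ℝ E H}
  {M : Type*} [TopologicalSpace M] [ChartedSpace H M]

/-- Integral curves of `v` on open intervals are determined by their value at one point. -/
def UniqueIntegralCurves (I : ModelWithCorners ℝ E H) (v : (x : M) → TangentSpace I x) : Prop :=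
  ∀ ⦃γ γ' : ℝ → M⦄ ⦃a b t₀ : ℝ⦄, t₀ ∈ Ioo a b → IsMIntegralCurveOn γ v (Ioo a b) →
    IsMIntegralCurveOn γ' v (Ioo a b) → γ t₀ = γ' t₀ → EqOn γ γ' (Ioo a b)

namespace UniqueIntegralCurves

variable {γ γ' : ℝ → M} {v : (x : M) → TangentSpace I x} {s s' : Set ℝ} {t₀ : ℝ}

/-- This is the uniqueness theorem of integral curves applied to a real-indexed family of integral
curves with the same starting point. -/
lemma eqOn_of_isMIntegralCurveOn_Ioo
    (hv : UniqueIntegralCurves I v) {x : M}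
    (γ : ℝ → ℝ → M) (hγx : ∀ a, γ a 0 = x) (hγ : ∀ a > 0, IsMIntegralCurveOn (γ a) v (Ioo (-a) a))
    {a a' : ℝ} (hpos : 0 < a') (hle : a' ≤ a) :
    EqOn (γ a') (γ a) (Ioo (-a') a') := by
  apply hv _
    (hγ a' (by positivity)) ((hγ a (lt_of_lt_of_le hpos hle)).mono _)
    (by rw [hγx a, hγx a'])
  · rw [mem_Ioo]
    exact ⟨neg_lt_zero.mpr hpos, by positivity⟩
  · apply Ioo_subset_Ioo <;> linarith

/-- For a family of integral curves `γ : ℝ → ℝ → M` with the same starting point `γ 0 = x` such that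
each `γ a` is defined on `Ioo (-a) a`, the global curve `γ_ext := fun t ↦ γ (|t| + 1) t` agrees
with each `γ a` on `Ioo (-a) a`. This will help us show that `γ_ext` is a global integral curve. -/
lemma eqOn_abs_add_one_of_isMIntegralCurveOn_Ioo
    (hv : UniqueIntegralCurves I v) {x : M}
    (γ : ℝ → ℝ → M) (hγx : ∀ a, γ a 0 = x) (hγ : ∀ a > 0, IsMIntegralCurveOn (γ a) v (Ioo (-a) a))
    {a : ℝ} : EqOn (fun t ↦ γ (|t| + 1) t) (γ a) (Ioo (-a) a) := by
  intro t ht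
  by_cases! hlt : |t| + 1 < a
  · exact eqOn_of_isMIntegralCurveOn_Ioo hv γ hγx hγ
      (by positivity) hlt.le (abs_lt.mp <| lt_add_one _)
  · exact eqOn_of_isMIntegralCurveOn_Ioo hv γ hγx hγ
      (neg_lt_self_iff.mp <| lt_trans ht.1 ht.2) hlt ht |>.symm

/-- For a family of integral curves `γ : ℝ → ℝ → M` with the same starting point `γ 0 = x` such that
each `γ a` is defined on `Ioo (-a) a`, the function `γ_ext := fun t ↦ γ (|t| + 1) t` is a global
integral curve. -/
lemma isMIntegralCurve_abs_add_one_of_isMIntegralCurveOn_Ioo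
    (hv : UniqueIntegralCurves I v) {x : M}
    (γ : ℝ → ℝ → M) (hγx : ∀ a, γ a 0 = x) (hγ : ∀ a > 0, IsMIntegralCurveOn (γ a) v (Ioo (-a) a)) :
    IsMIntegralCurve (fun t ↦ γ (|t| + 1) t) v := by
  intro t
  have ht : t ∈ Ioo (-(|t| + 1)) (|t| + 1) := by
    rw [mem_Ioo, ← abs_lt]
    exact lt_add_one _
  apply HasMFDerivAt.congr_of_eventuallyEq (f := γ (|t| + 1))
  · exact hγ (|t| + 1) (by positivity) _ ht |>.hasMFDerivAt (Ioo_mem_nhds ht.1 ht.2)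
  · rw [Filter.eventuallyEq_iff_exists_mem]
    refine ⟨Ioo (-(|t| + 1)) (|t| + 1), ?_,
      eqOn_abs_add_one_of_isMIntegralCurveOn_Ioo hv γ hγx hγ⟩
    have : |t| < |t| + 1 := lt_add_of_pos_right |t| zero_lt_one
    rw [abs_lt] at this
    exact Ioo_mem_nhds this.1 this.2

/-- The existence of a global integral curve is equivalent to the existence of a family of local
integral curves `γ : ℝ → ℝ → M` with the same starting point `γ 0 = x` such that each `γ a` is
defined on `Ioo (-a) a`. -/
lemma exists_isMIntegralCurve_iff_exists_isMIntegralCurveOn_Ioo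
    (hv : UniqueIntegralCurves I v) (x : M) :
    (∃ γ, γ 0 = x ∧ IsMIntegralCurve γ v) ↔
      ∀ a, ∃ γ, γ 0 = x ∧ IsMIntegralCurveOn γ v (Ioo (-a) a) := by
  refine ⟨fun ⟨γ, h1, h2⟩ _ ↦ ⟨γ, h1, h2.isMIntegralCurveOn _⟩, fun h ↦ ?_⟩
  choose γ hγx hγ using h
  exact ⟨fun t ↦ γ (|t| + 1) t, hγx (|0| + 1),
    isMIntegralCurve_abs_add_one_of_isMIntegralCurveOn_Ioo hv γ hγx (fun a _ ↦  hγ a)⟩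

/-- Let `γ` and `γ'` be integral curves defined on `Ioo a b` and `Ioo a' b'`, respectively. Then,
`piecewise (Ioo a b) γ γ'` is equal to `γ` and `γ'` in their respective domains.
`Set.piecewise_eqOn` shows the equality for `γ` by definition, while this lemma shows the equality
for `γ'` by the uniqueness of integral curves. -/
lemma eqOn_piecewise_of_isMIntegralCurveOn_Ioo
    (hv : UniqueIntegralCurves I v)
    {a b a' b' : ℝ} (hγ : IsMIntegralCurveOn γ v (Ioo a b))
    (hγ' : IsMIntegralCurveOn γ' v (Ioo a' b'))
    (ht₀ : t₀ ∈ Ioo a b ∩ Ioo a' b') (h : γ t₀ = γ' t₀) :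
    EqOn (piecewise (Ioo a b) γ γ') γ' (Ioo a' b') := by
  intro t ht
  suffices H : EqOn γ γ' (Ioo (max a a') (min b b')) by
    by_cases hmem : t ∈ Ioo a b
    · rw [piecewise, if_pos hmem]
      apply H
      simp [ht.1, ht.2, hmem.1, hmem.2]
    · rw [piecewise, if_neg hmem]
  apply hv _
    (hγ.mono (Ioo_subset_Ioo (le_max_left ..) (min_le_left ..)))
    (hγ'.mono (Ioo_subset_Ioo (le_max_right ..) (min_le_right ..))) h
  exact ⟨max_lt ht₀.1.1 ht₀.2.1, lt_min ht₀.1.2 ht₀.2.2⟩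

/-- The extension of an integral curve by another integral curve is an integral curve.

If two integral curves are defined on overlapping open intervals, and they agree at a point in
their common domain, then they can be patched together to form a longer integral curve.
 -/
lemma isMIntegralCurveOn_piecewise
    (hv : UniqueIntegralCurves I v)
    {a b a' b' : ℝ} (hγ : IsMIntegralCurveOn γ v (Ioo a b))
    (hγ' : IsMIntegralCurveOn γ' v (Ioo a' b')) {t₀ : ℝ}
    (ht₀ : t₀ ∈ Ioo a b ∩ Ioo a' b') (h : γ t₀ = γ' t₀) :
    IsMIntegralCurveOn (piecewise (Ioo a b) γ γ') v (Ioo a b ∪ Ioo a' b') := by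
  intro t ht
  by_cases hmem : t ∈ Ioo a b
  · rw [piecewise, if_pos hmem]
    apply hγ t hmem |>.hasMFDerivAt (Ioo_mem_nhds hmem.1 hmem.2) |>.hasMFDerivWithinAt
      (s := Ioo a b ∪ Ioo a' b') |>.congr_of_eventuallyEq _ (by rw [piecewise, if_pos hmem])
    rw [Filter.eventuallyEq_iff_exists_mem]
    refine ⟨Ioo a b, ?_, fun _ ht' ↦ by rw [piecewise, if_pos ht']⟩
    rw [(isOpen_Ioo.union isOpen_Ioo).nhdsWithin_eq ht]
    exact Ioo_mem_nhds hmem.1 hmem.2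
  · have ht' := ht
    rw [mem_union, or_iff_not_imp_left] at ht
    rw [piecewise, if_neg hmem]
    apply hγ' t (ht hmem) |>.hasMFDerivAt (Ioo_mem_nhds (ht hmem).1 (ht hmem).2)
      |>.hasMFDerivWithinAt (s := Ioo a b ∪ Ioo a' b')
      |>.congr_of_eventuallyEq _ (by rw [piecewise, if_neg hmem])
    rw [Filter.eventuallyEq_iff_exists_mem]
    refine ⟨Ioo a' b', ?_,
      eqOn_piecewise_of_isMIntegralCurveOn_Ioo hv hγ hγ' ht₀ h⟩
    rw [(isOpen_Ioo.union isOpen_Ioo).nhdsWithin_eq ht']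
    exact Ioo_mem_nhds (ht hmem).1 (ht hmem).2

/-- If there exists `ε > 0` such that the local integral curve at each point `x : M` is defined at
least on an open interval `Ioo (-ε) ε`, then every point on `M` has a global integral curve
passing through it. -/
lemma exists_isMIntegralCurve_of_isMIntegralCurveOn {v : (x : M) → TangentSpace I x}
    (hv : UniqueIntegralCurves I v)
    {ε : ℝ} (hε : 0 < ε) (h : ∀ x : M, ∃ γ : ℝ → M, γ 0 = x ∧ IsMIntegralCurveOn γ v (Ioo (-ε) ε))
    (x : M) : ∃ γ : ℝ → M, γ 0 = x ∧ IsMIntegralCurve γ v := by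
  let s := { a | ∃ γ, γ 0 = x ∧ IsMIntegralCurveOn γ v (Ioo (-a) a) }
  suffices hbdd : ¬BddAbove s by
    rw [not_bddAbove_iff] at hbdd
    rw [exists_isMIntegralCurve_iff_exists_isMIntegralCurveOn_Ioo hv]
    intro a
    obtain ⟨y, ⟨γ, hγ1, hγ2⟩, hlt⟩ := hbdd a
    exact ⟨γ, hγ1, hγ2.mono <| Ioo_subset_Ioo (neg_le_neg hlt.le) hlt.le⟩
  intro hbdd
  set asup := sSup s with hasup
  -- we will obtain two integral curves, one centred at some `t₀ > 0` with
  -- `0 ≤ asup - ε < t₀ < asup`; let `t₀ = asup - ε / 2`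
  -- another centred at 0 with domain up to `a ∈ S` with `t₀ < a < asup`
  obtain ⟨a, ha, hlt⟩ := Real.add_neg_lt_sSup (⟨ε, h x⟩ : Set.Nonempty s) (ε := - (ε / 2))
    (by rw [neg_lt, neg_zero]; exact half_pos hε)
  rw [mem_ofPred] at ha
  rw [← hasup, ← sub_eq_add_neg] at hlt
  -- integral curve defined on `Ioo (-a) a`
  obtain ⟨γ, h0, hγ⟩ := ha
  -- integral curve starting at `-(asup - ε / 2)` with radius `ε`
  obtain ⟨γ1_aux, h1_aux, hγ1⟩ := h (γ (-(asup - ε / 2)))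
  rw [← isMIntegralCurveOn_comp_add (dt := asup - ε / 2)] at hγ1
  set γ1 := γ1_aux ∘ (· + (asup - ε / 2)) with γ1_def
  have heq1 : γ1 (-(asup - ε / 2)) = γ (-(asup - ε / 2)) := by simp [γ1_def, h1_aux]
  -- integral curve starting at `asup - ε / 2` with radius `ε`
  obtain ⟨γ2_aux, h2_aux, hγ2⟩ := h (γ (asup - ε / 2))
  rw [← isMIntegralCurveOn_comp_sub (dt := asup - ε / 2)] at hγ2
  set γ2 := γ2_aux ∘ (· - (asup - ε / 2)) with γ2_def
  have heq2 : γ2 (asup - ε / 2) = γ (asup - ε / 2) := by simp [γ2_def, h2_aux]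
  -- rewrite shifted Ioo as Ioo
  simp_rw [Set.mem_Ioo, ← sub_lt_iff_lt_add, ← lt_sub_iff_add_lt, ← Set.mem_Ioo] at hγ1
  simp_rw [Set.mem_Ioo, lt_sub_iff_add_lt, sub_lt_iff_lt_add, ← Set.mem_Ioo] at hγ2
  -- to help `linarith`
  have hεle : ε ≤ asup := le_csSup hbdd (h x)
  -- extend `γ` on the left by `γ1` and on the right by `γ2`
  set γ_ext : ℝ → M := piecewise (Ioo (-(asup + ε / 2)) a)
    (piecewise (Ioo (-a) a) γ γ1) γ2 with γ_ext_def
  have heq_ext : γ_ext 0 = x := by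
    rw [γ_ext_def, piecewise, if_pos ⟨by linarith, by linarith⟩, piecewise,
      if_pos ⟨by linarith, by linarith⟩, h0]
  -- `asup + ε / 2` is an element of `s` greater than `asup`, a contradiction
  suffices hext : IsMIntegralCurveOn γ_ext v (Ioo (-(asup + ε / 2)) (asup + ε / 2)) from
    (not_lt.mpr <| le_csSup hbdd ⟨γ_ext, heq_ext, hext⟩) <| lt_add_of_pos_right asup (half_pos hε)
  apply (isMIntegralCurveOn_piecewise (t₀ := asup - ε / 2) hv _ hγ2
      ⟨⟨by linarith, hlt⟩, ⟨by linarith, by linarith⟩⟩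
      (by rw [piecewise, if_pos ⟨by linarith, hlt⟩, ← heq2])).mono
    (Ioo_subset_Ioo_union_Ioo le_rfl (by linarith) (by linarith))
  exact (isMIntegralCurveOn_piecewise (t₀ := -(asup - ε / 2)) hv hγ hγ1
      ⟨⟨neg_lt_neg hlt, by linarith⟩, ⟨by linarith, by linarith⟩⟩ heq1.symm).mono
    (union_comm _ _ ▸ Ioo_subset_Ioo_union_Ioo (by linarith) (by linarith) le_rfl)


end UniqueIntegralCurves

end UniformTime

/-! ### The Hamiltonian flow on a compact manifold with boundary -/

section

open Metric

variable {B : Type*} [TopologicalSpace B] {I : ModelWithCorners ℝ E4 B}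
  {M : Type*} [TopologicalSpace M] [ChartedSpace B M] [IsManifold I ∞ M]

namespace SymplecticForm

variable {Ω : SymplecticForm I M}

namespace DarbouxAtlas

variable (A : Ω.DarbouxAtlas) {i : Fin A.num} {p : M} {z : E4} {H : M → ℝ}

theorem exists_lipschitzOnWith_vf (hH : ContMDiff I 𝓘(ℝ, ℝ) 2 H) (hz : z ∈ A.tgt i) :
    ∃ K : NNReal, ∃ s ∈ 𝓝[range I] z, LipschitzOnWith K (A.vf i H) s := by
  have h := stdDual.contDiff.contDiffAt.comp_contDiffWithinAt z
    (A.contDiffWithinAt_fderivWithin_loc hH hz)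
  have h2 : ContDiffWithinAt ℝ 1 (A.vf i H) (range I) z := by
    refine h.congr_of_eventuallyEq ?_ (A.vf_eq (hH.mdifferentiable (by norm_num)) hz)
    filter_upwards [A.tgt_mem_nhdsWithin' hz] with w hw
    exact A.vf_eq (hH.mdifferentiable (by norm_num)) hw
  exact h2.exists_lipschitzOnWith I.convex_range

include A in
-- In a chart the field is C¹ within `range I`, hence Lipschitz near the point relative to that set,
-- and both curves stay in it; uniqueness for Lipschitz fields on a set applies, also at the
-- boundary.
theorem eventuallyEq_of_isMIntegralCurveAt (hH : ContMDiff I 𝓘(ℝ, ℝ) 2 H) {γ γ' : ℝ → M} {t₀ : ℝ}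
    (hγ : IsMIntegralCurveAt (I := I) γ (Ω.hamField H) t₀)
    (hγ' : IsMIntegralCurveAt (I := I) γ' (Ω.hamField H) t₀) (h : γ t₀ = γ' t₀) :
    γ =ᶠ[𝓝 t₀] γ' := by
  set i := A.idx (γ t₀) with hi
  have hp : γ t₀ ∈ A.src i := A.mem_idx _
  obtain ⟨K, s, hs, hlip⟩ := A.exists_lipschitzOnWith_vf hH (A.h_mem_tgt hp)
  have hsrc : ∀ {g : ℝ → M}, IsMIntegralCurveAt (I := I) g (Ω.hamField H) t₀ → g t₀ = γ t₀ →
      ∀ᶠ t in 𝓝 t₀, g t ∈ A.src i := by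
    intro g hg hg0
    exact hg.continuousAt.eventually ((A.isOpen_src i).mem_nhds (by rw [hg0]; exact hp))
  have hder : ∀ {g : ℝ → M}, IsMIntegralCurveAt (I := I) g (Ω.hamField H) t₀ → g t₀ = γ t₀ →
      ∀ᶠ t in 𝓝 t₀, HasDerivAt (fun t ↦ A.h i (g t)) (A.vf i H (A.h i (g t))) t ∧
        A.h i (g t) ∈ s := by
    intro g hg hg0
    have h1 : Tendsto g (𝓝 t₀) (𝓝 (γ t₀)) := hg0 ▸ hg.continuousAt
    filter_upwards [hsrc hg hg0, hg, h1.eventually (A.tendsto_h_nhdsWithin hp hs)]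
      with t ht1 ht2 ht3
    exact ⟨A.hasDerivAt_h_comp ht1 ht2, ht3⟩
  have key := ODE_solution_unique_of_eventually (v := fun _ ↦ A.vf i H) (s := fun _ ↦ s)
    (.of_forall fun _ ↦ hlip) (hder hγ rfl) (hder hγ' h.symm) (by simp only [h])
  filter_upwards [key, hsrc hγ rfl, hsrc hγ' h.symm] with t ht h1 h2
  exact A.h_injOn i h1 h2 ht

include A in
theorem uniqueIntegralCurves [T2Space M] (hH : ContMDiff I 𝓘(ℝ, ℝ) 2 H) :
    UniqueIntegralCurves I (Ω.hamField H) := by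
  intro γ γ' a b t₀ ht₀ hγ hγ' h
  have hc : ContinuousOn γ (Ioo a b) := hγ.continuousOn
  have hc' : ContinuousOn γ' (Ioo a b) := hγ'.continuousOn
  suffices hsub : Ioo a b ⊆ {t | γ t = γ' t} ∩ Ioo a b from fun t ht ↦ (hsub ht).1
  refine isPreconnected_Ioo.subset_of_closure_inter_subset ?_ ⟨t₀, ht₀, h, ht₀⟩ ?_
  · rw [isOpen_iff_mem_nhds]
    rintro t ⟨hteq, ht⟩
    have hmem := Ioo_mem_nhds ht.1 ht.2
    filter_upwards [A.eventuallyEq_of_isMIntegralCurveAt hH (hγ.isMIntegralCurveAt hmem)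
      (hγ'.isMIntegralCurveAt hmem) hteq, hmem] with s h1 h2 using ⟨h1, h2⟩
  · rintro t ⟨htc, ht⟩
    refine ⟨?_, ht⟩
    have hmem := Ioo_mem_nhds ht.1 ht.2
    by_contra hne
    have hev : ∀ᶠ s in 𝓝 t, γ s ≠ γ' s :=
      ((hc.continuousAt hmem).prodMk (hc'.continuousAt hmem)).eventually
        (isOpen_ne_fun continuous_fst continuous_snd |>.mem_nhds hne)
    obtain ⟨s, hs, hs'⟩ := mem_closure_iff_nhds.1 htc _ hev
    exact hs hs'.1

/-- The closed ball of radius `ρ` in the range of the chart. -/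
abbrev box (I : ModelWithCorners ℝ E4 B) (z₀ : E4) (ρ : ℝ) : Set E4 :=
  closedBall z₀ ρ ∩ range I

omit [IsManifold I ∞ M] in
theorem _root_.HamRealizable.convex_box (z₀ : E4) (ρ : ℝ) : Convex ℝ (box I z₀ ρ) :=
  (convex_closedBall z₀ ρ).inter I.convex_range

theorem lipschitzOnWith_vf_box (hH : ContMDiff I 𝓘(ℝ, ℝ) 2 H) {z₀ : E4} {ρ K : ℝ} (hK0 : 0 ≤ K)
    (hbox : box I z₀ ρ ⊆ A.tgt i) (hK : ∀ z ∈ box I z₀ ρ, ‖A.dvf i H z‖ ≤ K) :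
    LipschitzOnWith K.toNNReal (A.vf i H) (box I z₀ ρ) :=
  (convex_box z₀ ρ).lipschitzOnWith_of_nnnorm_hasFDerivWithin_le
    (fun z hz ↦ (A.hasFDerivWithinAt_vf hH (hbox hz)).mono inter_subset_right) fun z hz ↦ by
      rw [← NNReal.coe_le_coe, coe_nnnorm, Real.coe_toNNReal _ hK0]; exact hK z hz

theorem exists_integralCurve_box (hI : range I = univ ∨ range I = {y : E4 | 0 ≤ y 0})
    (hH : IsHamiltonian I 2 H) {z₀ : E4} {ρ K V δ : ℝ} (hz₀ : z₀ ∈ range I) (hρ : 0 ≤ ρ)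
    (hK0 : 0 ≤ K) (hV0 : 0 ≤ V)
    (hbox : box I z₀ ρ ⊆ A.tgt i) (hK : ∀ z ∈ box I z₀ ρ, ‖A.dvf i H z‖ ≤ K)
    (hV : ∀ z ∈ box I z₀ ρ, ‖A.vf i H z‖ ≤ V) (hδ : 0 ≤ δ) (hVδ : V * δ ≤ ρ / 2)
    (hz : z ∈ box I z₀ (ρ / 2)) :
    ∃ γ : ℝ → M, γ 0 = A.hinv i z ∧ IsMIntegralCurveOn (I := I) γ (Ω.hamField H) (Ioo (-δ) δ) ∧
      ∀ t ∈ Ioo (-δ) δ, γ t ∈ A.src i ∧ A.h i (γ t) ∈ box I z₀ ρ := by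
  have htan : range I = univ ∨ ∀ z ∈ box I z₀ ρ, z 0 = 0 → A.vf i H z 0 = 0 := by
    rcases hI with h | h
    · exact .inl h
    · by_cases hu : range I = univ
      · exact .inl hu
      · exact .inr fun z hz ↦ (A.vf_zero_coord (.inr h) hH (hbox hz)).resolve_left hu
  obtain ⟨α, h0, h⟩ := exists_solution_range hI hz₀ hρ hV0
    (A.lipschitzOnWith_vf_box hH.1 hK0 hbox hK) hV htan hδ hVδ hz
  refine ⟨fun t ↦ A.hinv i (α t), by simp only [h0], fun t ht ↦ ?_, fun t ht ↦ ?_⟩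
  · refine (A.hasMFDerivAt_hinv_comp (hbox (h t ht).2) ?_ (h t ht).1).hasMFDerivWithinAt
    filter_upwards [Ioo_mem_nhds ht.1 ht.2] with s hs using (h s hs).2.2
  · have := hbox (h t ht).2
    exact ⟨A.hinv_mem_src this, by rw [A.h_hinv this]; exact (h t ht).2⟩

theorem exists_box_subset_tgt (hz : z ∈ A.tgt i) {s : Set E4} (hs : s ∈ 𝓝[range I] z) :
    ∃ ρ > 0, box I z ρ ⊆ A.tgt i ∧ box I z ρ ⊆ s := by
  obtain ⟨ρ, hρ, h⟩ := (nhdsWithin_hasBasis nhds_basis_closedBall (range I)).mem_iff.1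
    (inter_mem (A.tgt_mem_nhdsWithin' hz) hs)
  exact ⟨ρ, hρ, fun w hw ↦ (h hw).1, fun w hw ↦ (h hw).2⟩

theorem exists_box_bound (hH : ContMDiff I 𝓘(ℝ, ℝ) 2 H) (hz : z ∈ A.tgt i) :
    ∃ ρ > 0, ∃ K ≥ 0, ∃ V ≥ 0, box I z ρ ⊆ A.tgt i ∧ (∀ w ∈ box I z ρ, ‖A.dvf i H w‖ ≤ K) ∧
      ∀ w ∈ box I z ρ, ‖A.vf i H w‖ ≤ V := by
  have h1 : ∀ᶠ w in 𝓝[range I] z, ‖A.dvf i H w‖ < ‖A.dvf i H z‖ + 1 :=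
    (A.continuousWithinAt_dvf hH hz).norm.eventually_lt_const (by linarith)
  have h2 : ∀ᶠ w in 𝓝[range I] z, ‖A.vf i H w‖ < ‖A.vf i H z‖ + 1 :=
    (A.continuousWithinAt_vf hH hz).norm.eventually_lt_const (by linarith)
  obtain ⟨ρ, hρ, ht, hs⟩ := A.exists_box_subset_tgt hz (h1.and h2)
  exact ⟨ρ, hρ, _, by positivity, _, by positivity, ht, fun w hw ↦ (hs hw).1.le,
    fun w hw ↦ (hs hw).2.le⟩

theorem h_preimage_box_mem_nhds (hp : p ∈ A.src i) {ρ : ℝ} (hρ : 0 < ρ) :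
    {q | q ∈ A.src i ∧ A.h i q ∈ box I (A.h i p) ρ} ∈ 𝓝 p := by
  filter_upwards [(A.isOpen_src i).mem_nhds hp,
    A.continuousAt_h hp (closedBall_mem_nhds _ hρ)] with q h1 h2
  exact ⟨h1, h2, A.h_mem_range i q⟩

include A in
-- Near each point, the box estimates give an existence time that serves all nearby starting points;
-- compactness makes it uniform, and local curves are then continued indefinitely.
theorem exists_isMIntegralCurve [T2Space M] [CompactSpace M]
    (hI : range I = univ ∨ range I = {y : E4 | 0 ≤ y 0}) (hH : IsHamiltonian I 2 H) (x : M) :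
    ∃ γ : ℝ → M, γ 0 = x ∧ IsMIntegralCurve (I := I) γ (Ω.hamField H) := by
  have hloc : ∀ p : M, ∃ δ > 0, ∀ᶠ q in 𝓝 p, ∃ γ : ℝ → M, γ 0 = q ∧
      IsMIntegralCurveOn (I := I) γ (Ω.hamField H) (Ioo (-δ) δ) := by
    intro p
    have hp := A.mem_idx p
    obtain ⟨ρ, hρ, K, hK0, V, hV0, hbox, hK, hV⟩ := A.exists_box_bound hH.1 (A.h_mem_tgt hp)
    refine ⟨ρ / 2 / (V + 1), by positivity, ?_⟩
    filter_upwards [A.h_preimage_box_mem_nhds hp (half_pos hρ)] with q hq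
    obtain ⟨γ, h0, h, -⟩ := A.exists_integralCurve_box hI hH (A.h_mem_range _ p) hρ.le hK0 hV0 hbox
      hK hV (δ := ρ / 2 / (V + 1)) (by positivity)
      (by rw [mul_div_assoc', div_le_iff₀ (by positivity)]; nlinarith) hq.2
    exact ⟨γ, by rw [h0, A.hinv_h hq.1], h⟩
  choose δ hδ hN using hloc
  obtain ⟨t, ht⟩ := isCompact_univ.elim_nhds_subcover' (fun p _ ↦ _) (fun p _ ↦ hN p)
  obtain ⟨ε, hε, hle⟩ : ∃ ε > 0, ∀ p ∈ t, ε ≤ δ p := by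
    rcases t.eq_empty_or_nonempty with rfl | hne
    · exact ⟨1, one_pos, by simp⟩
    · obtain ⟨p, hp, hmin⟩ := t.exists_min_image (fun p ↦ δ p) hne
      exact ⟨δ p, hδ p, hmin⟩
  refine (A.uniqueIntegralCurves hH.1).exists_isMIntegralCurve_of_isMIntegralCurveOn hε
    (fun q ↦ ?_) x
  obtain ⟨p, hp, hq⟩ := mem_iUnion₂.1 (ht (mem_univ q))
  obtain ⟨γ, h0, h⟩ := hq
  exact ⟨γ, h0, h.mono (Ioo_subset_Ioo (neg_le_neg (hle p hp)) (hle p hp))⟩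

section Flow

variable [T2Space M] [CompactSpace M]
  (hI : range I = univ ∨ range I = {y : E4 | 0 ≤ y 0}) (hH : IsHamiltonian I 2 H)

include A hI hH

theorem flow_zero (x : M) : Ω.flow H 0 x = x := by
  have h := A.exists_isMIntegralCurve hI hH x
  rw [flow, dif_pos h]
  exact h.choose_spec.1

theorem isMIntegralCurve_flow (x : M) :
    IsMIntegralCurve (I := I) (fun t ↦ Ω.flow H t x) (Ω.hamField H) := by
  have h := A.exists_isMIntegralCurve hI hH x
  simp only [flow, dif_pos h]
  exact h.choose_spec.2

theorem flow_unique {γ : ℝ → M} {a b : ℝ} (hab : (0 : ℝ) ∈ Ioo a b)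
    (hγ : IsMIntegralCurveOn (I := I) γ (Ω.hamField H) (Ioo a b)) {t : ℝ} (ht : t ∈ Ioo a b) :
    Ω.flow H t (γ 0) = γ t :=
  (A.uniqueIntegralCurves hH.1) hab ((A.isMIntegralCurve_flow hI hH (γ 0)).isMIntegralCurveOn _)
    hγ (A.flow_zero hI hH _) ht

theorem flow_add (s t : ℝ) (x : M) : Ω.flow H (s + t) x = Ω.flow H s (Ω.flow H t x) := by
  have h1 := (A.isMIntegralCurve_flow hI hH x).comp_add t
  have h2 := A.flow_unique hI hH (a := -(|s| + 1)) (b := |s| + 1)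
    ⟨by linarith [abs_nonneg s], by linarith [abs_nonneg s]⟩ (h1.isMIntegralCurveOn _)
    (t := s) (abs_lt.1 (by linarith))
  simpa using h2.symm

theorem flow_neg_flow (t : ℝ) (x : M) : Ω.flow H (-t) (Ω.flow H t x) = x := by
  rw [← A.flow_add hI hH, neg_add_cancel, A.flow_zero hI hH]

theorem continuous_flow_time (x : M) : Continuous fun t ↦ Ω.flow H t x :=
  (A.isMIntegralCurve_flow hI hH x).continuous

theorem hasDerivAt_h_flow {x : M} {t : ℝ} (h : Ω.flow H t x ∈ A.src i) :
    HasDerivAt (fun s ↦ A.h i (Ω.flow H s x)) (A.vf i H (A.h i (Ω.flow H t x))) t :=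
  A.hasDerivAt_h_comp h (A.isMIntegralCurve_flow hI hH x t)

theorem flow_mem_box {z₀ : E4} {ρ K V δ : ℝ} (hz₀ : z₀ ∈ range I) (hρ : 0 ≤ ρ)
    (hK0 : 0 ≤ K) (hV0 : 0 ≤ V)
    (hbox : box I z₀ ρ ⊆ A.tgt i) (hK : ∀ z ∈ box I z₀ ρ, ‖A.dvf i H z‖ ≤ K)
    (hV : ∀ z ∈ box I z₀ ρ, ‖A.vf i H z‖ ≤ V) (hVδ : V * δ ≤ ρ / 2)
    (hz : z ∈ box I z₀ (ρ / 2)) {t : ℝ} (ht : t ∈ Ioo (-δ) δ) :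
    Ω.flow H t (A.hinv i z) ∈ A.src i ∧ A.h i (Ω.flow H t (A.hinv i z)) ∈ box I z₀ ρ := by
  have hδ : 0 < δ := by linarith [ht.1, ht.2]
  obtain ⟨γ, h0, h, hmem⟩ := A.exists_integralCurve_box hI hH hz₀ hρ hK0 hV0 hbox hK hV hδ.le hVδ hz
  rw [← h0, A.flow_unique hI hH ⟨by linarith, hδ⟩ h ht]
  exact hmem t ht

theorem flow_eq_self_of_hamField_eq_zero {x : M} (hx : Ω.hamField H x = 0) (t : ℝ) :
    Ω.flow H t x = x := by
  have h := isMIntegralCurve_const (I := I) (v := Ω.hamField H) hx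
  exact A.flow_unique hI hH (γ := fun _ ↦ x) (a := -(|t| + 1)) (b := |t| + 1)
    ⟨by linarith [abs_nonneg t], by linarith [abs_nonneg t]⟩ (h.isMIntegralCurveOn _)
    (abs_lt.1 (by linarith))

end Flow

end DarbouxAtlas

end SymplecticForm

end

end HamRealizable

namespace HamRealizable

/-! ### Short-time estimates: the flow as a function of the Hamiltonian, and its differential -/

section

open Metric

theorem exists_sign_mul_abs (t : ℝ) : ∃ σ : ℝ, |σ| = 1 ∧ t = σ * |t| := by
  rcases le_total 0 t with h | h
  · exact ⟨1, by simp, by rw [abs_of_nonneg h]; ring⟩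
  · exact ⟨-1, by simp, by rw [abs_of_nonpos h]; ring⟩

theorem gronwallBound_le {d K η x : ℝ} (hK : 0 ≤ K) (hη : 0 ≤ η) :
    gronwallBound d K η x ≤ (d + η * x) * Real.exp (K * x) := by
  rcases hK.eq_or_lt with rfl | hK
  · simp [gronwallBound_K0]
  · rw [gronwallBound_of_K_ne_0 hK.ne', add_mul]
    refine add_le_add le_rfl ?_
    have h1 : Real.exp (K * x) - 1 ≤ K * x * Real.exp (K * x) := by
      have := Real.add_one_le_exp (-(K * x))
      have h2 := mul_le_mul_of_nonneg_right this (Real.exp_pos (K * x)).le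
      rw [← Real.exp_add, neg_add_cancel, Real.exp_zero] at h2
      linarith
    calc η / K * (Real.exp (K * x) - 1) ≤ η / K * (K * x * Real.exp (K * x)) := by gcongr
      _ = _ := by field_simp

/-- Grönwall's inequality on both sides of time zero: the substitution s ↦ σ s with σ = ±1 turns the
field v into σ v, which has the same Lipschitz constant. -/
theorem norm_sub_le_of_approx_solution {E : Type*} [NormedAddCommGroup E] [NormedSpace ℝ E]
    {v : E → E} {D : Set E} {K : NNReal} (hv : LipschitzOnWith K v D) {f g f' : ℝ → E}
    {δ η d : ℝ} (hη : 0 ≤ η) (hd : 0 ≤ d)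
    (hf : ∀ t ∈ Ioo (-δ) δ, HasDerivAt f (f' t) t ∧ ‖f' t - v (f t)‖ ≤ η ∧ f t ∈ D)
    (hg : ∀ t ∈ Ioo (-δ) δ, HasDerivAt g (v (g t)) t ∧ g t ∈ D) (h0 : ‖f 0 - g 0‖ ≤ d)
    {t : ℝ} (ht : t ∈ Ioo (-δ) δ) : ‖f t - g t‖ ≤ (d + η * δ) * Real.exp (K * δ) := by
  obtain ⟨σ, hσ, hσt⟩ := exists_sign_mul_abs t
  have htδ : |t| < δ := abs_lt.2 ht
  have hmem : ∀ s ∈ Icc 0 |t|, σ * s ∈ Ioo (-δ) δ := by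
    intro s hs
    refine abs_lt.1 ?_
    rw [abs_mul, hσ, one_mul, abs_of_nonneg hs.1]
    exact hs.2.trans_lt htδ
  have hσ' : ∀ w : E, ‖σ • w‖ = ‖w‖ := fun w ↦ by
    rw [norm_smul, Real.norm_eq_abs, hσ, one_mul]
  have hlin : ∀ s, HasDerivAt (fun s : ℝ ↦ σ * s) σ s := fun s ↦ by
    simpa using (hasDerivAt_id s).const_mul σ
  have hlip : LipschitzOnWith K (fun w ↦ σ • v w) D := by
    refine LipschitzOnWith.of_dist_le_mul fun w hw w' hw' ↦ ?_
    rw [dist_eq_norm, ← smul_sub, hσ', ← dist_eq_norm]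
    exact hv.dist_le_mul w hw w' hw'
  have key := dist_le_of_approx_trajectories_ODE_of_mem (v := fun _ w ↦ σ • v w)
    (s := fun _ ↦ D) (f := fun s ↦ f (σ * s)) (g := fun s ↦ g (σ * s))
    (f' := fun s ↦ σ • f' (σ * s)) (g' := fun s ↦ σ • v (g (σ * s)))
    (a := 0) (b := |t|) (δ := d) (εf := η) (εg := 0) (fun _ _ ↦ hlip)
    (fun s hs ↦ (((hf _ (hmem s hs)).1.scomp s (hlin s)).continuousAt.continuousWithinAt))
    (fun s hs ↦ ((hf _ (hmem s (Ico_subset_Icc_self hs))).1.scomp s (hlin s)).hasDerivWithinAt)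
    (fun s hs ↦ by
      rw [dist_eq_norm, ← smul_sub, hσ']; exact (hf _ (hmem s (Ico_subset_Icc_self hs))).2.1)
    (fun s hs ↦ (hf _ (hmem s (Ico_subset_Icc_self hs))).2.2)
    (fun s hs ↦ (((hg _ (hmem s hs)).1.scomp s (hlin s)).continuousAt.continuousWithinAt))
    (fun s hs ↦ ((hg _ (hmem s (Ico_subset_Icc_self hs))).1.scomp s (hlin s)).hasDerivWithinAt)
    (fun s hs ↦ by simp)
    (fun s hs ↦ (hg _ (hmem s (Ico_subset_Icc_self hs))).2)
    (by simpa [dist_eq_norm] using h0) |t| ⟨abs_nonneg t, le_rfl⟩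
  simp only [← hσt, dist_eq_norm, sub_zero, add_zero] at key
  refine key.trans ((gronwallBound_le K.2 hη).trans ?_)
  have hδ : 0 ≤ δ := (abs_nonneg t).trans htδ.le
  refine mul_le_mul (add_le_add le_rfl (mul_le_mul_of_nonneg_left htδ.le hη))
    (Real.exp_le_exp.2 (mul_le_mul_of_nonneg_left htδ.le K.2)) (Real.exp_pos _).le (by positivity)

/-- A tube lemma for filters: local uniformity at each point of a compact set gives uniformity over
the set. -/
theorem eventually_forall_of_isCompact {α β : Type*} [TopologicalSpace β] {l : Filter α}
    {K : Set β} (hK : IsCompact K) {P : α → β → Prop}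
    (h : ∀ y ∈ K, ∀ᶠ z in l ×ˢ 𝓝[K] y, P z.1 z.2) : ∀ᶠ a in l, ∀ y ∈ K, P a y := by
  refine hK.induction_on (p := fun s ↦ ∀ᶠ a in l, ∀ y ∈ s, P a y) (by simp)
    (fun s t hst ht ↦ ht.mono fun a ha y hy ↦ ha y (hst hy))
    (fun s t hs ht ↦ (hs.and ht).mono fun a ha y hy ↦ hy.elim (ha.1 y) (ha.2 y)) fun y hy ↦ ?_
  obtain ⟨pa, ha, pb, hb, hab⟩ := eventually_prod_iff.1 (h y hy)
  exact ⟨{y | pb y}, hb, ha.mono fun a ha' y hy' ↦ hab ha' hy'⟩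

variable {B : Type*} [TopologicalSpace B] {I : ModelWithCorners ℝ E4 B}
  {M : Type*} [TopologicalSpace M] [ChartedSpace B M] [IsManifold I ∞ M]

theorem isCompact_box (z₀ : E4) (ρ : ℝ) : IsCompact (closedBall z₀ ρ ∩ range I) :=
  (isCompact_closedBall z₀ ρ).inter_right I.isClosed_range

namespace SymplecticForm

variable {Ω : SymplecticForm I M}

namespace DarbouxAtlas

variable (A : Ω.DarbouxAtlas) {i : Fin A.num} {p : M} {z : E4} {H : M → ℝ}

section Flow

variable [T2Space M] [CompactSpace M]
  (hI : range I = univ ∨ range I = {y : E4 | 0 ≤ y 0})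

include hI

/-- In the chart, the differential of the flow solves the variational equation. Its distance to the
identity is controlled by the bound `K` on the derivative of the field alone, and it preserves the
standard form. Since `h i q` is in the open ball, the half-size box is a neighborhood of it within
`range I`, so that the derivative within the box is a derivative on the manifold. -/
theorem exists_hasMFDerivAt_flow_box (hH : IsHamiltonian I 2 H) {z₀ : E4} {ρ K V δ : ℝ}
    (hz₀ : z₀ ∈ range I) (hρ : 0 ≤ ρ) (hK0 : 0 ≤ K) (hV0 : 0 ≤ V)
    (hbox : box I z₀ ρ ⊆ A.tgt i) (hK : ∀ z ∈ box I z₀ ρ, ‖A.dvf i H z‖ ≤ K)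
    (hV : ∀ z ∈ box I z₀ ρ, ‖A.vf i H z‖ ≤ V) (hVδ : V * δ ≤ ρ / 2) (hKδ : 2 * K * δ ≤ 1)
    {q : M} (hq : q ∈ A.src i) (hqz : A.h i q ∈ Metric.ball z₀ (ρ / 2)) {t : ℝ} (ht : t ∈ Ioo (-δ) δ) :
    ∃ L : E4 →L[ℝ] E4, ‖L - .id ℝ E4‖ ≤ 2 * K * |t| ∧
      (∀ a b, stdForm (L a) (L b) = stdForm a b) ∧
      HasMFDerivAt I I (Ω.flow H t) q
        ((A.dh i (Ω.flow H t q)).inverse ∘L L ∘L A.dh i q) := by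
  obtain ⟨σ, hσ, hσt⟩ := exists_sign_mul_abs t
  have htδ : |t| < δ := abs_lt.2 ht
  have hmem : ∀ s ∈ Icc 0 |t|, σ * s ∈ Ioo (-δ) δ := by
    intro s hs
    refine abs_lt.1 ?_
    rw [abs_mul, hσ, one_mul, abs_of_nonneg hs.1]
    exact hs.2.trans_lt htδ
  have hin : ∀ w ∈ box I z₀ (ρ / 2), ∀ s ∈ Ioo (-δ) δ, Ω.flow H s (A.hinv i w) ∈ A.src i ∧
      A.h i (Ω.flow H s (A.hinv i w)) ∈ box I z₀ ρ := fun w hw s hs ↦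
    A.flow_mem_box hI hH hz₀ hρ hK0 hV0 hbox hK hV hVδ hw hs
  have hhalf : box I z₀ (ρ / 2) ⊆ A.tgt i := fun w hw ↦
    hbox ⟨closedBall_subset_closedBall (by linarith) hw.1, hw.2⟩
  have hlin : ∀ s, HasDerivAt (fun s : ℝ ↦ σ * s) σ s := fun s ↦ by
    simpa using (hasDerivAt_id s).const_mul σ
  set u : ℝ → E4 → E4 := fun s w ↦ A.h i (Ω.flow H (σ * s) (A.hinv i w)) with hu
  have hder : ∀ w ∈ box I z₀ (ρ / 2), ∀ s ∈ Icc 0 |t|,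
      HasDerivAt (fun s ↦ u s w) (σ • A.vf i H (u s w)) s ∧ u s w ∈ box I z₀ ρ := by
    intro w hw s hs
    have h1 := hin w hw _ (hmem s hs)
    exact ⟨(A.hasDerivAt_h_flow hI hH h1.1).scomp s (hlin s), h1.2⟩
  have hu0 : ∀ w ∈ box I z₀ (ρ / 2), u 0 w = w := by
    intro w hw
    simp only [hu, mul_zero]
    rw [A.flow_zero hI hH, A.h_hinv (hhalf hw)]
  have hzb : A.h i q ∈ box I z₀ (ρ / 2) := ⟨ball_subset_closedBall hqz, A.h_mem_range i q⟩
  have hdc : ContinuousOn (A.dvf i H) (box I z₀ ρ) := fun w hw ↦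
    (A.continuousWithinAt_dvf hH.1 (hbox hw)).mono inter_subset_right
  have hnσ : ∀ L : E4 →L[ℝ] E4, ‖σ • L‖ = ‖L‖ := fun L ↦ by
    rw [norm_smul, Real.norm_eq_abs, hσ, one_mul]
  obtain ⟨L, hL0, hL, hLn⟩ := exists_solution_variational
    (B := fun s ↦ σ • A.dvf i H (u s (A.h i q))) (K := K) (abs_nonneg t) hK0
    ((hdc.comp (fun s hs ↦ (hder _ hzb s hs).1.continuousAt.continuousWithinAt)
      fun s hs ↦ (hder _ hzb s hs).2).const_smul σ)
    (fun s hs ↦ by rw [hnσ]; exact hK _ (hder _ hzb s hs).2)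
    (by nlinarith)
  have ht' : |t| ∈ Icc 0 |t| := ⟨abs_nonneg t, le_rfl⟩
  refine ⟨L |t|, hLn _ ht', fun a b ↦ ?_, ?_⟩
  · rw [← stdFormL_apply, ← stdFormL_apply]
    refine bilinear_apply_variational hL0 hL stdFormL (fun s hs a b ↦ ?_) ht' a b
    have h1 := A.stdForm_dvf hH.1 (hbox (hder _ hzb s hs).2) a b
    rw [← stdFormL_apply, ← stdFormL_apply] at h1
    simp only [smul_apply, map_smul, smul_eq_mul, ← mul_add]
    rw [h1, mul_zero]
  · have hF := hasFDerivWithinAt_solution (D := box I z₀ ρ) (D₀ := box I z₀ (ρ / 2))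
      (v := fun w ↦ σ • A.vf i H w) (v' := fun w ↦ σ • A.dvf i H w) (K := K) (δ := |t|)
      (convex_box z₀ ρ) (isCompact_box z₀ ρ)
      (fun w hw ↦ ((A.hasFDerivWithinAt_vf hH.1 (hbox hw)).mono inter_subset_right).const_smul σ)
      (hdc.const_smul σ) hK0 (fun w hw ↦ by rw [hnσ]; exact hK w hw) hu0 hder hzb hL0
      hL ht'
    have hF' : HasFDerivWithinAt (u |t|) (L |t|) (range I) (A.h i q) := by
      refine hF.mono_of_mem_nhdsWithin ?_
      exact inter_mem (mem_nhdsWithin_of_mem_nhds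
        (mem_of_superset (isOpen_ball.mem_nhds hqz) ball_subset_closedBall)) self_mem_nhdsWithin
    have hut : u |t| (A.h i q) = A.h i (Ω.flow H t q) := by
      simp only [hu, ← hσt, A.hinv_h hq]
    have hfl : Ω.flow H t q ∈ A.src i := by
      have := (hin _ hzb t ht).1
      rwa [A.hinv_h hq] at this
    have h1 : HasMFDerivWithinAt 𝓘(ℝ, E4) I (A.hinv i) (range I) (u |t| (A.h i q))
        (A.dh i (Ω.flow H t q)).inverse := by
      have := A.hasMFDerivWithinAt_hinv (A.h_mem_tgt hfl)
      rw [A.hinv_h hfl] at this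
      rwa [hut]
    have h2 := h1.comp (A.h i q) hF'.hasMFDerivWithinAt
      (fun w _ ↦ A.h_mem_range i _)
    have h3 := h2.comp q (s := univ) (A.hasMFDerivAt_h hq).hasMFDerivWithinAt
      (fun w _ ↦ A.h_mem_range i w)
    rw [hasMFDerivWithinAt_univ] at h3
    refine h3.congr_of_eventuallyEq ?_
    have hn : ∀ᶠ q' in 𝓝 q, q' ∈ A.src i ∧ A.h i q' ∈ Metric.ball z₀ (ρ / 2) :=
      ((A.isOpen_src i).eventually_mem hq).and
        (A.continuousAt_h hq (isOpen_ball.mem_nhds hqz))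
    filter_upwards [hn] with q' hq'
    have h4 := (hin _ ⟨ball_subset_closedBall hq'.2, A.h_mem_range i q'⟩ t ht).1
    rw [A.hinv_h hq'.1] at h4
    simp only [Function.comp, hu, ← hσt, A.hinv_h hq'.1, A.hinv_h h4]

end Flow

/-- The Hamiltonians `H'` converge to `H` along `𝓕`, locally uniformly in the `C¹` sense and with
locally bounded second derivatives. -/
structure C1Conv (𝓕 : Filter (M → ℝ)) (H : M → ℝ) : Prop where
  ham : ∀ᶠ H' in 𝓕, IsHamiltonian I 2 H'
  bound : ∀ i, ∀ p ∈ A.src i, ∃ K : ℝ, ∀ᶠ P in 𝓕 ×ˢ 𝓝[range I] (A.h i p), ‖A.dvf i P.1 P.2‖ ≤ K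
  conv : ∀ i, ∀ p ∈ A.src i, Tendsto (fun P : (M → ℝ) × E4 ↦ A.vf i P.1 P.2)
    (𝓕 ×ˢ 𝓝[range I] (A.h i p)) (𝓝 (A.vf i H (A.h i p)))

theorem c1Conv_pure (hH : IsHamiltonian I 2 H) : A.C1Conv (pure H) H where
  ham := by simpa using hH
  bound i p hp := by
    have h := (A.continuousWithinAt_dvf hH.1 (A.h_mem_tgt hp)).norm
    refine ⟨‖A.dvf i H (A.h i p)‖ + 1, ?_⟩
    rw [pure_prod, eventually_map]
    filter_upwards [h.eventually_lt_const (lt_add_one _)] with z hz using hz.le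
  conv i p hp := by
    rw [pure_prod, tendsto_map'_iff]
    exact A.continuousWithinAt_vf hH.1 (A.h_mem_tgt hp)

variable {A} {𝓕 : Filter (M → ℝ)}

namespace C1Conv

variable (hC : A.C1Conv 𝓕 H)
include hC

theorem exists_box (hp : p ∈ A.src i) : ∃ ρ > 0, ∃ K ≥ 0, ∃ V ≥ 0,
    box I (A.h i p) ρ ⊆ A.tgt i ∧ ∀ᶠ H' in 𝓕, IsHamiltonian I 2 H' ∧
      (∀ w ∈ box I (A.h i p) ρ, ‖A.dvf i H' w‖ ≤ K) ∧
      ∀ w ∈ box I (A.h i p) ρ, ‖A.vf i H' w‖ ≤ V := by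
  obtain ⟨K, hK⟩ := hC.bound i p hp
  have hV : ∀ᶠ P in 𝓕 ×ˢ 𝓝[range I] (A.h i p), ‖A.vf i P.1 P.2‖ < ‖A.vf i H (A.h i p)‖ + 1 :=
    (hC.conv i p hp).norm.eventually_lt_const (lt_add_one _)
  obtain ⟨pa, ha, pb, hb, hab⟩ := eventually_prod_iff.1 (hK.and hV)
  obtain ⟨ρ, hρ, ht, hs⟩ := A.exists_box_subset_tgt (A.h_mem_tgt hp) hb
  refine ⟨ρ, hρ, |K|, abs_nonneg _, ‖A.vf i H (A.h i p)‖ + 1, by positivity, ht, ?_⟩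
  filter_upwards [ha, hC.ham] with H' hH' hham
  exact ⟨hham, fun w hw ↦ (hab hH' (hs hw)).1.trans (le_abs_self K),
    fun w hw ↦ (hab hH' (hs hw)).2.le⟩

theorem eventually_vf_sub_le (hH : IsHamiltonian I 2 H) {z₀ : E4} {ρ η : ℝ} (hη : 0 < η)
    (hbox : box I z₀ ρ ⊆ A.tgt i) :
    ∀ᶠ H' in 𝓕, ∀ w ∈ box I z₀ ρ, ‖A.vf i H' w - A.vf i H w‖ ≤ η := by
  refine eventually_forall_of_isCompact (isCompact_box z₀ ρ) fun w hw ↦ ?_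
  have hw' := hbox hw
  have h1 := hC.conv i _ (A.hinv_mem_src hw')
  rw [A.h_hinv hw'] at h1
  have h2 : Tendsto (fun P : (M → ℝ) × E4 ↦ A.vf i H P.2) (𝓕 ×ˢ 𝓝[range I] w)
      (𝓝 (A.vf i H w)) := (A.continuousWithinAt_vf hH.1 hw').tendsto.comp tendsto_snd
  have h3 := (h1.sub h2).norm
  rw [sub_self, norm_zero] at h3
  have h4 : 𝓕 ×ˢ 𝓝[box I z₀ ρ] w ≤ 𝓕 ×ˢ 𝓝[range I] w :=
    prod_mono le_rfl (nhdsWithin_mono _ inter_subset_right)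
  filter_upwards [(h3.mono_left h4).eventually_lt_const hη] with P hP using hP.le

variable [T2Space M] [CompactSpace M]
  (hI : range I = univ ∨ range I = {y : E4 | 0 ≤ y 0}) (hH : IsHamiltonian I 2 H)
include hI


/-- Short-time differentiability of the flows, uniformly along `𝓕`. -/
theorem exists_tangentFlow (hp : p ∈ A.src i) : ∃ δ > 0, ∃ K ≥ 0, ∀ᶠ P in 𝓕 ×ˢ 𝓝 p,
    ∀ t ∈ Ioo (-δ) δ, P.2 ∈ A.src i ∧ Ω.flow P.1 t P.2 ∈ A.src i ∧
      ∃ L : E4 →L[ℝ] E4, ‖L - .id ℝ E4‖ ≤ 2 * K * |t| ∧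
      (∀ a b, stdForm (L a) (L b) = stdForm a b) ∧
      HasMFDerivAt I I (Ω.flow P.1 t) P.2
        ((A.dh i (Ω.flow P.1 t P.2)).inverse ∘L L ∘L A.dh i P.2) := by
  obtain ⟨ρ, hρ, K, hK0, V, hV0, hbox, hev⟩ := hC.exists_box hp
  set δ := min (ρ / 2 / (V + 1)) (1 / (2 * K + 1)) with hδ
  have hδ0 : 0 < δ := by positivity
  have hVδ : V * δ ≤ ρ / 2 := by
    have h1 : δ ≤ ρ / 2 / (V + 1) := min_le_left _ _
    rw [le_div_iff₀ (by positivity)] at h1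
    nlinarith
  have hKδ : 2 * K * δ ≤ 1 := by
    have h1 : δ ≤ 1 / (2 * K + 1) := min_le_right _ _
    rw [le_div_iff₀ (by positivity)] at h1
    nlinarith
  have hn : ∀ᶠ q in 𝓝 p, q ∈ A.src i ∧ A.h i q ∈ Metric.ball (A.h i p) (ρ / 2) :=
    ((A.isOpen_src i).eventually_mem hp).and
      (A.continuousAt_h hp (ball_mem_nhds _ (by positivity)))
  refine ⟨δ, hδ0, K, hK0, ?_⟩
  filter_upwards [hev.prod_mk hn] with P hP t ht
  obtain ⟨⟨hham, hK, hV⟩, hq, hqz⟩ := hP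
  have h1 := A.flow_mem_box hI hham (A.h_mem_range i p) hρ.le hK0 hV0 hbox hK hV hVδ
    ⟨ball_subset_closedBall hqz, A.h_mem_range i P.2⟩ ht
  rw [A.hinv_h hq] at h1
  exact ⟨hq, h1.1, A.exists_hasMFDerivAt_flow_box hI hham (A.h_mem_range i p) hρ.le hK0 hV0 hbox
    hK hV hVδ hKδ hq hqz ht⟩

include hH

/-- In one box around p, the orbits of H' are approximate solutions of the equation of H with
uniformly small error, so Grönwall compares them with the orbits of H. The limit is joint in the
Hamiltonian, the time and the initial point, which allows the compactness arguments and the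
composition of short times. -/
theorem exists_tendsto_flow (p : M) : ∃ δ > 0, ∀ᶠ q in 𝓝 p, ∀ t₀ ∈ Ioo (-δ) δ,
    Tendsto (fun P : (M → ℝ) × ℝ × M ↦ Ω.flow P.1 P.2.1 P.2.2) (𝓕 ×ˢ 𝓝 t₀ ×ˢ 𝓝 q)
      (𝓝 (Ω.flow H t₀ q)) := by
  set i := A.idx p
  have hp : p ∈ A.src i := A.mem_idx p
  obtain ⟨ρ₁, hρ₁, K₁, hK₁0, V₁, hV₁0, hbox₁, hev⟩ := hC.exists_box hp
  obtain ⟨ρ₂, hρ₂, K₂, hK₂0, V₂, hV₂0, hbox₂, hev₂⟩ := (A.c1Conv_pure hH).exists_box hp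
  rw [eventually_pure] at hev₂
  set ρ := min ρ₁ ρ₂ with hρdef
  have hρ : 0 < ρ := lt_min hρ₁ hρ₂
  have hs₁ : box I (A.h i p) ρ ⊆ box I (A.h i p) ρ₁ :=
    inter_subset_inter_left _ (closedBall_subset_closedBall (min_le_left _ _))
  have hs₂ : box I (A.h i p) ρ ⊆ box I (A.h i p) ρ₂ :=
    inter_subset_inter_left _ (closedBall_subset_closedBall (min_le_right _ _))
  have hbox := hs₁.trans hbox₁
  set V := max V₁ V₂ with hVdef
  have hV0 : 0 ≤ V := hV₁0.trans (le_max_left _ _)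
  set δ := ρ / 2 / (V + 1) with hδ
  have hδ0 : 0 < δ := by positivity
  have hVδ : V * δ ≤ ρ / 2 := by
    rw [hδ, mul_div_assoc', div_le_iff₀ (by positivity)]
    nlinarith
  have hn : ∀ q ∈ {q | q ∈ A.src i ∧ A.h i q ∈ Metric.ball (A.h i p) (ρ / 2)},
      ∀ᶠ q' in 𝓝 q, q' ∈ A.src i ∧ A.h i q' ∈ Metric.ball (A.h i p) (ρ / 2) := fun q hq ↦
    ((A.isOpen_src i).eventually_mem hq.1).and
      (A.continuousAt_h hq.1 (isOpen_ball.mem_nhds hq.2))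
  have hnp : p ∈ {q | q ∈ A.src i ∧ A.h i q ∈ Metric.ball (A.h i p) (ρ / 2)} :=
    ⟨hp, mem_ball_self (by positivity)⟩
  have hmemH : ∀ q, q ∈ A.src i ∧ A.h i q ∈ Metric.ball (A.h i p) (ρ / 2) → ∀ t ∈ Ioo (-δ) δ,
      Ω.flow H t q ∈ A.src i ∧ A.h i (Ω.flow H t q) ∈ box I (A.h i p) ρ := by
    intro q hq t ht
    have := A.flow_mem_box hI hH (A.h_mem_range i p) hρ.le hK₂0 hV0 hbox
      (fun w hw ↦ hev₂.2.1 w (hs₂ hw)) (fun w hw ↦ (hev₂.2.2 w (hs₂ hw)).trans (le_max_right _ _))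
      hVδ ⟨ball_subset_closedBall hq.2, A.h_mem_range i q⟩ ht
    rwa [A.hinv_h hq.1] at this
  refine ⟨δ, hδ0, ?_⟩
  filter_upwards [hn p hnp] with q hq t₀ ht₀
  have hlip := A.lipschitzOnWith_vf_box hH.1 hK₂0 hbox fun w hw ↦ hev₂.2.1 w (hs₂ hw)
  have hfin := (hmemH q hq t₀ ht₀).1
  -- it suffices to prove convergence in the chart
  suffices hT : Tendsto (fun P : (M → ℝ) × ℝ × M ↦ A.h i (Ω.flow P.1 P.2.1 P.2.2))
      (𝓕 ×ˢ 𝓝 t₀ ×ˢ 𝓝 q) (𝓝 (A.h i (Ω.flow H t₀ q))) by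
    have h1 : Tendsto (fun P : (M → ℝ) × ℝ × M ↦ A.h i (Ω.flow P.1 P.2.1 P.2.2))
        (𝓕 ×ˢ 𝓝 t₀ ×ˢ 𝓝 q) (𝓝[range I] (A.h i (Ω.flow H t₀ q))) :=
      tendsto_nhdsWithin_iff.2 ⟨hT, Eventually.of_forall fun _ ↦ A.h_mem_range i _⟩
    refine ((A.tendsto_hinv_nhds hfin).comp h1).congr' ?_
    filter_upwards [hev.prod_mk ((isOpen_Ioo.eventually_mem ht₀).prod_mk
      (hn q hq))] with P hP
    obtain ⟨⟨hham, hK, hV⟩, ht, hq'⟩ := hP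
    have := A.flow_mem_box hI hham (A.h_mem_range i p) hρ.le hK₁0 hV0 hbox
      (fun w hw ↦ hK w (hs₁ hw)) (fun w hw ↦ (hV w (hs₁ hw)).trans (le_max_left _ _))
      hVδ ⟨ball_subset_closedBall hq'.2, A.h_mem_range i P.2.2⟩ ht
    rw [A.hinv_h hq'.1] at this
    exact A.hinv_h this.1
  rw [Metric.tendsto_nhds]
  intro ε hε
  set C := Real.exp (K₂.toNNReal * δ) with hCdef
  have hC0 : 0 < C := Real.exp_pos _
  -- The errors in the initial point and in the field are each allotted a quarter of ε after
  -- multiplication by the Grönwall factor `C`; the remaining half is for continuity in time.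
  have hε' : 0 < ε / (4 * C) := by positivity
  have hη : 0 < ε / (4 * C * δ) := by positivity
  have h1 : ∀ᶠ t in 𝓝 t₀, dist (A.h i (Ω.flow H t q)) (A.h i (Ω.flow H t₀ q)) < ε / 2 :=
    (A.hasDerivAt_h_flow hI hH hfin).continuousAt (ball_mem_nhds _ (half_pos hε))
  have h2 : ∀ᶠ q' in 𝓝 q, dist (A.h i q') (A.h i q) < ε / (4 * C) :=
    A.continuousAt_h hq.1 (ball_mem_nhds _ hε')
  filter_upwards [(hev.and (hC.eventually_vf_sub_le hH hη hbox)).prod_mk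
    (((isOpen_Ioo.eventually_mem ht₀).and h1).prod_mk
      ((hn q hq).and h2))] with P hP
  obtain ⟨⟨⟨hham, hK, hV⟩, hvf⟩, ⟨ht, hd1⟩, hq', hd2⟩ := hP
  have hmem' : ∀ t ∈ Ioo (-δ) δ, Ω.flow P.1 t P.2.2 ∈ A.src i ∧
      A.h i (Ω.flow P.1 t P.2.2) ∈ box I (A.h i p) ρ := by
    intro t ht
    have := A.flow_mem_box hI hham (A.h_mem_range i p) hρ.le hK₁0 hV0 hbox
      (fun w hw ↦ hK w (hs₁ hw)) (fun w hw ↦ (hV w (hs₁ hw)).trans (le_max_left _ _))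
      hVδ ⟨ball_subset_closedBall hq'.2, A.h_mem_range i P.2.2⟩ ht
    rwa [A.hinv_h hq'.1] at this
  have key := norm_sub_le_of_approx_solution hlip (f := fun t ↦ A.h i (Ω.flow P.1 t P.2.2))
    (g := fun t ↦ A.h i (Ω.flow H t q)) (δ := δ) (η := ε / (4 * C * δ)) (d := ε / (4 * C))
    hη.le hε'.le
    (fun t ht ↦ ⟨A.hasDerivAt_h_flow hI hham (hmem' t ht).1, hvf _ (hmem' t ht).2, (hmem' t ht).2⟩)
    (fun t ht ↦ ⟨A.hasDerivAt_h_flow hI hH (hmemH q hq t ht).1, (hmemH q hq t ht).2⟩)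
    (by
      rw [A.flow_zero hI hham, A.flow_zero hI hH, ← dist_eq_norm]
      exact hd2.le) ht
  rw [← dist_eq_norm] at key
  have h3 : (ε / (4 * C) + ε / (4 * C * δ) * δ) * C = ε / 2 := by field_simp; norm_num
  rw [← hCdef, h3] at key
  calc _ ≤ _ := dist_triangle _ (A.h i (Ω.flow H P.2.1 q)) _
    _ < ε := by linarith

end C1Conv

end DarbouxAtlas

end SymplecticForm

end

end HamRealizable

namespace HamRealizable

/-! ### The flow for all times: continuity, differentiability, conservation laws -/

section

open Metric

theorem exists_uniform_pos {M : Type*} [TopologicalSpace M] [CompactSpace M]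
    {Q : ℝ → M → Prop} (hQ : ∀ ε δ q, ε ≤ δ → Q δ q → Q ε q)
    (h : ∀ p, ∃ δ > 0, ∀ᶠ q in 𝓝 p, Q δ q) : ∃ ε > 0, ∀ q, Q ε q := by
  choose δ hδ hN using h
  obtain ⟨t, ht⟩ := isCompact_univ.elim_nhds_subcover' (fun p _ ↦ _) (fun p _ ↦ hN p)
  obtain ⟨ε, hε, hle⟩ : ∃ ε > 0, ∀ p ∈ t, ε ≤ δ p := by
    rcases t.eq_empty_or_nonempty with rfl | hne
    · exact ⟨1, one_pos, by simp⟩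
    · obtain ⟨p, hp, hmin⟩ := t.exists_min_image (fun p ↦ δ p) hne
      exact ⟨δ p, hδ p, hmin⟩
  refine ⟨ε, hε, fun q ↦ ?_⟩
  obtain ⟨p, hp, hq⟩ := mem_iUnion₂.1 (ht (mem_univ q))
  exact hQ _ _ q (hle p hp) hq

/-- Time t is cut into n equal steps shorter than ε, and the property is propagated along them. This
extends statements from a uniform short time to all times. -/
theorem forall_time_of_small {M : Type*} (φ : ℝ → M → M)
    {Q : ℝ → M → Prop} {ε : ℝ} (hε : 0 < ε) (hQ0 : ∀ q, ∀ t ∈ Ioo (-ε) ε, Q t q)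
    (hQadd : ∀ s t q, Q t q → Q s (φ t q) → Q (s + t) q) (t : ℝ) (q : M) : Q t q := by
  obtain ⟨n, hn⟩ := exists_nat_gt (|t| / ε)
  have hn0 : (0 : ℝ) < n := (by positivity : 0 ≤ |t| / ε).trans_lt hn
  have hs : t / n ∈ Ioo (-ε) ε := by
    refine abs_lt.1 ?_
    rw [abs_div, abs_of_pos hn0, div_lt_iff₀ hn0]
    rwa [div_lt_iff₀ hε, mul_comm] at hn
  have key : ∀ k : ℕ, Q (k * (t / n)) q := by
    intro k
    induction k with
    | zero => simpa using hQ0 q 0 ⟨by linarith, hε⟩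
    | succ k ih =>
      have := hQadd (t / n) (k * (t / n)) q ih (hQ0 _ _ hs)
      convert this using 1
      push_cast; ring
  have := key n
  rwa [mul_div_cancel₀ _ hn0.ne'] at this

variable {B : Type*} [TopologicalSpace B] {I : ModelWithCorners ℝ E4 B}
  {M : Type*} [TopologicalSpace M] [ChartedSpace B M] [IsManifold I ∞ M]

namespace SymplecticForm

variable {Ω : SymplecticForm I M}

omit [IsManifold I ∞ M] in
theorem dHam_congr {H H' : M → ℝ} {x : M} (h : H =ᶠ[𝓝 x] H') : dHam I H x = dHam I H' x :=
  h.mfderiv_eq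

theorem hamField_congr {H H' : M → ℝ} {x : M} (h : H =ᶠ[𝓝 x] H') :
    Ω.hamField H x = Ω.hamField H' x := (Ω.hamField_eq_iff H H' x).2 (dHam_congr h)

namespace DarbouxAtlas

variable {A : Ω.DarbouxAtlas} {i j : Fin A.num} {p : M} {z : E4} {H H' : M → ℝ}
  {𝓕 : Filter (M → ℝ)} [T2Space M] [CompactSpace M]

section

variable (hI : range I = univ ∨ range I = {y : E4 | 0 ≤ y 0}) (hH : IsHamiltonian I 2 H)

include A hI hH

theorem C1Conv.tendsto_flow (hC : A.C1Conv 𝓕 H) (t₀ : ℝ) (q : M) :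
    Tendsto (fun P : (M → ℝ) × ℝ × M ↦ Ω.flow P.1 P.2.1 P.2.2) (𝓕 ×ˢ 𝓝 t₀ ×ˢ 𝓝 q)
      (𝓝 (Ω.flow H t₀ q)) := by
  obtain ⟨ε, hε, h⟩ := exists_uniform_pos (Q := fun δ q ↦ ∀ t₀ ∈ Ioo (-δ) δ,
    Tendsto (fun P : (M → ℝ) × ℝ × M ↦ Ω.flow P.1 P.2.1 P.2.2) (𝓕 ×ˢ 𝓝 t₀ ×ˢ 𝓝 q)
      (𝓝 (Ω.flow H t₀ q))) (fun ε δ q hle h t ht ↦ h t ⟨by linarith [ht.1], by linarith [ht.2]⟩)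
    (hC.exists_tendsto_flow hI hH)
  refine forall_time_of_small (Q := fun t₀ q ↦
    Tendsto (fun P : (M → ℝ) × ℝ × M ↦ Ω.flow P.1 P.2.1 P.2.2) (𝓕 ×ˢ 𝓝 t₀ ×ˢ 𝓝 q)
      (𝓝 (Ω.flow H t₀ q))) (Ω.flow H) hε h ?_ t₀ q
  intro s t q h1 h2
  rw [A.flow_add hI hH]
  have h3 : Tendsto (fun P : (M → ℝ) × ℝ × M ↦ P.2.1 - s) (𝓕 ×ˢ 𝓝 (s + t) ×ˢ 𝓝 q) (𝓝 t) := by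
    have : Tendsto (fun P : (M → ℝ) × ℝ × M ↦ P.2.1) (𝓕 ×ˢ 𝓝 (s + t) ×ˢ 𝓝 q) (𝓝 (s + t)) :=
      tendsto_fst.comp tendsto_snd
    simpa using this.sub_const s
  have h4 : Tendsto (fun P : (M → ℝ) × ℝ × M ↦ Ω.flow P.1 (P.2.1 - s) P.2.2)
      (𝓕 ×ˢ 𝓝 (s + t) ×ˢ 𝓝 q) (𝓝 (Ω.flow H t q)) :=
    h1.comp (tendsto_fst.prodMk (h3.prodMk (tendsto_snd.comp tendsto_snd)))
  have h5 := h2.comp (tendsto_fst.prodMk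
    ((tendsto_const_nhds (x := s) (f := 𝓕 ×ˢ 𝓝 (s + t) ×ˢ 𝓝 q)).prodMk h4))
  refine h5.congr' ?_
  filter_upwards [tendsto_fst.eventually hC.ham] with P hP
  simp only [Function.comp]
  rw [← A.flow_add hI hP, add_sub_cancel]

theorem continuous_flow : Continuous fun P : ℝ × M ↦ Ω.flow H P.1 P.2 := by
  rw [continuous_iff_continuousAt]
  rintro ⟨t, q⟩
  have h := (A.c1Conv_pure hH).tendsto_flow hI hH t q
  rw [pure_prod, tendsto_map'_iff] at h
  rw [ContinuousAt, nhds_prod_eq]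
  exact h

theorem continuous_flow_space (t : ℝ) : Continuous (Ω.flow H t) :=
  (continuous_flow (A := A) hI hH).comp (Continuous.prodMk_right t)

theorem C1Conv.eventually_flow_mem (hC : A.C1Conv 𝓕 H) {K : Set ℝ} (hK : IsCompact K) {G : Set M}
    (hG : IsOpen G) {x : M} (h : ∀ t ∈ K, Ω.flow H t x ∈ G) :
    ∀ᶠ P in 𝓕 ×ˢ 𝓝 x, ∀ t ∈ K, Ω.flow P.1 t P.2 ∈ G := by
  refine eventually_forall_of_isCompact hK fun t ht ↦ ?_
  have h1 := (hC.tendsto_flow hI hH t x).eventually (hG.mem_nhds (h t ht))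
  have h2 : Tendsto (fun z : ((M → ℝ) × M) × ℝ ↦ (z.1.1, z.2, z.1.2))
      ((𝓕 ×ˢ 𝓝 x) ×ˢ 𝓝[K] t) (𝓕 ×ˢ 𝓝 t ×ˢ 𝓝 x) :=
    (tendsto_fst.comp tendsto_fst).prodMk
      ((tendsto_snd.mono_right nhdsWithin_le_nhds).prodMk (tendsto_snd.comp tendsto_fst))
  exact h2.eventually h1

/-- In a Hausdorff space, not meeting is an open condition on the pair of points, and the
compactness of the set of pairs of times makes it uniform. -/
theorem C1Conv.eventually_flow_ne {𝓕' : Filter (M → ℝ)} (hC : A.C1Conv 𝓕 H)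
    (hC' : A.C1Conv 𝓕' H) {K : Set (ℝ × ℝ)} (hK : IsCompact K)
    {x x' : M} (h : ∀ t ∈ K, Ω.flow H t.1 x ≠ Ω.flow H t.2 x') :
    ∀ᶠ P in (𝓕 ×ˢ 𝓝 x) ×ˢ (𝓕' ×ˢ 𝓝 x'), ∀ t ∈ K,
      Ω.flow P.1.1 t.1 P.1.2 ≠ Ω.flow P.2.1 t.2 P.2.2 := by
  refine eventually_forall_of_isCompact hK fun t ht ↦ ?_
  have h1 := hC.tendsto_flow hI hH t.1 x
  have h1' := hC'.tendsto_flow hI hH t.2 x'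
  have hle : ((𝓕 ×ˢ 𝓝 x) ×ˢ (𝓕' ×ˢ 𝓝 x')) ×ˢ 𝓝[K] t ≤
      ((𝓕 ×ˢ 𝓝 x) ×ˢ (𝓕' ×ˢ 𝓝 x')) ×ˢ 𝓝 t := prod_mono le_rfl nhdsWithin_le_nhds
  have hs : Tendsto (fun z : (((M → ℝ) × M) × ((M → ℝ) × M)) × ℝ × ℝ ↦ z.2)
      (((𝓕 ×ˢ 𝓝 x) ×ˢ (𝓕' ×ˢ 𝓝 x')) ×ˢ 𝓝[K] t) (𝓝 t) :=
    tendsto_snd.mono_right nhdsWithin_le_nhds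
  have h2 : Tendsto (fun z : (((M → ℝ) × M) × ((M → ℝ) × M)) × ℝ × ℝ ↦
      (z.1.1.1, z.2.1, z.1.1.2)) (((𝓕 ×ˢ 𝓝 x) ×ˢ (𝓕' ×ˢ 𝓝 x')) ×ˢ 𝓝[K] t)
      (𝓕 ×ˢ 𝓝 t.1 ×ˢ 𝓝 x) :=
    ((tendsto_fst.comp tendsto_fst).comp tendsto_fst).prodMk
      (((continuous_fst.tendsto t).comp hs).prodMk
        ((tendsto_snd.comp tendsto_fst).comp tendsto_fst))
  have h2' : Tendsto (fun z : (((M → ℝ) × M) × ((M → ℝ) × M)) × ℝ × ℝ ↦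
      (z.1.2.1, z.2.2, z.1.2.2)) (((𝓕 ×ˢ 𝓝 x) ×ˢ (𝓕' ×ˢ 𝓝 x')) ×ˢ 𝓝[K] t)
      (𝓕' ×ˢ 𝓝 t.2 ×ˢ 𝓝 x') :=
    ((tendsto_fst.comp tendsto_snd).comp tendsto_fst).prodMk
      (((continuous_snd.tendsto t).comp hs).prodMk
        ((tendsto_snd.comp tendsto_snd).comp tendsto_fst))
  have h3 := (h1.comp h2).prodMk_nhds (h1'.comp h2')
  exact h3.eventually ((isOpen_ne_fun continuous_fst continuous_snd).mem_nhds (h t ht))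

theorem exists_isSymplectic_small (p : M) : ∃ δ > 0, ∀ᶠ q in 𝓝 p, ∀ t ∈ Ioo (-δ) δ,
    MDifferentiableAt I I (Ω.flow H t) q ∧ ∀ v w : TangentSpace I q,
      Ω.form (Ω.flow H t q) (Ω.tangentFlow H t q v) (Ω.tangentFlow H t q w) = Ω.form q v w := by
  obtain ⟨δ, hδ, K, hK, h⟩ := (A.c1Conv_pure hH).exists_tangentFlow hI (A.mem_idx p)
  rw [pure_prod, eventually_map] at h
  refine ⟨δ, hδ, h.mono fun q hq t ht ↦ ?_⟩
  obtain ⟨hq, hq', L, -, hL, hd⟩ := hq t ht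
  refine ⟨hd.mdifferentiableAt, fun v w ↦ ?_⟩
  have h1 : ∀ v : TangentSpace I q, A.dh (A.idx p) (Ω.flow H t q) (Ω.tangentFlow H t q v)
      = L (A.dh (A.idx p) q v) := by
    intro v
    rw [tangentFlow, hd.mfderiv]
    exact A.dh_dh_inverse hq' _
  rw [← A.stdForm_dh hq', ← A.stdForm_dh hq, h1, h1, hL]

theorem mdifferentiableAt_flow (t : ℝ) (q : M) : MDifferentiableAt I I (Ω.flow H t) q := by
  obtain ⟨ε, hε, h⟩ := exists_uniform_pos (Q := fun δ q ↦ ∀ t ∈ Ioo (-δ) δ,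
    MDifferentiableAt I I (Ω.flow H t) q)
    (fun ε δ q hle h t ht ↦ h t ⟨by linarith [ht.1], by linarith [ht.2]⟩)
    (fun p ↦ (exists_isSymplectic_small (A := A) hI hH p).imp fun δ hδ ↦
      ⟨hδ.1, hδ.2.mono fun q hq t ht ↦ (hq t ht).1⟩)
  refine forall_time_of_small (Ω.flow H) hε h ?_ t q
  intro s t q h1 h2
  have : Ω.flow H (s + t) = Ω.flow H s ∘ Ω.flow H t := funext (A.flow_add hI hH s t)
  rw [this]
  exact h2.comp q h1

theorem hasMFDerivAt_flow (t : ℝ) (q : M) :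
    HasMFDerivAt I I (Ω.flow H t) q (Ω.tangentFlow H t q) :=
  (mdifferentiableAt_flow (A := A) hI hH t q).hasMFDerivAt

theorem tangentFlow_add_apply (s t : ℝ) (q : M) (v : TangentSpace I q) :
    (Ω.tangentFlow H (s + t) q v : E4) = Ω.tangentFlow H s (Ω.flow H t q) (Ω.tangentFlow H t q v) := by
  have h1 : Ω.flow H (s + t) = Ω.flow H s ∘ Ω.flow H t := funext (A.flow_add hI hH s t)
  have h2 := (hasMFDerivAt_flow (A := A) hI hH s (Ω.flow H t q)).comp q
    (hasMFDerivAt_flow (A := A) hI hH t q)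
  rw [← h1] at h2
  exact congrArg (fun f : E4 →L[ℝ] E4 ↦ f v) h2.mfderiv

theorem form_tangentFlow (t : ℝ) (q : M) (v w : TangentSpace I q) :
    Ω.form (Ω.flow H t q) (Ω.tangentFlow H t q v) (Ω.tangentFlow H t q w) = Ω.form q v w := by
  obtain ⟨ε, hε, h⟩ := exists_uniform_pos (Q := fun δ q ↦ ∀ t ∈ Ioo (-δ) δ,
    ∀ v w : TangentSpace I q,
      Ω.form (Ω.flow H t q) (Ω.tangentFlow H t q v) (Ω.tangentFlow H t q w) = Ω.form q v w)
    (fun ε δ q hle h t ht ↦ h t ⟨by linarith [ht.1], by linarith [ht.2]⟩)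
    (fun p ↦ (exists_isSymplectic_small (A := A) hI hH p).imp fun δ hδ ↦
      ⟨hδ.1, hδ.2.mono fun q hq t ht ↦ (hq t ht).2⟩)
  refine forall_time_of_small (Q := fun t q ↦ ∀ v w : TangentSpace I q,
      Ω.form (Ω.flow H t q) (Ω.tangentFlow H t q v) (Ω.tangentFlow H t q w) = Ω.form q v w)
      (Ω.flow H) hε h ?_ t q v w
  intro s t q h1 h2 v w
  have hv := tangentFlow_add_apply (A := A) hI hH s t q v
  have hw := tangentFlow_add_apply (A := A) hI hH s t q w
  have key : ∀ (y y' : M) (a b a' b' : E4), y = y' → a = a' → b = b' →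
      (Ω.form y (a : TangentSpace I y) (b : TangentSpace I y)) =
        Ω.form y' (a' : TangentSpace I y') (b' : TangentSpace I y') := by
    rintro y _ a b _ _ rfl rfl rfl; rfl
  refine (key _ _ _ _ _ _ (A.flow_add hI hH s t q) hv hw).trans ?_
  exact (h2 _ _).trans (h1 v w)

theorem tangentFlow_hamField (t : ℝ) (q : M) :
    Ω.tangentFlow H t q (Ω.hamField H q) = Ω.hamField H (Ω.flow H t q) := by
  have h1 := A.isMIntegralCurve_flow hI hH q 0
  have h2 : HasMFDerivAt I I (Ω.flow H t) (Ω.flow H 0 q) (Ω.tangentFlow H t (Ω.flow H 0 q)) :=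
    hasMFDerivAt_flow (A := A) hI hH t _
  have h3 := h2.comp (0 : ℝ) h1
  have h4 := A.isMIntegralCurve_flow hI hH (Ω.flow H t q) 0
  have h5 : (Ω.flow H t ∘ fun s ↦ Ω.flow H s q) = fun s ↦ Ω.flow H s (Ω.flow H t q) := by
    funext s
    simp only [Function.comp]
    rw [← A.flow_add hI hH, ← A.flow_add hI hH, add_comm]
  rw [h5] at h3
  have h6 := congrArg (fun f : ℝ →L[ℝ] E4 ↦ f 1) (h3.mfderiv.symm.trans h4.mfderiv)
  have h7 : (Ω.tangentFlow H t (Ω.flow H 0 q) ((1 : ℝ) • Ω.hamField H (Ω.flow H 0 q)) : E4)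
    = (1 : ℝ) • Ω.hamField H (Ω.flow H 0 (Ω.flow H t q)) := h6
  rw [one_smul, one_smul] at h7
  have key : ∀ y y', y = q → y' = Ω.flow H t q →
      (Ω.tangentFlow H t y (Ω.hamField H y) : E4) = Ω.hamField H y' →
      Ω.tangentFlow H t q (Ω.hamField H q) = Ω.hamField H (Ω.flow H t q) := by
    rintro _ _ rfl rfl h; exact h
  exact key _ _ (A.flow_zero hI hH _) (A.flow_zero hI hH _) h7

theorem comp_flow_eq (t : ℝ) (q : M) : H (Ω.flow H t q) = H q := by
  have hd : ∀ s, HasDerivAt (fun s ↦ H (Ω.flow H s q)) 0 s := by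
    intro s
    have h1 := A.isMIntegralCurve_flow hI hH q s
    have h2 : HasMFDerivAt I 𝓘(ℝ, ℝ) H (Ω.flow H s q) (dHam I H (Ω.flow H s q)) :=
      (ContMDiff.mdifferentiable hH.1 (by simp) _).hasMFDerivAt
    have h3 : HasFDerivAt (fun s ↦ H (Ω.flow H s q)) (dHam I H (Ω.flow H s q) ∘L
        (1 : ℝ →L[ℝ] ℝ).smulRight (Ω.hamField H (Ω.flow H s q)) : ℝ →L[ℝ] ℝ) s :=
      HasMFDerivAt.hasFDerivAt (h2.comp s h1)
    have h4 := h3.hasDerivAt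
    convert! h4 using 1
    change 0 = dHam I H (Ω.flow H s q) ((1 : ℝ) • Ω.hamField H (Ω.flow H s q))
    rw [one_smul, Ω.dHam_hamField]
  have := is_const_of_deriv_eq_zero (fun s ↦ (hd s).differentiableAt) (fun s ↦ (hd s).deriv) t 0
  simpa only [A.flow_zero hI hH] using this

theorem dHam_tangentFlow (t : ℝ) (q : M) (v : TangentSpace I q) :
    dHam I H (Ω.flow H t q) (Ω.tangentFlow H t q v) = dHam I H q v := by
  have h2 : HasMFDerivAt I 𝓘(ℝ, ℝ) H (Ω.flow H t q) (dHam I H (Ω.flow H t q)) :=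
    (ContMDiff.mdifferentiable hH.1 (by simp) _).hasMFDerivAt
  have h3 := h2.comp q (hasMFDerivAt_flow (A := A) hI hH t q)
  have h4 : H ∘ Ω.flow H t = H := funext (comp_flow_eq (A := A) hI hH t)
  rw [h4] at h3
  exact congrArg (fun f : E4 →L[ℝ] ℝ ↦ f v) h3.mfderiv.symm

omit hH in
-- Second derivatives are only bounded along 𝓕, so closeness of tangent flows to the identity is
-- available for short times only. The price is paid in δ, which depends on c.
theorem C1Conv.eventually_tangentFlow (hC : A.C1Conv 𝓕 H) (hp : p ∈ A.src i) {c : ℝ} (hc : 0 < c) :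
    ∃ δ > 0, ∀ᶠ P in 𝓕 ×ˢ 𝓝 p, ∀ t ∈ Ioo (-δ) δ, P.2 ∈ A.src i ∧ Ω.flow P.1 t P.2 ∈ A.src i ∧
      ∃ L : E4 →L[ℝ] E4, ‖L - .id ℝ E4‖ ≤ c ∧ ∀ v : TangentSpace I P.2,
        A.dh i (Ω.flow P.1 t P.2) (Ω.tangentFlow P.1 t P.2 v) = L (A.dh i P.2 v) := by
  obtain ⟨δ, hδ, K, hK, h⟩ := hC.exists_tangentFlow hI hp
  refine ⟨min δ (c / (2 * K + 1)), by positivity, ?_⟩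
  filter_upwards [h] with P hP t ht
  have htδ : t ∈ Ioo (-δ) δ :=
    ⟨by linarith [ht.1, min_le_left δ (c / (2 * K + 1))], ht.2.trans_le (min_le_left _ _)⟩
  obtain ⟨hq, hq', L, hL, -, hd⟩ := hP t htδ
  refine ⟨hq, hq', L, hL.trans ?_, fun v ↦ ?_⟩
  · have h1 : |t| < c / (2 * K + 1) := (abs_lt.2 ht).trans_le (min_le_right _ _)
    rw [lt_div_iff₀ (by positivity)] at h1
    nlinarith [abs_nonneg t]
  · rw [tangentFlow, hd.mfderiv]
    exact A.dh_dh_inverse hq' _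

omit hH in
-- The fields are compared on the open time interval only; the endpoints follow by continuity. For a
-- pasted Hamiltonian the agreement is indeed lost at the middle section.
theorem flow_eq_of_hamField_eq {H₁ H₂ : M → ℝ} (h₁ : IsHamiltonian I 2 H₁)
    (h₂ : IsHamiltonian I 2 H₂) {x : M} {t : ℝ}
    (h : ∀ s ∈ Ioo 0 t, Ω.hamField H₂ (Ω.flow H₁ s x) = Ω.hamField H₁ (Ω.flow H₁ s x))
    {s : ℝ} (hs : s ∈ Icc 0 t) : Ω.flow H₂ s x = Ω.flow H₁ s x := by
  have hcurve : IsMIntegralCurveOn (I := I) (fun s ↦ Ω.flow H₁ s x) (Ω.hamField H₂) (Ioo 0 t) := by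
    intro r hr
    rw [h r hr]
    exact (A.isMIntegralCurve_flow hI h₁ x r).hasMFDerivWithinAt
  have h0 := A.flow_zero hI h₁ x
  have hIoo : ∀ s ∈ Ioo 0 t, Ω.flow H₂ s x = Ω.flow H₁ s x := by
    intro s hs
    have h3 : ∀ r ∈ Ioo 0 t, Ω.flow H₂ (s - r) (Ω.flow H₁ r x) = Ω.flow H₁ s x := by
      intro r hr
      have h4 := hcurve.comp_add r
      have h5 := A.flow_unique hI h₂ (γ := (fun s ↦ Ω.flow H₁ s x) ∘ (· + r)) (a := 0 - r)
        (b := t - r) ⟨by linarith [hr.1], by linarith [hr.2]⟩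
        (h4.mono fun u hu ↦ ⟨by linarith [hu.1], by linarith [hu.2]⟩) (t := s - r)
        ⟨by linarith [hs.1], by linarith [hs.2]⟩
      simpa using h5
    have h6 : Tendsto (fun r ↦ Ω.flow H₂ (s - r) (Ω.flow H₁ r x)) (𝓝[>] 0)
        (𝓝 (Ω.flow H₂ s x)) := by
      have hc : Continuous fun r ↦ Ω.flow H₂ (s - r) (Ω.flow H₁ r x) :=
        (continuous_flow (A := A) hI h₂).comp
          ((continuous_const.sub continuous_id).prodMk (A.continuous_flow_time hI h₁ x))
      have := hc.tendsto 0
      rw [sub_zero, h0] at this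
      exact this.mono_left nhdsWithin_le_nhds
    refine tendsto_nhds_unique (h6.congr' ?_) tendsto_const_nhds
    filter_upwards [Ioo_mem_nhdsGT (hs.1.trans hs.2)] with r hr using h3 r hr
  rcases eq_or_lt_of_le hs.1 with rfl | hs0
  · rw [h0, A.flow_zero hI h₂]
  rcases eq_or_lt_of_le hs.2 with rfl | hst
  · have h1 : Tendsto (fun r ↦ Ω.flow H₂ r x) (𝓝[<] s) (𝓝 (Ω.flow H₂ s x)) :=
      ((A.continuous_flow_time hI h₂ x).tendsto s).mono_left nhdsWithin_le_nhds
    have h2 : Tendsto (fun r ↦ Ω.flow H₁ r x) (𝓝[<] s) (𝓝 (Ω.flow H₁ s x)) :=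
      ((A.continuous_flow_time hI h₁ x).tendsto s).mono_left nhdsWithin_le_nhds
    refine tendsto_nhds_unique h1 (h2.congr' ?_)
    filter_upwards [Ioo_mem_nhdsLT hs0] with r hr using (hIoo r hr).symm
  · exact hIoo s ⟨hs0, hst⟩

omit hH in
-- The orbit segment is compact, so the segments from nearby points stay in `O` as well. Agreement
-- near x is what gives equal tangent flows.
theorem flow_eventuallyEq {H₁ H₂ : M → ℝ} (h₁ : IsHamiltonian I 2 H₁)
    (h₂ : IsHamiltonian I 2 H₂) {O : Set M} (hO : IsOpen O) (hHO : EqOn H₁ H₂ O) {x : M} {t : ℝ}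
    (ht : 0 ≤ t) (h : ∀ s ∈ Icc 0 t, Ω.flow H₁ s x ∈ O) :
    Ω.flow H₂ t =ᶠ[𝓝 x] Ω.flow H₁ t := by
  have h1 := (A.c1Conv_pure h₁).eventually_flow_mem hI h₁ isCompact_Icc hO h
  rw [pure_prod, eventually_map] at h1
  filter_upwards [h1] with y hy
  refine flow_eq_of_hamField_eq (A := A) hI h₁ h₂ (t := t) (fun s hs ↦ ?_) ⟨ht, le_rfl⟩
  refine hamField_congr ?_
  filter_upwards [hO.mem_nhds (hy s (Ioo_subset_Icc_self hs))] with w hw using (hHO hw).symm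

/-- Joint differentiability of the flow in time and initial point, in charts. -/
theorem hasFDerivWithinAt_flow {q : M} {t₀ : ℝ} (hq : q ∈ A.src i)
    (hq' : Ω.flow H t₀ q ∈ A.src j) :
    ∃ L : E4 →L[ℝ] E4, (∀ v : TangentSpace I q,
        L (A.dh i q v) = A.dh j (Ω.flow H t₀ q) (Ω.tangentFlow H t₀ q v)) ∧
      HasFDerivWithinAt (fun P : ℝ × E4 ↦ A.h j (Ω.flow H P.1 (A.hinv i P.2)))
        ((ContinuousLinearMap.fst ℝ ℝ E4).smulRight (A.vf j H (A.h j (Ω.flow H t₀ q)))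
          + L ∘L ContinuousLinearMap.snd ℝ ℝ E4) (univ ×ˢ range I) (t₀, A.h i q) := by
  set q' := Ω.flow H t₀ q with hq'def
  set w₀ := A.h j q' with hw₀
  set v₀ := A.vf j H w₀ with hv₀
  -- the flow near time zero
  have hU : HasFDerivWithinAt (fun P : ℝ × E4 ↦ A.h j (Ω.flow H P.1 (A.hinv j P.2)))
      ((ContinuousLinearMap.fst ℝ ℝ E4).smulRight v₀ + ContinuousLinearMap.snd ℝ ℝ E4)
      (univ ×ˢ range I) (0, w₀) := by
    rw [hasFDerivWithinAt_iff_isLittleO, Asymptotics.isLittleO_iff]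
    intro c hc
    have h1 : Tendsto (fun P : ℝ × E4 ↦ Ω.flow H P.1 (A.hinv j P.2)) (𝓝 0 ×ˢ 𝓝[range I] w₀)
        (𝓝 q') := by
      have h2 := (continuous_flow (A := A) hI hH).tendsto (0, q')
      rw [A.flow_zero hI hH, nhds_prod_eq] at h2
      exact h2.comp (tendsto_fst.prodMk ((A.tendsto_hinv_nhds hq').comp tendsto_snd))
    have h3 : ∀ᶠ P in 𝓝 (0 : ℝ) ×ˢ 𝓝[range I] w₀, Ω.flow H P.1 (A.hinv j P.2) ∈ A.src j ∧
        ‖A.vf j H (A.h j (Ω.flow H P.1 (A.hinv j P.2))) - v₀‖ < c := by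
      refine (h1.eventually ((A.isOpen_src j).eventually_mem hq')).and ?_
      have h4 := (A.continuousWithinAt_vf hH.1 (A.h_mem_tgt hq')).tendsto.comp
        ((A.tendsto_h_nhdsWithin hq').comp h1)
      have h5 := (h4.sub_const v₀).norm
      rw [← hw₀, ← hv₀, sub_self, norm_zero] at h5
      exact h5.eventually_lt_const hc
    obtain ⟨pa, ha, pb, hb, hab⟩ := eventually_prod_iff.1 h3
    obtain ⟨r, hr, hball⟩ := Metric.eventually_nhds_iff_ball.1 ha
    rw [nhdsWithin_prod_eq, nhdsWithin_univ]
    filter_upwards [prod_mem_prod (ball_mem_nhds (0 : ℝ) hr)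
      (inter_mem hb (A.tgt_mem_nhdsWithin hq'))] with P hP
    obtain ⟨hP1, hP2, hP3⟩ := hP
    have hmv := (convex_ball (0 : ℝ) r).norm_image_sub_le_of_norm_hasDerivWithin_le (C := c)
      (f := fun s ↦ A.h j (Ω.flow H s (A.hinv j P.2)) - s • v₀)
      (f' := fun s ↦ A.vf j H (A.h j (Ω.flow H s (A.hinv j P.2))) - v₀)
      (fun s hs ↦ by
        have h6 := (hab (hball s hs) hP2).1
        have h7 := (A.hasDerivAt_h_flow hI hH h6).sub ((hasDerivAt_id s).smul_const v₀)
        rw [one_smul] at h7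
        exact h7.hasDerivWithinAt)
      (fun s hs ↦ (hab (hball s hs) hP2).2.le) (mem_ball_self hr) hP1
    simp only [A.flow_zero hI hH, A.h_hinv hP3, zero_smul, sub_zero] at hmv
    simp only [A.flow_zero hI hH, A.h_hinv (A.h_mem_tgt hq'), hw₀] at hmv ⊢
    refine le_trans (le_of_eq ?_) (hmv.trans (mul_le_mul_of_nonneg_left ?_ hc.le))
    · congr 1
      simp
      abel
    · have h8 := norm_fst_le (P - (0, A.h j q'))
      rwa [Prod.fst_sub, sub_zero] at h8
  have hg : ∃ L : E4 →L[ℝ] E4, (∀ v : TangentSpace I q,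
        L (A.dh i q v) = A.dh j q' (Ω.tangentFlow H t₀ q v)) ∧
      HasFDerivWithinAt (fun w ↦ A.h j (Ω.flow H t₀ (A.hinv i w))) L (range I) (A.h i q) := by
    have h1 := A.hasMFDerivWithinAt_hinv (A.h_mem_tgt hq)
    rw [A.hinv_h hq] at h1
    have h2 : HasMFDerivAt I I (Ω.flow H t₀) (A.hinv i (A.h i q))
        (Ω.tangentFlow H t₀ (A.hinv i (A.h i q))) := hasMFDerivAt_flow (A := A) hI hH t₀ _
    rw [A.hinv_h hq] at h2
    have h3 : HasMFDerivAt I 𝓘(ℝ, E4) (A.h j) (Ω.flow H t₀ (A.hinv i (A.h i q))) (A.dh j q') := by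
      rw [A.hinv_h hq]; exact A.hasMFDerivAt_h hq'
    have h2' : HasMFDerivAt I I (Ω.flow H t₀) (A.hinv i (A.h i q)) (Ω.tangentFlow H t₀ q) := by
      rw [A.hinv_h hq]; exact h2
    have h4 := h3.comp_hasMFDerivWithinAt (A.h i q) (h2'.comp_hasMFDerivWithinAt (A.h i q) h1)
    refine ⟨A.dh j q' ∘L Ω.tangentFlow H t₀ q ∘L (A.dh i q).inverse, fun v ↦ ?_,
      HasMFDerivWithinAt.hasFDerivWithinAt h4⟩
    simp only [ContinuousLinearMap.comp_apply]
    rw [A.dh_inverse_dh hq]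
  obtain ⟨L, hL, hLd⟩ := hg
  refine ⟨L, hL, ?_⟩
  -- The general case is reduced to times near zero by writing φ^t = φ^{t - t₀} ∘ φ^{t₀}, where
  -- φ^{t₀} is already known to be differentiable in space.
  have hpair : HasFDerivWithinAt (fun P : ℝ × E4 ↦
      (P.1 - t₀, A.h j (Ω.flow H t₀ (A.hinv i P.2))))
      ((ContinuousLinearMap.fst ℝ ℝ E4).prod (L ∘L ContinuousLinearMap.snd ℝ ℝ E4))
      (univ ×ˢ range I) (t₀, A.h i q) := by
    refine HasFDerivWithinAt.prodMk ?_ ?_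
    · exact (hasFDerivAt_fst.sub_const t₀).hasFDerivWithinAt
    · exact HasFDerivWithinAt.comp (f := Prod.snd) (s := univ ×ˢ range I) (t := range I)
        (t₀, A.h i q) hLd hasFDerivWithinAt_snd (fun P hP ↦ hP.2)
  have hU' : HasFDerivWithinAt (fun P : ℝ × E4 ↦ A.h j (Ω.flow H P.1 (A.hinv j P.2)))
      ((ContinuousLinearMap.fst ℝ ℝ E4).smulRight v₀ + ContinuousLinearMap.snd ℝ ℝ E4)
      (univ ×ˢ range I) ((fun P : ℝ × E4 ↦
      (P.1 - t₀, A.h j (Ω.flow H t₀ (A.hinv i P.2)))) (t₀, A.h i q)) := by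
    simp only [sub_self, A.hinv_h hq]
    exact hU
  have hcomp := HasFDerivWithinAt.comp (t := (univ : Set ℝ) ×ˢ range I) (t₀, A.h i q) hU' hpair
    (fun P _ ↦ mk_mem_prod (mem_univ _) (A.h_mem_range j _))
  have hcomp' := hcomp.congr_of_eventuallyEq
    (f₁ := fun P : ℝ × E4 ↦ A.h j (Ω.flow H P.1 (A.hinv i P.2))) ?_ ?_
  · convert! hcomp' using 1
  · have h1 : Tendsto (fun P : ℝ × E4 ↦ Ω.flow H t₀ (A.hinv i P.2))
        (𝓝[univ ×ˢ range I] (t₀, A.h i q)) (𝓝 q') := by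
      rw [nhdsWithin_prod_eq, nhdsWithin_univ]
      exact ((continuous_flow_space (A := A) hI hH t₀).tendsto q).comp
        ((A.tendsto_hinv_nhds hq).comp tendsto_snd)
    filter_upwards [h1.eventually ((A.isOpen_src j).eventually_mem hq')] with P hP
    simp only [Function.comp]
    rw [A.hinv_h hP, ← A.flow_add hI hH, sub_add_cancel]
  · simp only [Function.comp]
    rw [A.hinv_h hq, A.hinv_h hq', sub_self, A.flow_zero hI hH]

end

end DarbouxAtlas

end SymplecticForm

end

end HamRealizable

namespace HamRealizable

/-! ### Thin perturbations that are bounded in C² are small in C¹ -/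

section

open Metric

/-- The C²-norm of the statement involves partial derivatives along basis vectors; expansion in the
4^k multi-indices turns it into a bound on operator norms. -/
theorem norm_le_of_forall_single {k : ℕ} (m : ContinuousMultilinearMap ℝ (fun _ : Fin k ↦ E4) ℝ)
    {c : ℝ} (hc : 0 ≤ c) (h : ∀ a : Fin k → Fin 4, |m fun l ↦ EuclideanSpace.single (a l) 1| ≤ c) :
    ‖m‖ ≤ 4 ^ k * c := by
  refine m.opNorm_le_bound (by positivity) fun v ↦ ?_
  have hv : v = fun l ↦ ∑ a : Fin 4, v l a • EuclideanSpace.single a (1 : ℝ) := by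
    funext l
    ext b
    simp [Fin.sum_univ_four]
    fin_cases b <;> simp
  conv_lhs => rw [hv]
  rw [m.map_sum]
  calc _ ≤ ∑ r : Fin k → Fin 4, c * ∏ l, ‖v l‖ := by
        refine norm_sum_le_of_le _ fun r _ ↦ ?_
        rw [m.map_smul_univ, norm_smul, norm_prod, mul_comm]
        refine mul_le_mul (h r) (Finset.prod_le_prod (fun _ _ ↦ norm_nonneg _) fun l _ ↦ ?_)
          (Finset.prod_nonneg fun _ _ ↦ norm_nonneg _) hc
        exact PiLp.norm_apply_le (v l) (r l)
    _ = 4 ^ k * c * ∏ l, ‖v l‖ := by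
        rw [Finset.sum_const, Finset.card_univ, Fintype.card_fun, Fintype.card_fin, nsmul_eq_mul]
        push_cast [Fintype.card_fin]
        ring

theorem norm_iteratedFDerivWithin_two {S : Set E4} (hS : UniqueDiffOn ℝ S) {z : E4} (hz : z ∈ S)
    (f : E4 → ℝ) :
    ‖fderivWithin ℝ (fderivWithin ℝ f S) S z‖ = ‖iteratedFDerivWithin ℝ 2 f S z‖ := by
  rw [← norm_iteratedFDerivWithin_fderivWithin hS hz, norm_iteratedFDerivWithin_one _ (hS z hz)]

theorem uniqueDiffOn_of_mem_nhdsWithin {R S : Set E4} (hR : UniqueDiffOn ℝ R) (hSR : S ⊆ R)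
    (h : ∀ z ∈ S, S ∈ 𝓝[R] z) : UniqueDiffOn ℝ S := fun z hz ↦
  (hR z (hSR hz)).mono_nhds (nhdsWithin_le_iff.2 (h z hz))

theorem iteratedFDerivWithin_eq_of_mem_nhdsWithin {F : Type*} [NormedAddCommGroup F]
    [NormedSpace ℝ F] {R S : Set E4} (hSR : S ⊆ R) {z : E4}
    (h : S ∈ 𝓝[R] z) (n : ℕ) (f : E4 → F) :
    iteratedFDerivWithin ℝ n f S z = iteratedFDerivWithin ℝ n f R z := by
  refine iteratedFDerivWithin_congr_set ?_ n
  rw [← nhdsWithin_eq_iff_eventuallyEq]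
  exact le_antisymm (nhdsWithin_mono _ hSR) (nhdsWithin_le_iff.2 h)

variable {B : Type*} [TopologicalSpace B] {I : ModelWithCorners ℝ E4 B}
  {M : Type*} [TopologicalSpace M] [ChartedSpace B M] [IsManifold I ∞ M]

namespace SymplecticForm.DarbouxAtlas

variable {Ω : SymplecticForm I M} (A : Ω.DarbouxAtlas) {i j : Fin A.num} {p : M} {z : E4}
  {H H' : M → ℝ} {ε : ℝ}

theorem C2Close.norm_iteratedFDerivWithin_le (h : A.C2Close ε H' H) (hp : p ∈ A.core j) {k : ℕ}
    (hk : k ≤ 2) :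
    ‖iteratedFDerivWithin ℝ k (A.loc j (H' - H)) (range I) (A.h j p)‖ ≤ 4 ^ k * ε := by
  have h1 := h j p hp k hk
  have hε : 0 ≤ ε := (abs_nonneg _).trans (h1 fun _ ↦ 0).le
  exact norm_le_of_forall_single _ hε fun a ↦ (h1 a).le

/-- The second derivatives of a `C²`-bounded function are locally bounded in each chart. -/
theorem exists_bound_of_C2Close [T2Space M] (hp : p ∈ A.src i) (hε : 0 ≤ ε) :
    ∃ K : ℝ, ∀ᶠ z in 𝓝[range I] (A.h i p), ∀ H H' : M → ℝ, ContMDiff I 𝓘(ℝ, ℝ) 2 H →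
      ContMDiff I 𝓘(ℝ, ℝ) 2 H' → A.C2Close ε H' H →
      ‖fderivWithin ℝ (fderivWithin ℝ (A.loc i (H' - H)) (range I)) (range I) z‖ ≤ K := by
  -- The cores are closed and finite in number, so near p only those that contain p matter.
  -- Closeness is measured on the cores only, hence derivatives at nearby points must be transported
  -- from the chart of a core that contains them.
  have hcore : ∀ᶠ q in 𝓝 p, ∀ j, q ∈ A.core j → p ∈ A.core j := by
    refine eventually_all.2 fun j ↦ ?_
    by_cases hpj : p ∈ A.core j
    · exact Eventually.of_forall fun q _ ↦ hpj
    · filter_upwards [(A.isCompact_core j).isClosed.isOpen_compl.mem_nhds hpj] with q hq hq'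
      exact absurd hq' hq
  have key : ∀ j, ∃ K : ℝ, p ∈ A.core j → ∀ᶠ z in 𝓝[range I] (A.h i p), A.hinv i z ∈ A.core j →
      ∀ H H' : M → ℝ, ContMDiff I 𝓘(ℝ, ℝ) 2 H → ContMDiff I 𝓘(ℝ, ℝ) 2 H' → A.C2Close ε H' H →
      ‖fderivWithin ℝ (fderivWithin ℝ (A.loc i (H' - H)) (range I)) (range I) z‖ ≤ K := by
    intro j
    by_cases hpj : p ∈ A.core j
    swap
    · exact ⟨0, fun h ↦ absurd h hpj⟩
    have hpj' : p ∈ A.src j := A.core_subset j hpj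
    set S := A.tgt i ∩ A.hinv i ⁻¹' A.src j with hS
    have hSR : S ⊆ range I := fun z hz ↦ A.tgt_subset_range i hz.1
    have hSn : ∀ z ∈ S, S ∈ 𝓝[range I] z := fun z hz ↦
      inter_mem (A.tgt_mem_nhdsWithin' hz.1)
        ((A.continuousWithinAt_hinv hz.1).preimage_mem_nhdsWithin ((A.isOpen_src j).mem_nhds hz.2))
    have hSu := uniqueDiffOn_of_mem_nhdsWithin I.uniqueDiffOn hSR hSn
    have hTu : UniqueDiffOn ℝ (A.tgt j) := uniqueDiffOn_of_mem_nhdsWithin I.uniqueDiffOn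
      (A.tgt_subset_range j) fun z hz ↦ A.tgt_mem_nhdsWithin' hz
    set ψ : E4 → E4 := fun z ↦ A.h j (A.hinv i z) with hψ
    have hψS : ContDiffOn ℝ ∞ ψ S := by
      rw [← contMDiffOn_iff_contDiffOn]
      intro z hz
      exact (A.contMDiffAt_h hz.2).comp_contMDiffWithinAt z
        ((A.contMDiffOn_hinv i z hz.1).mono inter_subset_left)
    have hpS : A.h i p ∈ S := ⟨A.h_mem_tgt hp, by rw [mem_preimage, A.hinv_h hp]; exact hpj'⟩
    have hD : ∀ n : ℕ, ∃ D : ℝ, ∀ᶠ z in 𝓝[range I] (A.h i p),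
        ‖iteratedFDerivWithin ℝ n ψ S z‖ ≤ D := by
      intro n
      have hc := ((hψS.continuousOn_iteratedFDerivWithin (m := n) (by exact_mod_cast le_top) hSu)
        (A.h i p) hpS).mono_of_mem_nhdsWithin (hSn _ hpS)
      exact ⟨_, (hc.norm.eventually_lt_const (lt_add_one _)).mono fun z hz ↦ hz.le⟩
    obtain ⟨D₁, hD₁⟩ := hD 1
    obtain ⟨D₂, hD₂⟩ := hD 2
    set D := max 1 (max D₁ D₂) with hDdef
    -- The bound n! C Dⁿ for the n-th derivative of a composition with the transition map, with n =
    -- 2 and C = 4² ε. Taking D ≥ 1 makes the bound D₂ on second derivatives at most D².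
    refine ⟨2 * (16 * ε) * D ^ 2, fun _ ↦ ?_⟩
    filter_upwards [hD₁, hD₂, hSn _ hpS] with z hz1 hz2 hzS hzc H H' hH hH' hHH'
    rw [norm_iteratedFDerivWithin_two I.uniqueDiffOn (hSR hzS),
      ← iteratedFDerivWithin_eq_of_mem_nhdsWithin hSR (hSn z hzS)]
    have hcongr : iteratedFDerivWithin ℝ 2 (A.loc i (H' - H)) S z =
        iteratedFDerivWithin ℝ 2 (A.loc j (H' - H) ∘ ψ) S z := by
      refine iteratedFDerivWithin_congr (fun w hw ↦ ?_) hzS 2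
      simp only [loc, Function.comp, hψ]
      rw [A.hinv_h hw.2]
    rw [hcongr]
    have hg : ContDiffOn ℝ 2 (A.loc j (H' - H)) (A.tgt j) :=
      A.contDiffOn_loc (n := 2) (hH'.sub hH) j
    have := norm_iteratedFDerivWithin_comp_le (n := 2) (N := 2) (C := 16 * ε) (D := D) hg
      (hψS.of_le (by norm_cast)) le_rfl hTu hSu (fun w hw ↦ A.h_mem_tgt hw.2) hzS
      (fun k hk ↦ by
        rw [iteratedFDerivWithin_eq_of_mem_nhdsWithin (A.tgt_subset_range j)
          (A.tgt_mem_nhdsWithin (p := A.hinv i z) hzS.2)]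
        refine (hHH'.norm_iteratedFDerivWithin_le A hzc hk).trans ?_
        refine mul_le_mul_of_nonneg_right ?_ hε
        calc (4 : ℝ) ^ k ≤ 4 ^ 2 := pow_le_pow_right₀ (by norm_num) hk
          _ = 16 := by norm_num)
      (fun k hk1 hk2 ↦ by
        have h1D : 1 ≤ D := le_max_left _ _
        interval_cases k
        · rw [pow_one]
          exact hz1.trans ((le_max_left _ _).trans (le_max_right _ _))
        · have h2D : D₂ ≤ D := (le_max_right _ _).trans (le_max_right _ _)
          nlinarith)
    simpa using this
  choose K hK using key
  refine ⟨∑ j, |K j|, ?_⟩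
  have h1 : ∀ᶠ z in 𝓝[range I] (A.h i p), ∀ j, A.hinv i z ∈ A.core j → p ∈ A.core j :=
    (A.tendsto_hinv_nhds hp).eventually hcore
  have h2 : ∀ᶠ z in 𝓝[range I] (A.h i p), ∀ j, p ∈ A.core j → A.hinv i z ∈ A.core j →
      ∀ H H' : M → ℝ, ContMDiff I 𝓘(ℝ, ℝ) 2 H → ContMDiff I 𝓘(ℝ, ℝ) 2 H' → A.C2Close ε H' H →
      ‖fderivWithin ℝ (fderivWithin ℝ (A.loc i (H' - H)) (range I)) (range I) z‖ ≤ K j := by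
    refine eventually_all.2 fun j ↦ ?_
    by_cases hpj : p ∈ A.core j
    · exact (hK j hpj).mono fun z hz _ ↦ hz
    · exact Eventually.of_forall fun z h ↦ absurd h hpj
  filter_upwards [h1, h2] with z hz1 hz2 H H' hH hH' hHH'
  obtain ⟨j, hj⟩ := mem_iUnion.1 (A.iUnion_core ▸ mem_univ (A.hinv i z))
  refine (hz2 j (hz1 j hj) hj H H' hH hH' hHH').trans ((le_abs_self _).trans ?_)
  exact Finset.single_le_sum (f := fun j ↦ |K j|) (fun j _ ↦ abs_nonneg _) (Finset.mem_univ j)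

/-- The Hamiltonians that agree with `H` outside `N` and are `ε`-close to `H` in the `C²` sense. -/
def perturbations (ε : ℝ) (H : M → ℝ) (N : Set M) : Set (M → ℝ) :=
  {H' | IsHamiltonian I 2 H' ∧ A.C2Close ε H' H ∧ ∀ z ∉ N, H' z = H z}

theorem monotone_perturbations (ε : ℝ) (H : M → ℝ) : Monotone (A.perturbations ε H) :=
  fun _ _ hN _ h ↦ ⟨h.1, h.2.1, fun z hz ↦ h.2.2 z fun hz' ↦ hz (hN hz')⟩

/-- The filter of the perturbations of `H` supported in smaller and smaller neighborhoods of `Γ`. -/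
def thinFilter (ε : ℝ) (H : M → ℝ) (Γ : Set M) : Filter (M → ℝ) :=
  (𝓝ˢ Γ).lift' (A.perturbations ε H)

theorem eventually_thinFilter_iff {Γ : Set M} {P : (M → ℝ) → Prop} :
    (∀ᶠ H' in A.thinFilter ε H Γ, P H') ↔ ∃ N ∈ 𝓝ˢ Γ, ∀ H' ∈ A.perturbations ε H N, P H' :=
  mem_lift'_sets (A.monotone_perturbations ε H)

theorem fderivWithin_loc_sub (hH : ContMDiff I 𝓘(ℝ, ℝ) 2 H) (hH' : ContMDiff I 𝓘(ℝ, ℝ) 2 H')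
    (hz : z ∈ A.tgt i) :
    fderivWithin ℝ (A.loc i (H' - H)) (range I) z
      = fderivWithin ℝ (A.loc i H') (range I) z - fderivWithin ℝ (A.loc i H) (range I) z :=
  fderivWithin_fun_sub (I.uniqueDiffOn z (A.tgt_subset_range i hz))
    ((A.contDiffWithinAt_loc (n := 2) hH' hz).differentiableWithinAt (by simp))
    ((A.contDiffWithinAt_loc (n := 2) hH hz).differentiableWithinAt (by simp))

theorem dvf_sub (hH : ContMDiff I 𝓘(ℝ, ℝ) 2 H) (hH' : ContMDiff I 𝓘(ℝ, ℝ) 2 H')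
    (hz : z ∈ A.tgt i) : A.dvf i H' z - A.dvf i H z = A.dvf i (H' - H) z := by
  have h1 : fderivWithin ℝ (A.loc i (H' - H)) (range I) =ᶠ[𝓝[range I] z]
      fun w ↦ fderivWithin ℝ (A.loc i H') (range I) w - fderivWithin ℝ (A.loc i H) (range I) w := by
    filter_upwards [A.tgt_mem_nhdsWithin' hz] with w hw using A.fderivWithin_loc_sub hH hH' hw
  have hu := I.uniqueDiffOn z (A.tgt_subset_range i hz)
  rw [dvf, dvf, dvf, h1.fderivWithin_eq (A.fderivWithin_loc_sub hH hH' hz),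
    fderivWithin_fun_sub hu
      ((A.contDiffWithinAt_fderivWithin_loc hH' hz).differentiableWithinAt (by simp))
      ((A.contDiffWithinAt_fderivWithin_loc hH hz).differentiableWithinAt (by simp)),
    ContinuousLinearMap.comp_sub]

/-- Perturbations with bounded second derivatives that are supported in thin neighborhoods of a
closed set with dense complement are small in the `C¹` sense. -/
theorem c1Conv_thinFilter [T2Space M] [CompactSpace M]
    (hH : IsHamiltonian I 2 H) (hε : 0 ≤ ε) {Γ : Set M}
    (hΓ : IsClosed Γ) (hd : Dense Γᶜ) : A.C1Conv (A.thinFilter ε H Γ) H := by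
  have hH2 : ContMDiff I 𝓘(ℝ, ℝ) 2 H := hH.1
  have hall : ∀ᶠ H' in A.thinFilter ε H Γ, IsHamiltonian I 2 H' ∧ A.C2Close ε H' H :=
    A.eventually_thinFilter_iff.2 ⟨univ, univ_mem, fun H' h ↦ ⟨h.1, h.2.1⟩⟩
  have hdiff : ∀ {i p}, p ∈ A.src i → ∃ K : ℝ, 0 ≤ K ∧ ∀ᶠ z in 𝓝[range I] (A.h i p),
      ∀ H' : M → ℝ, IsHamiltonian I 2 H' → A.C2Close ε H' H →
        ‖A.dvf i H' z - A.dvf i H z‖ ≤ K := by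
    intro i p hp
    obtain ⟨K, hK⟩ := A.exists_bound_of_C2Close hp hε
    refine ⟨‖stdDual‖ * |K|, by positivity, ?_⟩
    filter_upwards [hK, A.tgt_mem_nhdsWithin hp] with z hz hzt H' hH' hHH'
    rw [A.dvf_sub hH2 hH'.1 hzt, dvf]
    refine (ContinuousLinearMap.opNorm_comp_le _ _).trans ?_
    exact mul_le_mul_of_nonneg_left ((hz H H' hH2 hH'.1 hHH').trans (le_abs_self _))
      (norm_nonneg _)
  refine ⟨hall.mono fun H' h ↦ h.1, fun i p hp ↦ ?_, fun i p hp ↦ ?_⟩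
  · obtain ⟨K, hK0, hK⟩ := hdiff hp
    have h1 := (A.continuousWithinAt_dvf hH2 (A.h_mem_tgt hp)).norm.eventually_lt_const
      (lt_add_one _)
    refine ⟨K + (‖A.dvf i H (A.h i p)‖ + 1), ?_⟩
    filter_upwards [hall.prod_mk (hK.and h1)] with P hP
    obtain ⟨⟨hham, hcl⟩, hz, hz'⟩ := hP
    calc ‖A.dvf i P.1 P.2‖ = ‖(A.dvf i P.1 P.2 - A.dvf i H P.2) + A.dvf i H P.2‖ := by
          rw [sub_add_cancel]
      _ ≤ _ := (norm_add_le _ _).trans (add_le_add (hz _ hham hcl) hz'.le)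
  · obtain ⟨K, hK0, hK⟩ := hdiff hp
    have hsub : Tendsto (fun P : (M → ℝ) × E4 ↦ A.vf i P.1 P.2 - A.vf i H P.2)
        (A.thinFilter ε H Γ ×ˢ 𝓝[range I] (A.h i p)) (𝓝 0) := by
      rw [Metric.tendsto_nhds]
      intro η hη
      obtain ⟨ρ₀, hρ₀, ht₀, hs₀⟩ := A.exists_box_subset_tgt (A.h_mem_tgt hp) hK
      -- Within ρ of p there is a point q off Γ, near which thin perturbations equal H. The
      -- difference of the fields vanishes at q and has derivative at most K, so on the box it is at
      -- most 2 K ρ < η.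
      set ρ := min ρ₀ (η / (4 * (K + 1))) with hρ
      have hρ0 : 0 < ρ := by positivity
      have hbs : box I (A.h i p) ρ ⊆ box I (A.h i p) ρ₀ :=
        inter_subset_inter_left _ (closedBall_subset_closedBall (min_le_left _ _))
      obtain ⟨q, hq, hqΓ⟩ := hd.inter_nhds_nonempty (A.h_preimage_box_mem_nhds hp hρ0)
      obtain ⟨hqs, hqb⟩ := hqΓ
      obtain ⟨U, hU, V, hV, hUV⟩ : ∃ U ∈ 𝓝ˢ Γ, ∃ V ∈ 𝓝 q, Disjoint U V := by
        exact Filter.disjoint_iff.1 (disjoint_nhdsSet_nhds.2 (by rwa [hΓ.closure_eq]))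
      have hagree : ∀ᶠ H' in A.thinFilter ε H Γ, H' =ᶠ[𝓝 q] H :=
        A.eventually_thinFilter_iff.2 ⟨U, hU, fun H' h ↦ by
          filter_upwards [hV] with w hw using h.2.2 w fun hwU ↦ hUV.ne_of_mem hwU hw rfl⟩
      have hbn : ∀ᶠ z in 𝓝[range I] (A.h i p), z ∈ box I (A.h i p) ρ := by
        filter_upwards [mem_nhdsWithin_of_mem_nhds (closedBall_mem_nhds _ hρ0),
          self_mem_nhdsWithin] with z h1 h2 using ⟨h1, h2⟩
      filter_upwards [(hall.and hagree).prod_mk hbn] with P hP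
      obtain ⟨⟨⟨hham, hcl⟩, hag⟩, hz⟩ := hP
      have hmv := (convex_box (I := I) (A.h i p) ρ).norm_image_sub_le_of_norm_hasFDerivWithin_le
        (f := fun w ↦ A.vf i P.1 w - A.vf i H w) (f' := fun w ↦ A.dvf i P.1 w - A.dvf i H w)
        (C := K) (fun w hw ↦ ((A.hasFDerivWithinAt_vf hham.1 (ht₀ (hbs hw))).sub
          (A.hasFDerivWithinAt_vf hH2 (ht₀ (hbs hw)))).mono inter_subset_right)
        (fun w hw ↦ hs₀ (hbs hw) P.1 hham hcl) hqb hz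
      have h0 : A.vf i P.1 (A.h i q) - A.vf i H (A.h i q) = 0 := by
        rw [vf, vf, A.localField_h _ hqs, A.localField_h _ hqs, hamField_congr hag, sub_self]
      simp only [h0, sub_zero] at hmv
      rw [dist_zero_right]
      have h2ρ : ‖P.2 - A.h i q‖ ≤ 2 * ρ := by
        have h1 := mem_closedBall.1 hz.1
        have h2 := mem_closedBall.1 hqb.1
        rw [← dist_eq_norm]
        linarith [dist_triangle_right P.2 (A.h i q) (A.h i p)]
      have h4 : ρ ≤ η / (4 * (K + 1)) := min_le_right _ _
      rw [le_div_iff₀ (by positivity)] at h4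
      nlinarith [norm_nonneg (P.2 - A.h i q)]
    have h1 : Tendsto (fun P : (M → ℝ) × E4 ↦ A.vf i H P.2)
        (A.thinFilter ε H Γ ×ˢ 𝓝[range I] (A.h i p)) (𝓝 (A.vf i H (A.h i p))) :=
      (A.continuousWithinAt_vf hH2 (A.h_mem_tgt hp)).tendsto.comp tendsto_snd
    simpa using hsub.add h1

section

variable [T2Space M] [CompactSpace M]
  (hI : range I = univ ∨ range I = {y : E4 | 0 ≤ y 0}) (hH : IsHamiltonian I 2 H)

include A hI hH

theorem hamField_ne_zero_of_flow_ne {x : M} {t : ℝ}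
    (h : Ω.flow H t x ≠ x) : Ω.hamField H x ≠ 0 :=
  fun h0 ↦ h (A.flow_eq_self_of_hamField_eq_zero hI hH h0 t)

theorem hamField_flow_ne_zero {x : M}
    (h : Ω.hamField H x ≠ 0) (t : ℝ) : Ω.hamField H (Ω.flow H t x) ≠ 0 := fun h0 ↦ by
  have := A.flow_eq_self_of_hamField_eq_zero hI hH h0 (-t)
  rw [A.flow_neg_flow hI hH] at this
  rw [← this] at h0
  exact h h0

/-- H is constant on the orbit, so an interior point of a piece of it would be a critical point; but
X_H does not vanish along a regular orbit. -/
theorem dense_compl_orbit {x : M}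
    (h : Ω.hamField H x ≠ 0) (K : Set ℝ) : Dense ((fun t ↦ Ω.flow H t x) '' K)ᶜ := by
  rw [← interior_eq_empty_iff_dense_compl, eq_empty_iff_forall_notMem]
  intro p hp
  obtain ⟨t, -, rfl⟩ := interior_subset hp
  refine A.hamField_flow_ne_zero hI hH h t ?_
  have h1 : H =ᶠ[𝓝 (Ω.flow H t x)] fun _ ↦ H x := by
    filter_upwards [isOpen_interior.mem_nhds hp] with q hq
    obtain ⟨s, -, rfl⟩ := interior_subset hq
    exact comp_flow_eq (A := A) hI hH s x
  have h2 : dHam I H (Ω.flow H t x) = 0 := by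
    rw [dHam_congr h1]
    exact mfderiv_const
  rw [hamField, h2, map_zero]

end

end SymplecticForm.DarbouxAtlas

end

end HamRealizable

namespace HamRealizable

/-! ### Transversal sections and crossing times -/

section

open Metric

variable {B : Type*} [TopologicalSpace B] {I : ModelWithCorners ℝ E4 B}
  {M : Type*} [TopologicalSpace M] [ChartedSpace B M] [IsManifold I ∞ M]

namespace SymplecticForm.DarbouxAtlas

variable {Ω : SymplecticForm I M} (A : Ω.DarbouxAtlas) (H : M → ℝ)

/-- A piece of an affine hyperplane in a chart, transversal to `X_H` at its base point `a`. -/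
structure LocalSection where
  /-- the index of the chart -/
  i : Fin A.num
  /-- the base point -/
  a : M
  mem : a ∈ A.src i
  /-- a linear parametrization of the direction of the hyperplane -/
  E : (Fin 3 → ℝ) →L[ℝ] E4
  /-- a linear form that vanishes on the direction of the hyperplane -/
  ℓ : E4 →L[ℝ] ℝ
  inj : Function.Injective E
  mem_range_iff : ∀ v, v ∈ range E ↔ ℓ v = 0
  pos : 0 < ℓ (A.vf i H (A.h i a))

variable {A H}

namespace LocalSection

variable (S : A.LocalSection H)

/-- The signed height above the section. -/
noncomputable def height (q : M) : ℝ := S.ℓ (A.h S.i q - A.h S.i S.a)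

/-- The points of the section. -/
def carrier : Set M := {q ∈ A.src S.i | S.height q = 0}

theorem a_mem_carrier : S.a ∈ S.carrier := ⟨S.mem, by simp [height]⟩

theorem continuousAt_height {q : M} (hq : q ∈ A.src S.i) : ContinuousAt S.height q :=
  S.ℓ.continuous.continuousAt.comp ((A.continuousAt_h hq).sub continuousAt_const)

/-- The orbit of `q` under `H'` crosses the section exactly once, and upwards, at a time in
`(T - δ, T + δ)`. -/
structure Hits (δ T : ℝ) (H' : M → ℝ) (q : M) : Prop where
  mem : ∀ t ∈ Icc (T - δ) (T + δ), Ω.flow H' t q ∈ A.src S.i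
  mono : StrictMonoOn (fun t ↦ S.height (Ω.flow H' t q)) (Icc (T - δ) (T + δ))
  neg : S.height (Ω.flow H' (T - δ) q) < 0
  pos : 0 < S.height (Ω.flow H' (T + δ) q)

open Classical in
/-- The time in `[T - δ, T + δ]` when the orbit crosses the section. -/
noncomputable def hitTime (δ T : ℝ) (H' : M → ℝ) (q : M) : ℝ :=
  if h : ∃ t ∈ Icc (T - δ) (T + δ), S.height (Ω.flow H' t q) = 0 then h.choose else T

/-- The point where the orbit crosses the section. -/
noncomputable def hit (δ T : ℝ) (H' : M → ℝ) (q : M) : M := Ω.flow H' (S.hitTime δ T H' q) q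

variable {S} {δ T : ℝ} {H' : M → ℝ} {q : M} [T2Space M] [CompactSpace M]
  (hI : range I = univ ∨ range I = {y : E4 | 0 ≤ y 0})

namespace Hits

include hI in
theorem hitTime_spec (hδ : 0 < δ) (hH' : IsHamiltonian I 2 H') (h : S.Hits δ T H' q) :
    S.hitTime δ T H' q ∈ Icc (T - δ) (T + δ) ∧ S.hit δ T H' q ∈ S.carrier := by
  have hex : ∃ t ∈ Icc (T - δ) (T + δ), S.height (Ω.flow H' t q) = 0 := by
    have hc : ContinuousOn (fun t ↦ S.height (Ω.flow H' t q)) (Icc (T - δ) (T + δ)) :=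
      fun t ht ↦ (ContinuousAt.comp (f := fun t ↦ Ω.flow H' t q)
        (S.continuousAt_height (h.mem t ht))
        (A.continuous_flow_time hI hH' q).continuousAt).continuousWithinAt
    obtain ⟨t, ht, ht0⟩ := intermediate_value_Icc (by linarith) hc ⟨h.neg.le, h.pos.le⟩
    exact ⟨t, ht, ht0⟩
  have h1 := hex.choose_spec
  rw [hit, hitTime, dif_pos hex]
  exact ⟨h1.1, h.mem _ h1.1, h1.2⟩

variable (hδ : 0 < δ) (hH' : IsHamiltonian I 2 H') (h : S.Hits δ T H' q)

include hI hδ hH' h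

theorem height_hit : S.height (S.hit δ T H' q) = 0 := (h.hitTime_spec hI hδ hH').2.2

theorem height_neg {t : ℝ} (ht : t ∈ Icc (T - δ) (T + δ)) (htτ : t < S.hitTime δ T H' q) :
    S.height (Ω.flow H' t q) < 0 := by
  have := h.mono ht (h.hitTime_spec hI hδ hH').1 htτ
  exact this.trans_eq (h.height_hit hI hδ hH')

theorem height_pos {t : ℝ} (ht : t ∈ Icc (T - δ) (T + δ)) (htτ : S.hitTime δ T H' q < t) :
    0 < S.height (Ω.flow H' t q) := by
  have := h.mono (h.hitTime_spec hI hδ hH').1 ht htτ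
  exact (h.height_hit hI hδ hH').symm.trans_lt this

theorem hitTime_mem_Ioo : S.hitTime δ T H' q ∈ Ioo (T - δ) (T + δ) := by
  have h1 := (h.hitTime_spec hI hδ hH').1
  have h0 := h.height_hit hI hδ hH'
  rw [hit] at h0
  refine ⟨h1.1.lt_of_ne fun h2 ↦ ?_, h1.2.lt_of_ne fun h2 ↦ ?_⟩
  · rw [← h2] at h0; exact h.neg.ne h0
  · rw [h2] at h0; exact h.pos.ne' h0

theorem eq_hitTime {t : ℝ} (ht : t ∈ Icc (T - δ) (T + δ)) (h0 : S.height (Ω.flow H' t q) = 0) :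
    t = S.hitTime δ T H' q := by
  rcases lt_trichotomy t (S.hitTime δ T H' q) with h1 | h1 | h1
  · exact absurd h0 (h.height_neg hI hδ hH' ht h1).ne
  · exact h1
  · exact absurd h0 (h.height_pos hI hδ hH' ht h1).ne'

/-- The sign of the height at a fixed time tells on which side of that time the crossing occurs, and
at a noncrossing time this sign is an open condition on the initial point. -/
theorem continuousAt_hitTime (hev : ∀ᶠ q' in 𝓝 q, S.Hits δ T H' q') :
    ContinuousAt (S.hitTime δ T H') q := by
  have hτ := h.hitTime_mem_Ioo hI hδ hH'
  have key : ∀ t ∈ Icc (T - δ) (T + δ),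
      ContinuousAt (fun q' ↦ S.height (Ω.flow H' t q')) q := fun t ht ↦
    (S.continuousAt_height (h.mem t ht)).comp
      (continuous_flow_space (A := A) hI hH' t).continuousAt
  refine tendsto_order.2 ⟨fun s hs ↦ ?_, fun s hs ↦ ?_⟩
  · have hm : max s (T - δ) < S.hitTime δ T H' q := max_lt hs hτ.1
    obtain ⟨t, ht1, ht2⟩ := exists_between hm
    have ht : t ∈ Icc (T - δ) (T + δ) := ⟨(le_max_right _ _).trans ht1.le, (ht2.trans hτ.2).le⟩
    filter_upwards [hev, (key t ht).eventually_lt_const (h.height_neg hI hδ hH' ht ht2)] with q' h' hq'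
    by_contra hle
    push Not at hle
    have hlt : S.hitTime δ T H' q' < t := hle.trans_lt ((le_max_left _ _).trans_lt ht1)
    exact hq'.not_gt (h'.height_pos hI hδ hH' ht hlt)
  · have hm : S.hitTime δ T H' q < min s (T + δ) := lt_min hs hτ.2
    obtain ⟨t, ht1, ht2⟩ := exists_between hm
    have ht : t ∈ Icc (T - δ) (T + δ) := ⟨(hτ.1.trans ht1).le, ht2.le.trans (min_le_right _ _)⟩
    filter_upwards [hev, (key t ht).eventually_const_lt (h.height_pos hI hδ hH' ht ht1)] with q' h' hq'
    by_contra hle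
    push Not at hle
    have hlt : t < S.hitTime δ T H' q' := (ht2.trans_le (min_le_left _ _)).trans_le hle
    exact hq'.not_gt (h'.height_neg hI hδ hH' ht hlt)

end Hits

variable {𝓕 : Filter (M → ℝ)} (hH : IsHamiltonian I 2 H)

include hI hH

/-- Along an orbit of H' the height grows at the rate ℓ(X_{H'}), which is positive near the base
point by transversality of X_H and convergence of the fields. -/
theorem eventually_height_mono (S : A.LocalSection H) (hC : A.C1Conv 𝓕 H)
    (hq : Ω.flow H T q = S.a) :
    ∃ δ > 0, ∀ᶠ P in 𝓕 ×ˢ 𝓝 q, (∀ t ∈ Icc (T - δ) (T + δ), Ω.flow P.1 t P.2 ∈ A.src S.i ∧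
        0 < S.ℓ (A.vf S.i P.1 (A.h S.i (Ω.flow P.1 t P.2)))) ∧
      StrictMonoOn (fun t ↦ S.height (Ω.flow P.1 t P.2)) (Icc (T - δ) (T + δ)) := by
  have h1 : ∀ᶠ P in 𝓕 ×ˢ 𝓝 S.a, P.2 ∈ A.src S.i ∧ 0 < S.ℓ (A.vf S.i P.1 (A.h S.i P.2)) := by
    refine (tendsto_snd.eventually ((A.isOpen_src S.i).eventually_mem S.mem)).and ?_
    have h2 := (S.ℓ.continuous.tendsto _).comp ((hC.conv S.i S.a S.mem).comp
      (tendsto_fst.prodMk ((A.tendsto_h_nhdsWithin S.mem).comp tendsto_snd)))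
    exact h2.eventually_const_lt S.pos
  have h2 := hC.tendsto_flow hI hH T q
  rw [hq] at h2
  have h3 := (tendsto_fst.prodMk h2).eventually h1
  obtain ⟨pa, ha, pb, hb, hab⟩ := eventually_prod_iff.1 h3
  obtain ⟨pc, hc, pd, hd, hcd⟩ := eventually_prod_iff.1 hb
  obtain ⟨δ, hδ, hball⟩ := nhds_basis_closedBall.eventually_iff.1 hc
  refine ⟨δ, hδ, ?_⟩
  filter_upwards [(ha.and hC.ham).prod_mk hd] with P hP
  have hmem : ∀ t ∈ Icc (T - δ) (T + δ), Ω.flow P.1 t P.2 ∈ A.src S.i ∧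
        0 < S.ℓ (A.vf S.i P.1 (A.h S.i (Ω.flow P.1 t P.2))) := fun t ht ↦
    hab hP.1.1 (y := (t, P.2)) (hcd (hball (by rwa [Real.closedBall_eq_Icc])) hP.2)
  have hder : ∀ t ∈ Icc (T - δ) (T + δ), HasDerivAt (fun t ↦ S.height (Ω.flow P.1 t P.2))
      (S.ℓ (A.vf S.i P.1 (A.h S.i (Ω.flow P.1 t P.2)))) t := fun t ht ↦
    S.ℓ.hasFDerivAt.comp_hasDerivAt t
      ((A.hasDerivAt_h_flow hI hP.1.2 (hmem t ht).1).sub_const _)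
  refine ⟨hmem, strictMonoOn_of_deriv_pos (convex_Icc _ _)
    (fun t ht ↦ (hder t ht).continuousAt.continuousWithinAt) fun t ht ↦ ?_⟩
  rw [(hder t (interior_subset ht)).deriv]
  exact (hmem t (interior_subset ht)).2

/-- All δ ≤ δ₀ are allowed because the same crossing is later examined in windows of different
widths. How thin the perturbation must be depends on δ. -/
theorem eventually_hits (S : A.LocalSection H) (hC : A.C1Conv 𝓕 H)
    (hq : Ω.flow H T q = S.a) :
    ∃ δ₀ > 0, ∀ δ ∈ Ioc 0 δ₀, ∀ᶠ P in 𝓕 ×ˢ 𝓝 q, S.Hits δ T P.1 P.2 ∧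
      ∀ t ∈ Icc (T - δ) (T + δ), 0 < S.ℓ (A.vf S.i P.1 (A.h S.i (Ω.flow P.1 t P.2))) := by
  obtain ⟨δ₁, hδ₁, h1⟩ := eventually_height_mono hI hH S hC hq
  obtain ⟨δ₂, hδ₂, h2⟩ := eventually_height_mono hI hH S (A.c1Conv_pure hH) hq
  rw [pure_prod, eventually_map] at h2
  have h2 := h2.self_of_nhds
  refine ⟨min δ₁ δ₂, lt_min hδ₁ hδ₂, fun δ hδ ↦ ?_⟩
  have hle1 : δ ≤ δ₁ := hδ.2.trans (min_le_left _ _)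
  have hle2 : δ ≤ δ₂ := hδ.2.trans (min_le_right _ _)
  have hsub : Icc (T - δ) (T + δ) ⊆ Icc (T - δ₁) (T + δ₁) := Icc_subset_Icc (by linarith) (by linarith)
  have hsub2 : Icc (T - δ) (T + δ) ⊆ Icc (T - δ₂) (T + δ₂) := Icc_subset_Icc (by linarith) (by linarith)
  have hT : T ∈ Icc (T - δ) (T + δ) := ⟨by linarith [hδ.1], by linarith [hδ.1]⟩
  have hm : T - δ ∈ Icc (T - δ) (T + δ) := ⟨le_rfl, by linarith [hδ.1]⟩
  have hp : T + δ ∈ Icc (T - δ) (T + δ) := ⟨by linarith [hδ.1], le_rfl⟩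
  have h0 : S.height (Ω.flow H T q) = 0 := by rw [hq]; exact S.a_mem_carrier.2
  have hcont : ∀ t ∈ Icc (T - δ) (T + δ), Tendsto
      (fun P : (M → ℝ) × M ↦ S.height (Ω.flow P.1 t P.2)) (𝓕 ×ˢ 𝓝 q)
      (𝓝 (S.height (Ω.flow H t q))) := fun t ht ↦
    (S.continuousAt_height (h2.1 t (hsub2 ht)).1).tendsto.comp
      ((hC.tendsto_flow hI hH t q).comp
        (tendsto_fst.prodMk (tendsto_const_nhds.prodMk tendsto_snd)))
  have hneg : S.height (Ω.flow H (T - δ) q) < 0 := by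
    rw [← h0]; exact h2.2 (hsub2 hm) (hsub2 hT) (by linarith [hδ.1])
  have hpos : 0 < S.height (Ω.flow H (T + δ) q) := by
    rw [← h0]; exact h2.2 (hsub2 hT) (hsub2 hp) (by linarith [hδ.1])
  filter_upwards [h1, (hcont _ hm).eventually_lt_const hneg,
    (hcont _ hp).eventually_const_lt hpos] with P hP hP1 hP2
  exact ⟨⟨fun t ht ↦ (hP.1 t (hsub ht)).1, hP.2.mono hsub, hP1, hP2⟩,
    fun t ht ↦ (hP.1 t (hsub ht)).2⟩

end LocalSection

end SymplecticForm.DarbouxAtlas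

end

end HamRealizable

namespace HamRealizable

/-! ### Invariance of the flux measure under transition maps -/

section

open Metric

/-- The 4-form `ω ∧ ω` of `ℝ⁴`. -/
noncomputable def stdSq (a b c d : E4) : ℝ :=
  2 * (stdForm a b * stdForm c d - stdForm a c * stdForm b d + stdForm a d * stdForm b c)

theorem stdForm_add_left (a b c : E4) : stdForm (a + b) c = stdForm a c + stdForm b c := by
  simp [stdForm]; ring

theorem stdForm_add_right (a b c : E4) : stdForm a (b + c) = stdForm a b + stdForm a c := by
  simp [stdForm]; ring

theorem stdForm_smul_left (r : ℝ) (a b : E4) : stdForm (r • a) b = r * stdForm a b := by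
  simp [stdForm]; ring

theorem stdForm_smul_right (r : ℝ) (a b : E4) : stdForm a (r • b) = r * stdForm a b := by
  simp [stdForm]; ring

/-- The form ω² is alternating, so components along v are invisible after contraction with v. In the
transition map these components come from the variable arrival time. -/
theorem stdSq_add_smul (v a b c : E4) (r s t : ℝ) :
    stdSq v (r • v + a) (s • v + b) (t • v + c) = stdSq v a b c := by
  simp only [stdSq, stdForm_add_left, stdForm_add_right, stdForm_smul_left, stdForm_smul_right,
    stdForm_self, stdForm_swap b v, stdForm_swap a v]
  ring

/-- The contraction of `ω ∧ ω` with a vector is multiplied by the determinant. -/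
theorem stdSq_comp (v : E4) (F : (Fin 3 → ℝ) →L[ℝ] E4) (m : (Fin 3 → ℝ) →L[ℝ] (Fin 3 → ℝ)) :
    stdSq v (F (m (Pi.single 0 1))) (F (m (Pi.single 1 1))) (F (m (Pi.single 2 1)))
      = m.det * stdSq v (F (Pi.single 0 1)) (F (Pi.single 1 1)) (F (Pi.single 2 1)) := by
  have hF : ∀ u : Fin 3 → ℝ, F u = u 0 • F (Pi.single 0 1) + u 1 • F (Pi.single 1 1)
      + u 2 • F (Pi.single 2 1) := by
    intro u
    conv_lhs => rw [pi_eq_sum_univ' u]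
    rw [map_sum, Fin.sum_univ_three]
    simp only [map_smul]
  have hdet : m.det = Matrix.det (LinearMap.toMatrix' (m : (Fin 3 → ℝ) →ₗ[ℝ] (Fin 3 → ℝ))) :=
    (LinearMap.det_toMatrix' _).symm
  rw [hdet, Matrix.det_fin_three]
  simp only [LinearMap.toMatrix'_apply, ContinuousLinearMap.coe_coe]
  rw [hF (m (Pi.single 0 1)), hF (m (Pi.single 1 1)), hF (m (Pi.single 2 1))]
  generalize F (Pi.single 0 1) = f0
  generalize F (Pi.single 1 1) = f1
  generalize F (Pi.single 2 1) = f2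
  generalize m (Pi.single 0 1) = u0
  generalize m (Pi.single 1 1) = u1
  generalize m (Pi.single 2 1) = u2
  simp only [stdSq, stdForm_add_left, stdForm_add_right, stdForm_smul_left, stdForm_smul_right,
    stdForm_self, stdForm_swap f1 f0, stdForm_swap f2 f0, stdForm_swap f2 f1]
  ring

/-- A continuous solution of an equation `g(u(x), x) = 0` is differentiable. -/
theorem hasFDerivWithinAt_of_implicit {E : Type*} [NormedAddCommGroup E] [NormedSpace ℝ E]
    {g : ℝ × E → ℝ} {g' : ℝ × E →L[ℝ] ℝ} {s : Set E} {x₀ : E} {u : E → ℝ}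
    (hg : HasFDerivWithinAt g g' (univ ×ˢ s) (u x₀, x₀)) (hc : g' (1, 0) ≠ 0)
    (hu : ContinuousWithinAt u s x₀) (hx₀ : x₀ ∈ s) (h0 : ∀ x ∈ s, g (u x, x) = 0) :
    HasFDerivWithinAt u (-(g' (1, 0))⁻¹ • g' ∘L ContinuousLinearMap.inr ℝ ℝ E) s x₀ := by
  set c := g' (1, 0) with hcdef
  set m := g' ∘L ContinuousLinearMap.inr ℝ ℝ E with hm
  have hg' : ∀ t x, g' (t, x) = t * c + m x := by
    intro t x
    have : ((t, x) : ℝ × E) = t • ((1, 0) : ℝ × E) + (0, x) := by simp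
    rw [this, map_add, map_smul, smul_eq_mul]
    simp [hm, hcdef]
  have ht : Tendsto (fun x ↦ (u x, x)) (𝓝[s] x₀) (𝓝[univ ×ˢ s] (u x₀, x₀)) := by
    rw [nhdsWithin_prod_eq, nhdsWithin_univ]
    exact hu.tendsto.prodMk tendsto_id
  have h1 := (hasFDerivWithinAt_iff_isLittleO.1 hg).comp_tendsto ht
  have h2 : (fun x ↦ (u x - u x₀) * c + m (x - x₀)) =o[𝓝[s] x₀]
      fun x ↦ ((u x - u x₀, x - x₀) : ℝ × E) := by
    refine (h1.neg_left).congr' ?_ (Eventually.of_forall fun x ↦ rfl)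
    filter_upwards [self_mem_nhdsWithin] with x hx
    simp only [Function.comp, h0 x hx, h0 x₀ hx₀, Prod.mk_sub_mk, hg']
    ring
  -- A Lipschitz bound at x₀ comes first: half of |c| |u x - u x₀| absorbs the part of the error
  -- that depends on the unknown increment. The remainder is then o(‖x - x₀‖), which identifies the
  -- derivative.
  have h3 : (fun x ↦ u x - u x₀) =O[𝓝[s] x₀] fun x ↦ x - x₀ := by
    have hc' : 0 < |c| := abs_pos.2 hc
    refine Asymptotics.IsBigO.of_bound ((‖m‖ + |c| / 2) / (|c| / 2)) ?_
    filter_upwards [h2.bound (half_pos hc')] with x hx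
    have h4 : ‖((u x - u x₀, x - x₀) : ℝ × E)‖ ≤ |u x - u x₀| + ‖x - x₀‖ := by
      rw [Prod.norm_def]
      exact max_le (by simp) (by simp)
    have h5 : |u x - u x₀| * |c| ≤ ‖(u x - u x₀) * c + m (x - x₀)‖ + ‖m‖ * ‖x - x₀‖ := by
      rw [← abs_mul]
      calc |(u x - u x₀) * c| = ‖((u x - u x₀) * c + m (x - x₀)) - m (x - x₀)‖ := by
            rw [add_sub_cancel_right, Real.norm_eq_abs]
        _ ≤ _ := (norm_sub_le _ _).trans (by gcongr; exact m.le_opNorm _)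
    rw [Real.norm_eq_abs, div_mul_eq_mul_div, le_div_iff₀ (by positivity)]
    nlinarith [abs_nonneg (u x - u x₀)]
  have h4 : (fun x ↦ ((u x - u x₀, x - x₀) : ℝ × E)) =O[𝓝[s] x₀] fun x ↦ x - x₀ :=
    h3.prod_left (Asymptotics.isBigO_refl _ _)
  have h5 := (h2.trans_isBigO h4).const_mul_left c⁻¹
  rw [hasFDerivWithinAt_iff_isLittleO]
  refine h5.congr_left fun x ↦ ?_
  simp only [smul_apply, smul_eq_mul]
  field_simp
  ring

variable {B : Type*} [TopologicalSpace B] {I : ModelWithCorners ℝ E4 B}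
  {M : Type*} [TopologicalSpace M] [ChartedSpace B M] [IsManifold I ∞ M]

namespace SymplecticForm.DarbouxAtlas.LocalSection

variable {Ω : SymplecticForm I M} {A : Ω.DarbouxAtlas} {H H' : M → ℝ} (S S' : A.LocalSection H)

/-- The affine parametrization of the section, in the chart. -/
noncomputable def param (c : Fin 3 → ℝ) : E4 := A.h S.i S.a + S.E c

/-- The point of the section with the given coordinates. -/
noncomputable def pt (c : Fin 3 → ℝ) : M := A.hinv S.i (S.param c)

theorem exists_leftInverse : ∃ R : E4 →L[ℝ] (Fin 3 → ℝ), ∀ c, R (S.E c) = c := by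
  obtain ⟨g, hg⟩ := LinearMap.exists_leftInverse_of_injective
    (S.E : (Fin 3 → ℝ) →ₗ[ℝ] E4) (LinearMap.ker_eq_bot.2 S.inj)
  exact ⟨LinearMap.toContinuousLinearMap g, fun c ↦ congrArg (fun f ↦ f c) hg⟩

/-- The coordinates of a vector, with respect to the parametrization of the section. -/
noncomputable def R : E4 →L[ℝ] (Fin 3 → ℝ) := S.exists_leftInverse.choose

theorem R_E (c : Fin 3 → ℝ) : S.R (S.E c) = c := S.exists_leftInverse.choose_spec c

theorem E_R {v : E4} (h : S.ℓ v = 0) : S.E (S.R v) = v := by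
  obtain ⟨c, rfl⟩ := (S.mem_range_iff v).2 h
  rw [R_E]

/-- The coordinates of a point of the section. -/
noncomputable def coord (q : M) : Fin 3 → ℝ := S.R (A.h S.i q - A.h S.i S.a)

theorem param_coord {q : M} (hq : q ∈ S.carrier) : S.param (S.coord q) = A.h S.i q := by
  rw [param, coord, S.E_R hq.2, add_sub_cancel]

theorem pt_coord {q : M} (hq : q ∈ S.carrier) : S.pt (S.coord q) = q := by
  rw [pt, S.param_coord hq, A.hinv_h hq.1]

/-- The coordinates of the points of a set that lie in the section. -/
noncomputable def coords (Y : Set M) : Set (Fin 3 → ℝ) := {c | ∃ y ∈ Y ∩ S.carrier, A.h S.i y = S.param c}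

theorem pt_mem {Y : Set M} {c : Fin 3 → ℝ} (hc : c ∈ S.coords Y) :
    S.pt c ∈ Y ∩ S.carrier ∧ A.h S.i (S.pt c) = S.param c ∧ S.coord (S.pt c) = c := by
  obtain ⟨y, hy, h⟩ := hc
  have h1 : S.pt c = y := by rw [pt, ← h, A.hinv_h hy.2.1]
  rw [h1]
  refine ⟨hy, h, ?_⟩
  rw [coord, h, param, add_sub_cancel_left, R_E]

theorem coord_mem {Y : Set M} {q : M} (hq : q ∈ Y) (hq' : q ∈ S.carrier) :
    S.coord q ∈ S.coords Y := ⟨q, ⟨hq, hq'⟩, (S.param_coord hq').symm⟩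

theorem coords_mono {Y Z : Set M} (h : Y ⊆ Z) : S.coords Y ⊆ S.coords Z :=
  fun _ ⟨y, hy, hc⟩ ↦ ⟨y, ⟨h hy.1, hy.2⟩, hc⟩

theorem continuous_param : Continuous S.param := continuous_const.add S.E.continuous

theorem continuousOn_pt (Y : Set M) : ContinuousOn S.pt (S.coords Y) := by
  intro c hc
  have h1 := S.pt_mem hc
  have h2 := A.continuousWithinAt_hinv (A.h_mem_tgt h1.1.2.1)
  rw [h1.2.1] at h2
  refine h2.comp S.continuous_param.continuousWithinAt fun c' hc' ↦ ?_
  rw [← (S.pt_mem hc').2.1]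
  exact A.h_mem_range _ _

theorem mapsTo_param (Y : Set M) : MapsTo S.param (S.coords Y) (range I) := fun c hc ↦ by
  rw [← (S.pt_mem hc).2.1]; exact A.h_mem_range _ _

theorem hasFDerivAt_param (c : Fin 3 → ℝ) : HasFDerivAt S.param S.E c :=
  S.E.hasFDerivAt.const_add _

/-- The density of `ι_X ω²` in the coordinates of the section. -/
noncomputable def density (H' : M → ℝ) (c : Fin 3 → ℝ) : ℝ :=
  |Ω.sq (S.pt c) (Ω.hamField H' (S.pt c)) ((A.dh S.i (S.pt c)).inverse (S.E (Pi.single 0 1)))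
    ((A.dh S.i (S.pt c)).inverse (S.E (Pi.single 1 1)))
    ((A.dh S.i (S.pt c)).inverse (S.E (Pi.single 2 1)))|

theorem density_eq {c : Fin 3 → ℝ} (hc : S.pt c ∈ A.src S.i) :
    S.density H' c = |stdSq (A.dh S.i (S.pt c) (Ω.hamField H' (S.pt c))) (S.E (Pi.single 0 1))
      (S.E (Pi.single 1 1)) (S.E (Pi.single 2 1))| := by
  rw [density, sq, stdSq]
  simp only [← A.stdForm_dh hc, A.dh_dh_inverse hc]

theorem coords_image {Y : Set M} (hY : Y ⊆ S.carrier) {P : M → M}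
    (hmaps : ∀ y ∈ Y, P y ∈ S'.carrier) :
    S'.coords (P '' Y) = (fun c ↦ S'.coord (P (S.pt c))) '' S.coords Y := by
  ext c'
  constructor
  · rintro ⟨_, ⟨⟨y, hy, rfl⟩, h1⟩, h2⟩
    refine ⟨S.coord y, S.coord_mem hy (hY hy), ?_⟩
    simp only
    rw [S.pt_coord (hY hy), coord, h2, param, add_sub_cancel_left, R_E]
  · rintro ⟨c, hc, rfl⟩
    have h1 := S.pt_mem hc
    exact S'.coord_mem (mem_image_of_mem _ h1.1.1) (hmaps _ h1.1.1)

variable [T2Space M] [CompactSpace M]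
  (hI : range I = univ ∨ range I = {y : E4 | 0 ≤ y 0})

include hI

/-- The differential of a transition map between two sections along the flow of `H'`, and its
determinant. -/
theorem exists_hasFDerivWithinAt_transition (hH' : IsHamiltonian I 2 H') {Y : Set M}
    {u : M → ℝ} (hu : ContinuousOn u Y)
    (hmaps : ∀ y ∈ Y, Ω.flow H' (u y) y ∈ S'.carrier)
    (htr : ∀ y ∈ Y, S'.ℓ (A.vf S'.i H' (A.h S'.i (Ω.flow H' (u y) y))) ≠ 0)
    {c : Fin 3 → ℝ} (hc : c ∈ S.coords Y) :
    ∃ p' : (Fin 3 → ℝ) →L[ℝ] (Fin 3 → ℝ),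
      HasFDerivWithinAt (fun c ↦ S'.coord (Ω.flow H' (u (S.pt c)) (S.pt c))) p' (S.coords Y) c ∧
      |p'.det| * S'.density H' (S'.coord (Ω.flow H' (u (S.pt c)) (S.pt c)))
        = S.density H' c := by
  obtain ⟨⟨hyY, hyS⟩, hyc, -⟩ := S.pt_mem hc
  set y := S.pt c with hy
  set t₀ := u y with ht₀
  set q' := Ω.flow H' t₀ y with hq'
  have hq'S : q' ∈ S'.carrier := hmaps y hyY
  obtain ⟨L, hL, hd⟩ := hasFDerivWithinAt_flow (A := A) hI hH' (t₀ := t₀) hyS.1 hq'S.1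
  rw [← hq'] at hL
  set v₀ := A.vf S'.i H' (A.h S'.i q') with hv₀
  have htr' : S'.ℓ v₀ ≠ 0 := htr y hyY
  -- the flow, as a function of time and coordinates
  have hG : HasFDerivWithinAt (fun P : ℝ × (Fin 3 → ℝ) ↦ A.h S'.i (Ω.flow H' P.1 (S.pt P.2)))
      ((ContinuousLinearMap.fst ℝ ℝ (Fin 3 → ℝ)).smulRight v₀
        + (L ∘L S.E) ∘L ContinuousLinearMap.snd ℝ ℝ (Fin 3 → ℝ)) (univ ×ˢ S.coords Y) (t₀, c) := by
    have h1 : HasFDerivWithinAt (fun P : ℝ × (Fin 3 → ℝ) ↦ (P.1, S.param P.2))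
        ((ContinuousLinearMap.fst ℝ ℝ (Fin 3 → ℝ)).prod
          (S.E ∘L ContinuousLinearMap.snd ℝ ℝ (Fin 3 → ℝ))) (univ ×ˢ S.coords Y) (t₀, c) :=
      hasFDerivWithinAt_fst.prodMk
        (HasFDerivAt.comp_hasFDerivWithinAt (f := Prod.snd) (t₀, c) (S.hasFDerivAt_param c)
          hasFDerivWithinAt_snd)
    rw [hyc] at hd
    have h2 := HasFDerivWithinAt.comp (t := (univ : Set ℝ) ×ˢ range I) (t₀, c) hd h1
      (fun P hP ↦ mk_mem_prod (mem_univ _) (S.mapsTo_param Y hP.2))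
    exact h2
  have hun : ContinuousWithinAt (fun c ↦ u (S.pt c)) (S.coords Y) c :=
    ContinuousWithinAt.comp (hu y hyY) (S.continuousOn_pt Y c hc) fun c' hc' ↦ (S.pt_mem hc').1.1
  -- The arrival time solves the equation height = 0, whose time derivative is nonzero by
  -- transversality; hence its mere continuity implies differentiability.
  have hud := hasFDerivWithinAt_of_implicit (u := fun c ↦ u (S.pt c))
    (g := fun P ↦ S'.ℓ (A.h S'.i (Ω.flow H' P.1 (S.pt P.2)) - A.h S'.i S'.a))
    (S'.ℓ.hasFDerivAt.comp_hasFDerivWithinAt (t₀, c) (hG.sub_const _)) (by simpa using htr')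
    hun hc (fun c' hc' ↦ (hmaps _ (S.pt_mem hc').1.1).2)
  set u' := -((S'.ℓ ∘L ((ContinuousLinearMap.fst ℝ ℝ (Fin 3 → ℝ)).smulRight v₀
        + (L ∘L S.E) ∘L ContinuousLinearMap.snd ℝ ℝ (Fin 3 → ℝ))) (1, 0))⁻¹ •
        (S'.ℓ ∘L ((ContinuousLinearMap.fst ℝ ℝ (Fin 3 → ℝ)).smulRight v₀
        + (L ∘L S.E) ∘L ContinuousLinearMap.snd ℝ ℝ (Fin 3 → ℝ))) ∘L
        ContinuousLinearMap.inr ℝ ℝ (Fin 3 → ℝ) with hu'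
  set D : (Fin 3 → ℝ) →L[ℝ] E4 := u'.smulRight v₀ + L ∘L S.E with hD
  have hDa : ∀ e, D e = u' e • v₀ + L (S.E e) := fun e ↦ rfl
  have hDd : HasFDerivWithinAt (fun c ↦ A.h S'.i (Ω.flow H' (u (S.pt c)) (S.pt c))) D
      (S.coords Y) c := by
    have h1 : HasFDerivWithinAt (fun c ↦ (u (S.pt c), c)) (u'.prod (.id ℝ _)) (S.coords Y) c :=
      hud.prodMk (hasFDerivWithinAt_id c _)
    have h2 := HasFDerivWithinAt.comp (f := fun c ↦ (u (S.pt c), c))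
      (t := (univ : Set ℝ) ×ˢ S.coords Y) c hG h1
      (fun c' hc' ↦ mk_mem_prod (mem_univ _) hc')
    refine h2.congr_fderiv ?_
    ext1 e
    rfl
  have hℓD : ∀ e, S'.ℓ (D e) = 0 := by
    intro e
    have : u' e = -(S'.ℓ v₀)⁻¹ * S'.ℓ (L (S.E e)) := by simp [hu']
    rw [hDa, map_add, map_smul, this, smul_eq_mul]
    field_simp
    ring
  refine ⟨S'.R ∘L D, S'.R.hasFDerivAt.comp_hasFDerivWithinAt c (hDd.sub_const _), ?_⟩
  have hED : ∀ e, S'.E ((S'.R ∘L D) e) = D e := fun e ↦ S'.E_R (hℓD e)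
  have hpt' : S'.pt (S'.coord q') = q' := S'.pt_coord hq'S
  have hMD : MDifferentiable I 𝓘(ℝ, ℝ) H' := ContMDiff.mdifferentiable hH'.1 (by simp)
  have hv : A.dh S'.i q' (Ω.hamField H' q') = v₀ := by
    rw [hv₀, vf, A.localField_h _ hq'S.1]
  have hLv : L (A.dh S.i y (Ω.hamField H' y)) = v₀ := by
    rw [hL, tangentFlow_hamField (A := A) hI hH', hv]
  have hLB : ∀ a b, stdForm (L a) (L b) = stdForm a b := by
    intro a b
    rw [← A.dh_dh_inverse hyS.1 a, ← A.dh_dh_inverse hyS.1 b, hL, hL, A.stdForm_dh hq'S.1,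
      A.stdForm_dh hyS.1, form_tangentFlow (A := A) hI hH']
  have hLsq : ∀ a b c d, stdSq (L a) (L b) (L c) (L d) = stdSq a b c d := fun a b c d ↦ by
    simp only [stdSq, hLB]
  have e1 : S'.density H' (S'.coord q') = |stdSq v₀ (S'.E (Pi.single 0 1))
      (S'.E (Pi.single 1 1)) (S'.E (Pi.single 2 1))| := by
    rw [S'.density_eq (by rw [hpt']; exact hq'S.1)]
    have key : ∀ z, z = q' → A.dh S'.i z (Ω.hamField H' z) = v₀ := by rintro _ rfl; exact hv
    rw [key _ hpt']
  -- The derivative `D e` differs from L(E e) by a multiple of v₀, which does not count; L preserves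
  -- ω² and carries the field at y to v₀. What remains is the determinant relation between the two
  -- densities.
  rw [e1, S.density_eq hyS.1, ← abs_mul, ← stdSq_comp, hED, hED, hED, hDa, hDa, hDa,
    stdSq_add_smul, ← hLv, hLsq]

/-- Transition maps between sections along the flow of `H'` preserve the flux measure. -/
theorem lintegral_transition (hH' : IsHamiltonian I 2 H') {Y : Set M}
    {u : M → ℝ} (hY : Y ⊆ S.carrier) (hu : ContinuousOn u Y)
    (hmaps : ∀ y ∈ Y, Ω.flow H' (u y) y ∈ S'.carrier)
    (htr : ∀ y ∈ Y, S'.ℓ (A.vf S'.i H' (A.h S'.i (Ω.flow H' (u y) y))) ≠ 0)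
    (hinj : InjOn (fun y ↦ Ω.flow H' (u y) y) Y) (hm : MeasurableSet (S.coords Y)) :
    ∫⁻ c in S.coords Y, ENNReal.ofReal (S.density H' c)
      = ∫⁻ c in S'.coords ((fun y ↦ Ω.flow H' (u y) y) '' Y), ENNReal.ofReal (S'.density H' c) := by
  choose! p' hp' using fun c hc ↦
    exists_hasFDerivWithinAt_transition S S' hI hH' hu hmaps htr (c := c) hc
  rw [coords_image S S' hY hmaps, lintegral_image_eq_lintegral_abs_det_fderiv_mul volume hm
    (fun c hc ↦ (hp' c hc).1)]
  · refine setLIntegral_congr_fun hm fun c hc ↦ ?_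
    rw [← ENNReal.ofReal_mul (abs_nonneg _), (hp' c hc).2]
  · intro c hc d hd h
    have h1 := S.pt_mem hc
    have h2 := S.pt_mem hd
    have h3 := congrArg S'.pt h
    rw [S'.pt_coord (hmaps _ h1.1.1), S'.pt_coord (hmaps _ h2.1.1)] at h3
    rw [← h1.2.2, ← h2.2.2, hinj h1.1.1 h2.1.1 h3]

/-- Differentiable maps between spaces of equal dimension send null sets to null sets. Measurability
and injectivity are not needed, so this applies to exceptional sets. -/
theorem volume_coords_transition (hH' : IsHamiltonian I 2 H') {Y : Set M}
    {u : M → ℝ} (hY : Y ⊆ S.carrier) (hu : ContinuousOn u Y)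
    (hmaps : ∀ y ∈ Y, Ω.flow H' (u y) y ∈ S'.carrier)
    (htr : ∀ y ∈ Y, S'.ℓ (A.vf S'.i H' (A.h S'.i (Ω.flow H' (u y) y))) ≠ 0)
    (h0 : volume (S.coords Y) = 0) :
    volume (S'.coords ((fun y ↦ Ω.flow H' (u y) y) '' Y)) = 0 := by
  rw [coords_image S S' hY hmaps]
  refine addHaar_image_eq_zero_of_differentiableOn_of_addHaar_eq_zero volume (fun c hc ↦ ?_) h0
  obtain ⟨p', hp', -⟩ := exists_hasFDerivWithinAt_transition S S' hI hH' hu hmaps htr hc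
  exact hp'.differentiableWithinAt

end SymplecticForm.DarbouxAtlas.LocalSection

end

end HamRealizable

namespace HamRealizable

/-! ### Almost everywhere agreement of the fields where the Hamiltonians agree -/

section

open Metric

/-- The derivative of a function that vanishes on a set vanishes at almost every point of it. -/
theorem ae_fderivWithin_eq_zero {n : ℕ} [NeZero n] {s : Set (Fin n → ℝ)} (hs : MeasurableSet s)
    {f : (Fin n → ℝ) → ℝ} {f' : (Fin n → ℝ) → (Fin n → ℝ) →L[ℝ] ℝ}
    (hf : ∀ c ∈ s, HasFDerivWithinAt f (f' c) s c) (h0 : ∀ c ∈ s, f c = 0) :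
    ∀ᵐ c, c ∈ s → f' c = 0 := by
  -- Multiplication by a fixed vector turns f into a self-map of ℝⁿ. On s it is approximated by the
  -- zero map with constant 0, and the derivative is then a.e. within 0 of the zero map.
  set e : Fin n → ℝ := fun _ ↦ 1 with he
  have h1 : ApproximatesLinearOn (fun c ↦ f c • e) (0 : (Fin n → ℝ) →L[ℝ] (Fin n → ℝ)) s 0 := by
    intro x hx y hy
    simp [h0 x hx, h0 y hy]
  have h2 := h1.norm_fderiv_sub_le volume hs (fun c ↦ (f' c).smulRight e)
    (fun c hc ↦ (hf c hc).smul_const e)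
  rw [ae_restrict_iff' hs] at h2
  filter_upwards [h2] with c hc hcs
  have h3 : (f' c).smulRight e = 0 := by
    have := hc hcs
    rw [sub_zero, nonpos_iff_eq_zero, nnnorm_eq_zero] at this
    exact this
  ext1 v
  have h4 := congrFun (congrArg (fun g ↦ g v) h3) 0
  simpa [he] using h4

theorem eq_zero_of_forall_rat {g : ℝ → ℝ} {a b : ℝ} {t : ℝ} (ht : t ∈ Ioo a b)
    (hg : ContinuousAt g t) (h : ∀ q : ℚ, (q : ℝ) ∈ Ioo a b → g q = 0) : g t = 0 := by
  by_contra hne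
  have h1 : ∀ᶠ s in 𝓝 t, g s ≠ 0 ∧ s ∈ Ioo a b :=
    (hg.eventually_ne hne).and (isOpen_Ioo.eventually_mem ht)
  obtain ⟨_, ⟨q, rfl⟩, hs1, hs2⟩ := Rat.isDenseEmbedding_coe_real.dense.inter_nhds_nonempty h1
  exact hs1 (h q hs2)

variable {B : Type*} [TopologicalSpace B] {I : ModelWithCorners ℝ E4 B}
  {M : Type*} [TopologicalSpace M] [ChartedSpace B M] [IsManifold I ∞ M]

namespace SymplecticForm.DarbouxAtlas

variable {Ω : SymplecticForm I M} {A : Ω.DarbouxAtlas} {H H' : M → ℝ}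

namespace LocalSection

variable (S : A.LocalSection H)

theorem mem_coords_iff {Y : Set M} {c : Fin 3 → ℝ} :
    c ∈ S.coords Y ↔ S.param c ∈ A.tgt S.i ∧ S.pt c ∈ Y := by
  constructor
  · intro hc
    have h := S.pt_mem hc
    exact ⟨by rw [← h.2.1]; exact A.h_mem_tgt h.1.2.1, h.1.1⟩
  · rintro ⟨h1, h2⟩
    have h3 : A.h S.i (S.pt c) = S.param c := A.h_hinv h1
    refine ⟨S.pt c, ⟨h2, A.hinv_mem_src h1, ?_⟩, h3⟩
    rw [height, h3, param, add_sub_cancel_left]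
    exact (S.mem_range_iff _).1 (mem_range_self c)

theorem measurableSet_tgt (i : Fin A.num) : MeasurableSet (A.tgt i) := by
  have h : A.tgt i = range I ∩ interior (A.tgt i ∪ (range I)ᶜ) := by
    ext z
    constructor
    · intro hz
      refine ⟨A.tgt_subset_range i hz, ?_⟩
      rw [mem_interior_iff_mem_nhds, union_comm]
      filter_upwards [mem_nhdsWithin_iff_eventually.1 (A.tgt_mem_nhdsWithin' hz)] with w hw
      by_cases hr : w ∈ range I
      · exact Or.inr (hw hr)
      · exact Or.inl hr
    · rintro ⟨hz1, hz2⟩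
      exact (interior_subset hz2).resolve_right fun h ↦ h hz1
  rw [h]
  exact I.isClosed_range.measurableSet.inter isOpen_interior.measurableSet

theorem measurableSet_coords {Y : Set M} (hY : MeasurableSet[borel M] Y) :
    MeasurableSet (S.coords Y) := by
  borelize M
  have hC : MeasurableSet (S.coords univ) := by
    have : S.coords univ = S.param ⁻¹' A.tgt S.i := by
      ext c; simp [mem_coords_iff]
    rw [this]
    exact S.continuous_param.measurable (measurableSet_tgt _)
  have h1 : S.coords Y = Subtype.val '' ((S.coords univ).domRestrict S.pt ⁻¹' Y) := by
    ext c
    constructor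
    · intro hc
      exact ⟨⟨c, S.coords_mono (subset_univ Y) hc⟩, (S.mem_coords_iff.1 hc).2, rfl⟩
    · rintro ⟨c, hc, rfl⟩
      exact S.mem_coords_iff.2 ⟨(S.mem_coords_iff.1 c.2).1, hc⟩
  rw [h1]
  exact hC.subtype_image ((continuousOn_iff_continuous_domRestrict.1
    (S.continuousOn_pt univ)).measurable hY)

/-- A relatively open condition defines a measurable set of coordinates. -/
theorem measurableSet_coords_lt {Z : Set M} (hZ : MeasurableSet (S.coords Z)) {τ : M → ℝ}
    (hτ : ContinuousOn τ Z) (t : ℝ) : MeasurableSet (S.coords {y ∈ Z | t < τ y}) := by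
  have h1 : S.coords {y ∈ Z | t < τ y} = S.coords Z ∩ (fun c ↦ τ (S.pt c)) ⁻¹' Ioi t := by
    ext c
    simp only [mem_coords_iff, mem_inter_iff, mem_preimage, mem_Ioi, mem_ofPred_eq]
    tauto
  have h2 : ContinuousOn (fun c ↦ τ (S.pt c)) (S.coords Z) :=
    hτ.comp (S.continuousOn_pt Z) fun c hc ↦ (S.pt_mem hc).1.1
  obtain ⟨u, hu, hu'⟩ := continuousOn_iff'.1 h2 _ (isOpen_Ioi (a := t))
  rw [h1, inter_comm, hu']
  exact hu.measurableSet.inter hZ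

theorem hasMFDerivWithinAt_pt {Y : Set M} {c : Fin 3 → ℝ} (hc : c ∈ S.coords Y) :
    HasMFDerivWithinAt 𝓘(ℝ, Fin 3 → ℝ) I S.pt (S.coords Y) c
      ((A.dh S.i (S.pt c)).inverse ∘L S.E) := by
  have h1 : HasMFDerivWithinAt 𝓘(ℝ, Fin 3 → ℝ) 𝓘(ℝ, E4) S.param (S.coords Y) c S.E :=
    (S.hasFDerivAt_param c).hasMFDerivAt.hasMFDerivWithinAt
  have hz := A.h_mem_tgt (S.pt_mem hc).1.2.1
  rw [(S.pt_mem hc).2.1] at hz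
  exact HasMFDerivWithinAt.comp c (A.hasMFDerivWithinAt_hinv hz) h1 (S.mapsTo_param Y)

variable [T2Space M] [CompactSpace M]
  (hI : range I = univ ∨ range I = {y : E4 | 0 ≤ y 0})

include hI

/-- If `H'` agrees with `H` on the orbit segments from the points of a measurable subset of the
section, then the vector fields agree there too, for almost every point. -/
theorem ae_hamField_eq (hH : IsHamiltonian I 2 H) (hH' : IsHamiltonian I 2 H') {Z : Set M}
    {τ : M → ℝ} (hτ : ContinuousOn τ Z) (hZ : MeasurableSet (S.coords Z))
    (htr : ∀ y ∈ Z, S.ℓ (A.vf S.i H (A.h S.i y)) ≠ 0)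
    (h0 : ∀ y ∈ Z, ∀ t ∈ Icc 0 (τ y), H' (Ω.flow H t y) = H (Ω.flow H t y)) :
    ∀ᵐ c, c ∈ S.coords Z → ∀ t ∈ Ioo 0 (τ (S.pt c)),
      Ω.hamField H' (Ω.flow H t (S.pt c)) = Ω.hamField H (Ω.flow H t (S.pt c)) := by
  have hd : ∀ q, MDifferentiableAt I 𝓘(ℝ, ℝ) H q := ContMDiff.mdifferentiable hH.1 (by simp)
  have hd' : ∀ q, MDifferentiableAt I 𝓘(ℝ, ℝ) H' q := ContMDiff.mdifferentiable hH'.1 (by simp)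
  -- At a fixed time, H' - H along the flow vanishes on a measurable set of coordinates, so its
  -- derivative vanishes at almost every point of that set. The strict bound t < τ y leaves room to
  -- differentiate in time as well.
  have key : ∀ t : ℝ, 0 < t → ∀ᵐ c, c ∈ S.coords {y ∈ Z | t < τ y} →
      Ω.hamField H' (Ω.flow H t (S.pt c)) = Ω.hamField H (Ω.flow H t (S.pt c)) := by
    intro t ht
    set Y := {y ∈ Z | t < τ y} with hYdef
    have hY := S.measurableSet_coords_lt hZ hτ t
    have hder : ∀ c ∈ S.coords Y, HasFDerivWithinAt
        (fun c ↦ H' (Ω.flow H t (S.pt c)) - H (Ω.flow H t (S.pt c)))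
        (((dHam I H' (Ω.flow H t (S.pt c)) : E4 →L[ℝ] ℝ) - dHam I H (Ω.flow H t (S.pt c))) ∘L
          (Ω.tangentFlow H t (S.pt c) : E4 →L[ℝ] E4) ∘L
          ((A.dh S.i (S.pt c)).inverse ∘L S.E : (Fin 3 → ℝ) →L[ℝ] E4)) (S.coords Y) c := by
      intro c hc
      have h1 := S.hasMFDerivWithinAt_pt hc
      have h2 := (hasMFDerivAt_flow (A := A) hI hH t (S.pt c)).comp_hasMFDerivWithinAt c h1
      have h3 := (hd' (Ω.flow H t (S.pt c))).hasMFDerivAt.comp_hasMFDerivWithinAt c h2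
      have h4 := (hd (Ω.flow H t (S.pt c))).hasMFDerivAt.comp_hasMFDerivWithinAt c h2
      have h5 := (HasMFDerivWithinAt.hasFDerivWithinAt h3).sub
        (HasMFDerivWithinAt.hasFDerivWithinAt h4)
      exact h5
    have hae := ae_fderivWithin_eq_zero hY hder fun c hc ↦ by
      have h1 := (S.pt_mem hc).1.1
      rw [h0 _ h1.1 t ⟨ht.le, h1.2.le⟩, sub_self]
    filter_upwards [hae] with c hc hcY
    have h1 := hc hcY
    obtain ⟨⟨⟨hyZ, hyτ⟩, hyS⟩, -, -⟩ := S.pt_mem hcY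
    set y := S.pt c with hy
    set q := Ω.flow H t y with hq
    set m : E4 →L[ℝ] ℝ := (dHam I H' q : E4 →L[ℝ] ℝ) - dHam I H q with hm
    rw [hamField_eq_iff]
    -- the difference of the differentials vanishes along the flow direction
    have hX : m (Ω.hamField H q) = 0 := by
      have h2 : HasDerivAt (fun s ↦ H' (Ω.flow H s y) - H (Ω.flow H s y))
          (m (Ω.hamField H q)) t := by
        have h3 := A.isMIntegralCurve_flow hI hH y t
        have h4 := HasMFDerivAt.hasFDerivAt ((hd' (Ω.flow H t y)).hasMFDerivAt.comp t h3)
        have h5 := HasMFDerivAt.hasFDerivAt ((hd (Ω.flow H t y)).hasMFDerivAt.comp t h3)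
        have h6 := (h4.sub h5).hasDerivAt
        convert! h6 using 1
        change _ = dHam I H' q ((1 : ℝ) • Ω.hamField H q) - dHam I H q ((1 : ℝ) • Ω.hamField H q)
        rw [one_smul]
        rfl
      have h3 : (fun s ↦ H' (Ω.flow H s y) - H (Ω.flow H s y)) =ᶠ[𝓝 t] fun _ ↦ 0 := by
        filter_upwards [isOpen_Ioo.eventually_mem (⟨ht, hyτ⟩ : t ∈ Ioo 0 (τ y))] with s hs
        rw [h0 y hyZ s (Ioo_subset_Icc_self hs), sub_self]
      exact h2.unique ((hasDerivAt_const t (0 : ℝ)).congr_of_eventuallyEq h3)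
    -- By transversality, the flow direction and the directions of the section span the tangent
    -- space at y; both have been dealt with.
    have hall : ∀ v : TangentSpace I y, m (Ω.tangentFlow H t y v) = 0 := by
      intro v
      set X := A.dh S.i y (Ω.hamField H y) with hXdef
      have hXℓ : S.ℓ X ≠ 0 := by
        have := htr y hyZ
        rwa [vf, A.localField_h _ hyS.1] at this
      set r := S.ℓ (A.dh S.i y v) / S.ℓ X with hr
      obtain ⟨e, he⟩ := (S.mem_range_iff (A.dh S.i y v - r • X)).2 (by
        rw [map_sub, map_smul, smul_eq_mul, hr]; field_simp; ring)
      have hv : v = r • Ω.hamField H y + (A.dh S.i y).inverse (S.E e) := by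
        rw [he, map_sub, map_smul, hXdef, A.dh_inverse_dh hyS.1, A.dh_inverse_dh hyS.1]
        abel
      rw [hv, map_add, map_smul, tangentFlow_hamField (A := A) hI hH]
      have h2 : m (Ω.tangentFlow H t y ((A.dh S.i y).inverse (S.E e))) = 0 :=
        congrArg (fun f ↦ f e) h1
      refine (m.map_add (r • Ω.hamField H q : E4) _).trans ?_
      rw [h2, add_zero]
      refine (m.map_smul r (Ω.hamField H q : E4)).trans ?_
      rw [hX, smul_zero]
    ext v
    obtain ⟨w, rfl⟩ : ∃ w, Ω.tangentFlow H t y w = v := by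
      have key : ∀ f : E4 →L[ℝ] E4, (∀ u, f u = 0 → u = 0) → ∀ v, ∃ u, f u = v := by
        intro f hf
        have hinj : Function.Injective (f : E4 →ₗ[ℝ] E4) :=
          LinearMap.ker_eq_bot.1 (LinearMap.ker_eq_bot'.2 hf)
        exact LinearMap.injective_iff_surjective.1 hinj
      have hinj : ∀ u : TangentSpace I y, Ω.tangentFlow H t y u = 0 → u = 0 := by
        intro u hu
        refine Ω.nondegenerate y u fun w ↦ ?_
        rw [← form_tangentFlow (A := A) hI hH t]
        rw [hu, map_zero, zero_apply]
      exact key (Ω.tangentFlow H t y) hinj v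
    have := hall w
    exact sub_eq_zero.1 this
  -- The exceptional null set depends on the time, so only rational times are collected; continuity
  -- of the fields along each orbit then gives all times.
  have hQ : ∀ᵐ c, ∀ r : ℚ, 0 < (r : ℝ) → c ∈ S.coords {y ∈ Z | (r : ℝ) < τ y} →
      Ω.hamField H' (Ω.flow H r (S.pt c)) = Ω.hamField H (Ω.flow H r (S.pt c)) := by
    rw [ae_all_iff]
    intro r
    by_cases hr : 0 < (r : ℝ)
    · filter_upwards [key r hr] with c hc _ using hc
    · exact Eventually.of_forall fun c h ↦ absurd h hr
  filter_upwards [hQ] with c hc hcZ t ht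
  have hyZ := (S.pt_mem hcZ).1
  set y := S.pt c with hy
  have hcont := A.continuous_flow_time hI hH y
  set i := A.idx (Ω.flow H t y) with hi
  have hsrc : Ω.flow H t y ∈ A.src i := A.mem_idx _
  have hcf : ∀ {F : M → ℝ}, ContMDiff I 𝓘(ℝ, ℝ) 2 F →
      ContinuousAt (fun s ↦ A.vf i F (A.h i (Ω.flow H s y))) t := fun hF ↦
    (A.continuousWithinAt_vf hF (A.h_mem_tgt hsrc)).tendsto.comp
      ((A.tendsto_h_nhdsWithin hsrc).comp hcont.continuousAt)
  obtain ⟨ρ, hρ, hball⟩ := Metric.eventually_nhds_iff_ball.1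
    ((hcont.continuousAt.eventually ((A.isOpen_src i).eventually_mem hsrc)).and
      (isOpen_Ioo.eventually_mem ht))
  have hz := eq_zero_of_forall_rat (g := fun s ↦ ‖A.vf i H' (A.h i (Ω.flow H s y))
      - A.vf i H (A.h i (Ω.flow H s y))‖) (a := t - ρ) (b := t + ρ) (t := t)
      ⟨by linarith, by linarith⟩ ((hcf hH'.1).sub (hcf hH.1)).norm (fun r hr ↦ by
        obtain ⟨hr1, hr2⟩ := hball r (by rwa [Real.ball_eq_Ioo])
        rw [vf, vf, A.localField_h _ hr1, A.localField_h _ hr1,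
          hc r hr2.1 ((S.mem_coords_iff).2 ⟨((S.mem_coords_iff).1 hcZ).1, hyZ.1, hr2.2⟩), sub_self,
          norm_zero])
  rw [norm_eq_zero, sub_eq_zero, vf, vf, A.localField_h _ hsrc, A.localField_h _ hsrc] at hz
  rw [← A.dh_inverse_dh hsrc (Ω.hamField H' (Ω.flow H t y)), hz, A.dh_inverse_dh hsrc]

end LocalSection

end SymplecticForm.DarbouxAtlas

end

end HamRealizable

namespace HamRealizable

/-! ### Two consecutive sections: crossing, non-return and Poincaré maps, uniformly over thin
perturbations -/

section

open Metric

variable {B : Type*} [TopologicalSpace B] {I : ModelWithCorners ℝ E4 B}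
  {M : Type*} [TopologicalSpace M] [ChartedSpace B M] [IsManifold I ∞ M]

namespace SymplecticForm.DarbouxAtlas

variable {Ω : SymplecticForm I M} {A : Ω.DarbouxAtlas} {H H₁ H₂ : M → ℝ}

/-- Two consecutive sections `S₀`, `S₁` along an orbit of `H`, with neighborhoods `V₀ ⊆ W₀` and `W₁`
of their base points such that the orbits of the Hamiltonians in `P` that start in these
neighborhoods behave like those of `H` that start at the base points. -/
structure SectionPair (S₀ S₁ : A.LocalSection H) (T₁ T₂ δ : ℝ) (P : Set (M → ℝ))
    (V₀ W₀ W₁ : Set M) : Prop where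
  delta_pos : 0 < δ
  delta_le : δ ≤ T₁
  self_mem : H ∈ P
  ham : ∀ H' ∈ P, IsHamiltonian I 2 H'
  isOpen_V₀ : IsOpen V₀
  isOpen_W₀ : IsOpen W₀
  isOpen_W₁ : IsOpen W₁
  mem_V₀ : S₀.a ∈ V₀
  mem_W₁ : S₁.a ∈ W₁
  V₀_subset : V₀ ⊆ W₀
  hits : ∀ H' ∈ P, ∀ y ∈ W₀, S₁.Hits δ T₁ H' y
  -- The same crossing in a narrower window: it occurs within δ / 4 of T₁, while it is unique in a
  -- window of half-width δ. The margin absorbs time shifts.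
  hits_quarter : ∀ H' ∈ P, ∀ y ∈ W₀, S₁.Hits (δ / 4) T₁ H' y
  transversal : ∀ H' ∈ P, ∀ y ∈ W₀, ∀ t ∈ Icc (T₁ - δ) (T₁ + δ),
    0 < S₁.ℓ (A.vf S₁.i H' (A.h S₁.i (Ω.flow H' t y)))
  hits₀ : ∀ H' ∈ P, ∀ y ∈ W₀, S₀.Hits δ 0 H' y
  transversal₀ : ∀ y ∈ W₀, 0 < S₀.ℓ (A.vf S₀.i H (A.h S₀.i y))
  hits₁ : ∀ H' ∈ P, ∀ q ∈ W₁, S₁.Hits δ 0 H' q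
  hits_back : ∀ q ∈ W₁, S₀.Hits δ (-T₁) H q
  hit_back_mem : ∀ q ∈ W₁, S₀.hit δ (-T₁) H q ∈ W₀
  hit_mem : ∀ H' ∈ P, ∀ y ∈ V₀, S₁.hit δ T₁ H' y ∈ W₁
  -- Away from the crossing the two pieces are disjoint by non-periodicity; near it the heights are
  -- compared instead. The bound T₂ + 1 leaves room for arrival times slightly larger than T₂.
  ne₀₁ : ∀ H' ∈ P, ∀ H'' ∈ P, ∀ y ∈ W₀, ∀ q ∈ W₁, ∀ t ∈ Icc 0 (T₁ + δ / 4), ∀ s ∈ Icc 0 (T₂ + 1),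
    Ω.flow H' t y = Ω.flow H'' s q → T₁ - δ / 2 < t ∧ s < δ / 2
  ne₀₀ : ∀ y ∈ W₀, ∀ y' ∈ W₀, ∀ t ∈ Icc 0 (T₁ + δ), ∀ s ∈ Icc 0 (T₁ + δ),
    Ω.flow H t y = Ω.flow H s y' → |t - s| < δ

namespace SectionPair

variable {S₀ S₁ : A.LocalSection H} {T₁ T₂ δ : ℝ} {P : Set (M → ℝ)} {V₀ W₀ W₁ : Set M}
  (G : SectionPair S₀ S₁ T₁ T₂ δ P V₀ W₀ W₁) [T2Space M] [CompactSpace M]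
  (hI : range I = univ ∨ range I = {y : E4 | 0 ≤ y 0})

include G hI

theorem abs_hitTime_sub_lt (h₁ : H₁ ∈ P) {y : M} (hy : y ∈ W₀) :
    |S₁.hitTime δ T₁ H₁ y - T₁| < δ / 4 := by
  have hδ := G.delta_pos
  have h1 := G.hits_quarter H₁ h₁ y hy
  have h2 := h1.hitTime_mem_Ioo hI (by linarith) (G.ham _ h₁)
  have h3 : S₁.hitTime (δ / 4) T₁ H₁ y = S₁.hitTime δ T₁ H₁ y :=
    (G.hits H₁ h₁ y hy).eq_hitTime hI hδ (G.ham _ h₁)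
      ⟨by linarith [h2.1], by linarith [h2.2]⟩ (h1.height_hit hI (by linarith) (G.ham _ h₁))
  rw [← h3, abs_lt]
  exact ⟨by linarith [h2.1], by linarith [h2.2]⟩

theorem hitTime_mem (h₁ : H₁ ∈ P) {y : M} (hy : y ∈ W₀) :
    S₁.hitTime δ T₁ H₁ y ∈ Ioo (T₁ - δ / 4) (T₁ + δ / 4) := by
  have := abs_lt.1 (G.abs_hitTime_sub_lt hI h₁ hy)
  exact ⟨by linarith [this.1], by linarith [this.2]⟩

theorem hitTime_pos (h₁ : H₁ ∈ P) {y : M} (hy : y ∈ W₀) : 0 < S₁.hitTime δ T₁ H₁ y := by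
  linarith [(G.hitTime_mem hI h₁ hy).1, G.delta_pos, G.delta_le]

theorem hit_mem_carrier (h₁ : H₁ ∈ P) {y : M} (hy : y ∈ W₀) :
    S₁.hit δ T₁ H₁ y ∈ S₁.carrier :=
  ((G.hits H₁ h₁ y hy).hitTime_spec hI G.delta_pos (G.ham _ h₁)).2

theorem continuousOn_hitTime (h₁ : H₁ ∈ P) : ContinuousOn (S₁.hitTime δ T₁ H₁) W₀ := fun y hy ↦
  ((G.hits H₁ h₁ y hy).continuousAt_hitTime hI G.delta_pos (G.ham _ h₁) (by
    filter_upwards [G.isOpen_W₀.mem_nhds hy] with y' hy' using G.hits H₁ h₁ y' hy')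
    ).continuousWithinAt

theorem continuousOn_hit (h₁ : H₁ ∈ P) : ContinuousOn (S₁.hit δ T₁ H₁) W₀ :=
  (continuous_flow (A := A) hI (G.ham _ h₁)).comp_continuousOn
    ((G.continuousOn_hitTime hI h₁).prodMk continuousOn_id)

theorem eq_hitTime (h₁ : H₁ ∈ P) {y : M} (hy : y ∈ W₀) {t : ℝ} (ht : |t - T₁| ≤ δ)
    (h : Ω.flow H₁ t y ∈ S₁.carrier) : t = S₁.hitTime δ T₁ H₁ y := by
  have := abs_le.1 ht
  exact (G.hits H₁ h₁ y hy).eq_hitTime hI G.delta_pos (G.ham _ h₁)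
    ⟨by linarith [this.1], by linarith [this.2]⟩ h.2

/-- Orbit segments before and after the second section meet only on it. -/
theorem eq_of_flow_eq (h₁ : H₁ ∈ P) (h₂ : H₂ ∈ P) {y q : M} (hy : y ∈ W₀) (hq : q ∈ W₁)
    (hqS : q ∈ S₁.carrier) {t s : ℝ} (ht : t ∈ Icc 0 (S₁.hitTime δ T₁ H₁ y))
    (hs : s ∈ Icc 0 (T₂ + 1)) (h : Ω.flow H₁ t y = Ω.flow H₂ s q) :
    t = S₁.hitTime δ T₁ H₁ y ∧ s = 0 := by
  have hδ := G.delta_pos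
  have hτ := G.hitTime_mem hI h₁ hy
  obtain ⟨h3, h4⟩ := G.ne₀₁ H₁ h₁ H₂ h₂ y hy q hq t ⟨ht.1, by linarith [ht.2, hτ.2]⟩ s hs h
  have ht' : t ∈ Icc (T₁ - δ) (T₁ + δ) := ⟨by linarith, by linarith [ht.2, hτ.2]⟩
  have hs' : s ∈ Icc (0 - δ) (0 + δ) := ⟨by linarith [hs.1], by linarith⟩
  have hq0 : (0 : ℝ) = S₁.hitTime δ 0 H₂ q :=
    (G.hits₁ H₂ h₂ q hq).eq_hitTime hI hδ (G.ham _ h₂) ⟨by linarith, by linarith⟩ (by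
      rw [A.flow_zero hI (G.ham _ h₂)]; exact hqS.2)
  -- Both times are now in the windows where the height is increasing. It is negative before the
  -- crossing and positive after time 0 on the second orbit, so a common point has height zero.
  rcases ht.2.lt_or_eq with hlt | heq
  · exfalso
    have h5 := (G.hits H₁ h₁ y hy).height_neg hI hδ (G.ham _ h₁) ht' hlt
    rw [h] at h5
    rcases hs.1.lt_or_eq with hlt' | heq'
    · have h6 := (G.hits₁ H₂ h₂ q hq).height_pos hI hδ (G.ham _ h₂) hs' (hq0 ▸ hlt')
      linarith
    · rw [← heq', A.flow_zero hI (G.ham _ h₂), hqS.2] at h5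
      exact lt_irrefl _ h5
  · refine ⟨heq, ?_⟩
    by_contra hne
    have hlt' : 0 < s := lt_of_le_of_ne hs.1 (Ne.symm hne)
    have h6 := (G.hits₁ H₂ h₂ q hq).height_pos hI hδ (G.ham _ h₂) hs' (hq0 ▸ hlt')
    rw [← h, heq] at h6
    exact h6.ne' (G.hit_mem_carrier hI h₁ hy).2

theorem eq_of_flow_eq_of_mem (h₁ : H₁ ∈ P) {y : M} (hy : y ∈ W₀) (hyS : y ∈ S₀.carrier) {t : ℝ}
    (ht : |t| ≤ δ) (h : Ω.flow H₁ t y ∈ S₀.carrier) : t = 0 := by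
  have hδ := G.delta_pos
  have hh := G.hits₀ H₁ h₁ y hy
  have := abs_le.1 ht
  have h1 := hh.eq_hitTime hI hδ (G.ham _ h₁) (t := t) ⟨by linarith, by linarith⟩ h.2
  have h2 := hh.eq_hitTime hI hδ (G.ham _ h₁) (t := 0) ⟨by linarith, by linarith⟩ (by
    rw [A.flow_zero hI (G.ham _ h₁)]; exact hyS.2)
  rw [h1, ← h2]

/-- The flowbox coordinates are unique. -/
theorem eq_of_flow_eq₀ {y y' : M} (hy : y ∈ W₀) (hyS : y ∈ S₀.carrier) (hy' : y' ∈ W₀)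
    (hyS' : y' ∈ S₀.carrier) {t s : ℝ} (ht : t ∈ Icc 0 (S₁.hitTime δ T₁ H y))
    (hs : s ∈ Icc 0 (S₁.hitTime δ T₁ H y')) (h : Ω.flow H t y = Ω.flow H s y') : y = y' := by
  have hH := G.ham _ G.self_mem
  have hδ := G.delta_pos
  have h1 := G.hitTime_mem hI G.self_mem hy
  have h2 := G.hitTime_mem hI G.self_mem hy'
  have h3 := G.ne₀₀ y hy y' hy' t ⟨ht.1, by linarith [ht.2, h1.2]⟩ s
    ⟨hs.1, by linarith [hs.2, h2.2]⟩ h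
  have h4 : Ω.flow H (t - s) y = y' := by
    rw [sub_eq_neg_add, A.flow_add hI hH, h, A.flow_neg_flow hI hH]
  have h5 := G.eq_of_flow_eq_of_mem hI G.self_mem hy hyS h3.le (by rw [h4]; exact hyS')
  rw [← h4, h5, A.flow_zero hI hH]

/-- Two points with the same image lie on one orbit, at a time difference less than δ, and in such a
window the orbit crosses S₀ only once. -/
theorem injOn_hit (h₁ : H₁ ∈ P) : InjOn (S₁.hit δ T₁ H₁) (W₀ ∩ S₀.carrier) := by
  intro y hy y' hy' h
  have hH := G.ham _ h₁
  have h1 := abs_lt.1 (G.abs_hitTime_sub_lt hI h₁ hy.1)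
  have h2 := abs_lt.1 (G.abs_hitTime_sub_lt hI h₁ hy'.1)
  have h4 : Ω.flow H₁ (S₁.hitTime δ T₁ H₁ y - S₁.hitTime δ T₁ H₁ y') y = y' := by
    rw [sub_eq_neg_add, A.flow_add hI hH]
    exact (congrArg _ h).trans (A.flow_neg_flow hI hH _ _)
  have h5 := G.eq_of_flow_eq_of_mem hI h₁ hy.1 hy.2 (t := S₁.hitTime δ T₁ H₁ y -
    S₁.hitTime δ T₁ H₁ y') (abs_le.2 ⟨by linarith [h1.1, h2.2, G.delta_pos],
      by linarith [h1.2, h2.1, G.delta_pos]⟩) (by rw [h4]; exact hy'.2)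
  rw [← h4, h5, A.flow_zero hI hH]

/-- The backward Poincaré map. -/
theorem hit_hit_back {q : M} (hq : q ∈ W₁) (hqS : q ∈ S₁.carrier) :
    S₀.hit δ (-T₁) H q ∈ W₀ ∩ S₀.carrier ∧ S₁.hit δ T₁ H (S₀.hit δ (-T₁) H q) = q := by
  have hH := G.ham _ G.self_mem
  have h1 := (G.hits_back q hq).hitTime_spec hI G.delta_pos hH
  have hW := G.hit_back_mem q hq
  refine ⟨⟨hW, h1.2⟩, ?_⟩
  have h2 : Ω.flow H (-S₀.hitTime δ (-T₁) H q) (S₀.hit δ (-T₁) H q) = q :=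
    A.flow_neg_flow hI hH _ _
  have h3 := G.eq_hitTime hI G.self_mem hW (t := -S₀.hitTime δ (-T₁) H q)
    (abs_le.2 ⟨by linarith [h1.1.2], by linarith [h1.1.1]⟩) (by rw [h2]; exact hqS)
  rw [LocalSection.hit, ← h3, h2]

theorem hit_back_hit {y : M} (hy : y ∈ W₀) (hyS : y ∈ S₀.carrier)
    (hW : S₁.hit δ T₁ H y ∈ W₁) : S₀.hit δ (-T₁) H (S₁.hit δ T₁ H y) = y := by
  obtain ⟨h1, h2⟩ := G.hit_hit_back hI hW (G.hit_mem_carrier hI G.self_mem hy)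
  exact G.injOn_hit hI G.self_mem h1 ⟨hy, hyS⟩ h2

theorem continuousOn_hit_back : ContinuousOn (S₀.hit δ (-T₁) H) W₁ := by
  have hH := G.ham _ G.self_mem
  refine (continuous_flow (A := A) hI hH).comp_continuousOn (ContinuousOn.prodMk ?_ continuousOn_id)
  exact fun q hq ↦ ((G.hits_back q hq).continuousAt_hitTime hI G.delta_pos hH (by
    filter_upwards [G.isOpen_W₁.mem_nhds hq] with q' hq' using G.hits_back q' hq')
    ).continuousWithinAt

/-- The Poincaré map is open. -/
theorem exists_isOpen_image {U : Set M} (hU : U ⊆ V₀ ∩ S₀.carrier) {V : Set M} (hV : IsOpen V)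
    (hUV : U = V ∩ S₀.carrier) :
    ∃ V', IsOpen V' ∧ S₁.hit δ T₁ H '' U = V' ∩ S₁.carrier := by
  obtain ⟨u, hu, hu'⟩ := continuousOn_iff'.1 (G.continuousOn_hit_back hI) V hV
  refine ⟨u ∩ W₁, hu.inter G.isOpen_W₁, ?_⟩
  rw [← hu']
  ext q
  constructor
  · rintro ⟨y, hy, rfl⟩
    have hyW := G.V₀_subset (hU hy).1
    have h1 := G.hit_mem H G.self_mem y (hU hy).1
    refine ⟨⟨?_, h1⟩, G.hit_mem_carrier hI G.self_mem hyW⟩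
    rw [mem_preimage, G.hit_back_hit hI hyW (hU hy).2 h1]
    rw [hUV] at hy
    exact hy.1
  · rintro ⟨⟨h1, h2⟩, h3⟩
    obtain ⟨h4, h5⟩ := G.hit_hit_back hI h2 h3
    refine ⟨_, ?_, h5⟩
    rw [hUV]
    exact ⟨h1, h4.2⟩

end SectionPair

variable [T2Space M] [CompactSpace M]
  (hI : range I = univ ∨ range I = {y : E4 | 0 ≤ y 0}) (hH : IsHamiltonian I 2 H)

include hI hH

/-- Every requirement holds at the base orbit, by transversality and non-periodicity, and is an open
condition on the Hamiltonian and the initial point. The neighborhoods are chosen in the order W₀,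
then W₁ (so that the backward map lands in W₀), then V₀ (so that the forward maps land in W₁). -/
theorem exists_sectionPair {𝓕 : Filter (M → ℝ)} (hC : A.C1Conv 𝓕 H) (hself : pure H ≤ 𝓕)
    (S₀ S₁ : A.LocalSection H) {T₁ T₂ : ℝ} (hT₁ : 0 < T₁)
    (hx : ∀ t : ℝ, t ≠ 0 → Ω.flow H t S₀.a ≠ S₀.a) (ha : Ω.flow H T₁ S₀.a = S₁.a) :
    ∃ δ₀ > 0, ∀ δ ∈ Ioc 0 δ₀, ∀ E₀ ∈ 𝓝 S₀.a, ∀ E₁ ∈ 𝓝 S₁.a, ∀ P₀ ∈ 𝓕,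
      ∃ P ∈ 𝓕, P ⊆ P₀ ∧ ∃ V₀ ⊆ E₀, ∃ W₀, ∃ W₁ ⊆ E₁, SectionPair S₀ S₁ T₁ T₂ δ P V₀ W₀ W₁ := by
  have hfl : ∀ s t, Ω.flow H s S₀.a = Ω.flow H t S₀.a → s = t := by
    intro s t h
    by_contra hne
    refine hx (s - t) (sub_ne_zero.2 hne) ?_
    rw [sub_eq_neg_add, A.flow_add hI hH, h, A.flow_neg_flow hI hH]
  have hpure := A.c1Conv_pure hH
  have ha' : Ω.flow H (-T₁) S₁.a = S₀.a := by rw [← ha, A.flow_neg_flow hI hH]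
  obtain ⟨d1, hd1, hits1⟩ := LocalSection.eventually_hits hI hH S₁ hC ha
  obtain ⟨d2, hd2, hits2⟩ := LocalSection.eventually_hits hI hH S₀ hC (A.flow_zero hI hH S₀.a)
  obtain ⟨d3, hd3, hits3⟩ := LocalSection.eventually_hits hI hH S₁ hC (A.flow_zero hI hH S₁.a)
  obtain ⟨d4, hd4, hits4⟩ := LocalSection.eventually_hits hI hH S₀ hpure ha'
  refine ⟨min (min d1 d2) (min (min d3 d4) T₁), by positivity, ?_⟩
  rintro δ ⟨hδ, hδle⟩ E₀ hE₀ E₁ hE₁ P₀ hP₀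
  obtain ⟨⟨l1, l2⟩, ⟨l3, l4⟩, l5⟩ : (δ ≤ d1 ∧ δ ≤ d2) ∧ (δ ≤ d3 ∧ δ ≤ d4) ∧ δ ≤ T₁ := by
    simpa only [le_min_iff] using hδle
  have e1 := hits1 δ ⟨hδ, l1⟩
  have e1' := hits1 (δ / 4) ⟨by linarith, by linarith⟩
  have e2 := hits2 δ ⟨hδ, l2⟩
  have e3 := hits3 δ ⟨hδ, l3⟩
  have e4 := hits4 δ ⟨hδ, l4⟩
  rw [pure_prod, eventually_map] at e4
  -- non-intersection
  have n1 := hC.eventually_flow_ne hI hH hC (x := S₀.a) (x' := S₁.a)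
    (K := (Icc 0 (T₁ + δ / 4) ×ˢ Icc 0 (T₂ + 1)) ∩ {t | t.1 ≤ T₁ - δ / 2 ∨ δ / 2 ≤ t.2})
    ((isCompact_Icc.prod isCompact_Icc).inter_right
      ((isClosed_le continuous_fst continuous_const).union
        (isClosed_le continuous_const continuous_snd))) (by
      rintro ⟨t, s⟩ ⟨⟨ht, hs⟩, hts⟩ h
      simp only at ht hs hts h
      rw [← ha, ← A.flow_add hI hH] at h
      have h2 := hfl _ _ h
      rcases hts with h3 | h3
      · linarith [hs.1]
      · linarith [ht.2])
  have n0 := hpure.eventually_flow_ne hI hH hpure (x := S₀.a) (x' := S₀.a)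
    (K := (Icc 0 (T₁ + δ) ×ˢ Icc 0 (T₁ + δ)) ∩ {t | δ ≤ |t.1 - t.2|})
    ((isCompact_Icc.prod isCompact_Icc).inter_right
      (isClosed_le continuous_const (continuous_fst.sub continuous_snd).abs)) (by
      rintro ⟨t, s⟩ ⟨⟨ht, hs⟩, hts⟩ h
      have h2 : t = s := hfl _ _ h
      simp only [mem_ofPred_eq, h2, sub_self, abs_zero] at hts
      linarith)
  obtain ⟨qa, hqa, qb, hqb, hqab⟩ := eventually_prod_iff.1 n1
  obtain ⟨pa, hpa, pb, hpb, hpab⟩ := eventually_prod_iff.1 n0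
  rw [pure_prod, eventually_map] at hpa hpb
  obtain ⟨a1, ha1, b1, hb1, hab1⟩ := eventually_prod_iff.1 (e1.and (e1'.and (e2.and hqa)))
  obtain ⟨a2, ha2, b2, hb2, hab2⟩ := eventually_prod_iff.1 (e3.and hqb)
  have hHall : ∀ {p : (M → ℝ) → Prop}, (∀ᶠ H' in 𝓕, p H') → p H := fun h ↦ hself h
  obtain ⟨W₀, hW₀s, hW₀o, hW₀x⟩ := eventually_nhds_iff.1 (hb1.and (hpa.and (hpb.and
    (eventually_mem_set.2 hE₀))))
  -- the backward map
  have hbc : ContinuousAt (S₀.hit δ (-T₁) H) S₁.a := by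
    refine (continuous_flow (A := A) hI hH).continuousAt.comp
      (ContinuousAt.prodMk ?_ continuousAt_id)
    exact (e4.self_of_nhds.1).continuousAt_hitTime hI hδ hH (e4.mono fun q hq ↦ hq.1)
  have hb0 : S₀.hit δ (-T₁) H S₁.a = S₀.a := by
    have := e4.self_of_nhds.1.eq_hitTime hI hδ hH (t := -T₁) ⟨by linarith, by linarith⟩
      (by rw [ha']; exact S₀.a_mem_carrier.2)
    rw [LocalSection.hit, ← this, ha']
  have hbm : ∀ᶠ q in 𝓝 S₁.a, S₀.hit δ (-T₁) H q ∈ W₀ :=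
    hbc.eventually (by rw [hb0]; exact hW₀o.mem_nhds hW₀x)
  obtain ⟨W₁, hW₁s, hW₁o, hW₁x⟩ := eventually_nhds_iff.1 (hb2.and (e4.and (hbm.and
    (eventually_mem_set.2 hE₁))))
  -- the forward map
  have hft := hC.tendsto_flow hI hH T₁ S₀.a
  rw [ha] at hft
  obtain ⟨c1, hc1, c2, hc2, hc12⟩ := eventually_prod_iff.1 (hft.eventually (hW₁o.mem_nhds hW₁x))
  obtain ⟨c3, hc3, c4, hc4, hc34⟩ := eventually_prod_iff.1 hc2
  obtain ⟨η, hη, hηball⟩ := Metric.eventually_nhds_iff_ball.1 hc3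
  -- A still narrower window. The crossing in it is the crossing in the window of width δ, and it
  -- occurs at a time for which the flow is known to be in W₁.
  set ρ := min δ (η / 2) with hρ
  have hρ0 : 0 < ρ := by positivity
  have e5 := hits1 ρ ⟨hρ0, (min_le_left _ _).trans l1⟩
  obtain ⟨a5, ha5, b5, hb5, hab5⟩ := eventually_prod_iff.1 e5
  obtain ⟨V₀, hV₀s, hV₀o, hV₀x⟩ := eventually_nhds_iff.1 (hc4.and (hb5.and
    (hW₀o.eventually_mem hW₀x)))
  refine ⟨{H' | IsHamiltonian I 2 H' ∧ a1 H' ∧ a2 H' ∧ c1 H' ∧ a5 H' ∧ H' ∈ P₀},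
    hC.ham.and (ha1.and (ha2.and (hc1.and (ha5.and hP₀)))), fun H' h ↦ h.2.2.2.2.2, V₀,
    fun y hy ↦ (hW₀s y (hV₀s y hy).2.2).2.2.2, W₀, W₁, fun q hq ↦ (hW₁s q hq).2.2.2, ?_⟩
  refine ⟨hδ, l5, ⟨hH, hHall ha1, hHall ha2, hHall hc1, hHall ha5, hHall hP₀⟩, fun H' h ↦ h.1,
    hV₀o, hW₀o, hW₁o, hV₀x, hW₁x, fun y hy ↦ (hV₀s y hy).2.2,
    fun H' h y hy ↦ (hab1 h.2.1 (hW₀s y hy).1).1.1,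
    fun H' h y hy ↦ (hab1 h.2.1 (hW₀s y hy).1).2.1.1,
    fun H' h y hy ↦ (hab1 h.2.1 (hW₀s y hy).1).1.2,
    fun H' h y hy ↦ (hab1 h.2.1 (hW₀s y hy).1).2.2.1.1,
    fun y hy ↦ ?_,
    fun H' h q hq ↦ (hab2 h.2.2.1 (hW₁s q hq).1).1.1,
    fun q hq ↦ (hW₁s q hq).2.1.1, fun q hq ↦ (hW₁s q hq).2.2.1, fun H' h y hy ↦ ?_,
    fun H' h H'' h' y hy q hq t ht s hs hts ↦ ?_, fun y hy y' hy' t ht s hs hts ↦ ?_⟩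
  · have := (hab1 (hHall ha1) (hW₀s y hy).1).2.2.1.2 0 ⟨by linarith, by linarith⟩
    rwa [A.flow_zero hI hH] at this
  · obtain ⟨h1, h2, h3⟩ := hV₀s y hy
    have h4 := (hab5 h.2.2.2.2.1 h2).1
    have h5 := h4.hitTime_spec hI hρ0 h.1
    have h6 : S₁.hitTime ρ T₁ H' y = S₁.hitTime δ T₁ H' y := by
      refine (hab1 h.2.1 (hW₀s y h3).1).1.1.eq_hitTime hI hδ h.1 ?_ h5.2.2
      have : ρ ≤ δ := min_le_left _ _
      exact ⟨by linarith [h5.1.1], by linarith [h5.1.2]⟩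
    rw [LocalSection.hit, ← h6]
    refine hc12 h.2.2.2.1 (y := (S₁.hitTime ρ T₁ H' y, y)) (hc34 (hηball _ ?_) h1)
    have : ρ ≤ η / 2 := min_le_right _ _
    rw [Real.ball_eq_Ioo]
    exact ⟨by linarith [h5.1.1], by linarith [h5.1.2]⟩
  · by_contra hcon
    rw [not_and_or, not_lt, not_lt] at hcon
    exact hqab (x := (H', y)) (y := (H'', q)) (hab1 h.2.1 (hW₀s y hy).1).2.2.2
      (hab2 h'.2.2.1 (hW₁s q hq).1).2 (t, s) ⟨⟨ht, hs⟩, hcon⟩ hts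
  · by_contra hcon
    rw [not_lt] at hcon
    exact hpab (x := (H, y)) (y := (H, y')) (hW₀s y hy).2.1 (hW₀s y' hy').2.2.1 (t, s)
      ⟨⟨ht, hs⟩, hcon⟩ hts

end SymplecticForm.DarbouxAtlas

end

end HamRealizable

namespace HamRealizable

/-! ### The measure estimate -/

section

variable {B : Type*} [TopologicalSpace B] {I : ModelWithCorners ℝ E4 B}
  {M : Type*} [TopologicalSpace M] [ChartedSpace B M] [IsManifold I ∞ M]

namespace SymplecticForm.DarbouxAtlas

variable {Ω : SymplecticForm I M} {A : Ω.DarbouxAtlas} {H H₁ H₂ : M → ℝ}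

/-- The flux measure on a section. -/
noncomputable def LocalSection.flux (S : A.LocalSection H) (Y : Set M) : ENNReal :=
  ∫⁻ c in S.coords Y, ENNReal.ofReal (S.density H c)

theorem LocalSection.flux_mono (S : A.LocalSection H) {Y Z : Set M} (h : Y ⊆ Z) :
    S.flux Y ≤ S.flux Z := lintegral_mono_set (S.coords_mono h)

theorem LocalSection.flux_union_le (S : A.LocalSection H) (Y Z : Set M) :
    S.flux (Y ∪ Z) ≤ S.flux Y + S.flux Z := by
  have : S.coords (Y ∪ Z) = S.coords Y ∪ S.coords Z := by
    ext c; simp only [S.mem_coords_iff, mem_union]; tauto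
  rw [flux, this]
  exact lintegral_union_le _ _ _

theorem LocalSection.density_congr (S : A.LocalSection H) {c : Fin 3 → ℝ}
    (h : Ω.hamField H₁ (S.pt c) = Ω.hamField H (S.pt c)) : S.density H₁ c = S.density H c := by
  rw [density, density, h]

namespace SectionPair

variable {S₀ S₁ : A.LocalSection H} {T₁ T₂ δ : ℝ} {P : Set (M → ℝ)} {V₀ W₀ W₁ : Set M}
  (G : SectionPair S₀ S₁ T₁ T₂ δ P V₀ W₀ W₁) [T2Space M] [CompactSpace M]
  (hI : range I = univ ∨ range I = {y : E4 | 0 ≤ y 0})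

include G hI

theorem lintegral_hit (h₁ : H₁ ∈ P) {Y : Set M} (hY : Y ⊆ W₀ ∩ S₀.carrier)
    (hm : MeasurableSet (S₀.coords Y)) :
    ∫⁻ c in S₀.coords Y, ENNReal.ofReal (S₀.density H₁ c)
      = ∫⁻ c in S₁.coords (S₁.hit δ T₁ H₁ '' Y), ENNReal.ofReal (S₁.density H₁ c) :=
  LocalSection.lintegral_transition S₀ S₁ hI (G.ham _ h₁) (u := S₁.hitTime δ T₁ H₁)
    (hY.trans inter_subset_right)
    ((G.continuousOn_hitTime hI h₁).mono (hY.trans inter_subset_left))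
    (fun _ hy ↦ G.hit_mem_carrier hI h₁ (hY hy).1)
    (fun y hy ↦ (G.transversal H₁ h₁ y (hY hy).1 _
      ((G.hits H₁ h₁ y (hY hy).1).hitTime_spec hI G.delta_pos (G.ham _ h₁)).1).ne')
    ((G.injOn_hit hI h₁).mono hY) hm

theorem volume_coords_hit (h₁ : H₁ ∈ P) {Y : Set M} (hY : Y ⊆ W₀ ∩ S₀.carrier)
    (hm : volume (S₀.coords Y) = 0) : volume (S₁.coords (S₁.hit δ T₁ H₁ '' Y)) = 0 :=
  LocalSection.volume_coords_transition S₀ S₁ hI (G.ham _ h₁) (u := S₁.hitTime δ T₁ H₁)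
    (hY.trans inter_subset_right)
    ((G.continuousOn_hitTime hI h₁).mono (hY.trans inter_subset_left))
    (fun _ hy ↦ G.hit_mem_carrier hI h₁ (hY hy).1)
    (fun y hy ↦ (G.transversal H₁ h₁ y (hY hy).1 _
      ((G.hits H₁ h₁ y (hY hy).1).hitTime_spec hI G.delta_pos (G.ham _ h₁)).1).ne') hm

theorem measurableSet_preimage_hit (h₁ : H₁ ∈ P) {K₁ K₂ : Set M} (hK₁ : MeasurableSet[borel M] K₁)
    (hK₁V : K₁ ⊆ W₀) (hK₂ : MeasurableSet[borel M] K₂) :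
    MeasurableSet[borel M] {y ∈ K₁ | S₁.hit δ T₁ H₁ y ∈ K₂} := by
  borelize M
  have h1 : {y ∈ K₁ | S₁.hit δ T₁ H₁ y ∈ K₂} =
      K₁ ∩ Subtype.val '' (W₀.domRestrict (S₁.hit δ T₁ H₁) ⁻¹' K₂) := by
    ext y
    constructor
    · rintro ⟨h2, h3⟩
      exact ⟨h2, ⟨y, hK₁V h2⟩, h3, rfl⟩
    · rintro ⟨h2, ⟨y, hy⟩, h3, rfl⟩
      exact ⟨h2, h3⟩
  rw [h1]
  exact hK₁.inter (G.isOpen_W₀.measurableSet.subtype_image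
    ((continuousOn_iff_continuous_domRestrict.1 (G.continuousOn_hit hI h₁)).measurable hK₂))

/-- The Poincaré map preserves the flux. -/
theorem flux_image {U : Set M} (hU : U ⊆ W₀ ∩ S₀.carrier) (hm : MeasurableSet (S₀.coords U)) :
    S₁.flux (S₁.hit δ T₁ H '' U) = S₀.flux U := (G.lintegral_hit hI G.self_mem hU hm).symm

/-- The Poincaré map of a perturbation supported in the flowbox over `U` maps almost every point of
`U` into the image of `U` under the Poincaré map of `H`. -/
theorem volume_hit_notMem (h₁ : H₁ ∈ P) {U : Set M} (hU : U ⊆ V₀ ∩ S₀.carrier)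
    (hUm : MeasurableSet (S₀.coords U))
    (hUr : ∃ V, IsOpen V ∧ U = V ∩ S₀.carrier)
    (hH₁ : ∀ z ∉ flowbox Ω H U (S₁.hitTime δ T₁ H), H₁ z = H z) :
    volume (S₁.coords (S₁.hit δ T₁ H₁ '' {y ∈ U | S₁.hit δ T₁ H₁ y ∉ S₁.hit δ T₁ H '' U})) = 0 := by
  have hH := G.ham _ G.self_mem
  have hH1 := G.ham _ h₁
  obtain ⟨V, hV, hUV⟩ := hUr
  -- The set of points to which the a.e. statement applies: by uniqueness of flowbox coordinates
  -- their H-orbits avoid the flowbox over U, so H₁ = H on them. As Z may have empty interior, this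
  -- does not give equality of the fields everywhere. A point y of U with a bad image q has an
  -- H-preimage y' of q in Z; unless y' is exceptional, its H₁-orbit also ends at q and forces y =
  -- y'. So bad images are H-images of a null set.
  set Z := (W₀ ∩ S₀.carrier) \ U with hZdef
  have hZW : Z ⊆ W₀ ∩ S₀.carrier := sdiff_subset
  have hZm : MeasurableSet (S₀.coords Z) := by
    have : S₀.coords Z = S₀.coords W₀ \ S₀.coords U := by
      ext c
      constructor
      · intro hc
        have h1 := S₀.pt_mem hc
        exact ⟨S₀.coords_mono (hZW.trans inter_subset_left) hc,
          fun hc' ↦ h1.1.1.2 (S₀.pt_mem hc').1.1⟩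
      · rintro ⟨hc, hc'⟩
        have h1 := S₀.pt_mem hc
        have h2 := S₀.mem_coords_iff.1 hc
        exact S₀.mem_coords_iff.2 ⟨h2.1, ⟨h2.2, h1.1.2⟩,
          fun h ↦ hc' (S₀.mem_coords_iff.2 ⟨h2.1, h⟩)⟩
    rw [this]
    refine (S₀.measurableSet_coords ?_).diff hUm
    borelize M
    exact G.isOpen_W₀.measurableSet
  have hae := S₀.ae_hamField_eq hI hH hH1 (Z := Z) (τ := S₁.hitTime δ T₁ H)
    ((G.continuousOn_hitTime hI G.self_mem).mono (hZW.trans inter_subset_left)) hZm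
    (fun y hy ↦ (G.transversal₀ y hy.1.1).ne') (fun y hy t ht ↦ hH₁ _ (by
      rintro ⟨y', hy', s, hs, h⟩
      have := G.eq_of_flow_eq₀ hI hy.1.1 hy.1.2 (G.V₀_subset (hU hy').1) (hU hy').2 ht hs h
      exact hy.2 (this ▸ hy')))
  -- the exceptional points
  set Z₀ := {y ∈ Z | ¬ ∀ t ∈ Ioo 0 (S₁.hitTime δ T₁ H y),
    Ω.hamField H₁ (Ω.flow H t y) = Ω.hamField H (Ω.flow H t y)} with hZ₀
  have hZ₀0 : volume (S₀.coords Z₀) = 0 := by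
    refine measure_mono_null (fun c hc ↦ ?_) (ae_iff.1 hae)
    have h1 := S₀.pt_mem hc
    intro h
    exact h1.1.1.2 (h (S₀.coords_mono (fun y hy ↦ hy.1) hc))
  have hnull := G.volume_coords_hit hI G.self_mem (Y := Z₀) (fun y hy ↦ hZW hy.1) hZ₀0
  refine measure_mono_null (S₁.coords_mono ?_) hnull
  rintro _ ⟨y, ⟨hyU, hyn⟩, rfl⟩
  have hyW := G.V₀_subset (hU hyU).1
  set q := S₁.hit δ T₁ H₁ y with hq
  have hqW : q ∈ W₁ := G.hit_mem H₁ h₁ y (hU hyU).1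
  have hqS : q ∈ S₁.carrier := G.hit_mem_carrier hI h₁ hyW
  obtain ⟨h1, h2⟩ := G.hit_hit_back hI hqW hqS
  set y' := S₀.hit δ (-T₁) H q with hy'
  have hy'U : y' ∉ U := fun h ↦ hyn ⟨y', h, h2⟩
  refine ⟨y', ⟨⟨h1, hy'U⟩, fun hall ↦ ?_⟩, h2⟩
  -- otherwise the two Poincaré maps agree at `y'`
  have hτ := G.hitTime_mem hI G.self_mem h1.1
  have hτ0 := G.hitTime_pos hI G.self_mem h1.1
  have h3 := flow_eq_of_hamField_eq (A := A) hI hH hH1 hall (s := S₁.hitTime δ T₁ H y')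
    ⟨hτ0.le, le_rfl⟩
  have h4 : Ω.flow H₁ (S₁.hitTime δ T₁ H y') y' = q := h3.trans h2
  have h5 := G.eq_hitTime hI h₁ h1.1 (t := S₁.hitTime δ T₁ H y')
    ((G.abs_hitTime_sub_lt hI G.self_mem h1.1).le.trans (by linarith [G.delta_pos]))
    (by rw [h4]; exact hqS)
  have h6 : S₁.hit δ T₁ H₁ y' = S₁.hit δ T₁ H₁ y := by
    rw [LocalSection.hit, ← h5, h4]
  have h7 := G.injOn_hit hI h₁ h1 ⟨hyW, (hU hyU).2⟩ h6
  exact hy'U (h7 ▸ hyU)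

/-- The measure estimate for the concatenation. -/
theorem flux_diff_le (h₁ : H₁ ∈ P) {U : Set M} (hU : U ⊆ V₀ ∩ S₀.carrier)
    (hUm : MeasurableSet (S₀.coords U))
    (hUr : ∃ V, IsOpen V ∧ U = V ∩ S₀.carrier)
    (hH₁ : ∀ z ∉ flowbox Ω H U (S₁.hitTime δ T₁ H), H₁ z = H z)
    (hX₀ : ∀ y ∈ U, Ω.hamField H₁ y = Ω.hamField H y)
    (hX₁ : ∀ y ∈ U, Ω.hamField H₁ (S₁.hit δ T₁ H y) = Ω.hamField H (S₁.hit δ T₁ H y))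
    {K₁ K₂ : Set M} (hK₁ : MeasurableSet[borel M] K₁) (hK₁U : K₁ ⊆ U)
    (hK₂ : MeasurableSet[borel M] K₂) :
    S₀.flux (U \ {y ∈ K₁ | S₁.hit δ T₁ H₁ y ∈ K₂})
      ≤ S₀.flux (U \ K₁) + S₁.flux ((S₁.hit δ T₁ H '' U) \ K₂) := by
  set p := S₁.hit δ T₁ H₁ with hp
  set U' := S₁.hit δ T₁ H '' U with hU'
  have hUW : U ⊆ W₀ ∩ S₀.carrier := fun y hy ↦ ⟨G.V₀_subset (hU hy).1, (hU hy).2⟩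
  obtain ⟨V', hV', hUV'⟩ := G.exists_isOpen_image hI hU hUr.choose_spec.1 hUr.choose_spec.2
  rw [← hU'] at hUV'
  set E₁ := {y ∈ K₁ | p y ∈ V' \ K₂} with hE₁
  set E₂ := {y ∈ K₁ | p y ∈ V'ᶜ} with hE₂
  have hpS : ∀ y ∈ U, p y ∈ S₁.carrier := fun y hy ↦ G.hit_mem_carrier hI h₁ (hUW hy).1
  -- The loss has three parts: points outside K₁, points sent by p into the image of U but not into
  -- K₂, and points sent outside the image. The second is measured by flux invariance under H₁,
  -- whose density is that of H on U and on its image; the third is null. The open set V' stands for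
  -- the image so that these sets are Borel.
  have hsub : U \ {y ∈ K₁ | p y ∈ K₂} ⊆ (U \ K₁) ∪ (E₁ ∪ E₂) := by
    rintro y ⟨hy, hyK⟩
    by_cases h1 : y ∈ K₁
    · right
      by_cases h2 : p y ∈ V'
      · exact Or.inl ⟨h1, h2, fun h3 ↦ hyK ⟨h1, h3⟩⟩
      · exact Or.inr ⟨h1, h2⟩
    · exact Or.inl ⟨hy, h1⟩
  have hV'm : MeasurableSet[borel M] V' := by borelize M; exact hV'.measurableSet
  have hK₁W : K₁ ⊆ W₀ := fun y hy ↦ (hUW (hK₁U hy)).1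
  have hE₁m := S₀.measurableSet_coords (G.measurableSet_preimage_hit hI h₁ hK₁ hK₁W
    (by borelize M; exact hV'm.diff hK₂ : MeasurableSet[borel M] (V' \ K₂)))
  have hE₂m := S₀.measurableSet_coords (G.measurableSet_preimage_hit hI h₁ hK₁ hK₁W
    (by borelize M; exact hV'm.compl : MeasurableSet[borel M] V'ᶜ))
  have hE₁U : E₁ ⊆ U := fun y hy ↦ hK₁U hy.1
  have hE₂U : E₂ ⊆ U := fun y hy ↦ hK₁U hy.1
  have hdens : ∀ {E : Set M}, E ⊆ U → MeasurableSet (S₀.coords E) → S₀.flux E =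
      ∫⁻ c in S₁.coords (p '' E), ENNReal.ofReal (S₁.density H₁ c) := by
    intro E hE hEm
    rw [← G.lintegral_hit hI h₁ (hE.trans hUW) hEm]
    refine setLIntegral_congr_fun hEm fun c hc ↦ ?_
    rw [S₀.density_congr (hX₀ _ (hE (S₀.pt_mem hc).1.1))]
  have h1 : S₀.flux E₁ ≤ S₁.flux (U' \ K₂) := by
    rw [hdens hE₁U hE₁m]
    have hsub : p '' E₁ ⊆ U' \ K₂ := by
      rintro _ ⟨y, hy, rfl⟩
      exact ⟨by rw [hUV']; exact ⟨hy.2.1, hpS y (hE₁U hy)⟩, hy.2.2⟩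
    have hm : MeasurableSet (S₁.coords (V' \ K₂)) :=
      S₁.measurableSet_coords (by borelize M; exact hV'm.diff hK₂)
    have h2 : S₁.coords (V' \ K₂) = S₁.coords (U' \ K₂) := by
      ext c
      constructor
      · rintro ⟨q, ⟨hq, hqS⟩, h⟩
        exact ⟨q, ⟨⟨by rw [hUV']; exact ⟨hq.1, hqS⟩, hq.2⟩, hqS⟩, h⟩
      · rintro ⟨q, ⟨hq, hqS⟩, h⟩
        rw [hUV'] at hq
        exact ⟨q, ⟨⟨hq.1.1, hq.2⟩, hqS⟩, h⟩
    rw [h2] at hm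
    calc _ ≤ ∫⁻ c in S₁.coords (U' \ K₂), ENNReal.ofReal (S₁.density H₁ c) :=
          lintegral_mono_set (S₁.coords_mono hsub)
      _ = S₁.flux (U' \ K₂) := by
          refine setLIntegral_congr_fun hm fun c hc ↦ ?_
          obtain ⟨y, hy, hyq⟩ := (S₁.pt_mem hc).1.1.1
          rw [S₁.density_congr (by rw [← hyq]; exact hX₁ y hy)]
  have h2 : S₀.flux E₂ = 0 := by
    rw [hdens hE₂U hE₂m]
    refine setLIntegral_measure_zero _ _ (measure_mono_null (S₁.coords_mono ?_)
      (G.volume_hit_notMem hI h₁ hU hUm hUr hH₁))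
    rintro _ ⟨y, hy, rfl⟩
    refine ⟨y, ⟨hE₂U hy, fun h ↦ hy.2 ?_⟩, rfl⟩
    have h3 : p y ∈ U' := h
    rw [hUV'] at h3
    exact h3.1
  calc _ ≤ S₀.flux ((U \ K₁) ∪ (E₁ ∪ E₂)) := S₀.flux_mono hsub
    _ ≤ S₀.flux (U \ K₁) + (S₀.flux E₁ + S₀.flux E₂) :=
        (S₀.flux_union_le _ _).trans (add_le_add le_rfl (S₀.flux_union_le _ _))
    _ ≤ _ := by rw [h2, add_zero]; exact add_le_add le_rfl h1

end SectionPair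

end SymplecticForm.DarbouxAtlas

end

end HamRealizable

namespace HamRealizable

/-! ### Pasting two perturbations -/

section

variable {B : Type*} [TopologicalSpace B] {I : ModelWithCorners ℝ E4 B}
  {M : Type*} [TopologicalSpace M] [ChartedSpace B M] [IsManifold I ∞ M]

namespace SymplecticForm.DarbouxAtlas

variable {Ω : SymplecticForm I M} {A : Ω.DarbouxAtlas} {H H₁ H₂ H' H'' : M → ℝ} {p : M}

theorem eventuallyEq_loc {i : Fin A.num} (hp : p ∈ A.src i) {f g : M → ℝ} (h : f =ᶠ[𝓝 p] g) :
    A.loc i f =ᶠ[𝓝[range I] (A.h i p)] A.loc i g := (A.tendsto_hinv_nhds hp).eventually h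

/-- Derivatives of order at most 2 of a C² function are continuous on the chart image, so equality
on an open set extends to its closure. -/
theorem iteratedFDerivWithin_loc_eq_of_mem_closure {i : Fin A.num} {f g : M → ℝ}
    (hf : ContMDiff I 𝓘(ℝ, ℝ) 2 f) (hg : ContMDiff I 𝓘(ℝ, ℝ) 2 g) {O : Set M} (hO : IsOpen O)
    (hfg : EqOn f g O) (hp : p ∈ A.src i) (hpO : p ∈ closure O) {k : ℕ} (hk : k ≤ 2) :
    iteratedFDerivWithin ℝ k (A.loc i f) (range I) (A.h i p)
      = iteratedFDerivWithin ℝ k (A.loc i g) (range I) (A.h i p) := by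
  have hTu : UniqueDiffOn ℝ (A.tgt i) := uniqueDiffOn_of_mem_nhdsWithin I.uniqueDiffOn
    (A.tgt_subset_range i) fun z hz ↦ A.tgt_mem_nhdsWithin' hz
  have hc : ∀ {f : M → ℝ}, ContMDiff I 𝓘(ℝ, ℝ) 2 f → Tendsto
      (fun q ↦ iteratedFDerivWithin ℝ k (A.loc i f) (range I) (A.h i q)) (𝓝[O] p)
      (𝓝 (iteratedFDerivWithin ℝ k (A.loc i f) (range I) (A.h i p))) := by
    intro f hf
    have h1 := (A.contDiffOn_loc (n := 2) hf i).continuousOn_iteratedFDerivWithin (m := k)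
      (by exact_mod_cast hk) hTu _ (A.h_mem_tgt hp)
    have h2 : Tendsto (A.h i) (𝓝[O] p) (𝓝[A.tgt i] (A.h i p)) := by
      refine tendsto_nhdsWithin_iff.2 ⟨(A.continuousAt_h hp).tendsto.mono_left
        nhdsWithin_le_nhds, ?_⟩
      filter_upwards [mem_nhdsWithin_of_mem_nhds ((A.isOpen_src i).mem_nhds hp)] with q hq
      exact A.h_mem_tgt hq
    have h3 := h1.tendsto.comp h2
    rw [iteratedFDerivWithin_eq_of_mem_nhdsWithin (A.tgt_subset_range i)
      (A.tgt_mem_nhdsWithin hp)] at h3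
    refine h3.congr' ?_
    filter_upwards [mem_nhdsWithin_of_mem_nhds ((A.isOpen_src i).mem_nhds hp)] with q hq
    exact iteratedFDerivWithin_eq_of_mem_nhdsWithin (A.tgt_subset_range i)
      (A.tgt_mem_nhdsWithin hq) _ _
  have := mem_closure_iff_nhdsWithin_neBot.1 hpO
  refine tendsto_nhds_unique ((hc hf).congr' ?_) (hc hg)
  filter_upwards [mem_nhdsWithin_of_mem_nhds ((A.isOpen_src i).mem_nhds hp),
    self_mem_nhdsWithin] with q hq hqO
  refine Filter.EventuallyEq.iteratedFDerivWithin_eq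
    (eventuallyEq_loc hq (hfg.eventuallyEq_of_mem (hO.mem_nhds hqO))) ?_ k
  simp only [loc]
  rw [A.hinv_h hq, hfg hqO]

/-- Closeness is a condition on the 2-jet at each point separately. It may be verified at each point
with a different comparison function. -/
theorem C2Close.of_closure {ε : ℝ} (hH : ContMDiff I 𝓘(ℝ, ℝ) 2 H)
    (hH' : ContMDiff I 𝓘(ℝ, ℝ) 2 H')
    (h : ∀ p, ∃ H₁, ContMDiff I 𝓘(ℝ, ℝ) 2 H₁ ∧ A.C2Close ε H₁ H ∧
      ∃ O, IsOpen O ∧ EqOn H' H₁ O ∧ p ∈ closure O) : A.C2Close ε H' H := by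
  intro i p hp k hk a
  obtain ⟨H₁, hH₁, hc, O, hO, hE, hpO⟩ := h p
  have h1 := iteratedFDerivWithin_loc_eq_of_mem_closure (A := A) (i := i) (hH'.sub hH)
    (hH₁.sub hH) hO (fun q hq ↦ by simp only; rw [hE hq]) (A.core_subset i hp) hpO hk
  have h2 := hc i p hp k hk a
  have h3 : iteratedFDerivWithin ℝ k (fun z ↦ H' (A.hinv i z) - H (A.hinv i z)) (range I) (A.h i p)
    = iteratedFDerivWithin ℝ k (fun z ↦ H₁ (A.hinv i z) - H (A.hinv i z)) (range I) (A.h i p) := h1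
  rw [h3]
  exact h2

theorem SameDerivAt.congr (h : A.SameDerivAt H' H p) (he : H'' =ᶠ[𝓝 p] H') :
    A.SameDerivAt H'' H p := by
  intro i hp
  obtain ⟨h1, h2⟩ := h i hp
  have h3 : A.localField i (Ω.hamField H'') =ᶠ[𝓝[range I] (A.h i p)]
      A.localField i (Ω.hamField H') := by
    filter_upwards [(A.tendsto_hinv_nhds hp).eventually he.eventually_nhds] with z hz
    rw [localField, localField, hamField_congr hz]
  have h4 : A.localField i (Ω.hamField H'') (A.h i p) = A.localField i (Ω.hamField H') (A.h i p) :=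
    h3.eq_of_nhdsWithin (A.h_mem_range i p)
  exact ⟨h4.trans h1, (h3.fderivWithin_eq h4).trans h2⟩

theorem SameDerivAt.hamField_eq (h : A.SameDerivAt H' H p) : Ω.hamField H' p = Ω.hamField H p := by
  have h1 := (h _ (A.mem_idx p)).1
  rw [A.localField_h _ (A.mem_idx p), A.localField_h _ (A.mem_idx p)] at h1
  rw [← A.dh_inverse_dh (A.mem_idx p) (Ω.hamField H' p), h1, A.dh_inverse_dh (A.mem_idx p)]

include A in
theorem isCompact_flowbox [T2Space M] [CompactSpace M]
    (hI : range I = univ ∨ range I = {y : E4 | 0 ≤ y 0}) (hH : IsHamiltonian I 2 H) {D : Set M}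
    (hD : IsCompact D) {τ : M → ℝ} (hτ : ContinuousOn τ D) (h0 : ∀ y ∈ D, 0 ≤ τ y) :
    IsCompact (flowbox Ω H D τ) := by
  have h1 : flowbox Ω H D τ = (fun P : ℝ × M ↦ Ω.flow H (P.1 * τ P.2) P.2) '' (Icc 0 1 ×ˢ D) := by
    ext z
    constructor
    · rintro ⟨y, hy, t, ht, rfl⟩
      rcases (h0 y hy).eq_or_lt with h | h
      · refine ⟨(0, y), ⟨⟨le_rfl, zero_le_one⟩, hy⟩, ?_⟩
        have : t = 0 := le_antisymm (by linarith [ht.2]) ht.1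
        simp [this]
      · refine ⟨(t / τ y, y), ⟨⟨by have := ht.1; positivity, (div_le_one h).2 ht.2⟩, hy⟩, ?_⟩
        simp only
        rw [div_mul_cancel₀ _ h.ne']
    · rintro ⟨⟨s, y⟩, ⟨hs, hy⟩, rfl⟩
      have := h0 y hy
      exact ⟨y, hy, s * τ y, ⟨mul_nonneg hs.1 this, mul_le_of_le_one_left this hs.2⟩, rfl⟩
  rw [h1]
  refine (isCompact_Icc.prod hD).image_of_continuousOn ?_
  refine (continuous_flow (A := A) hI hH).comp_continuousOn
    (ContinuousOn.prodMk (f := fun P : ℝ × M ↦ P.1 * τ P.2) ?_ continuousOn_snd)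
  exact continuousOn_fst.mul (hτ.comp continuousOn_snd fun P hP ↦ hP.2)

theorem flowbox_mono {D D' : Set M} {τ τ' : M → ℝ} (h : D ⊆ D') (hτ : ∀ y ∈ D, τ y ≤ τ' y) :
    flowbox Ω H D τ ⊆ flowbox Ω H D' τ' := fun _ ⟨y, hy, t, ht, hz⟩ ↦
  ⟨y, h hy, t, ⟨ht.1, ht.2.trans (hτ y hy)⟩, hz⟩

/-- The Hamiltonian obtained by performing both perturbations `H₁` and `H₂` of `H`. -/
def paste (H H₁ H₂ : M → ℝ) : M → ℝ := H₁ + H₂ - H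

theorem isHamiltonian_paste {s : ℕ∞} (hH : IsHamiltonian I s H) (h₁ : IsHamiltonian I s H₁)
    (h₂ : IsHamiltonian I s H₂) : IsHamiltonian I s (paste H H₁ H₂) :=
  ⟨(h₁.1.add h₂.1).sub hH.1, fun x hx _ hy ↦ by
    simp only [paste, Pi.sub_apply, Pi.add_apply]
    rw [hH.2 x hx _ hy, h₁.2 x hx _ hy, h₂.2 x hx _ hy]⟩

omit [TopologicalSpace M] in
theorem paste_eq_left {z : M} (h : H₂ z = H z) : paste H H₁ H₂ z = H₁ z := by
  simp [paste, h]

omit [TopologicalSpace M] in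
theorem paste_eq_right {z : M} (h : H₁ z = H z) : paste H H₁ H₂ z = H₂ z := by
  simp [paste, h]

namespace SectionPair

variable {S₀ S₁ : A.LocalSection H} {T₁ T₂ δ : ℝ} {P : Set (M → ℝ)} {V₀ W₀ W₁ D₀ D₁ : Set M}
  (G : SectionPair S₀ S₁ T₁ T₂ δ P V₀ W₀ W₁) [T2Space M] [CompactSpace M]
  (hI : range I = univ ∨ range I = {y : E4 | 0 ≤ y 0})

include G hI

theorem isCompact_flowbox_left (hD₀ : IsCompact D₀) (hD₀W : D₀ ⊆ W₀) :
    IsCompact (flowbox Ω H D₀ (S₁.hitTime δ T₁ H)) :=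
  isCompact_flowbox (A := A) hI (G.ham _ G.self_mem) hD₀
    ((G.continuousOn_hitTime hI G.self_mem).mono hD₀W)
    fun _ hy ↦ (G.hitTime_pos hI G.self_mem (hD₀W hy)).le

theorem isCompact_flowbox_right (hT₂ : 0 < T₂) (hD₁ : IsCompact D₁) :
    IsCompact (flowbox Ω H D₁ fun _ ↦ T₂ + 1) :=
  isCompact_flowbox (A := A) hI (G.ham _ G.self_mem) hD₁ continuousOn_const
    fun _ _ ↦ by linarith

theorem flow_notMem_right (h₁ : H₁ ∈ P) (hD₁ : D₁ ⊆ W₁ ∩ S₁.carrier) {y : M} (hy : y ∈ W₀) {t : ℝ}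
    (ht : 0 ≤ t) (htτ : t < S₁.hitTime δ T₁ H₁ y) :
    Ω.flow H₁ t y ∉ flowbox Ω H D₁ fun _ ↦ T₂ + 1 := by
  rintro ⟨q, hq, s, hs, h⟩
  exact htτ.ne (G.eq_of_flow_eq hI h₁ G.self_mem hy (hD₁ hq).1 (hD₁ hq).2 ⟨ht, htτ.le⟩ hs h).1

theorem flow_notMem_left (h₂ : H₂ ∈ P) (hD₀ : D₀ ⊆ W₀) {q : M} (hq : q ∈ W₁)
    (hqS : q ∈ S₁.carrier) {s : ℝ} (hs : 0 < s) (hsT : s ≤ T₂ + 1) :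
    Ω.flow H₂ s q ∉ flowbox Ω H D₀ (S₁.hitTime δ T₁ H) := by
  rintro ⟨y, hy, t, ht, h⟩
  exact hs.ne' (G.eq_of_flow_eq hI G.self_mem h₂ (hD₀ hy) hq hqS ht ⟨hs.le, hsT⟩ h.symm).2

/-- The two flowboxes meet only on the middle section. -/
theorem mem_closure_compl (hD₀ : D₀ ⊆ W₀) (hD₁ : D₁ ⊆ W₁ ∩ S₁.carrier) (p : M) :
    p ∈ closure (flowbox Ω H D₀ (S₁.hitTime δ T₁ H))ᶜ ∨
      p ∈ closure (flowbox Ω H D₁ fun _ ↦ T₂ + 1)ᶜ := by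
  have hH := G.ham _ G.self_mem
  by_cases h0 : p ∈ flowbox Ω H D₀ (S₁.hitTime δ T₁ H)
  swap
  · exact Or.inl (subset_closure h0)
  by_cases h1 : p ∈ flowbox Ω H D₁ fun _ ↦ T₂ + 1
  swap
  · exact Or.inr (subset_closure h1)
  right
  obtain ⟨y, hy, t, ht, rfl⟩ := h0
  obtain ⟨q, hq, s, hs, h⟩ := h1
  have heq := (G.eq_of_flow_eq hI G.self_mem G.self_mem (hD₀ hy) (hD₁ hq).1 (hD₁ hq).2 ht hs h).1
  have hτ := G.hitTime_pos hI G.self_mem (hD₀ hy)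
  rw [heq]
  have h2 : Tendsto (fun t ↦ Ω.flow H t y) (𝓝[<] S₁.hitTime δ T₁ H y)
      (𝓝 (Ω.flow H (S₁.hitTime δ T₁ H y) y)) :=
    (A.continuous_flow_time hI hH y).continuousAt.tendsto.mono_left nhdsWithin_le_nhds
  refine mem_closure_of_tendsto h2 ?_
  filter_upwards [Ioo_mem_nhdsLT hτ] with r hr
  exact G.flow_notMem_right hI G.self_mem hD₁ (hD₀ hy) hr.1.le hr.2

variable (hD₀ : IsCompact D₀) (hD₀W : D₀ ⊆ W₀) (hT₂ : 0 < T₂) (hD₁ : IsCompact D₁)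
  (hD₁W : D₁ ⊆ W₁ ∩ S₁.carrier)
  (hH₁ : ∀ z ∉ flowbox Ω H D₀ (S₁.hitTime δ T₁ H), H₁ z = H z)
  (hH₂ : ∀ z ∉ flowbox Ω H D₁ fun _ ↦ T₂ + 1, H₂ z = H z)

theorem isOpen_compl_left (hD₀ : IsCompact D₀) (hD₀W : D₀ ⊆ W₀) :
    IsOpen (flowbox Ω H D₀ (S₁.hitTime δ T₁ H))ᶜ :=
  (G.isCompact_flowbox_left hI hD₀ hD₀W).isClosed.isOpen_compl

theorem isOpen_compl_right (hT₂ : 0 < T₂) (hD₁ : IsCompact D₁) :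
    IsOpen (flowbox Ω H D₁ fun _ ↦ T₂ + 1)ᶜ :=
  (G.isCompact_flowbox_right hI hT₂ hD₁).isClosed.isOpen_compl

include hD₀ hD₀W hT₂ hD₁ hD₁W hH₁ hH₂ in
-- Each point is a limit of points of an open set on which one of the perturbations is inactive. The
-- flowboxes are taken over compact sets `D₀` and `D₁`, which makes their complements open.
theorem c2Close_paste {ε : ℝ} (h₁ : H₁ ∈ P) (h₂ : H₂ ∈ P) (hc₁ : A.C2Close ε H₁ H)
    (hc₂ : A.C2Close ε H₂ H) : A.C2Close ε (paste H H₁ H₂) H := by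
  have hH := G.ham _ G.self_mem
  refine C2Close.of_closure hH.1 (isHamiltonian_paste hH (G.ham _ h₁) (G.ham _ h₂)).1 fun p ↦ ?_
  rcases G.mem_closure_compl hI hD₀W hD₁W p with h | h
  · exact ⟨H₂, (G.ham _ h₂).1, hc₂, _, G.isOpen_compl_left hI hD₀ hD₀W,
      fun z hz ↦ paste_eq_right (hH₁ z hz), h⟩
  · exact ⟨H₁, (G.ham _ h₁).1, hc₁, _, G.isOpen_compl_right hI hT₂ hD₁,
      fun z hz ↦ paste_eq_left (hH₂ z hz), h⟩

include hT₂ hD₁ hH₂ in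
theorem paste_eventuallyEq_left {z : M} (hz : z ∉ flowbox Ω H D₁ fun _ ↦ T₂ + 1) :
    paste H H₁ H₂ =ᶠ[𝓝 z] H₁ := by
  filter_upwards [(G.isOpen_compl_right hI hT₂ hD₁).mem_nhds hz] with w hw
  exact paste_eq_left (hH₂ w hw)

include hD₀ hD₀W hH₁ in
theorem paste_eventuallyEq_right {z : M} (hz : z ∉ flowbox Ω H D₀ (S₁.hitTime δ T₁ H)) :
    paste H H₁ H₂ =ᶠ[𝓝 z] H₂ := by
  filter_upwards [(G.isOpen_compl_left hI hD₀ hD₀W).mem_nhds hz] with w hw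
  exact paste_eq_right (hH₁ w hw)

section

variable (h₁ : H₁ ∈ P) (h₂ : H₂ ∈ P)

include hT₂ hD₁ hD₁W hH₂ h₁ h₂

theorem flow_paste_left {y : M} (hy : y ∈ W₀) {t : ℝ} (ht : t ∈ Icc 0 (S₁.hitTime δ T₁ H₁ y)) :
    Ω.flow (paste H H₁ H₂) t y = Ω.flow H₁ t y :=
  flow_eq_of_hamField_eq (A := A) hI (G.ham _ h₁)
    (isHamiltonian_paste (G.ham _ G.self_mem) (G.ham _ h₁) (G.ham _ h₂))
    (fun _ hs ↦ hamField_congr (G.paste_eventuallyEq_left hI hT₂ hD₁ hH₂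
      (G.flow_notMem_right hI h₁ hD₁W hy hs.1.le hs.2))) ht

/-- Strictly before the crossing, the compact orbit segment lies in the open complement of the
second flowbox. The inequality must be strict: at the section that flowbox begins, and nearby orbits
may already have entered it. -/
theorem tangentFlow_paste_left {y : M} (hy : y ∈ W₀) {t : ℝ} (ht : 0 ≤ t)
    (htτ : t < S₁.hitTime δ T₁ H₁ y) :
    (Ω.tangentFlow (paste H H₁ H₂) t y : E4 →L[ℝ] E4) = Ω.tangentFlow H₁ t y := by
  have h := flow_eventuallyEq (A := A) hI (G.ham _ h₁)
    (isHamiltonian_paste (G.ham _ G.self_mem) (G.ham _ h₁) (G.ham _ h₂))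
    (G.isOpen_compl_right hI hT₂ hD₁) (fun z hz ↦ (paste_eq_left (hH₂ z hz)).symm) ht
    (x := y) fun s hs ↦ G.flow_notMem_right hI h₁ hD₁W hy hs.1 (hs.2.trans_lt htτ)
  exact h.mfderiv_eq

end

section

variable (h₁ : H₁ ∈ P) (h₂ : H₂ ∈ P)

include hD₀ hD₀W hH₁ h₁ h₂

theorem flow_paste_right {q : M} (hq : q ∈ W₁) (hqS : q ∈ S₁.carrier) {s : ℝ}
    (hs : s ∈ Icc 0 (T₂ + 1)) : Ω.flow (paste H H₁ H₂) s q = Ω.flow H₂ s q :=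
  flow_eq_of_hamField_eq (A := A) hI (G.ham _ h₂)
    (isHamiltonian_paste (G.ham _ G.self_mem) (G.ham _ h₁) (G.ham _ h₂))
    (fun _ hr ↦ hamField_congr (G.paste_eventuallyEq_right hI hD₀ hD₀W hH₁
      (G.flow_notMem_left hI h₂ hD₀W hq hqS hr.1 hr.2.le))) hs

/-- For the same reason the comparison starts a positive time `s` after the section. -/
theorem tangentFlow_paste_right {q : M} (hq : q ∈ W₁) (hqS : q ∈ S₁.carrier) {s t : ℝ}
    (hs : 0 < s) (ht : 0 ≤ t) (hst : s + t ≤ T₂ + 1) :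
    (Ω.tangentFlow (paste H H₁ H₂) t (Ω.flow H₂ s q) : E4 →L[ℝ] E4)
      = Ω.tangentFlow H₂ t (Ω.flow H₂ s q) := by
  have h := flow_eventuallyEq (A := A) hI (G.ham _ h₂)
    (isHamiltonian_paste (G.ham _ G.self_mem) (G.ham _ h₁) (G.ham _ h₂))
    (G.isOpen_compl_left hI hD₀ hD₀W) (fun z hz ↦ (paste_eq_right (hH₁ z hz)).symm) ht
    (x := Ω.flow H₂ s q) fun r hr ↦ by
      rw [← A.flow_add hI (G.ham _ h₂)]
      exact G.flow_notMem_left hI h₂ hD₀W hq hqS (by linarith [hr.1]) (by linarith [hr.2])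
  exact h.mfderiv_eq

end

end SectionPair

end SymplecticForm.DarbouxAtlas

end

end HamRealizable

namespace HamRealizable

/-! ### Projections onto normal spaces in charts -/

section

/-- The projection along `X` onto its orthogonal complement with respect to the bilinear form `g`. -/
noncomputable def projNormal (P : (E4 →L[ℝ] E4 →L[ℝ] ℝ) × E4) : E4 →L[ℝ] E4 :=
  .id ℝ E4 - (P.1 P.2 P.2)⁻¹ • (P.1 P.2).smulRight P.2

theorem projNormal_apply (g : E4 →L[ℝ] E4 →L[ℝ] ℝ) (X v : E4) :
    projNormal (g, X) v = v - (g X v / g X X) • X := by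
  simp [projNormal, smul_smul, div_eq_inv_mul]

theorem continuousAt_projNormal {P : (E4 →L[ℝ] E4 →L[ℝ] ℝ) × E4} (h : P.1 P.2 P.2 ≠ 0) :
    ContinuousAt projNormal P := by
  have h1 : Continuous fun P : (E4 →L[ℝ] E4 →L[ℝ] ℝ) × E4 ↦ P.1 P.2 P.2 := by fun_prop
  have h2 : Continuous fun P : (E4 →L[ℝ] E4 →L[ℝ] ℝ) × E4 ↦ (P.1 P.2).smulRight P.2 := by fun_prop
  exact continuousAt_const.sub ((h1.continuousAt.inv₀ h).smul h2.continuousAt)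

theorem tendsto_projNormal {α : Type*} {l : Filter α} {g : α → E4 →L[ℝ] E4 →L[ℝ] ℝ} {X : α → E4}
    {g₀ : E4 →L[ℝ] E4 →L[ℝ] ℝ} {X₀ : E4} (hg : Tendsto g l (𝓝 g₀)) (hX : Tendsto X l (𝓝 X₀))
    (h : g₀ X₀ X₀ ≠ 0) : Tendsto (fun a ↦ projNormal (g a, X a)) l (𝓝 (projNormal (g₀, X₀))) :=
  (continuousAt_projNormal (P := (g₀, X₀)) h).tendsto.comp (hg.prodMk_nhds hX)

variable {B : Type*} [TopologicalSpace B] {I : ModelWithCorners ℝ E4 B}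
  {M : Type*} [TopologicalSpace M] [ChartedSpace B M] [IsManifold I ∞ M]

namespace SymplecticForm.DarbouxAtlas

variable {Ω : SymplecticForm I M} (A : Ω.DarbouxAtlas) {H H' : M → ℝ} {p q : M} {i : Fin A.num}

/-- The section is the tangent map of the inverse chart applied to a constant vector, and that map
is continuous because the inverse chart is smooth. -/
theorem continuousAt_dh_inverse (hp : p ∈ A.src i) (a : E4) :
    ContinuousAt (fun q ↦ TotalSpace.mk' E4 (E := fun x : M ↦ TangentSpace I x) q
      ((A.dh i q).inverse a)) p := by
  have hU : UniqueMDiffOn 𝓘(ℝ, E4) (A.tgt i) := uniqueMDiffOn_iff_uniqueDiffOn.2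
    (uniqueDiffOn_of_mem_nhdsWithin I.uniqueDiffOn (A.tgt_subset_range i)
      fun z hz ↦ A.tgt_mem_nhdsWithin' hz)
  have h1 := (A.contMDiffOn_hinv i).continuousOn_tangentMapWithin (by simp) hU
  have h2 : ContinuousOn (fun q ↦ (⟨A.h i q, a⟩ : TangentBundle 𝓘(ℝ, E4) E4)) (A.src i) := by
    have h3 : Continuous fun z : E4 ↦ (⟨z, a⟩ : TangentBundle 𝓘(ℝ, E4) E4) :=
      (tangentBundleModelSpaceHomeomorph 𝓘(ℝ, E4)).symm.continuous.comp
        (continuous_id.prodMk continuous_const)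
    exact h3.comp_continuousOn (A.continuousOn_h i)
  have h4 := h1.comp h2 fun q hq ↦ A.h_mem_tgt hq
  have h5 := h4.continuousAt ((A.isOpen_src i).mem_nhds hp)
  refine h5.congr ?_
  filter_upwards [(A.isOpen_src i).mem_nhds hp] with q hq
  have h6 : mfderivWithin 𝓘(ℝ, E4) I (A.hinv i) (A.tgt i) (A.h i q)
      = (A.dh i (A.hinv i (A.h i q))).inverse :=
    ((A.hasMFDerivWithinAt_hinv (A.h_mem_tgt hq)).mono (A.tgt_subset_range i)).mfderivWithin
      (hU _ (A.h_mem_tgt hq))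
  simp only [Function.comp, tangentMapWithin]
  rw [h6, A.hinv_h hq]
  rfl

variable [RiemannianBundle (fun x : M ↦ TangentSpace I x)]

/-- The expression of the Riemannian metric in the `i`-th chart. -/
noncomputable def metric (i : Fin A.num) (q : M) : E4 →L[ℝ] E4 →L[ℝ] ℝ :=
  (innerSL ℝ (E := TangentSpace I q)).bilinearComp (A.dh i q).inverse (A.dh i q).inverse

theorem metric_apply (i : Fin A.num) (q : M) (a b : E4) :
    A.metric i q a b = inner ℝ ((A.dh i q).inverse a) ((A.dh i q).inverse b) := rfl

theorem continuousAt_metric [IsContMDiffRiemannianBundle I ∞ E4 (fun x : M ↦ TangentSpace I x)]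
    (hp : p ∈ A.src i) : ContinuousAt (A.metric i) p := by
  have : IsContinuousRiemannianBundle E4 (fun x : M ↦ TangentSpace I x) := by
    obtain ⟨g, hg, h⟩ := IsContMDiffRiemannianBundle.exists_contMDiff (IB := I) (n := ∞) (F := E4)
      (E := fun x : M ↦ TangentSpace I x)
    exact ⟨g, hg.continuous, h⟩
  refine continuousAt_clm_apply.2 fun a ↦ continuousAt_clm_apply.2 fun b ↦ ?_
  exact (A.continuousAt_dh_inverse hp a).inner_bundle (A.continuousAt_dh_inverse hp b)

theorem metric_dh (hp : p ∈ A.src i) (v w : TangentSpace I p) :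
    A.metric i p (A.dh i p v) (A.dh i p w) = inner ℝ v w := by
  rw [metric_apply, A.dh_inverse_dh hp, A.dh_inverse_dh hp]

theorem dh_starProjection (hp : p ∈ A.src i) (v : TangentSpace I p) :
    A.dh i p ((normalSpace Ω H p).starProjection v)
      = projNormal (A.metric i p, A.dh i p (Ω.hamField H p)) (A.dh i p v) := by
  rw [projNormal_apply, A.metric_dh hp, A.metric_dh hp, normalSpace,
    Submodule.starProjection_orthogonal_val, Submodule.starProjection_singleton, map_sub, map_smul,
    real_inner_self_eq_norm_sq]
  rfl

theorem metric_self_ne_zero (hp : p ∈ A.src i) (hX : Ω.hamField H p ≠ 0) :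
    A.metric i p (A.dh i p (Ω.hamField H p)) (A.dh i p (Ω.hamField H p)) ≠ 0 := by
  rw [A.metric_dh hp]
  exact inner_self_ne_zero.2 hX

/-- Differentials of short pieces of orbits, projected to the normal spaces, are close to the
projection to the normal space. -/
theorem exists_isOpen_projNormal_close
    [IsContMDiffRiemannianBundle I ∞ E4 (fun x : M ↦ TangentSpace I x)] [T2Space M] [CompactSpace M]
    (hI : range I = univ ∨ range I = {y : E4 | 0 ≤ y 0}) {𝓕 : Filter (M → ℝ)}
    (hC : A.C1Conv 𝓕 H) (hH : IsHamiltonian I 2 H) (hp : p ∈ A.src i) (hX : Ω.hamField H p ≠ 0)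
    {η : ℝ} (hη : 0 < η) :
    ∃ δ > 0, ∃ P ∈ 𝓕, ∃ O, IsOpen O ∧ p ∈ O ∧ O ⊆ A.src i ∧ ∀ H' ∈ P, ∀ q ∈ O, ∀ t, |t| < δ →
      Ω.flow H' t q ∈ A.src i ∧
      ∃ S : E4 →L[ℝ] E4, ‖S - projNormal (A.metric i p, A.dh i p (Ω.hamField H p))‖ < η ∧
        ∀ v : TangentSpace I q, A.dh i (Ω.flow H' t q)
          ((normalSpace Ω H' (Ω.flow H' t q)).starProjection (Ω.tangentFlow H' t q v))
            = S (A.dh i q v) := by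
  set Q := projNormal (A.metric i p, A.dh i p (Ω.hamField H p)) with hQ
  -- With L within c of the identity and Q' within c of Q, the error Q' L - Q = Q' (L - 1) + (Q' -
  -- Q) has norm at most (‖Q‖ + c) c + c.
  obtain ⟨c, hc, hcη⟩ : ∃ c > 0, c * (‖Q‖ + c) + c < η := by
    have h1 : Tendsto (fun c : ℝ ↦ c * (‖Q‖ + c) + c) (𝓝[>] 0) (𝓝 (0 * (‖Q‖ + 0) + 0)) := by
      refine Tendsto.mono_left ?_ nhdsWithin_le_nhds
      exact Continuous.tendsto (by fun_prop) 0
    simp only [zero_mul, add_zero] at h1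
    obtain ⟨c, h2, h3⟩ := ((h1.eventually_lt_const hη).and self_mem_nhdsWithin).exists
    exact ⟨c, h3, h2⟩
  obtain ⟨δ, hδ, h1⟩ := hC.eventually_tangentFlow hI hp hc
  have h2 : Tendsto (fun P : (M → ℝ) × M ↦ projNormal (A.metric i P.2, A.vf i P.1 (A.h i P.2)))
      (𝓕 ×ˢ 𝓝 p) (𝓝 Q) := by
    have h3 : Tendsto (fun P : (M → ℝ) × M ↦ A.vf i P.1 (A.h i P.2)) (𝓕 ×ˢ 𝓝 p)
        (𝓝 (A.vf i H (A.h i p))) :=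
      Tendsto.comp (g := fun P : (M → ℝ) × E4 ↦ A.vf i P.1 P.2)
        (f := fun P : (M → ℝ) × M ↦ (P.1, A.h i P.2)) (hC.conv i p hp)
        (tendsto_fst.prodMk ((A.tendsto_h_nhdsWithin hp).comp tendsto_snd))
    have h4 : Tendsto (fun P : (M → ℝ) × M ↦ A.metric i P.2) (𝓕 ×ˢ 𝓝 p) (𝓝 (A.metric i p)) :=
      Tendsto.comp (g := A.metric i) (A.continuousAt_metric hp) tendsto_snd
    have h6 : A.vf i H (A.h i p) = A.dh i p (Ω.hamField H p) := A.localField_h _ hp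
    rw [h6] at h3
    have h5 := A.metric_self_ne_zero hp hX
    rw [hQ]
    generalize A.dh i p (Ω.hamField H p) = X₀ at h3 h5 ⊢
    exact tendsto_projNormal h4 h3 h5
  have h3 := (hC.tendsto_flow hI hH 0 p)
  rw [A.flow_zero hI hH] at h3
  have h4 : Tendsto (fun P : (M → ℝ) × ℝ × M ↦ (P.1, Ω.flow P.1 P.2.1 P.2.2)) (𝓕 ×ˢ 𝓝 0 ×ˢ 𝓝 p)
      (𝓕 ×ˢ 𝓝 p) := tendsto_fst.prodMk h3
  have h5 : ∀ᶠ P : (M → ℝ) × ℝ × M in 𝓕 ×ˢ 𝓝 0 ×ˢ 𝓝 p, ‖projNormal (A.metric i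
      (Ω.flow P.1 P.2.1 P.2.2), A.vf i P.1 (A.h i (Ω.flow P.1 P.2.1 P.2.2))) - Q‖ < c := by
    have := (h2.comp h4).eventually (Metric.ball_mem_nhds Q hc)
    simpa only [Function.comp, Metric.mem_ball, dist_eq_norm] using this
  obtain ⟨P₁, hP₁, R, hR, h6⟩ := eventually_prod_iff.1 h5
  obtain ⟨R₁, hR₁, R₂, hR₂, h7⟩ := eventually_prod_iff.1 hR
  obtain ⟨δ', hδ', hball⟩ := Metric.eventually_nhds_iff.1 hR₁
  obtain ⟨P₂, hP₂, R₃, hR₃, h8⟩ := eventually_prod_iff.1 h1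
  obtain ⟨O, hO1, hO2, hO3⟩ := eventually_nhds_iff.1
    ((hR₂.and hR₃).and ((A.isOpen_src i).mem_nhds hp))
  refine ⟨min δ δ', lt_min hδ hδ', {H' | (P₁ H' ∧ P₂ H') ∧ IsHamiltonian I 2 H'},
    (hP₁.and hP₂).and hC.ham, O, hO2, hO3, fun q hq ↦ (hO1 q hq).2, ?_⟩
  rintro H' ⟨⟨hH1, hH2⟩, hH'⟩ q hq t ht
  obtain ⟨hq1, hq2, L, hL, hLv⟩ := h8 hH2 (hO1 q hq).1.2 t
    (abs_lt.1 (ht.trans_le (min_le_left _ _)))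
  have h9 := h6 hH1 (h7 (hball (y := t) (by
    rw [Real.dist_0_eq_abs]; exact ht.trans_le (min_le_right _ _))) (hO1 q hq).1.1)
  simp only at h9 hq1 hq2 hLv
  refine ⟨hq2, projNormal (A.metric i (Ω.flow H' t q), A.vf i H' (A.h i (Ω.flow H' t q))) ∘L L,
    ?_, fun v ↦ ?_⟩
  · set Q' := projNormal (A.metric i (Ω.flow H' t q), A.vf i H' (A.h i (Ω.flow H' t q)))
    have h10 : Q' ∘L L - Q = Q' ∘L (L - .id ℝ E4) + (Q' - Q) := by
      ext1 v
      simp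
    have h11 : ‖Q'‖ ≤ ‖Q‖ + c := by
      calc ‖Q'‖ = ‖Q + (Q' - Q)‖ := by rw [add_sub_cancel]
        _ ≤ _ := (norm_add_le _ _).trans (by linarith)
    calc ‖Q' ∘L L - Q‖ ≤ ‖Q'‖ * ‖L - .id ℝ E4‖ + ‖Q' - Q‖ := by
          rw [h10]
          exact (norm_add_le _ _).trans (by gcongr; exact ContinuousLinearMap.opNorm_comp_le _ _)
      _ ≤ (‖Q‖ + c) * c + c := by gcongr
      _ < η := by linarith
  · rw [A.dh_starProjection hq2, hLv v, ← A.localField_h (Ω.hamField H') hq2]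
    rfl

end SymplecticForm.DarbouxAtlas

end

end HamRealizable

namespace HamRealizable

/-! ### Normal sections as transversal sections -/

section

variable {B : Type*} [TopologicalSpace B] {I : ModelWithCorners ℝ E4 B}
  {M : Type*} [TopologicalSpace M] [ChartedSpace B M] [IsManifold I ∞ M]
  [RiemannianBundle (fun x : M ↦ TangentSpace I x)]
  {Ω : SymplecticForm I M} (A : Ω.DarbouxAtlas) {H H' : M → ℝ} {a p q : M} {r r' : ℝ}

theorem mem_normalSpace_iff {v : TangentSpace I a} :
    v ∈ normalSpace Ω H a ↔ inner ℝ (Ω.hamField H a) v = 0 :=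
  Submodule.mem_orthogonal_singleton_iff_inner_right

theorem finrank_normalSpace (hX : Ω.hamField H a ≠ 0) :
    Module.finrank ℝ (normalSpace Ω H a) = 3 := by
  have : Fact (Module.finrank ℝ (TangentSpace I a) = 3 + 1) :=
    ⟨(finrank_euclideanSpace_fin : Module.finrank ℝ E4 = 4)⟩
  exact Submodule.finrank_orthogonal_span_singleton hX

namespace SymplecticForm.DarbouxAtlas

theorem normalFrame_eq (hX : Ω.hamField H a ≠ 0) (k : Fin 3) : normalFrame Ω H a k =
    (Module.finBasisOfFinrankEq ℝ (normalSpace Ω H a) (finrank_normalSpace hX) k) := by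
  rw [normalFrame, dif_pos (finrank_normalSpace hX)]

theorem linearCombination_normalFrame (hX : Ω.hamField H a ≠ 0) (c : Fin 3 → ℝ) :
    ∑ k, c k • normalFrame Ω H a k = ((Module.finBasisOfFinrankEq ℝ (normalSpace Ω H a)
      (finrank_normalSpace hX)).equivFun.symm c : normalSpace Ω H a) := by
  rw [Module.Basis.equivFun_symm_apply]
  simp [normalFrame_eq hX]

/-- The normal section as a transversal section. -/
noncomputable def normalLocalSection (hX : Ω.hamField H a ≠ 0) : A.LocalSection H where
  i := A.idx a
  a := a
  mem := A.mem_idx a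
  E := A.dh (A.idx a) a ∘L
    LinearMap.toContinuousLinearMap (Fintype.linearCombination ℝ (normalFrame Ω H a))
  ℓ := innerSL ℝ (Ω.hamField H a) ∘L (A.dh (A.idx a) a).inverse
  inj c c' h := by
    have h1 := congrArg (A.dh (A.idx a) a).inverse h
    simp only [ContinuousLinearMap.comp_apply, A.dh_inverse_dh (A.mem_idx a),
      LinearMap.coe_toContinuousLinearMap', Fintype.linearCombination_apply,
      linearCombination_normalFrame hX] at h1
    exact (LinearEquiv.injective _) (Subtype.ext h1)
  mem_range_iff v := by
    constructor
    · rintro ⟨c, rfl⟩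
      simp only [ContinuousLinearMap.comp_apply, A.dh_inverse_dh (A.mem_idx a),
        LinearMap.coe_toContinuousLinearMap', Fintype.linearCombination_apply,
        linearCombination_normalFrame hX]
      exact mem_normalSpace_iff.1 (Subtype.prop _)
    · intro h
      have h1 : (A.dh (A.idx a) a).inverse v ∈ normalSpace Ω H a := mem_normalSpace_iff.2 h
      refine ⟨(Module.finBasisOfFinrankEq ℝ (normalSpace Ω H a)
        (finrank_normalSpace hX)).equivFun ⟨_, h1⟩, ?_⟩
      simp only [ContinuousLinearMap.comp_apply,
        LinearMap.coe_toContinuousLinearMap', Fintype.linearCombination_apply,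
        linearCombination_normalFrame hX, LinearEquiv.symm_apply_apply]
      exact A.dh_dh_inverse (A.mem_idx a) v
  pos := by
    have h1 : A.vf (A.idx a) H (A.h (A.idx a) a) = A.dh (A.idx a) a (Ω.hamField H a) :=
      A.localField_h _ (A.mem_idx a)
    rw [h1, ContinuousLinearMap.comp_apply, A.dh_inverse_dh (A.mem_idx a)]
    exact real_inner_self_pos.2 hX

theorem carrier_normalLocalSection (hX : Ω.hamField H a ≠ 0) :
    (A.normalLocalSection hX).carrier = A.normalSection H a := by
  ext q
  exact and_congr_right fun _ ↦ mem_normalSpace_iff.symm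

theorem E_normalLocalSection (hX : Ω.hamField H a ≠ 0) (c : Fin 3 → ℝ) :
    (A.normalLocalSection hX).E c = A.dh (A.idx a) a (∑ k, c k • normalFrame Ω H a k) := rfl

theorem density_normalLocalSection (hX : Ω.hamField H a ≠ 0) (c : Fin 3 → ℝ) :
    (A.normalLocalSection hX).density H c = A.fluxDensity H a c := by
  have h1 : ∀ k, (A.normalLocalSection hX).E (Pi.single k 1)
      = A.dh (A.idx a) a (normalFrame Ω H a k) := by
    intro k
    rw [E_normalLocalSection]
    congr 1
    simp [Pi.single_apply]
  rw [LocalSection.density, h1, h1, h1]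
  rfl

theorem flux_normalLocalSection (hX : Ω.hamField H a ≠ 0) (Y : Set M) :
    (A.normalLocalSection hX).flux Y = A.sectionMeasure H a Y := by
  have h1 : (A.normalLocalSection hX).coords Y = {c : Fin 3 → ℝ | ∃ y ∈ Y ∩ A.normalSection H a,
      A.h (A.idx a) y = A.sectionCoord H a c} := by
    rw [LocalSection.coords, carrier_normalLocalSection]
    rfl
  rw [LocalSection.flux, sectionMeasure, h1]
  simp only [density_normalLocalSection]

omit [RiemannianBundle (fun x : M ↦ TangentSpace I x)] in
theorem continuousOn_displacement : ContinuousOn (A.displacement a) (A.src (A.idx a)) :=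
  (A.dh (A.idx a) a).inverse.continuous.comp_continuousOn
    ((A.continuousOn_h _).sub continuousOn_const)

omit [RiemannianBundle (fun x : M ↦ TangentSpace I x)] in
theorem displacement_self : A.displacement a a = 0 := by simp [displacement]

theorem self_mem_normalSection : a ∈ A.normalSection H a :=
  ⟨A.mem_idx a, by rw [displacement_self]; exact zero_mem _⟩

theorem self_mem_ball (hr : 0 < r) : a ∈ A.ball H a r :=
  ⟨A.self_mem_normalSection, by simp [displacement_self, hr]⟩

theorem ball_subset : A.ball H a r ⊆ A.normalSection H a := fun _ h ↦ h.1

theorem ball_mono (h : r ≤ r') : A.ball H a r ⊆ A.ball H a r' :=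
  fun _ hq ↦ ⟨hq.1, hq.2.1.trans_le h, hq.2.2.trans_le h⟩

theorem exists_isOpen_ball (H : M → ℝ) (a : M) (r : ℝ) :
    ∃ V, IsOpen V ∧ A.ball H a r = V ∩ A.normalSection H a := by
  have h1 : IsOpen {v : TangentSpace I a | ‖(transSpace Ω H a).starProjection v‖ < r ∧
      ‖v - (transSpace Ω H a).starProjection v‖ < r} := by
    have h2 : IsOpen {v : TangentSpace I a | ‖(transSpace Ω H a).starProjection v‖ < r} :=
      isOpen_lt (ContinuousLinearMap.continuous _).norm continuous_const
    have h3 : IsOpen {v : TangentSpace I a | ‖v - (transSpace Ω H a).starProjection v‖ < r} :=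
      isOpen_lt (continuous_id.sub (ContinuousLinearMap.continuous _)).norm continuous_const
    exact h2.inter h3
  refine ⟨_, A.continuousOn_displacement.isOpen_inter_preimage (A.isOpen_src (A.idx a)) h1, ?_⟩
  ext q
  exact ⟨fun h ↦ ⟨⟨h.1.1, h.2⟩, h.1⟩, fun h ↦ ⟨h.2, h.1.2⟩⟩

theorem exists_ball_subset (H : M → ℝ) {W : Set M} (hW : W ∈ 𝓝 a) : ∃ r > 0, A.ball H a r ⊆ W := by
  have h1 := A.tendsto_hinv_nhds (A.mem_idx a) hW
  obtain ⟨ρ, hρ, h2⟩ := Metric.mem_nhdsWithin_iff.1 (mem_map.1 h1)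
  set C := ‖A.dh (A.idx a) a‖ with hC
  refine ⟨ρ / (2 * C + 1), by positivity, fun q hq ↦ ?_⟩
  set v := A.displacement a q with hv
  have h3 : A.h (A.idx a) q - A.h (A.idx a) a = A.dh (A.idx a) a v :=
    (A.dh_dh_inverse (A.mem_idx a) _).symm
  have h4 : ‖v‖ ≤ 2 * (ρ / (2 * C + 1)) := by
    calc ‖v‖ = ‖(transSpace Ω H a).starProjection v
          + (v - (transSpace Ω H a).starProjection v)‖ := by rw [add_sub_cancel]
      _ ≤ _ := norm_add_le _ _
      _ ≤ 2 * (ρ / (2 * C + 1)) := by linarith [hq.2.1, hq.2.2]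
  have h5 : A.h (A.idx a) q ∈ Metric.ball (A.h (A.idx a) a) ρ := by
    rw [mem_ball_iff_norm, h3]
    calc _ ≤ C * ‖v‖ := ContinuousLinearMap.le_opNorm _ _
      _ ≤ C * (2 * (ρ / (2 * C + 1))) := by gcongr
      _ = 2 * C / (2 * C + 1) * ρ := by ring
      _ < 1 * ρ := by
        gcongr
        rw [div_lt_one (by positivity)]
        linarith
      _ = ρ := one_mul ρ
  have h6 := h2 ⟨h5, A.h_mem_range _ q⟩
  rwa [mem_preimage, A.hinv_h hq.1.1] at h6

end SymplecticForm.DarbouxAtlas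

end

end HamRealizable

namespace HamRealizable

/-! ### The linear Poincaré flow as a cocycle, and concatenated linear flows -/

section

/-- Composition is continuous. Six factors occur in the decomposition of the pasted linear Poincaré
flow: two long ones and four short corrections. -/
theorem exists_forall_comp_close {V : Type*} [NormedAddCommGroup V] [NormedSpace ℝ V]
    (a b c d e f : V →L[ℝ] V) {γ : ℝ} (hγ : 0 < γ) :
    ∃ η > 0, ∀ a' b' c' d' e' f' : V →L[ℝ] V, ‖a' - a‖ < η → ‖b' - b‖ < η → ‖c' - c‖ < η →
      ‖d' - d‖ < η → ‖e' - e‖ < η → ‖f' - f‖ < η →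
      ‖a' ∘L b' ∘L c' ∘L d' ∘L e' ∘L f' - a ∘L b ∘L c ∘L d ∘L e ∘L f‖ < γ := by
  have h1 : Continuous fun P : (V →L[ℝ] V) × (V →L[ℝ] V) × (V →L[ℝ] V) × (V →L[ℝ] V) ×
      (V →L[ℝ] V) × (V →L[ℝ] V) ↦
      P.1 ∘L P.2.1 ∘L P.2.2.1 ∘L P.2.2.2.1 ∘L P.2.2.2.2.1 ∘L P.2.2.2.2.2 := by fun_prop
  obtain ⟨η, hη, h2⟩ := Metric.continuousAt_iff.1 (h1.continuousAt (x := (a, b, c, d, e, f))) γ hγ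
  refine ⟨η, hη, fun a' b' c' d' e' f' ha hb hc hd he hf ↦ ?_⟩
  have h3 := h2 (x := (a', b', c', d', e', f')) (by
    simp only [Prod.dist_eq, max_lt_iff]
    simp only [dist_eq_norm]
    exact ⟨ha, hb, hc, hd, he, hf⟩)
  rwa [dist_eq_norm] at h3

variable {B : Type*} [TopologicalSpace B] {I : ModelWithCorners ℝ E4 B}
  {M : Type*} [TopologicalSpace M] [ChartedSpace B M] [IsManifold I ∞ M]
  [RiemannianBundle (fun x : M ↦ TangentSpace I x)]
  {Ω : SymplecticForm I M} {H H' : M → ℝ} {p q : M}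

variable (Ω) in
/-- The linear Poincaré flow, as a map between the full tangent spaces. -/
noncomputable def normalFlow (H : M → ℝ) (t : ℝ) (q : M) (v : TangentSpace I q) :
    TangentSpace I (Ω.flow H t q) :=
  (normalSpace Ω H (Ω.flow H t q)).starProjection (Ω.tangentFlow H t q v)

theorem exists_starProjection_normalSpace (v : TangentSpace I q) :
    ∃ c : ℝ, (normalSpace Ω H q).starProjection v = v - c • Ω.hamField H q := by
  rw [normalSpace, Submodule.starProjection_orthogonal_val, Submodule.starProjection_singleton]
  exact ⟨_, rfl⟩

theorem starProjection_normalSpace_hamField :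
    (normalSpace Ω H q).starProjection (Ω.hamField H q) = 0 := by
  rw [normalSpace, Submodule.starProjection_orthogonal_val, Submodule.starProjection_eq_self_iff.2
    (Submodule.mem_span_singleton_self _), sub_self]

theorem starProjection_mem_transSpace {v : TangentSpace I q} (hv : dHam I H q v = 0) :
    (normalSpace Ω H q).starProjection v ∈ transSpace Ω H q := by
  refine ⟨Submodule.starProjection_apply_mem _ _, ?_⟩
  obtain ⟨c, hc⟩ := exists_starProjection_normalSpace (Ω := Ω) (H := H) v
  change dHam I H q _ = 0
  rw [hc, map_sub, map_smul, hv, Ω.dHam_hamField, smul_zero, sub_zero]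

theorem dHam_of_mem_transSpace {v : TangentSpace I q} (hv : v ∈ transSpace Ω H q) :
    dHam I H q v = 0 := hv.2

/-- Tangent vectors at points that are equal only propositionally are compared in the common model
space `E4`; with the next lemmas this avoids transport along equalities of base points. -/
theorem starProjection_normalSpace_congr {p q : M} (h : p = q)
    (hX : (Ω.hamField H' p : E4) = Ω.hamField H q) {v : TangentSpace I p} {w : TangentSpace I q}
    (hv : (v : E4) = w) : ((normalSpace Ω H' p).starProjection v : E4)
      = (normalSpace Ω H q).starProjection w := by
  subst h
  have h1 : normalSpace Ω H' p = normalSpace Ω H p := by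
    rw [normalSpace, normalSpace, show Ω.hamField H' p = Ω.hamField H p from hX]
  rw [h1, show v = w from hv]

theorem normalFlow_congr {t : ℝ} (h : Ω.flow H' t q = Ω.flow H t q) {v w : TangentSpace I q}
    (hD : (Ω.tangentFlow H' t q v : E4) = Ω.tangentFlow H t q w)
    (hX : Ω.hamField H' (Ω.flow H t q) = Ω.hamField H (Ω.flow H t q)) :
    (normalFlow Ω H' t q v : E4) = normalFlow Ω H t q w := by
  have h1 : (Ω.hamField H' (Ω.flow H' t q) : E4) = Ω.hamField H (Ω.flow H t q) := by
    rw [← hX, h]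
  exact starProjection_normalSpace_congr h h1 hD

theorem normalFlow_base_congr {t : ℝ} {p q : M} (h : p = q) {v : TangentSpace I p}
    {w : TangentSpace I q} (hv : (v : E4) = w) :
    (normalFlow Ω H t p v : E4) = normalFlow Ω H t q w := by
  subst h
  rw [show v = w from hv]

namespace SymplecticForm.DarbouxAtlas

variable {A : Ω.DarbouxAtlas} [T2Space M] [CompactSpace M]
  (hI : range I = univ ∨ range I = {y : E4 | 0 ≤ y 0}) (hH : IsHamiltonian I 2 H)

include A hI hH

/-- The discarded component is a multiple of X_H, which the flow carries to X_H and the final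
projection kills. -/
theorem normalFlow_starProjection (t : ℝ) (q : M) (v : TangentSpace I q) :
    normalFlow Ω H t q ((normalSpace Ω H q).starProjection v) = normalFlow Ω H t q v := by
  obtain ⟨c, hc⟩ := exists_starProjection_normalSpace (Ω := Ω) (H := H) v
  rw [hc, normalFlow, normalFlow, map_sub, map_smul, tangentFlow_hamField (A := A) hI hH t q,
    map_sub, map_smul, starProjection_normalSpace_hamField, smul_zero, sub_zero]

/-- Since intermediate projections are invisible, an orbit may be cut at any times, which need not
be arrival times at sections. -/
theorem normalFlow_add (s t : ℝ) (q : M) (v : TangentSpace I q) :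
    (normalFlow Ω H (s + t) q v : E4)
      = normalFlow Ω H s (Ω.flow H t q) (normalFlow Ω H t q v) := by
  have h1 := normalFlow_starProjection (A := A) hI hH s (Ω.flow H t q) (Ω.tangentFlow H t q v)
  have h3 : (Ω.hamField H (Ω.flow H (s + t) q) : E4) = Ω.hamField H (Ω.flow H s (Ω.flow H t q)) := by
    rw [A.flow_add hI hH]
  have h4 := starProjection_normalSpace_congr (A.flow_add hI hH s t q) h3
    (tangentFlow_add_apply (A := A) hI hH s t q v)
  exact h4.trans (congrArg (fun w : TangentSpace I _ ↦ (w : E4)) h1.symm)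

theorem normalFlow_mem_transSpace (t : ℝ) (q : M) {v : TangentSpace I q} (hv : dHam I H q v = 0) :
    (normalFlow Ω H t q v : TangentSpace I (Ω.flow H t q)) ∈ transSpace Ω H (Ω.flow H t q) :=
  starProjection_mem_transSpace (by rw [dHam_tangentFlow (A := A) hI hH, hv])

end SymplecticForm.DarbouxAtlas

namespace LinearFlow

variable {x : M} {T₁ : ℝ} {L₁ : LinearFlow Ω H x} {L₂ : LinearFlow Ω H (Ω.flow H T₁ x)}

theorem apply_cast {y : M} (e : p = q) (f : transSpace Ω H y →L[ℝ] transSpace Ω H p)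
    (w : transSpace Ω H y) :
    (((e ▸ f : transSpace Ω H y →L[ℝ] transSpace Ω H q) w : TangentSpace I q) : E4)
      = (f w : TangentSpace I p) := by
  subst e
  rfl

theorem concat_of_le {t : ℝ} (ht : t ≤ T₁) : concat T₁ L₁ L₂ t = L₁ t := if_pos ht

theorem concat_apply {t : ℝ} (ht : T₁ < t)
    (e : Ω.flow H (t - T₁) (Ω.flow H T₁ x) = Ω.flow H t x) (w : transSpace Ω H x) :
    ((concat T₁ L₁ L₂ t w : TangentSpace I (Ω.flow H t x)) : E4)
      = (L₂ (t - T₁) (L₁ T₁ w) : TangentSpace I (Ω.flow H (t - T₁) (Ω.flow H T₁ x))) := by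
  have h1 : concat T₁ L₁ L₂ t = e ▸ (L₂ (t - T₁) ∘L L₁ T₁) := by
    rw [concat, if_neg ht.not_ge, dif_pos e]
  rw [h1]
  exact apply_cast e _ w

omit [RiemannianBundle (fun x : M ↦ TangentSpace I x)] in
theorem form_congr (e : p = q) {v w : TangentSpace I p} {v' w' : TangentSpace I q}
    (hv : (v : E4) = v') (hw : (w : E4) = w') : Ω.form p v w = Ω.form q v' w' := by
  subst e
  rw [show v = v' from hv, show w = w' from hw]

theorem isSymplectic_concat {T₂ : ℝ} (hT₁ : 0 ≤ T₁)
    (e : ∀ t, Ω.flow H (t - T₁) (Ω.flow H T₁ x) = Ω.flow H t x) (h₁ : L₁.IsSymplectic T₁)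
    (h₂ : L₂.IsSymplectic T₂) : (concat T₁ L₁ L₂).IsSymplectic (T₁ + T₂) := by
  intro t ht v w
  rcases le_or_gt t T₁ with h | h
  · rw [concat_of_le h]
    exact h₁ t ⟨ht.1, h⟩ v w
  · rw [← h₁ T₁ ⟨hT₁, le_rfl⟩ v w, ← h₂ (t - T₁) ⟨by linarith, by linarith [ht.2]⟩ (L₁ T₁ v) (L₁ T₁ w)]
    exact (form_congr (e t) (concat_apply h (e t) v).symm (concat_apply h (e t) w).symm).symm

theorem ext_mem (L : LinearFlow Ω H x) (t : ℝ) (v : TangentSpace I x) :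
    L.ext t v ∈ transSpace Ω H (Ω.flow H t x) :=
  (L t ((transSpace Ω H x).orthogonalProjectionOnto v)).2

theorem concat_ext {T₂ : ℝ} (hT₂ : 0 < T₂)
    (e : ∀ t, Ω.flow H (t - T₁) (Ω.flow H T₁ x) = Ω.flow H t x) (v : TangentSpace I x) :
    ((concat T₁ L₁ L₂).ext (T₁ + T₂) v : E4) = L₂.ext T₂ (L₁.ext T₁ v) := by
  have h1 : ((concat T₁ L₁ L₂).ext (T₁ + T₂) v : E4) = _ := concat_apply (L₁ := L₁) (L₂ := L₂)
    (show T₁ < T₁ + T₂ by linarith) (e _) ((transSpace Ω H x).orthogonalProjectionOnto v)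
  rw [h1, add_sub_cancel_left]
  have h2 : (transSpace Ω H (Ω.flow H T₁ x)).orthogonalProjectionOnto (L₁.ext T₁ v)
      = L₁ T₁ ((transSpace Ω H x).orthogonalProjectionOnto v) :=
    Submodule.orthogonalProjectionOnto_mem_subspace_eq_self _
  have h3 : L₂.ext T₂ (L₁.ext T₁ v) = L₂ T₂ ((transSpace Ω H (Ω.flow H T₁ x)).orthogonalProjectionOnto
    (L₁.ext T₁ v)) := rfl
  rw [h3, h2]

end LinearFlow

end

end HamRealizable

namespace HamRealizable

/-! ### Cutting the orbit of a pasted Hamiltonian near the middle section -/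

section

variable {B : Type*} [TopologicalSpace B] {I : ModelWithCorners ℝ E4 B}
  {M : Type*} [TopologicalSpace M] [ChartedSpace B M] [IsManifold I ∞ M]
  {Ω : SymplecticForm I M} {H H' H₁ H₂ K : M → ℝ} {p q : M}

theorem dHam_eq_of_hamField_eq (h : Ω.hamField H' q = Ω.hamField H q) : dHam I H' q = dHam I H q :=
  (Ω.hamField_eq_iff H' H q).1 h

theorem SymplecticForm.DarbouxAtlas.dh_congr (A : Ω.DarbouxAtlas) (i : Fin A.num) (h : p = q)
    {v : TangentSpace I p} {w : TangentSpace I q} (hv : (v : E4) = w) :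
    A.dh i p v = A.dh i q w := by
  subst h
  rw [show v = w from hv]

variable [RiemannianBundle (fun x : M ↦ TangentSpace I x)]

theorem normalFlow_time_congr {s t : ℝ} (h : s = t) (v : TangentSpace I q) :
    (normalFlow Ω H s q v : E4) = normalFlow Ω H t q v := by
  subst h
  rfl

theorem transSpace_congr (h : Ω.hamField H' q = Ω.hamField H q) :
    transSpace Ω H' q = transSpace Ω H q := by
  rw [transSpace, transSpace, normalSpace, normalSpace, h, dHam_eq_of_hamField_eq h]

theorem transFlow_apply (t : ℝ) (q : M) (v : TangentSpace I q) :
    transFlow Ω H t q v = normalFlow Ω H t q ((transSpace Ω H q).starProjection v) := rfl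

namespace SymplecticForm.DarbouxAtlas

variable {A : Ω.DarbouxAtlas} [T2Space M] [CompactSpace M]

/-- The expression in charts of the transversal linear Poincaré flow of a Hamiltonian `K` that
coincides with `H₁` along the first part of an orbit and with `H₂` along the last part of it. -/
theorem transFlow_eq_comp (hI : range I = univ ∨ range I = {y : E4 | 0 ≤ y 0})
    (h₁ : IsHamiltonian I 2 H₁) (h₂ : IsHamiltonian I 2 H₂) (hK : IsHamiltonian I 2 K)
    {i₀ i₁ i₂ : Fin A.num} {y p₁ p₂ p₃ p₄ p₅ : M} {T₁ T₂ d e e' : ℝ} (he : e + e' = 2 * d)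
    (hp₁ : Ω.flow H₁ T₁ y = p₁) (hp₂ : Ω.flow H₁ (-d) p₁ = p₂) (hp₃ : Ω.flow K e p₂ = p₃)
    (hp₄ : Ω.flow H₂ (-d) p₃ = p₄) (hp₅ : Ω.flow H₂ T₂ p₄ = p₅) (hz : p₄ ∈ A.src i₁)
    (hl : Ω.flow K (T₁ - d) y = Ω.flow H₁ (T₁ - d) y)
    (hl' : (Ω.tangentFlow K (T₁ - d) y : E4 →L[ℝ] E4) = Ω.tangentFlow H₁ (T₁ - d) y)
    (hr : Ω.flow K (T₂ - d) p₃ = Ω.flow H₂ (T₂ - d) p₃)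
    (hr' : (Ω.tangentFlow K (T₂ - d) p₃ : E4 →L[ℝ] E4) = Ω.tangentFlow H₂ (T₂ - d) p₃)
    (hXy : Ω.hamField K y = Ω.hamField H₁ y) (hX₂ : Ω.hamField K p₂ = Ω.hamField H₁ p₂)
    (hX₃ : Ω.hamField K p₃ = Ω.hamField H₂ p₃) (hX₅ : Ω.hamField K p₅ = Ω.hamField H₂ p₅)
    {S₁ S₂ S₃ S₅ : E4 →L[ℝ] E4}
    (hS₁ : ∀ v : TangentSpace I p₁,
      A.dh i₁ (Ω.flow H₁ (-d) p₁) (normalFlow Ω H₁ (-d) p₁ v) = S₁ (A.dh i₁ p₁ v))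
    (hS₂ : ∀ v : TangentSpace I p₂,
      A.dh i₁ (Ω.flow K e p₂) (normalFlow Ω K e p₂ v) = S₂ (A.dh i₁ p₂ v))
    (hS₃ : ∀ v : TangentSpace I p₃,
      A.dh i₁ (Ω.flow H₂ (-d) p₃) (normalFlow Ω H₂ (-d) p₃ v) = S₃ (A.dh i₁ p₃ v))
    (hS₅ : ∀ v : TangentSpace I p₅,
      A.dh i₂ (Ω.flow K e' p₅) (normalFlow Ω K e' p₅ v) = S₅ (A.dh i₂ p₅ v)) :
    Ω.flow K (T₁ + T₂) y = Ω.flow K e' p₅ ∧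
    A.dh i₂ (Ω.flow K (T₁ + T₂) y) ∘L transFlow Ω K (T₁ + T₂) y ∘L (A.dh i₀ y).inverse
      = S₅ ∘L (A.dh i₂ (Ω.flow H₂ T₂ p₄) ∘L transFlow Ω H₂ T₂ p₄ ∘L (A.dh i₁ p₄).inverse) ∘L
        S₃ ∘L S₂ ∘L S₁ ∘L
        (A.dh i₁ (Ω.flow H₁ T₁ y) ∘L transFlow Ω H₁ T₁ y ∘L (A.dh i₀ y).inverse) := by
  -- The path goes along H₁ for time T₁ to p₁, back by d to p₂, where K still follows H₁; along K
  -- for the short time e across the section to p₃, from which K follows H₂; back along H₂ by d to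
  -- the section point p₄; along H₂ for time T₂ to p₅; and along K for the remaining time e'. The
  -- backward steps complete the shortened pieces to full lengths T₁ and T₂, at the price of short
  -- factors only.
  subst hp₁ hp₂ hp₃ hp₄ hp₅
  set p₁ := Ω.flow H₁ T₁ y
  set p₂ := Ω.flow H₁ (-d) p₁ with hp₂
  set p₃ := Ω.flow K e p₂ with hp₃
  set p₄ := Ω.flow H₂ (-d) p₃ with hp₄
  set p₅ := Ω.flow H₂ T₂ p₄ with hp₅
  have q₂ : p₂ = Ω.flow H₁ (T₁ - d) y := by
    rw [hp₂, ← A.flow_add hI h₁, sub_eq_neg_add]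
  have q₂' : p₂ = Ω.flow K (T₁ - d) y := q₂.trans hl.symm
  have q₃ : p₃ = Ω.flow K (e + (T₁ - d)) y := by
    rw [hp₃, q₂', ← A.flow_add hI hK]
  have q₅ : p₅ = Ω.flow H₂ (T₂ - d) p₃ := by
    rw [hp₅, hp₄, ← A.flow_add hI h₂, sub_eq_add_neg]
  have q₅' : p₅ = Ω.flow K (T₂ - d) p₃ := q₅.trans hr.symm
  have q₅'' : p₅ = Ω.flow K (T₂ - d + (e + (T₁ - d))) y := by
    rw [q₅', q₃, ← A.flow_add hI hK]
  have hT : e' + (T₂ - d + (e + (T₁ - d))) = T₁ + T₂ := by linarith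
  have q₆ : Ω.flow K (T₁ + T₂) y = Ω.flow K e' p₅ := by
    rw [q₅'', ← A.flow_add hI hK, hT]
  refine ⟨q₆, ?_⟩
  ext1 a
  set u := (transSpace Ω H₁ y).starProjection ((A.dh i₀ y).inverse a) with hu
  have hu0 : dHam I H₁ y u = 0 := dHam_of_mem_transSpace (Submodule.starProjection_apply_mem _ _)
  set v₁ := normalFlow Ω H₁ T₁ y u with hv₁
  have k₁ : dHam I H₁ p₁ v₁ = 0 :=
    dHam_of_mem_transSpace (normalFlow_mem_transSpace (A := A) hI h₁ T₁ y hu0)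
  set v₂ := normalFlow Ω H₁ (-d) p₁ v₁ with hv₂
  have k₂ : dHam I K p₂ v₂ = 0 := by
    rw [dHam_eq_of_hamField_eq hX₂]
    exact dHam_of_mem_transSpace (normalFlow_mem_transSpace (A := A) hI h₁ (-d) p₁ k₁)
  set v₃ := normalFlow Ω K e p₂ v₂ with hv₃
  have k₃ : dHam I H₂ p₃ v₃ = 0 := by
    rw [← dHam_eq_of_hamField_eq hX₃]
    exact dHam_of_mem_transSpace (normalFlow_mem_transSpace (A := A) hI hK e p₂ k₂)
  set v₄ := normalFlow Ω H₂ (-d) p₃ v₃ with hv₄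
  have k₄ : v₄ ∈ transSpace Ω H₂ p₄ := normalFlow_mem_transSpace (A := A) hI h₂ (-d) p₃ k₃
  set v₅ := normalFlow Ω H₂ T₂ p₄ v₄ with hv₅
  have l₂ : (v₂ : E4) = normalFlow Ω K (T₁ - d) y u := by
    have e₁ : (v₂ : E4) = normalFlow Ω H₁ (-d + T₁) y u :=
      (normalFlow_add (A := A) hI h₁ (-d) T₁ y u).symm
    have e₂ := normalFlow_congr (Ω := Ω) hl (v := u) (w := u)
      (congrArg (fun f : E4 →L[ℝ] E4 ↦ f u) hl') (by rw [← q₂]; exact hX₂)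
    exact (e₁.trans (normalFlow_time_congr (by ring) u)).trans e₂.symm
  have l₃ : (v₃ : E4) = normalFlow Ω K (e + (T₁ - d)) y u :=
    (normalFlow_base_congr q₂' l₂).trans (normalFlow_add (A := A) hI hK e (T₁ - d) y u).symm
  have l₅ : (v₅ : E4) = normalFlow Ω K (T₂ - d + (e + (T₁ - d))) y u := by
    have e₁ : (v₅ : E4) = normalFlow Ω H₂ (T₂ + -d) p₃ v₃ :=
      (normalFlow_add (A := A) hI h₂ T₂ (-d) p₃ v₃).symm
    have e₂ := normalFlow_congr (Ω := Ω) hr (v := v₃) (w := v₃)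
      (congrArg (fun f : E4 →L[ℝ] E4 ↦ f v₃) hr') (by rw [← q₅]; exact hX₅)
    have e₃ : (v₅ : E4) = normalFlow Ω K (T₂ - d) p₃ v₃ :=
      (e₁.trans (normalFlow_time_congr (by ring) v₃)).trans e₂.symm
    exact (e₃.trans (normalFlow_base_congr q₃ l₃)).trans
      (normalFlow_add (A := A) hI hK (T₂ - d) (e + (T₁ - d)) y u).symm
  have l₆ : (normalFlow Ω K (T₁ + T₂) y u : E4) = normalFlow Ω K e' p₅ v₅ := by
    have e₁ := normalFlow_base_congr (Ω := Ω) (H := K) (t := e') q₅'' l₅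
    have e₂ := normalFlow_add (A := A) hI hK e' (T₂ - d + (e + (T₁ - d))) y u
    exact ((normalFlow_time_congr hT u).symm.trans e₂).trans e₁.symm
  have m₁ : (transSpace Ω K y).starProjection ((A.dh i₀ y).inverse a) = u := by
    rw [transSpace_congr hXy]
  have m₄ : (transSpace Ω H₂ p₄).starProjection v₄ = v₄ := Submodule.starProjection_eq_self_iff.2 k₄
  have hleft : A.dh i₂ (Ω.flow K (T₁ + T₂) y) (transFlow Ω K (T₁ + T₂) y ((A.dh i₀ y).inverse a))
      = S₅ (A.dh i₂ p₅ v₅) := by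
    rw [transFlow_apply, m₁, ← hS₅]
    exact A.dh_congr i₂ q₆ l₆
  have hright : A.dh i₂ p₅ (transFlow Ω H₂ T₂ p₄ ((A.dh i₁ p₄).inverse
      (S₃ (S₂ (S₁ (A.dh i₁ p₁ v₁)))))) = A.dh i₂ p₅ v₅ := by
    rw [← hS₁, ← hS₂, ← hS₃, A.dh_inverse_dh hz, transFlow_apply, m₄]
  exact hleft.trans (congrArg S₅ hright.symm)

end SymplecticForm.DarbouxAtlas

end

end HamRealizable

namespace HamRealizable

/-! ### Closeness of the pasted linear Poincaré flow to the composed maps -/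

section

variable {B : Type*} [TopologicalSpace B] {I : ModelWithCorners ℝ E4 B}
  {M : Type*} [TopologicalSpace M] [ChartedSpace B M] [IsManifold I ∞ M]
  [RiemannianBundle (fun x : M ↦ TangentSpace I x)]
  [IsContMDiffRiemannianBundle I ∞ E4 (fun x : M ↦ TangentSpace I x)]
  {Ω : SymplecticForm I M} [T2Space M] [CompactSpace M]

namespace SymplecticForm.DarbouxAtlas

variable {A : Ω.DarbouxAtlas} {H : M → ℝ}

/-- If the transversal linear Poincaré flows of `H₁` and of `H₂` are close to `Λ₁` and to `Λ₂`, then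
that of the Hamiltonian `paste H H₁ H₂` is close to `Λ₂ ∘ Λ₁`. -/
theorem exists_transFlow_paste_close (hI : range I = univ ∨ range I = {y : E4 | 0 ≤ y 0})
    (hH : IsHamiltonian I 2 H) {𝓕 : Filter (M → ℝ)} (hC : A.C1Conv 𝓕 H)
    {S₀ S₁ : A.LocalSection H} {T₁ T₂ : ℝ} (hT₂ : 0 < T₂)
    {i₀ i₁ i₂ : Fin A.num} (hi₁ : S₁.a ∈ A.src i₁) (hi₂ : Ω.flow H T₂ S₁.a ∈ A.src i₂)
    (hX₁ : Ω.hamField H S₁.a ≠ 0) (hX₂ : Ω.hamField H (Ω.flow H T₂ S₁.a) ≠ 0)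
    {Λ₁ Λ₂ : E4 →L[ℝ] E4}
    (hΛ₁ : projNormal (A.metric i₁ S₁.a, A.dh i₁ S₁.a (Ω.hamField H S₁.a)) ∘L Λ₁ = Λ₁)
    (hΛ₂ : projNormal (A.metric i₂ (Ω.flow H T₂ S₁.a), A.dh i₂ (Ω.flow H T₂ S₁.a)
      (Ω.hamField H (Ω.flow H T₂ S₁.a))) ∘L Λ₂ = Λ₂) {γ : ℝ} (hγ : 0 < γ) :
    ∃ η > 0, ∃ δ₁ > 0, ∃ E₁ ∈ 𝓝 S₁.a, ∃ P₀ ∈ 𝓕, ∀ δ ≤ δ₁, ∀ (P : Set (M → ℝ)) (V₀ W₀ W₁ : Set M),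
      P ⊆ P₀ → W₁ ⊆ E₁ → SectionPair S₀ S₁ T₁ T₂ δ P V₀ W₀ W₁ → ∀ H₁ ∈ P, ∀ H₂ ∈ P,
      paste H H₁ H₂ ∈ P → ∀ D₀ D₁ : Set M, IsCompact D₀ → D₀ ⊆ W₀ → IsCompact D₁ →
      D₁ ⊆ W₁ ∩ S₁.carrier → (∀ z ∉ flowbox Ω H D₀ (S₁.hitTime δ T₁ H), H₁ z = H z) →
      (∀ z ∉ flowbox Ω H D₁ fun _ ↦ T₂ + 1, H₂ z = H z) → ∀ y ∈ W₀, ∀ z, S₁.hit δ T₁ H₁ y = z →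
      z ∈ W₁ →
      ‖A.dh i₁ (Ω.flow H₁ T₁ y) ∘L transFlow Ω H₁ T₁ y ∘L (A.dh i₀ y).inverse - Λ₁‖ < η →
      ‖A.dh i₂ (Ω.flow H₂ T₂ z) ∘L transFlow Ω H₂ T₂ z ∘L (A.dh i₁ z).inverse - Λ₂‖ < η →
      Ω.flow (paste H H₁ H₂) (T₁ + T₂) y ∈ A.src i₂ ∧
      ‖A.dh i₂ (Ω.flow (paste H H₁ H₂) (T₁ + T₂) y) ∘L transFlow Ω (paste H H₁ H₂) (T₁ + T₂) y ∘L
        (A.dh i₀ y).inverse - Λ₂ ∘L Λ₁‖ < γ := by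
  -- The ideal values of the four short factors are projections onto the normal spaces at the middle
  -- and final points. They fix the ranges of Λ₁ and Λ₂, so the ideal product is Λ₂ Λ₁.
  obtain ⟨η, hη, hcomp⟩ := exists_forall_comp_close
    (projNormal (A.metric i₂ (Ω.flow H T₂ S₁.a), A.dh i₂ (Ω.flow H T₂ S₁.a)
      (Ω.hamField H (Ω.flow H T₂ S₁.a)))) Λ₂
    (projNormal (A.metric i₁ S₁.a, A.dh i₁ S₁.a (Ω.hamField H S₁.a)))
    (projNormal (A.metric i₁ S₁.a, A.dh i₁ S₁.a (Ω.hamField H S₁.a)))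
    (projNormal (A.metric i₁ S₁.a, A.dh i₁ S₁.a (Ω.hamField H S₁.a))) Λ₁ hγ
  rw [hΛ₁, hΛ₁, hΛ₁, ← ContinuousLinearMap.comp_assoc, hΛ₂] at hcomp
  obtain ⟨δ', hδ', P', hP', O, hO, hO1, hOs, hc1⟩ :=
    A.exists_isOpen_projNormal_close hI hC hH hi₁ hX₁ hη
  obtain ⟨δ'', hδ'', P'', hP'', O', hO', hO'1, hO's, hc2⟩ :=
    A.exists_isOpen_projNormal_close hI hC hH hi₂ hX₂ hη
  have hev1 := hC.tendsto_flow hI hH 0 S₁.a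
  rw [A.flow_zero hI hH] at hev1
  obtain ⟨Q₁, hQ₁, R, hR, h6⟩ := eventually_prod_iff.1 (hev1.eventually (hO.mem_nhds hO1))
  obtain ⟨R₁, hR₁, R₂, hR₂, h7⟩ := eventually_prod_iff.1 hR
  obtain ⟨ρ, hρ, hball⟩ := Metric.eventually_nhds_iff.1 hR₁
  have hev2 := (hC.tendsto_flow hI hH T₂ S₁.a).eventually (hO'.mem_nhds hO'1)
  obtain ⟨Q₂, hQ₂, R', hR', h8⟩ := eventually_prod_iff.1 hev2
  obtain ⟨R₃, hR₃, R₄, hR₄, h9⟩ := eventually_prod_iff.1 hR'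
  -- The piece across the section lasts δ plus the deviation t - T₁, hence less than 2δ ≤ δ'. The
  -- bound δ'' serves the final correction T₁ - t, ρ keeps the cutting points near the section
  -- point, and δ ≤ T₂ makes T₂ - δ / 2 nonnegative.
  refine ⟨η, hη, min (min (δ' / 2) δ'') (min ρ T₂), by positivity, {q | R₂ q ∧ R₄ q}, hR₂.and hR₄,
    (P' ∩ P'') ∩ {H' | Q₁ H' ∧ Q₂ H'},
    inter_mem (inter_mem hP' hP'') (hQ₁.and hQ₂), ?_⟩
  intro δ hδ P V₀ W₀ W₁ hPP hWE G H₁ h₁ H₂ h₂ hK D₀ D₁ hD₀ hD₀W hD₁ hD₁W hH₁ hH₂ y hy z hz hzW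
    hM₁ hM₂
  have hδ0 := G.delta_pos
  have hδ1 : δ ≤ δ' / 2 := hδ.trans ((min_le_left _ _).trans (min_le_left _ _))
  have hδ2 : δ ≤ δ'' := hδ.trans ((min_le_left _ _).trans (min_le_right _ _))
  have hδ3 : δ ≤ ρ := hδ.trans ((min_le_right _ _).trans (min_le_left _ _))
  have hδ4 : δ ≤ T₂ := hδ.trans ((min_le_right _ _).trans (min_le_right _ _))
  have hδT := G.delta_le
  have g₁ := G.ham _ h₁
  have g₂ := G.ham _ h₂
  have gK := G.ham _ hK
  set K := paste H H₁ H₂ with hKdef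
  set t := S₁.hitTime δ T₁ H₁ y with ht
  have htT := abs_lt.1 (G.abs_hitTime_sub_lt hI h₁ hy)
  have hzS : z ∈ S₁.carrier := by rw [← hz]; exact G.hit_mem_carrier hI h₁ hy
  have hzt : Ω.flow H₁ t y = z := hz
  have hnear : ∀ H' ∈ P, ∀ s, |s| < δ → Ω.flow H' s z ∈ O := fun H' hH' s hs ↦
    h6 (hPP hH').2.1 (h7 (hball (y := s) (by rw [Real.dist_0_eq_abs]; exact hs.trans_le hδ3))
      (hWE hzW).1)
  have hback : ∀ s, Ω.flow H₁ (s - t) z = Ω.flow H₁ s y := by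
    intro s
    rw [← hzt, ← A.flow_add hI g₁, sub_add_cancel]
  have hp₁ : Ω.flow H₁ T₁ y ∈ O := by
    rw [← hback]
    exact hnear H₁ h₁ _ (abs_lt.2 ⟨by linarith [htT.2], by linarith [htT.1]⟩)
  have e₂ : Ω.flow H₁ (-(δ / 2)) (Ω.flow H₁ T₁ y) = Ω.flow H₁ (T₁ - δ / 2) y := by
    rw [← A.flow_add hI g₁, sub_eq_neg_add]
  have hp₂ : Ω.flow H₁ (T₁ - δ / 2) y ∈ O := by
    rw [← hback]
    exact hnear H₁ h₁ _ (abs_lt.2 ⟨by linarith [htT.2], by linarith [htT.1]⟩)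
  have hl := G.flow_paste_left hI hT₂ hD₁ hD₁W hH₂ h₁ h₂ hy (t := T₁ - δ / 2)
    ⟨by linarith, by linarith [htT.1]⟩
  have hl' := G.tangentFlow_paste_left hI hT₂ hD₁ hD₁W hH₂ h₁ h₂ hy (t := T₁ - δ / 2)
    (by linarith) (by linarith [htT.1])
  have hlz := G.flow_paste_left hI hT₂ hD₁ hD₁W hH₂ h₁ h₂ hy (t := t)
    ⟨by linarith [htT.1], le_rfl⟩
  rw [hzt] at hlz
  have hrd := G.flow_paste_right hI hD₀ hD₀W hH₁ h₁ h₂ hzW hzS (s := δ / 2)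
    ⟨by linarith, by linarith⟩
  have hrT := G.flow_paste_right hI hD₀ hD₀W hH₁ h₁ h₂ hzW hzS (s := T₂) ⟨hT₂.le, by linarith⟩
  -- The orbit of K follows H₁ up to z, which it reaches at time t, and H₂ afterwards.
  have e₃ : Ω.flow K (t + δ / 2 - (T₁ - δ / 2)) (Ω.flow H₁ (T₁ - δ / 2) y)
      = Ω.flow H₂ (δ / 2) z := by
    rw [← hl, ← A.flow_add hI gK, sub_add_cancel, add_comm, A.flow_add hI gK, hlz, hrd]
  have hp₃ : Ω.flow H₂ (δ / 2) z ∈ O := hnear H₂ h₂ _ (abs_lt.2 ⟨by linarith, by linarith⟩)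
  have e₄ : Ω.flow H₂ (-(δ / 2)) (Ω.flow H₂ (δ / 2) z) = z := by
    rw [← A.flow_add hI g₂, neg_add_cancel, A.flow_zero hI g₂]
  have e₅ : Ω.flow H₂ (T₂ - δ / 2) (Ω.flow H₂ (δ / 2) z) = Ω.flow H₂ T₂ z := by
    rw [← A.flow_add hI g₂, sub_add_cancel]
  have hr : Ω.flow K (T₂ - δ / 2) (Ω.flow H₂ (δ / 2) z)
      = Ω.flow H₂ (T₂ - δ / 2) (Ω.flow H₂ (δ / 2) z) := by
    rw [e₅, ← hrd, ← A.flow_add hI gK, sub_add_cancel, hrT]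
  have hr' := G.tangentFlow_paste_right hI hD₀ hD₀W hH₁ h₁ h₂ hzW hzS (s := δ / 2)
    (t := T₂ - δ / 2) (by linarith) (by linarith) (by linarith)
  have hp₅ : Ω.flow H₂ T₂ z ∈ O' :=
    h8 (hPP h₂).2.2 (h9 (hR₃.self_of_nhds) (hWE hzW).2)
  have hXl : ∀ s, 0 ≤ s → s < t → Ω.hamField K (Ω.flow H₁ s y) = Ω.hamField H₁ (Ω.flow H₁ s y) :=
    fun s hs hst ↦ hamField_congr (G.paste_eventuallyEq_left hI hT₂ hD₁ hH₂
      (G.flow_notMem_right hI h₁ hD₁W hy hs hst))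
  have hXr : ∀ s, 0 < s → s ≤ T₂ + 1 → Ω.hamField K (Ω.flow H₂ s z)
      = Ω.hamField H₂ (Ω.flow H₂ s z) :=
    fun s hs hst ↦ hamField_congr (G.paste_eventuallyEq_right hI hD₀ hD₀W hH₁
      (G.flow_notMem_left hI h₂ hD₀W hzW hzS hs hst))
  have hXy : Ω.hamField K y = Ω.hamField H₁ y := by
    have := hXl 0 le_rfl (by linarith [htT.1])
    rwa [A.flow_zero hI g₁] at this
  obtain ⟨-, B₁, hB₁, hS₁⟩ := hc1 H₁ (hPP h₁).1.1 _ hp₁ (-(δ / 2))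
    (abs_lt.2 ⟨by linarith, by linarith⟩)
  obtain ⟨-, B₂, hB₂, hS₂⟩ := hc1 K (hPP hK).1.1 _ hp₂ (t + δ / 2 - (T₁ - δ / 2))
    (abs_lt.2 ⟨by linarith [htT.1], by linarith [htT.2]⟩)
  obtain ⟨-, B₃, hB₃, hS₃⟩ := hc1 H₂ (hPP h₂).1.1 _ hp₃ (-(δ / 2))
    (abs_lt.2 ⟨by linarith, by linarith⟩)
  obtain ⟨hs₆, B₅, hB₅, hS₅⟩ := hc2 K (hPP hK).1.2 _ hp₅ (T₁ - t)
    (abs_lt.2 ⟨by linarith [htT.2], by linarith [htT.1]⟩)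
  have hzO : z ∈ A.src i₁ := hOs (by
    have := hnear H₁ h₁ 0 (by simpa using hδ0)
    rwa [A.flow_zero hI g₁] at this)
  obtain ⟨k1, k2⟩ := transFlow_eq_comp (A := A) hI g₁ g₂ gK (i₀ := i₀) (i₁ := i₁) (i₂ := i₂)
    (d := δ / 2) (e := t + δ / 2 - (T₁ - δ / 2)) (e' := T₁ - t) (T₁ := T₁) (T₂ := T₂) (by ring)
    rfl e₂ e₃ e₄ rfl hzO hl hl' hr hr' hXy
    (hXl _ (by linarith) (by linarith [htT.1])) (hXr _ (by linarith) (by linarith))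
    (hXr _ hT₂ (by linarith)) hS₁ hS₂ hS₃ hS₅
  refine ⟨by rw [k1]; exact hs₆, ?_⟩
  rw [k2]
  exact hcomp _ _ _ _ _ _ hB₅ hM₂ hB₃ hB₂ hB₁ hM₁

end SymplecticForm.DarbouxAtlas

end

end HamRealizable

namespace HamRealizable

/-! ### Preparations for the choice of neighborhoods -/

section

variable {B : Type*} [TopologicalSpace B] {I : ModelWithCorners ℝ E4 B}
  {M : Type*} [TopologicalSpace M] [ChartedSpace B M] [IsManifold I ∞ M]
  {Ω : SymplecticForm I M}

namespace SymplecticForm.DarbouxAtlas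

variable {A : Ω.DarbouxAtlas} {H : M → ℝ} {ε : ℝ}

theorem c2Close_self (hε : 0 < ε) : A.C2Close ε H H := by
  intro i p _ k _ a
  simp only [sub_self]
  have h1 : iteratedFDerivWithin ℝ k (fun _ : E4 ↦ (0 : ℝ)) (range I) (A.h i p) = 0 :=
    congrFun iteratedFDerivWithin_fun_zero _
  rw [h1]
  simpa using hε

theorem pure_le_thinFilter (hH : IsHamiltonian I 2 H) (hε : 0 < ε) (Γ : Set M) :
    pure H ≤ A.thinFilter ε H Γ := by
  refine pure_le_iff.2 fun P hP ↦ ?_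
  obtain ⟨N, -, hN⟩ := A.eventually_thinFilter_iff.1 (show ∀ᶠ H' in A.thinFilter ε H Γ, H' ∈ P from hP)
  exact hN H ⟨hH, c2Close_self hε, fun _ _ ↦ rfl⟩

theorem LocalSection.exists_isCompact_inter_carrier [T2Space M] [CompactSpace M]
    (S : A.LocalSection H) {W : Set M} (hW : W ∈ 𝓝 S.a) :
    ∃ K ∈ 𝓝 S.a, K ⊆ W ∧ IsCompact (K ∩ S.carrier) := by
  obtain ⟨K, hK, hKW, hKc⟩ := local_compact_nhds
    (inter_mem hW ((A.isOpen_src S.i).mem_nhds S.mem))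
  refine ⟨K, hK, fun q hq ↦ (hKW hq).1, ?_⟩
  have h1 : ContinuousOn S.height K :=
    fun q hq ↦ (S.continuousAt_height (hKW hq).2).continuousWithinAt
  have h2 : K ∩ S.carrier = K ∩ S.height ⁻¹' {0} := by
    ext q
    exact ⟨fun h ↦ ⟨h.1, h.2.2⟩, fun h ↦ ⟨h.1, (hKW h.1).2, h.2⟩⟩
  rw [h2]
  exact hKc.of_isClosed_subset (h1.preimage_isClosed_of_isClosed hKc.isClosed isClosed_singleton)
    inter_subset_left

theorem LocalSection.measurableSet_coords_of_isOpen [T2Space M] [CompactSpace M]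
    (S : A.LocalSection H) {U : Set M}
    (hU : ∃ V, IsOpen V ∧ U = V ∩ S.carrier) : MeasurableSet (S.coords U) := by
  obtain ⟨V, hV, rfl⟩ := hU
  have h1 : S.coords (V ∩ S.carrier) = S.coords V := by
    rw [coords, coords, inter_assoc, inter_self]
  rw [h1]
  refine S.measurableSet_coords ?_
  borelize M
  exact hV.measurableSet

/-- The values of a linear flow lie in 𝒩 ⊆ N, hence are fixed by the projection onto N. -/
theorem projNormal_comp_ext [RiemannianBundle (fun x : M ↦ TangentSpace I x)] {x : M}
    (L : LinearFlow Ω H x) (T : ℝ) :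
    projNormal (A.metric (A.idx (Ω.flow H T x)) (Ω.flow H T x),
        A.dh (A.idx (Ω.flow H T x)) (Ω.flow H T x) (Ω.hamField H (Ω.flow H T x))) ∘L
      (A.dh (A.idx (Ω.flow H T x)) (Ω.flow H T x) ∘L L.ext T ∘L (A.dh (A.idx x) x).inverse)
      = A.dh (A.idx (Ω.flow H T x)) (Ω.flow H T x) ∘L L.ext T ∘L (A.dh (A.idx x) x).inverse := by
  ext1 a
  have h1 := A.dh_starProjection (H := H) (A.mem_idx (Ω.flow H T x))
    (L.ext T ((A.dh (A.idx x) x).inverse a))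
  rw [Submodule.starProjection_eq_self_iff.2 (L.ext_mem T _).1] at h1
  exact h1.symm

theorem IsPoincareTime.eventually_abs_sub_lt
    [RiemannianBundle (fun x : M ↦ TangentSpace I x)] {x : M} {T r : ℝ} {τ : M → ℝ}
    (h : A.IsPoincareTime H x T r τ) (hr : 0 < r) {c : ℝ} (hc : 0 < c) :
    ∀ᶠ y in 𝓝 x, y ∈ A.ball H x r → |τ y - T| < c := by
  have h1 := h.1 x (A.self_mem_ball hr)
  rw [ContinuousWithinAt, h.2.1] at h1
  have h2 := eventually_nhdsWithin_iff.1 (h1.eventually (Metric.ball_mem_nhds T hc))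
  filter_upwards [h2] with y hy hyb
  have := hy hyb
  rwa [Real.dist_eq] at this

end SymplecticForm.DarbouxAtlas

end

end HamRealizable

/-! ### The concatenation -/

open HamRealizable HamRealizable.SymplecticForm.DarbouxAtlas in
theorem mainTheorem9
    {B : Type*} [TopologicalSpace B] (I : ModelWithCorners ℝ HamRealizable.E4 B)
    (hI : Set.range I = Set.univ ∨ Set.range I = {y : HamRealizable.E4 | 0 ≤ y 0})
    {M : Type*} [TopologicalSpace M] [T2Space M] [CompactSpace M] [ChartedSpace B M]
    [IsManifold I ∞ M]
    [Bundle.RiemannianBundle (fun x : M ↦ TangentSpace I x)]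
    [IsContMDiffRiemannianBundle I ∞ HamRealizable.E4 (fun x : M ↦ TangentSpace I x)]
    (Ω : HamRealizable.SymplecticForm I M) (A : Ω.DarbouxAtlas)
    (s : ℕ∞) (hs : 2 ≤ s) (H : M → ℝ) (hH : HamRealizable.IsHamiltonian I (s + 1) H)
    (x : M) (hx : ∀ t : ℝ, t ≠ 0 → Ω.flow H t x ≠ x)
    (ε κ₁ κ₂ T₁ T₂ : ℝ)
    (L₁ : HamRealizable.LinearFlow Ω H x)
    (L₂ : HamRealizable.LinearFlow Ω H (Ω.flow H T₁ x))
    (h₁ : HamRealizable.IsRealizable A s H ε κ₁ T₁ x L₁)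
    (h₂ : HamRealizable.IsRealizable A s H ε κ₂ T₂ (Ω.flow H T₁ x) L₂)
    (hκ : κ₁ + κ₂ < 1) :
    HamRealizable.IsRealizable A s H ε (κ₁ + κ₂) (T₁ + T₂) x
      (HamRealizable.LinearFlow.concat T₁ L₁ L₂) := by
  obtain ⟨hT₁, hε, hκ₁, -, -, hs₁, h₁⟩ := h₁
  obtain ⟨hT₂, -, hκ₂, -, -, hs₂, h₂⟩ := h₂
  have hHs : IsHamiltonian I s H := ⟨hH.1.of_le (by exact_mod_cast le_self_add), hH.2⟩
  have hH2 : IsHamiltonian I 2 H := ⟨hHs.1.of_le (by exact_mod_cast hs), hH.2⟩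
  have hham : ∀ {H' : M → ℝ}, IsHamiltonian I s H' → IsHamiltonian I 2 H' :=
    fun h ↦ ⟨h.1.of_le (by exact_mod_cast hs), h.2⟩
  have hfl : ∀ t, Ω.flow H (t - T₁) (Ω.flow H T₁ x) = Ω.flow H t x := fun t ↦ by
    rw [← A.flow_add hI hH2, sub_add_cancel]
  refine ⟨by linarith, hε, by linarith, hκ, fun t ht ↦ hx t ht.1.ne',
    LinearFlow.isSymplectic_concat hT₁.le hfl hs₁ hs₂, fun γ hγ ↦ ?_⟩
  have hx₂ : Ω.flow H (T₁ + T₂) x = Ω.flow H T₂ (Ω.flow H T₁ x) := by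
    rw [add_comm, A.flow_add hI hH2]
  have hX₀ : Ω.hamField H x ≠ 0 := A.hamField_ne_zero_of_flow_ne hI hH2 (hx 1 one_ne_zero)
  have hX₁ := A.hamField_flow_ne_zero hI hH2 hX₀ T₁
  have hX₂ := A.hamField_flow_ne_zero hI hH2 hX₁ T₂
  set S₀ := A.normalLocalSection hX₀ with hS₀
  set S₁ := A.normalLocalSection hX₁ with hS₁
  have hc₀ : S₀.carrier = A.normalSection H x := A.carrier_normalLocalSection hX₀
  have hc₁ : S₁.carrier = A.normalSection H (Ω.flow H T₁ x) := A.carrier_normalLocalSection hX₁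
  have hf₀ : ∀ Y, S₀.flux Y = A.sectionMeasure H x Y := A.flux_normalLocalSection hX₀
  have hf₁ : ∀ Y, S₁.flux Y = A.sectionMeasure H (Ω.flow H T₁ x) Y := A.flux_normalLocalSection hX₁
  -- The extra unit of time accommodates the arrival times at nearby points, each at most 1/2 larger
  -- than T₁ or T₂.
  set Γ := (fun t ↦ Ω.flow H t x) '' Icc 0 (T₁ + T₂ + 1) with hΓ
  have hΓc : IsClosed Γ :=
    (isCompact_Icc.image (A.continuous_flow_time hI hH2 x)).isClosed
  have hC : A.C1Conv (A.thinFilter ε H Γ) H :=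
    A.c1Conv_thinFilter hH2 hε.le hΓc (A.dense_compl_orbit hI hH2 hX₀ _)
  have hLΛ₁ := projNormal_comp_ext (A := A) L₁ T₁
  have hLΛ₂ := projNormal_comp_ext (A := A) L₂ T₂
  -- Order of the choices: the tolerance η for both given flows comes from γ alone, then the radii
  -- r₁ and r₂ from η, then δ, the neighborhoods and the thinness N of the supports, and finally r.
  obtain ⟨η, hη, δ₁, hδ₁, E₁, hE₁, P₀, hP₀, hclose⟩ :=
    exists_transFlow_paste_close (A := A) hI hH2 hC (S₀ := S₀) (S₁ := S₁) (T₁ := T₁) hT₂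
      (i₀ := A.idx x) (A.mem_idx _) (A.mem_idx _) hX₁ hX₂ hLΛ₁ hLΛ₂ hγ
  obtain ⟨r₁, hr₁, τ₁, hτ₁, hU₁⟩ := h₁ η hη
  obtain ⟨r₂, hr₂, τ₂, hτ₂, hU₂⟩ := h₂ η hη
  obtain ⟨δ₀, hδ₀, hpair⟩ := exists_sectionPair (T₂ := T₂) hI hH2 hC
    (pure_le_thinFilter hH2 hε Γ) S₀ S₁ hT₁ hx rfl
  set δ := min (min δ₀ δ₁) (1 / 2) with hδ
  have hδ0 : 0 < δ := by positivity
  obtain ⟨V₂, hV₂, hV₂b⟩ := A.exists_isOpen_ball H (Ω.flow H T₁ x) r₂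
  have hxV₂ : Ω.flow H T₁ x ∈ V₂ := (hV₂b ▸ A.self_mem_ball hr₂ :
    Ω.flow H T₁ x ∈ V₂ ∩ A.normalSection H (Ω.flow H T₁ x)).1
  -- Deviation below T₂ makes τ₂ positive, and deviation below 1/2 keeps it at most T₂ + 1/2.
  have hτ₂' := hτ₂.eventually_abs_sub_lt hr₂ (c := min T₂ (1 / 2)) (by positivity)
  obtain ⟨P, hP, hPP, V₀, hV₀, W₀, W₁, hW₁, G⟩ := hpair δ
    ⟨hδ0, (min_le_left _ _).trans (min_le_left _ _)⟩ _ (hτ₁.eventually_abs_sub_lt hr₁ hδ0)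
    _ (inter_mem (inter_mem hE₁ (hV₂.mem_nhds hxV₂)) hτ₂') P₀ hP₀
  obtain ⟨N', hN', hN'P⟩ := A.eventually_thinFilter_iff.1
    (show ∀ᶠ H' in A.thinFilter ε H Γ, H' ∈ P from hP)
  obtain ⟨N, hN, hΓN, hNN'⟩ := mem_nhdsSet_iff_exists.1 hN'
  have hNP : ∀ {H' : M → ℝ}, IsHamiltonian I 2 H' → A.C2Close ε H' H →
      (∀ z ∉ N, H' z = H z) → H' ∈ P := fun h1 h2 h3 ↦
    hN'P _ ⟨h1, h2, fun z hz ↦ h3 z fun hzN ↦ hz (hNN' hzN)⟩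
  have hxW₀ : x ∈ W₀ := G.V₀_subset G.mem_V₀
  have htx : S₁.hitTime δ T₁ H x = T₁ :=
    (G.eq_hitTime hI G.self_mem hxW₀ (t := T₁) (by simpa using hδ0.le) S₁.a_mem_carrier).symm
  have hpx : S₁.hit δ T₁ H x = Ω.flow H T₁ x := by rw [LocalSection.hit, htx]
  -- Compact sets that contain all the sets U and their images, chosen before U: the flowboxes over
  -- them are closed, unlike those over U.
  obtain ⟨D₀, hD₀, hD₀W, hD₀c⟩ := local_compact_nhds (G.isOpen_W₀.mem_nhds hxW₀)
  obtain ⟨K₁, hK₁, hK₁W, hK₁c⟩ := S₁.exists_isCompact_inter_carrier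
    (G.isOpen_W₁.mem_nhds G.mem_W₁)
  set D₁ := K₁ ∩ S₁.carrier with hD₁
  have hD₁W : D₁ ⊆ W₁ ∩ S₁.carrier := fun q hq ↦ ⟨hK₁W hq.1, hq.2⟩
  have hflN : ∀ᶠ y in 𝓝 x, ∀ t ∈ Icc 0 (T₁ + T₂ + 1), Ω.flow H t y ∈ N := by
    have := (A.c1Conv_pure hH2).eventually_flow_mem hI hH2 isCompact_Icc hN (x := x)
      fun t ht ↦ hΓN ⟨t, ht, rfl⟩
    rwa [pure_prod, eventually_map] at this
  have hhitK : ∀ᶠ y in 𝓝 x, S₁.hit δ T₁ H y ∈ K₁ := by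
    have := (G.continuousOn_hit hI G.self_mem).continuousAt (G.isOpen_W₀.mem_nhds hxW₀)
    refine this.eventually_mem ?_
    rw [hpx]
    exact hK₁
  obtain ⟨r', hr', hr'W⟩ := A.exists_ball_subset H
    (inter_mem (inter_mem (G.isOpen_V₀.mem_nhds G.mem_V₀) hD₀) (hflN.and hhitK))
  set r := min r' r₁ with hr
  have hball₁ : A.ball H x r ⊆ A.ball H x r₁ := A.ball_mono (min_le_right _ _)
  have hballV : ∀ y ∈ A.ball H x r, y ∈ V₀ ∧ y ∈ D₀ ∧
      (∀ t ∈ Icc 0 (T₁ + T₂ + 1), Ω.flow H t y ∈ N) ∧ S₁.hit δ T₁ H y ∈ K₁ := fun y hy ↦ by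
    have := hr'W (A.ball_mono (min_le_left _ _) hy)
    exact ⟨this.1.1, this.1.2, this.2.1, this.2.2⟩
  have hballW : ∀ y ∈ A.ball H x r, y ∈ W₀ := fun y hy ↦ G.V₀_subset (hballV y hy).1
  -- The given arrival time is within δ of T₁ and leads to the section, so it is the unique crossing
  -- time in the window.
  have hτeq : ∀ y ∈ A.ball H x r, τ₁ y = S₁.hitTime δ T₁ H y := fun y hy ↦
    G.eq_hitTime hI G.self_mem (hballW y hy) (hV₀ (hballV y hy).1 (hball₁ hy)).le
      (by rw [hc₁]; exact hτ₁.2.2 y (hball₁ hy))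
  have hhitS : ∀ y ∈ A.ball H x r, S₁.hit δ T₁ H y ∈ S₁.carrier := fun y hy ↦
    G.hit_mem_carrier hI G.self_mem (hballW y hy)
  have hhitD : ∀ y ∈ A.ball H x r, S₁.hit δ T₁ H y ∈ D₁ := fun y hy ↦
    ⟨(hballV y hy).2.2.2, hhitS y hy⟩
  have hball₂ : ∀ q ∈ W₁ ∩ S₁.carrier, q ∈ A.ball H (Ω.flow H T₁ x) r₂ := fun q hq ↦ by
    rw [hV₂b, ← hc₁]
    exact ⟨(hW₁ hq.1).1.2, hq.2⟩
  have hτ₂b : ∀ q ∈ W₁ ∩ S₁.carrier, 0 < τ₂ q ∧ τ₂ q ≤ T₂ + 1 / 2 := fun q hq ↦ by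
    have h3 := abs_lt.1 ((hW₁ hq.1).2 (hball₂ q hq))
    exact ⟨by linarith [h3.1, min_le_left T₂ (1 / 2)], by linarith [h3.2, min_le_right T₂ (1 / 2)]⟩
  have hτ₁b : ∀ y ∈ A.ball H x r, 0 < S₁.hitTime δ T₁ H y ∧ S₁.hitTime δ T₁ H y ≤ T₁ + 1 / 2 :=
    fun y hy ↦ ⟨G.hitTime_pos hI G.self_mem (hballW y hy), by
      linarith [(G.hitTime_mem hI G.self_mem (hballW y hy)).2, min_le_right (min δ₀ δ₁) (1 / 2)]⟩
  refine ⟨r, lt_min hr' hr₁, fun y ↦ S₁.hitTime δ T₁ H y + τ₂ (S₁.hit δ T₁ H y), ⟨?_, ?_, ?_⟩, ?_⟩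
  · refine ((G.continuousOn_hitTime hI G.self_mem).mono hballW).add ?_
    exact hτ₂.1.comp ((G.continuousOn_hit hI G.self_mem).mono hballW)
      fun y hy ↦ hball₂ _ (hD₁W (hhitD y hy))
  · simp only
    rw [htx, hpx, hτ₂.2.1]
  · intro y hy
    simp only
    rw [hx₂, add_comm (S₁.hitTime δ T₁ H y), A.flow_add hI hH2]
    exact hτ₂.2.2 _ (hball₂ _ (hD₁W (hhitD y hy)))
  intro U hU hUo
  obtain ⟨K₁, hK₁U, hK₁m, hK₁μ, H₁, hH₁s, hH₁c, hH₁f, hH₁d, hH₁K⟩ :=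
    hU₁ U (hU.trans hball₁) hUo
  rw [← hc₀] at hUo
  set U' := S₁.hit δ T₁ H '' U with hU'
  have hUV : U ⊆ V₀ ∩ S₀.carrier := fun y hy ↦ ⟨(hballV y (hU hy)).1, by
    rw [hc₀]; exact A.ball_subset (hU hy)⟩
  have hU'D : U' ⊆ D₁ := by rintro _ ⟨y, hy, rfl⟩; exact hhitD y (hU hy)
  -- The second perturbation is made over the image of U under the Poincaré map of the unperturbed
  -- H, so that H₂ does not depend on H₁. The image is relatively open since the Poincaré map is
  -- open.
  obtain ⟨K₂, hK₂U, hK₂m, hK₂μ, H₂, hH₂s, hH₂c, hH₂f, hH₂d, hH₂K⟩ :=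
    hU₂ U' (fun q hq ↦ hball₂ q (hD₁W (hU'D hq))) (by
      rw [← hc₁]
      exact G.exists_isOpen_image hI hUV hUo.choose_spec.1 hUo.choose_spec.2)
  have hH₁f' : ∀ z ∉ flowbox Ω H U (S₁.hitTime δ T₁ H), H₁ z = H z := fun z hz ↦
    hH₁f z fun hz' ↦ hz (flowbox_mono le_rfl (fun y hy ↦ (hτeq y (hU hy)).le) hz')
  have hH₁D : ∀ z ∉ flowbox Ω H D₀ (S₁.hitTime δ T₁ H), H₁ z = H z := fun z hz ↦
    hH₁f' z fun hz' ↦ hz (flowbox_mono (fun y hy ↦ (hballV y (hU hy)).2.1) (fun _ _ ↦ le_rfl) hz')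
  have hH₂D : ∀ z ∉ flowbox Ω H D₁ fun _ ↦ T₂ + 1, H₂ z = H z := fun z hz ↦
    hH₂f z fun hz' ↦ hz (flowbox_mono hU'D
      (fun q hq ↦ by linarith [(hτ₂b q (hD₁W (hU'D hq))).2]) hz')
  have hH₁N : ∀ z ∉ N, H₁ z = H z := fun z hz ↦ hH₁f' z (by
    rintro ⟨y, hy, t, ht, rfl⟩
    exact hz ((hballV y (hU hy)).2.2.1 t ⟨ht.1, by linarith [ht.2, (hτ₁b y (hU hy)).2]⟩))
  have hH₂N : ∀ z ∉ N, H₂ z = H z := fun z hz ↦ hH₂f z (by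
    rintro ⟨_, ⟨y, hy, rfl⟩, t, ht, rfl⟩
    refine hz ?_
    rw [LocalSection.hit, ← A.flow_add hI hH2]
    have h3 := hτ₁b y (hU hy)
    have h4 := hτ₂b _ (hD₁W (hhitD y (hU hy)))
    exact (hballV y (hU hy)).2.2.1 _ ⟨by linarith [ht.1], by linarith [ht.2]⟩)
  have hP₁ : H₁ ∈ P := hNP (hham hH₁s) hH₁c hH₁N
  have hP₂ : H₂ ∈ P := hNP (hham hH₂s) hH₂c hH₂N
  have hKc : A.C2Close ε (paste H H₁ H₂) H :=
    G.c2Close_paste hI hD₀c hD₀W hT₂ hK₁c hD₁W hH₁D hH₂D hP₁ hP₂ hH₁c hH₂c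
  -- The pasted Hamiltonian is itself an ε-close perturbation supported in N, so the uniform
  -- estimates apply to it and control its flow across the middle section.
  have hPK : paste H H₁ H₂ ∈ P := hNP (isHamiltonian_paste hH2 (hham hH₁s) (hham hH₂s)) hKc
    fun z hz ↦ by rw [paste_eq_left (hH₂N z hz), hH₁N z hz]
  refine ⟨{y ∈ K₁ | S₁.hit δ T₁ H₁ y ∈ K₂}, fun y hy ↦ hK₁U hy.1,
    G.measurableSet_preimage_hit hI hP₁ hK₁m (fun y hy ↦ hballW y (hU (hK₁U hy))) hK₂m, ?_,
    paste H H₁ H₂, isHamiltonian_paste hHs hH₁s hH₂s, hKc, ?_, ?_, ?_⟩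
  -- The loss at the second stage is at most κ₂ times the flux of U', which equals the flux of U.
  · have hm := S₀.measurableSet_coords_of_isOpen hUo
    have h3 := G.flux_diff_le hI hP₁ hUV hm hUo hH₁f'
      (fun y hy ↦ (hH₁d y hy).1.hamField_eq)
      (fun y hy ↦ by
        have := (hH₁d y hy).2.hamField_eq
        rwa [hτeq y (hU hy)] at this) hK₁m hK₁U hK₂m
    have h4 : S₁.flux U' = S₀.flux U :=
      G.flux_image hI (fun y hy ↦ ⟨hballW y (hU hy), (hUV hy).2⟩) hm
    rw [← hf₀, ← hf₀] at hK₁μ ⊢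
    rw [← hf₁, ← hf₁, h4] at hK₂μ
    rw [ENNReal.ofReal_add hκ₁.le hκ₂.le, add_mul]
    exact h3.trans (add_le_add hK₁μ hK₂μ)
  · intro z hz
    have hz₁ : H₁ z = H z := hH₁f' z fun hz' ↦ hz (flowbox_mono le_rfl
      (fun y hy ↦ by linarith [(hτ₂b _ (hD₁W (hhitD y (hU hy)))).1]) hz')
    have hz₂ : H₂ z = H z := hH₂f z (by
      rintro ⟨_, ⟨y, hy, rfl⟩, t, ht, rfl⟩
      refine hz ⟨y, hy, t + S₁.hitTime δ T₁ H y, ⟨?_, ?_⟩, ?_⟩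
      · linarith [ht.1, (hτ₁b y (hU hy)).1]
      · linarith [ht.2]
      · rw [A.flow_add hI hH2, LocalSection.hit])
    rw [paste_eq_left hz₂, hz₁]
  -- The initial points are off the second closed flowbox and the final points off the first, so
  -- near them the pasted Hamiltonian is H₁, respectively H₂.
  · intro y hy
    constructor
    · refine (hH₁d y hy).1.congr (G.paste_eventuallyEq_left hI hT₂ hK₁c hH₂D ?_)
      have := G.flow_notMem_right hI G.self_mem hD₁W (hballW y (hU hy)) le_rfl (hτ₁b y (hU hy)).1
      rwa [A.flow_zero hI hH2] at this
    · have h3 := hhitD y (hU hy)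
      have h4 := hτ₂b _ (hD₁W h3)
      have h5 := (hH₂d _ (mem_image_of_mem _ hy)).2.congr (G.paste_eventuallyEq_right hI hD₀c hD₀W
        hH₁D (G.flow_notMem_left hI G.self_mem hD₀W (hD₁W h3).1 h3.2 h4.1 (by linarith [h4.2])))
      rwa [LocalSection.hit, ← A.flow_add hI hH2, add_comm] at h5
  · rintro y ⟨hy₁, hy₂⟩
    have hyb := hU (hK₁U hy₁)
    obtain ⟨h3, h4⟩ := hclose δ ((min_le_left _ _).trans (min_le_right _ _)) P V₀ W₀ W₁ hPP
      (fun q hq ↦ (hW₁ hq).1.1) G H₁ hP₁ H₂ hP₂ hPK D₀ D₁ hD₀c hD₀W hK₁c hD₁W hH₁D hH₂D y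
      (hballW y hyb) _ rfl (hD₁W (hU'D (hK₂U hy₂))).1 (hH₁K y hy₁).2 (hH₂K _ hy₂).2
    -- The two expressions of the final point are only propositionally equal, so the chart and the
    -- extended linear flow are carried over by hand.
    have hi : A.idx (Ω.flow H (T₁ + T₂) x) = A.idx (Ω.flow H T₂ (Ω.flow H T₁ x)) := by rw [hx₂]
    have h5 : A.dh (A.idx (Ω.flow H T₂ (Ω.flow H T₁ x))) (Ω.flow H (T₁ + T₂) x) ∘L
        (LinearFlow.concat T₁ L₁ L₂).ext (T₁ + T₂) ∘L (A.dh (A.idx x) x).inverse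
      = (A.dh (A.idx (Ω.flow H T₂ (Ω.flow H T₁ x))) (Ω.flow H T₂ (Ω.flow H T₁ x)) ∘L L₂.ext T₂ ∘L
          (A.dh (A.idx (Ω.flow H T₁ x)) (Ω.flow H T₁ x)).inverse) ∘L
        (A.dh (A.idx (Ω.flow H T₁ x)) (Ω.flow H T₁ x) ∘L L₁.ext T₁ ∘L
          (A.dh (A.idx x) x).inverse) := by
      ext1 a
      have h6 := A.dh_congr (A.idx (Ω.flow H T₂ (Ω.flow H T₁ x))) hx₂
        (LinearFlow.concat_ext (L₁ := L₁) (L₂ := L₂) hT₂ hfl ((A.dh (A.idx x) x).inverse a))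
      simp only [ContinuousLinearMap.comp_apply, A.dh_inverse_dh (A.mem_idx _)]
      exact h6
    rw [mapDist, hi, h5]
    exact ⟨h3, h4⟩
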